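/- **Setting.** Fix $\lambda>0$ and $\kappa\in\{1,-1\}$. On the circle $\mathbb T=\mathbb R/2\pi\mathbb Z$ write $\int f=\lambda\int_0^{2\pi}f(x)\,dx$ and $\|u\|_{\dot H^s}^2=2\pi\lambda\sum_{n}|n|^{2s}|\hat u(n)|^2$, $\|u\|_{L^2}=\|u\|_{\dot H^0}$, where $u=\sum_n\hat u(n)e^{inx}$. Let $\mathcal H$ be the Hilbert transform, with Fourier multiplier $-i\kappa\,\mathrm{sgn}(n)$ (the two values of $\kappa$ are the two usual sign conventions). For $s\in\mathbb R$ let $H^s$ be the Sobolev space of real-valued periodic distributions $u$ with $\hat u(0)=0$ and $\|u\|_{\dot H^s}<\infty$, with this norm. Let $\mu_{3/2}$ be the law of the random series $$\frac1{\sqrt{4\pi\lambda}}\sum_{n\ne0}\frac{g_n}{|n|^{3/2}}e^{inx},$$ where $(g_n)_{n>0}$ are independent centered complex Gaussian variables with $E|g_n|^2=1$ and independent real and imaginary parts of variance $\tfrac12$, and $g_{-n}=\overline{g_n}$. (Formally $d\mu_{3/2}=Z^{-1}e^{-\|u\|^2_{\dot H^{3/2}}}du$; for $\lambda=1/(4\pi)$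 the prefactor is $1$.) For $\sigma>0$ it is a Borel probability measure on $H^{1-\sigma}$. For each $\varepsilon\in(0,1)$ let $\psi_\varepsilon:\mathbb R\to\mathbb R$ be a smooth even function with $\psi_\varepsilon=1$ on $[0,1-\varepsilon]$, $\psi_\varepsilon(x)=0$ for $x>1$ and $\|\psi_\varepsilon\|_{L^\infty}=1$. Let $\chi:\mathbb R\to\mathbb R$ be smooth with compact support and $\chi(x)=1$ for $|x|<1$, and $\chi_R(x)=\chi(x/R)$. For an integer $N\ge1$ let $\pi_N$ be the projector onto the Fourier modes $|n|\le N$ and let $S_N^\varepsilon$ be the Fourier multiplier $\psi_\varepsilon(n/N)$. Let $\Phi_N^\varepsilon(t)$ be the flow on $H^{1-\sigma}$ of $$\partial_tu+\mathcal H\partial_x^2u+S_N^\varepsilon\big(S_N^\varepsilon u\cdot S_N^\varepsilon u_x\big)=0 .$$ Put $\alpha_N=\sum_{n=1}^N\frac1n$ and $$E_1(u)=\|u\|_{\dot H^1}^2+\tfrac34\int u^2\mathcal H u_x+\tfrac18\int u^4,$$ $$E_{3/2}(u)=\|u\|_{\dot H^{3/2}}^2+\kappa\Big[\int\big(\tfrac32uu_x^2+\tfrac12u(\mathcal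 Hu_x)^2\big)+\int\big(\tfrac13u^3\mathcal Hu_x+\tfrac14u^2\mathcal H(uu_x)\big)+\tfrac1{20}\int u^5\Big],$$ $$E_N^\varepsilon(u)=\|u\|_{\dot H^1}^2-\|S_N^\varepsilon u\|_{\dot H^1}^2+E_1(S_N^\varepsilon u),$$ $$H_{N,R}^\varepsilon(u)=\chi_R(\|\pi_Nu\|_{L^2})\;\chi_R\Big(\|\pi_Nu\|_{\dot H^{1/2}}^2+\tfrac\kappa3\int(S_N^\varepsilon u)^3\Big)\;\chi_R\big(E_N^\varepsilon(\pi_Nu)-\alpha_N\big)\;\exp\big(\|S_N^\varepsilon u\|_{\dot H^{3/2}}^2-E_{3/2}(S_N^\varepsilon u)\big).$$ **Proposition.** Let $\sigma,R>0$ be fixed. For every $\delta>0$ there exist an integer $N_0\ge1$ and $\varepsilon\in(0,1)$ such that for every integer $N\ge N_0$, every Borel set $A\subset H^{1-\sigma}$ and every $t\in\mathbb R$, $$\Big|\int_AH_{N,R}^\varepsilon\,d\mu_{3/2}-\int_{\Phi_N^\varepsilon(t)A}H_{N,R}^\varepsilon\,d\mu_{3/2}\Big|\le\delta|t| .$$ 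-/

import Mathlib

open scoped ContDiff ComplexConjugate

noncomputable section

namespace BenjaminOno

open MeasureTheory ProbabilityTheory

/-! ## Trigonometric polynomials

A trigonometric polynomial `∑ aₙ e^{inx}` is a Laurent polynomial in `e^{ix}`; the product of
Laurent polynomials is the pointwise product of functions (see `TrigPoly.eval`). -/

/-- Complex trigonometric polynomials on the circle `ℝ / 2πℤ`. -/
abbrev TrigPoly : Type := LaurentPolynomial ℂ

namespace TrigPoly

/-- The value at `x` of the function `∑ aₙ e^{inx}`. -/
def eval (p : TrigPoly) (x : ℝ) : ℂ :=
  p.coeff.sum fun n a => a * Complex.exp (Complex.I * n * x)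

/-- The Fourier multiplier `∑ aₙ e^{inx} ↦ ∑ m(n) aₙ e^{inx}`. -/
def multiplier (m : ℤ → ℂ) (p : TrigPoly) : TrigPoly :=
  p.coeff.sum fun n a => AddMonoidAlgebra.single n (m n * a)

/-- The derivative `∂ₓ`. -/
def dx (p : TrigPoly) : TrigPoly :=
  multiplier (fun n => Complex.I * n) p

/-- The Fourier symbol of the Hilbert transform. The two sign conventions in use are
`-i sgn(n)` (`κ = 1`) and `i sgn(n)` (`κ = -1`). -/
def hilbertSymbol (κ : ℝ) (n : ℤ) : ℂ :=
  -(Complex.I * κ * (n.sign : ℂ))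

/-- The Hilbert transform. -/
def hilbert (κ : ℝ) (p : TrigPoly) : TrigPoly :=
  multiplier (hilbertSymbol κ) p

/-- The integral over the circle of a (real valued) trigonometric polynomial with respect to
the measure `lam · dx`. -/
def integral (lam : ℝ) (p : TrigPoly) : ℝ :=
  lam * ∫ x in (0 : ℝ)..(2 * Real.pi), (p.eval x).re

/-- The square of the homogeneous Sobolev norm `Ḣ^s`, with respect to the measure `lam · dx`;
for `s = 0` it is the square of the `L²` norm. -/
def normSq (lam s : ℝ) (p : TrigPoly) : ℝ :=
  lam * (2 * Real.pi) * p.coeff.sum fun n a => |(n : ℝ)| ^ (2 * s) * ‖a‖ ^ 2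

/-- The smoothed projector: the Fourier multiplier with symbol `φ (n / N)`. -/
def smooth (φ : ℝ → ℝ) (N : ℕ) (p : TrigPoly) : TrigPoly :=
  multiplier (fun n => (φ ((n : ℝ) / N) : ℂ)) p

/-- The energy `‖u‖²_{Ḣ^1} + 3/4 ∫ u² H uₓ + 1/8 ∫ u⁴`. -/
def energyOne (κ lam : ℝ) (u : TrigPoly) : ℝ :=
  normSq lam 1 u + 3 / 4 * integral lam (u ^ 2 * hilbert κ (dx u)) + 1 / 8 * integral lam (u ^ 4)

/-- The energy `‖u‖²_{Ḣ^{3/2}} + κ (∫ (3/2 u uₓ² + 1/2 u (H uₓ)²)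
+ ∫ (1/3 u³ H uₓ + 1/4 u² H (u uₓ)) + 1/20 ∫ u⁵)`. -/
def energyThreeHalves (κ lam : ℝ) (u : TrigPoly) : ℝ :=
  normSq lam (3 / 2) u
    + κ * ((3 / 2 * integral lam (u * dx u ^ 2)
          + 1 / 2 * integral lam (u * hilbert κ (dx u) ^ 2))
        + (1 / 3 * integral lam (u ^ 3 * hilbert κ (dx u))
          + 1 / 4 * integral lam (u ^ 2 * hilbert κ (u * dx u)))
        + 1 / 20 * integral lam (u ^ 5))

end TrigPoly

/-! ## Sobolev spaces of real distributions with mean zero on the circle -/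

/-- The Sobolev space `H^s` of real valued periodic distributions of mean zero, an element being
given by its Fourier coefficients. On mean zero distributions the weights `|n|^{2s}` and
`(1 + n²)^s` give equivalent norms. -/
@[ext]
structure Sobolev (s : ℝ) where
  /-- The Fourier coefficients. -/
  coeff : ℤ → ℂ
  coeff_neg : ∀ n, coeff (-n) = conj (coeff n)
  coeff_zero : coeff 0 = 0
  summable : Summable fun n : ℤ => (|(n : ℝ)| ^ s * ‖coeff n‖) ^ 2

namespace Sobolev

variable {s : ℝ}

instance : Zero (Sobolev s) := ⟨⟨0, by simp, rfl, by simp [summable_zero]⟩⟩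

/-- The isometric embedding `u ↦ (|n|^s û(n))ₙ` of `H^s` into `ℓ²(ℤ)`. -/
def toEllTwo (u : Sobolev s) : lp (fun _ : ℤ => ℂ) 2 :=
  ⟨fun n => ((|(n : ℝ)| ^ s : ℝ) : ℂ) * u.coeff n, by
    refine memℓp_gen ?_
    refine u.summable.congr fun n => ?_
    have h : (0 : ℝ) ≤ |(n : ℝ)| ^ s := by positivity
    simp [abs_of_nonneg h]⟩

/-- The norm topology of `H^s`. -/
instance : TopologicalSpace (Sobolev s) :=
  TopologicalSpace.induced toEllTwo inferInstance

instance : MeasurableSpace (Sobolev s) := borel _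

instance : BorelSpace (Sobolev s) := ⟨rfl⟩

/-- The sharp projector `π_N` onto the Fourier modes `|n| ≤ N`. -/
def proj (N : ℕ) (u : Sobolev s) : TrigPoly :=
  ∑ n ∈ Finset.Icc (-(N : ℤ)) N, AddMonoidAlgebra.single n (u.coeff n)

end Sobolev

/-! ## The Gaussian measure -/

/-- The standard complex Gaussian law: independent centred real and imaginary parts of
variance `1 / 2`. -/
def complexGaussian : Measure ℂ :=
  ((gaussianReal 0 (1 / 2)).prod (gaussianReal 0 (1 / 2))).map
    Complex.measurableEquivRealProd.symm

instance : IsProbabilityMeasure complexGaussian :=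
  Measure.isProbabilityMeasure_map Complex.measurableEquivRealProd.symm.measurable.aemeasurable

/-- The law of a sequence of independent standard complex Gaussian variables. -/
def noise : Measure (ℕ → ℂ) :=
  Measure.infinitePi fun _ => complexGaussian

/-- The variables `gₙ`, `n ∈ ℤ`: independent standard Gaussians for `n > 0`, and
`g₋ₙ = conj gₙ`. -/
def g (z : ℕ → ℂ) (n : ℤ) : ℂ :=
  if 0 < n then z n.natAbs else if n < 0 then conj (z n.natAbs) else 0

/-- The Fourier coefficients of the random series
`∑_{n ≠ 0} gₙ / ((4π lam)^{1/2} |n|^{3/2}) e^{inx}`. -/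
def seriesCoeff (lam : ℝ) (z : ℕ → ℂ) (n : ℤ) : ℂ :=
  g z n / ((√(4 * Real.pi * lam) * |(n : ℝ)| ^ (3 / 2 : ℝ) : ℝ) : ℂ)

lemma seriesCoeff_neg (lam : ℝ) (z : ℕ → ℂ) (n : ℤ) :
    seriesCoeff lam z (-n) = conj (seriesCoeff lam z n) := by
  have : g z (-n) = conj (g z n) := by
    rcases lt_trichotomy n 0 with h | h | h
    · simp [g, h, h.not_gt]
    · simp [g, h]
    · simp [g, h, h.not_gt]
  unfold seriesCoeff
  rw [this, map_div₀, Complex.conj_ofReal]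
  simp

open Classical in
/-- The random series as an element of `H^s` (it converges in `H^s` almost surely if `s < 1`). -/
def randomSeries (s lam : ℝ) (z : ℕ → ℂ) : Sobolev s :=
  if h : Summable fun n : ℤ => (|(n : ℝ)| ^ s * ‖seriesCoeff lam z n‖) ^ 2 then
    ⟨seriesCoeff lam z, seriesCoeff_neg lam z, by simp [seriesCoeff, g], h⟩
  else 0

/-- The Gaussian measure `μ_{3/2}` on `H^s`, `s < 1`: the law of the random series. Formally it
has density `exp (-‖u‖²_{Ḣ^{3/2}})` up to normalization. -/
def gaussianMeasure (s lam : ℝ) : Measure (Sobolev s) :=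
  noise.map (randomSeries s lam)

/-! ## The truncated equation -/

/-- The nonlinearity `S (S u · S uₓ)`, where `S` is the smoothed projector with profile `φ`.
When `φ` vanishes outside `[-1, 1]` it only sees the modes `|n| ≤ N` of `u`. -/
def nonlinearity (φ : ℝ → ℝ) (N : ℕ) {s : ℝ} (u : Sobolev s) : TrigPoly :=
  ((u.proj N).smooth φ N * (u.proj N).dx.smooth φ N).smooth φ N

/-- `u` is a global solution in `H^s` of `∂ₜ u + H ∂ₓ² u + S (S u · S uₓ) = 0`, the equation
being written for each Fourier coefficient. -/
structure IsSolution (κ : ℝ) (φ : ℝ → ℝ) (N : ℕ) {s : ℝ} (u : ℝ → Sobolev s) : Prop where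
  continuous : Continuous u
  equation : ∀ (n : ℤ) (t : ℝ), HasDerivAt (fun τ => (u τ).coeff n)
    (-(TrigPoly.hilbertSymbol κ n * (Complex.I * n) ^ 2 * (u t).coeff n)
      - (nonlinearity φ N (u t)).coeff n) t

open Classical in
/-- The flow `Φ(t)` of the truncated equation: `flow κ φ N t u₀` is the value at time `t` of the
solution that equals `u₀` at time `0`. -/
def flow (κ : ℝ) (φ : ℝ → ℝ) (N : ℕ) {s : ℝ} (t : ℝ) (u₀ : Sobolev s) : Sobolev s :=
  if h : ∃ u : ℝ → Sobolev s, IsSolution κ φ N u ∧ u 0 = u₀ then h.choose t else u₀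

/-! ## The approximating densities -/

/-- A smooth, compactly supported cut-off which is `1` on `(-1, 1)`. -/
structure IsCutoff (χ : ℝ → ℝ) : Prop where
  smooth : ContDiff ℝ ∞ χ
  hasCompactSupport : HasCompactSupport χ
  eq_one : ∀ x, |x| < 1 → χ x = 1

/-- The admissible symbols `ψ_ε` of the smoothed projectors. -/
structure IsProfile (ε : ℝ) (φ : ℝ → ℝ) : Prop where
  smooth : ContDiff ℝ ∞ φ
  eq_one : ∀ x ∈ Set.Icc 0 (1 - ε), φ x = 1
  eq_zero : ∀ x, 1 < x → φ x = 0
  abs_le_one : ∀ x, |φ x| ≤ 1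
  even : ∀ x, φ x = φ |x|

/-- The density `H_{N,R}^ε`, for the smoothed projector with profile `φ`. The renormalization
constant `α_N = ∑_{n=1}^N 1/n` is the mean of `‖π_N u‖²_{Ḣ^1}` under `μ_{3/2}`. -/
def density (κ lam : ℝ) (χ φ : ℝ → ℝ) (R : ℝ) (N : ℕ) {s : ℝ} (u : Sobolev s) : ℝ :=
  let p : TrigPoly := u.proj N
  let v : TrigPoly := p.smooth φ N
  χ (√(p.normSq lam 0) / R)
    * χ ((p.normSq lam (1 / 2) + κ / 3 * (v ^ 3).integral lam) / R)
    * χ ((p.normSq lam 1 - v.normSq lam 1 + v.energyOne κ lam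
        - ∑ n ∈ Finset.Icc 1 N, 1 / (n : ℝ)) / R)
    * Real.exp (v.normSq lam (3 / 2) - v.energyThreeHalves κ lam)

end BenjaminOno

end

open scoped ContDiff ComplexConjugate

noncomputable section

namespace BenjaminOno

open MeasureTheory ProbabilityTheory

section

namespace TrigPoly

open Finset

/-! ### Coefficients -/

/-! Write `v = S u`. Multiplying the density by the Gaussian weight turns it into a function
`weight` times a flat measure, which is Lebesgue measure on the modes `1 ≤ n ≤ N` and Gaussian on
the others. The factor `exp (‖π_N u‖²)` cancels the Gaussian weight, and the exponent becomes minus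
the modified `H^{3/2}` energy. The truncated equation is a divergence free ODE on the low modes and
a rotation of the high ones, so by Liouville's theorem its flow preserves the flat measure
(`IsGlobalFlow.measurePreserving`, `measurePreserving_noiseFlow`). The difference of the two
integrals is therefore the integral over `A` of `weight - weight ∘ Φ(t)`, at most `|t|` times the
`L¹` norm of the derivative `weightRate` of the weight along the flow (`abs_setIntegral_sub_le`).
The point is that this norm can be made at most `δ`.

Mass and Hamiltonian are conserved exactly. The function `v` solves the Benjamin-Ono equation with
the extra forcing `w = (1 - S²)(v vₓ)`. By the conservation laws of the untruncated equation, the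
derivatives of the two modified energies contain only terms linear in `w`, the defects
(`hasDerivAt_modifiedOne`, `hasDerivAt_modifiedThreeHalves`). Young's inequality bounds `weightRate`
by `η exp (-2 · remainder)` on the support of the cutoffs plus `1/η` times the squared defects
(`abs_weightRate_mul_le`), where `remainder` is the `H^{3/2}` energy without its quadratic part.

The exponential moment is bounded uniformly in `N` and the profile (`lintegral_exp_remainder_le`).
The mass and Hamiltonian cutoffs bound the `H^{1/2}` norm, and under this bound `-2 · remainder` at
`Y + k` is at most a polynomial functional `G(Y)` plus half the squared Cameron–Martin norm of `k`
(`neg_remainder_le`). The inf-convolution inequality of the Gaussian measure, property `(τ)`, then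
bounds the product of the exponential moment and `E exp (-G)` by `1`. Jensen's inequality gives `E
exp (-G) ≥ exp (-E G)`, and `E G` is bounded: the cubic term of `G` is odd and has mean zero, and
the rest are moments of norms that stay finite as `N` grows.

The defects are small in `L²`. Since `w` only has frequencies above `(1 - ε) N`, all of them except
the quartic one are bounded pathwise by the square of the `H¹` norm of the modes between `(1 - 2ε)
N` and `N`, up to a power of `N` that tends to zero (`norm_defect_le`). The expectation of this
square is `O(ε + 1/N)`, because the sum of `1/n` over that range is. The quartic defect is expanded
in the Gaussian variables: the terms with two opposite frequencies cancel by the symmetry `n ↦ -n`,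
and the remaining ones are orthogonal up to finitely many rearrangements, so that the second moment
is `O(N^{-1/4})` (`integral_defectQuartic_sq_le`). Taking `η` proportional to `δ`, then `ε` small,
then `N` large concludes. -/

@[simp] lemma coeff_multiplier (m : ℤ → ℂ) (p : TrigPoly) (n : ℤ) :
    (multiplier m p).coeff n = m n * p.coeff n := by
  unfold multiplier
  rw [AddMonoidAlgebra.coeff_finsuppSum, Finsupp.sum_apply]
  simp only [AddMonoidAlgebra.coeff_single, Finsupp.single_apply]
  rw [Finsupp.sum_ite_eq']
  split_ifs with h
  · rfl
  · rw [Finsupp.notMem_support_iff.mp h, mul_zero]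

lemma multiplier_add (m : ℤ → ℂ) (p q : TrigPoly) :
    multiplier m (p + q) = multiplier m p + multiplier m q := by
  ext n; simp [mul_add]

lemma multiplier_smul (m : ℤ → ℂ) (c : ℂ) (p : TrigPoly) :
    multiplier m (c • p) = c • multiplier m p := by
  ext n; simp; ring

/-- A Fourier multiplier as a linear map. -/
def multiplierₗ (m : ℤ → ℂ) : TrigPoly →ₗ[ℂ] TrigPoly where
  toFun := multiplier m
  map_add' := multiplier_add m
  map_smul' := multiplier_smul m

@[simp] lemma multiplierₗ_apply (m : ℤ → ℂ) (p : TrigPoly) : multiplierₗ m p = multiplier m p := rfl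

lemma multiplier_sub (m : ℤ → ℂ) (p q : TrigPoly) :
    multiplier m (p - q) = multiplier m p - multiplier m q := (multiplierₗ m).map_sub p q

lemma multiplier_neg (m : ℤ → ℂ) (p : TrigPoly) :
    multiplier m (-p) = -multiplier m p := (multiplierₗ m).map_neg p

lemma multiplier_sum {ι : Type*} (m : ℤ → ℂ) (s : Finset ι) (p : ι → TrigPoly) :
    multiplier m (∑ i ∈ s, p i) = ∑ i ∈ s, multiplier m (p i) := map_sum (multiplierₗ m) p s

lemma multiplier_multiplier (m m' : ℤ → ℂ) (p : TrigPoly) :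
    multiplier m (multiplier m' p) = multiplier (fun n => m n * m' n) p := by
  ext n; simp; ring

@[simp] lemma multiplier_single (m : ℤ → ℂ) (n : ℤ) (a : ℂ) :
    multiplier m (AddMonoidAlgebra.single n a) = AddMonoidAlgebra.single n (m n * a) := by
  ext k
  simp only [coeff_multiplier, AddMonoidAlgebra.coeff_single, Finsupp.single_apply]
  split_ifs with h
  · rw [h]
  · simp

lemma sum_single_eq {p : TrigPoly} {s : Finset ℤ} (h : p.coeff.support ⊆ s) :
    ∑ n ∈ s, AddMonoidAlgebra.single n (p.coeff n) = p := by
  conv_rhs => rw [← AddMonoidAlgebra.sum_coeff_single p]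
  rw [Finsupp.sum_of_support_subset _ h]
  simp

/-- Any finite set containing the support may serve as index set. Products of curves or of random
polynomials can thus be written over one fixed set and treated termwise. -/
lemma coeff_mul_eq_sum {p q : TrigPoly} {s : Finset ℤ} (h : p.coeff.support ⊆ s) (n : ℤ) :
    (p * q).coeff n = ∑ k ∈ s, p.coeff k * q.coeff (n - k) := by
  conv_lhs => rw [← sum_single_eq h, Finset.sum_mul]
  rw [AddMonoidAlgebra.coeff_sum, Finsupp.finsetSum_apply]
  refine Finset.sum_congr rfl fun k _ => ?_
  rw [AddMonoidAlgebra.coeff_single_mul_eq_mul_coeff (m₂ := n - k)]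
  intro m' _; constructor <;> intro h <;> omega

lemma coeff_mul_eq_finsum (p q : TrigPoly) (n : ℤ) :
    (p * q).coeff n = ∑ k ∈ p.coeff.support, p.coeff k * q.coeff (n - k) :=
  coeff_mul_eq_sum subset_rfl n

/-! ### Mean value, derivative and Hilbert transform -/

/-- The mean value of a trigonometric polynomial. -/
def mean : TrigPoly →ₗ[ℂ] ℂ where
  toFun p := p.coeff 0
  map_add' p q := by simp
  map_smul' c p := by simp

lemma mean_def (p : TrigPoly) : mean p = p.coeff 0 := rfl

lemma mean_mul {p : TrigPoly} {s : Finset ℤ} (h : p.coeff.support ⊆ s) (q : TrigPoly) :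
    mean (p * q) = ∑ k ∈ s, p.coeff k * q.coeff (-k) := by
  rw [mean_def, coeff_mul_eq_sum h]; simp

@[simp] lemma coeff_dx (p : TrigPoly) (n : ℤ) : (dx p).coeff n = Complex.I * n * p.coeff n :=
  coeff_multiplier _ _ _

@[simp] lemma coeff_hilbert (κ : ℝ) (p : TrigPoly) (n : ℤ) :
    (hilbert κ p).coeff n = hilbertSymbol κ n * p.coeff n :=
  coeff_multiplier _ _ _

@[simp] lemma coeff_smooth (φ : ℝ → ℝ) (N : ℕ) (p : TrigPoly) (n : ℤ) :
    (smooth φ N p).coeff n = (φ ((n : ℝ) / N) : ℂ) * p.coeff n :=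
  coeff_multiplier _ _ _

lemma dx_add (p q : TrigPoly) : dx (p + q) = dx p + dx q := multiplier_add _ _ _
lemma dx_sub (p q : TrigPoly) : dx (p - q) = dx p - dx q := multiplier_sub _ _ _
lemma dx_neg (p : TrigPoly) : dx (-p) = -dx p := multiplier_neg _ _
lemma hilbert_add (κ : ℝ) (p q : TrigPoly) : hilbert κ (p + q) = hilbert κ p + hilbert κ q :=
  multiplier_add _ _ _
lemma hilbert_smul (κ : ℝ) (c : ℂ) (p : TrigPoly) : hilbert κ (c • p) = c • hilbert κ p :=
  multiplier_smul _ _ _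
lemma smooth_add (φ : ℝ → ℝ) (N : ℕ) (p q : TrigPoly) :
    smooth φ N (p + q) = smooth φ N p + smooth φ N q := multiplier_add _ _ _
lemma smooth_sub (φ : ℝ → ℝ) (N : ℕ) (p q : TrigPoly) :
    smooth φ N (p - q) = smooth φ N p - smooth φ N q := multiplier_sub _ _ _
lemma smooth_neg (φ : ℝ → ℝ) (N : ℕ) (p : TrigPoly) :
    smooth φ N (-p) = -smooth φ N p := multiplier_neg _ _

lemma hilbert_dx (κ : ℝ) (p : TrigPoly) : hilbert κ (dx p) = dx (hilbert κ p) := by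
  ext n; simp; ring

lemma smooth_dx (φ : ℝ → ℝ) (N : ℕ) (p : TrigPoly) : smooth φ N (dx p) = dx (smooth φ N p) := by
  ext n; simp; ring

lemma smooth_hilbert (κ : ℝ) (φ : ℝ → ℝ) (N : ℕ) (p : TrigPoly) :
    smooth φ N (hilbert κ p) = hilbert κ (smooth φ N p) := by
  ext n; simp; ring

lemma dx_mul (p q : TrigPoly) : dx (p * q) = dx p * q + p * dx q := by
  ext n
  rw [AddMonoidAlgebra.coeff_add, Finsupp.add_apply, coeff_dx, coeff_mul_eq_finsum,
    coeff_mul_eq_finsum p, coeff_mul_eq_sum (s := p.coeff.support), Finset.mul_sum,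
    ← Finset.sum_add_distrib]
  · refine Finset.sum_congr rfl fun k _ => ?_
    simp; ring
  · intro k hk
    rw [Finsupp.mem_support_iff] at hk ⊢
    rw [coeff_dx] at hk
    exact right_ne_zero_of_mul hk

lemma mean_dx (p : TrigPoly) : mean (dx p) = 0 := by simp [mean_def]

/-- Integration by parts. -/
lemma mean_mul_dx (p q : TrigPoly) : mean (p * dx q) = -mean (dx p * q) := by
  have := mean_dx (p * q)
  rw [dx_mul, map_add] at this
  linear_combination this

/-- The bilinear pairing `mean (p * q)` couples the frequency `n` with `-n`, so the transpose of a
multiplier has the reflected symbol. Even symbols are symmetric and odd ones antisymmetric. -/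
lemma mean_mul_multiplier (m : ℤ → ℂ) (p q : TrigPoly) :
    mean (p * multiplier m q) = mean (multiplier (fun n => m (-n)) p * q) := by
  rw [mean_mul subset_rfl, mean_mul (s := p.coeff.support)]
  · refine Finset.sum_congr rfl fun k _ => ?_
    simp; ring
  · intro k hk
    rw [Finsupp.mem_support_iff] at hk ⊢
    rw [coeff_multiplier] at hk
    exact right_ne_zero_of_mul hk

lemma hilbertSymbol_neg (κ : ℝ) (n : ℤ) : hilbertSymbol κ (-n) = -hilbertSymbol κ n := by
  simp [hilbertSymbol]

/-- The Hilbert transform is antisymmetric. -/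
lemma mean_mul_hilbert (κ : ℝ) (p q : TrigPoly) :
    mean (p * hilbert κ q) = -mean (hilbert κ p * q) := by
  rw [hilbert, mean_mul_multiplier, ← map_neg, ← neg_mul]
  congr 2
  ext n; simp [hilbertSymbol_neg, hilbert]

lemma mean_mul_smooth {φ : ℝ → ℝ} (hφ : ∀ x, φ x = φ |x|) (N : ℕ) (p q : TrigPoly) :
    mean (p * smooth φ N q) = mean (smooth φ N p * q) := by
  rw [smooth, mean_mul_multiplier, smooth]
  congr 3
  funext n
  rw [hφ, hφ ((n : ℝ) / N)]
  simp [abs_div]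

variable {κ : ℝ}

lemma hilbertSymbol_sq (hκ : κ = 1 ∨ κ = -1) {n : ℤ} (hn : n ≠ 0) :
    hilbertSymbol κ n * hilbertSymbol κ n = -1 := by
  have h1 : ((n.sign : ℤ) : ℂ) * n.sign = 1 := by
    rcases lt_or_gt_of_ne hn with h | h
    · rw [Int.sign_eq_neg_one_of_neg h]; norm_num
    · rw [Int.sign_eq_one_of_pos h]; norm_num
  have h2 : (κ : ℂ) * κ = 1 := by rcases hκ with rfl | rfl <;> norm_num
  unfold hilbertSymbol
  linear_combination (Complex.I * Complex.I) * (κ * κ) * h1 + Complex.I * Complex.I * h2 +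
    Complex.I_mul_I

lemma norm_hilbertSymbol_le (hκ : κ = 1 ∨ κ = -1) (n : ℤ) : ‖hilbertSymbol κ n‖ ≤ 1 := by
  have h2 : |κ| = 1 := by rcases hκ with rfl | rfl <;> norm_num
  have h3 : ‖((n.sign : ℤ) : ℂ)‖ ≤ 1 := by
    rcases lt_trichotomy n 0 with h | h | h
    · rw [Int.sign_eq_neg_one_of_neg h]; norm_num
    · rw [h]; norm_num
    · rw [Int.sign_eq_one_of_pos h]; norm_num
  simpa [hilbertSymbol, h2] using h3

/-- `H² = -1` on functions of mean zero. -/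
lemma hilbert_hilbert (hκ : κ = 1 ∨ κ = -1) {p : TrigPoly} (hp : p.coeff 0 = 0) :
    hilbert κ (hilbert κ p) = -p := by
  ext n
  rcases eq_or_ne n 0 with rfl | hn
  · simp [hp]
  · simp only [coeff_hilbert, AddMonoidAlgebra.coeff_neg, Finsupp.neg_apply]
    rw [← mul_assoc, hilbertSymbol_sq hκ hn]; ring

lemma hilbert_single (n : ℤ) (a : ℂ) :
    hilbert κ (AddMonoidAlgebra.single n a) = AddMonoidAlgebra.single n (hilbertSymbol κ n * a) :=
  multiplier_single _ _ _

/-- After removing `κ² = 1` and `i² = -1` this is `sgn (m + n) (sgn m + sgn n) = 1 + sgn m sgn n`: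
both sides vanish for opposite signs and equal `2` for equal signs. -/
lemma hilbertSymbol_cotlar (hκ : κ = 1 ∨ κ = -1) {m n : ℤ} (hm : m ≠ 0) (hn : n ≠ 0) :
    hilbertSymbol κ (m + n) * (hilbertSymbol κ n + hilbertSymbol κ m)
      = hilbertSymbol κ m * hilbertSymbol κ n - 1 := by
  have h2 : (κ : ℂ) * κ = 1 := by rcases hκ with rfl | rfl <;> norm_num
  have key : ((m + n).sign : ℂ) * (n.sign + m.sign) = m.sign * n.sign + 1 := by
    rcases lt_or_gt_of_ne hm with h | h <;> rcases lt_or_gt_of_ne hn with h' | h'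
    · rw [Int.sign_eq_neg_one_of_neg h, Int.sign_eq_neg_one_of_neg h',
        Int.sign_eq_neg_one_of_neg (by omega)]; norm_num
    · rw [Int.sign_eq_neg_one_of_neg h, Int.sign_eq_one_of_pos h']; norm_num
    · rw [Int.sign_eq_neg_one_of_neg h', Int.sign_eq_one_of_pos h]; norm_num
    · rw [Int.sign_eq_one_of_pos h, Int.sign_eq_one_of_pos h',
        Int.sign_eq_one_of_pos (by omega)]; norm_num
  unfold hilbertSymbol
  linear_combination (Complex.I * Complex.I) * (κ * κ) * key + Complex.I * Complex.I * h2 +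
    Complex.I_mul_I

/-- The product identity of the Hilbert transform, for functions of mean zero. -/
lemma hilbert_cotlar (hκ : κ = 1 ∨ κ = -1) {p q : TrigPoly} (hp : p.coeff 0 = 0)
    (hq : q.coeff 0 = 0) :
    hilbert κ (p * hilbert κ q + q * hilbert κ p) = hilbert κ p * hilbert κ q - p * q := by
  rw [mul_comm q]
  have hps : ∑ n ∈ p.coeff.support, AddMonoidAlgebra.single n (p.coeff n) = p :=
    sum_single_eq subset_rfl
  have hqs : ∑ n ∈ q.coeff.support, AddMonoidAlgebra.single n (q.coeff n) = q :=
    sum_single_eq subset_rfl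
  have hH : ∀ r : TrigPoly, hilbert κ r
      = ∑ n ∈ r.coeff.support, AddMonoidAlgebra.single n (hilbertSymbol κ n * r.coeff n) := by
    intro r
    conv_lhs => rw [← sum_single_eq (p := r) subset_rfl]
    exact (multiplier_sum _ _ _).trans (Finset.sum_congr rfl fun n _ => hilbert_single _ _)
  -- Both sides are expanded over pairs of frequencies `(m, n)`, where the claim is the symbol
  -- identity.
  have e1 : p * hilbert κ q + hilbert κ p * q = ∑ m ∈ p.coeff.support, ∑ n ∈ q.coeff.support,
      AddMonoidAlgebra.single (m + n)
        ((hilbertSymbol κ n + hilbertSymbol κ m) * (p.coeff m * q.coeff n)) := by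
    conv_lhs =>
      rw [hH q, hH p]
      arg 1
      rw [← hps]
    conv_lhs =>
      arg 2
      rw [← hqs]
    rw [Finset.sum_mul_sum, Finset.sum_mul_sum, ← Finset.sum_add_distrib]
    refine Finset.sum_congr rfl fun m _ => ?_
    rw [← Finset.sum_add_distrib]
    refine Finset.sum_congr rfl fun n _ => ?_
    rw [AddMonoidAlgebra.single_mul_single, AddMonoidAlgebra.single_mul_single,
      ← AddMonoidAlgebra.single_add]
    congr 1; ring
  have e2 : hilbert κ p * hilbert κ q - p * q = ∑ m ∈ p.coeff.support, ∑ n ∈ q.coeff.support,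
      AddMonoidAlgebra.single (m + n)
        ((hilbertSymbol κ m * hilbertSymbol κ n - 1) * (p.coeff m * q.coeff n)) := by
    conv_lhs =>
      rw [hH q, hH p]
      arg 2
      rw [← hqs, ← hps]
    rw [Finset.sum_mul_sum, Finset.sum_mul_sum, ← Finset.sum_sub_distrib]
    refine Finset.sum_congr rfl fun m _ => ?_
    rw [← Finset.sum_sub_distrib]
    refine Finset.sum_congr rfl fun n _ => ?_
    rw [AddMonoidAlgebra.single_mul_single, AddMonoidAlgebra.single_mul_single,
      ← AddMonoidAlgebra.single_sub]
    congr 1; ring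
  rw [e1, e2]
  unfold hilbert
  rw [multiplier_sum]
  refine Finset.sum_congr rfl fun m hm => ?_
  rw [multiplier_sum]
  refine Finset.sum_congr rfl fun n hn => ?_
  rw [multiplier_single, ← mul_assoc, hilbertSymbol_cotlar hκ]
  · rintro rfl; exact Finsupp.mem_support_iff.mp hm hp
  · rintro rfl; exact Finsupp.mem_support_iff.mp hn hq

end TrigPoly
end

section

namespace TrigPoly

open Finset

/-! ### Algebraic identities behind the conservation laws -/

variable {κ : ℝ}

lemma mean_congr {p q : TrigPoly} (h : p = q) : mean p = mean q := congrArg _ h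

lemma mean_mul_hilbert_self (κ : ℝ) (p : TrigPoly) : mean (p * hilbert κ p) = 0 := by
  have h := mean_mul_hilbert κ p p
  rw [mul_comm (hilbert κ p)] at h
  linear_combination (1 / 2 : ℂ) * h

lemma mean_mul_dx_self (p : TrigPoly) : mean (p * dx p) = 0 := by
  have h := mean_mul_dx p p
  rw [mul_comm (dx p)] at h
  linear_combination (1 / 2 : ℂ) * h

lemma mean_hilbert_mul_hilbert (hκ : κ = 1 ∨ κ = -1) {p : TrigPoly} (hp : p.coeff 0 = 0)
    (q : TrigPoly) : mean (hilbert κ p * hilbert κ q) = mean (p * q) := by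
  rw [mean_mul_hilbert, hilbert_hilbert hκ hp, neg_mul, map_neg, neg_neg]

/-- `H` and `∂ₓ` are both antisymmetric and commute, so `H ∂ₓ` is symmetric. -/
lemma mean_mul_hilbert_dx (κ : ℝ) (p q : TrigPoly) :
    mean (p * hilbert κ (dx q)) = mean (q * hilbert κ (dx p)) := by
  rw [mean_mul_hilbert, mean_mul_dx, neg_neg, ← hilbert_dx, mul_comm]

/-- The product identity with both factors equal to `f` reads `H(2 f Hf) = (Hf)² - f²`. Pairing it
with `f` and moving `H` to the other factor gives the relation. -/
lemma mean_cube (hκ : κ = 1 ∨ κ = -1) {f : TrigPoly} (hf : f.coeff 0 = 0) :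
    mean (f * (f * f)) = 3 * mean (f * (hilbert κ f * hilbert κ f)) := by
  have h1 := hilbert_cotlar hκ hf hf
  have h2 := mean_mul_hilbert κ f (f * hilbert κ f + f * hilbert κ f)
  rw [h1, mul_sub, map_sub, mul_add, map_add,
    mean_congr (show hilbert κ f * (f * hilbert κ f) = f * (hilbert κ f * hilbert κ f) by ring)]
    at h2
  linear_combination -h2

/-- The differential of the cubic and quartic terms of `energyOne`. -/
lemma differential_energyOne (κ : ℝ) (v t : TrigPoly) :
    3 / 4 * (2 * mean (v * t * hilbert κ (dx v)) + mean (v * v * hilbert κ (dx t)))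
      + 1 / 2 * mean (v * v * v * t)
    = 3 / 2 * (mean (t * (v * hilbert κ (dx v))) + mean (t * hilbert κ (v * dx v)))
      + 1 / 2 * mean (t * (v * v * v)) := by
  have h1 : mean (v * v * hilbert κ (dx t)) = 2 * mean (t * hilbert κ (v * dx v)) := by
    rw [mean_mul_hilbert_dx, dx_mul, mean_congr (show t * hilbert κ (dx v * v + v * dx v)
      = t * hilbert κ (v * dx v) + t * hilbert κ (v * dx v) by
        rw [hilbert_add, mul_add, mul_comm (dx v)]), map_add]
    ring
  rw [h1, mean_congr (show v * t * hilbert κ (dx v) = t * (v * hilbert κ (dx v)) by ring),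
    mul_comm (v * v * v)]
  ring

/-- Conservation of `energyOne` by the Benjamin-Ono equation. -/
lemma conservation_energyOne (hκ : κ = 1 ∨ κ = -1) (v : TrigPoly) :
    -2 * mean (dx v * dx (v * dx v))
      + (3 / 2 * (mean ((-hilbert κ (dx (dx v)) - v * dx v) * (v * hilbert κ (dx v)))
          + mean ((-hilbert κ (dx (dx v)) - v * dx v) * hilbert κ (v * dx v)))
        + 1 / 2 * mean ((-hilbert κ (dx (dx v)) - v * dx v) * (v * v * v))) = 0 := by
  have hf0 : (dx v).coeff 0 = 0 := mean_dx v
  have hcube := mean_cube hκ hf0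
  have hiso : mean (hilbert κ (dx (dx v)) * hilbert κ (v * dx v)) = mean (dx (dx v) * (v * dx v)) :=
    mean_hilbert_mul_hilbert hκ (mean_dx (dx v)) _
  have hself := mean_mul_hilbert_self κ (v * dx v)
  rw [hilbert_dx κ (dx v)] at *
  -- The identity is checked degree by degree in `v`. In degree three, integration by parts reduces
  -- everything to the means of `f³` and `f (Hf)²` with `f = vₓ`, which `hcube` links; degree four
  -- is `e3` and antisymmetry of `H`; degree five is a total derivative.
  have e1 : mean (dx v * (hilbert κ (dx v) * hilbert κ (dx v)))
      + 2 * mean (dx (hilbert κ (dx v)) * (v * hilbert κ (dx v))) = 0 := by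
    rw [← mean_dx (v * (hilbert κ (dx v) * hilbert κ (dx v))), dx_mul, dx_mul, two_mul, ← map_add,
      ← map_add]
    exact mean_congr (by ring)
  have e2 : mean (dx v * (dx v * dx v)) + 2 * mean (dx (dx v) * (v * dx v)) = 0 := by
    rw [← mean_dx (v * (dx v * dx v)), dx_mul, dx_mul, two_mul, ← map_add, ← map_add]
    exact mean_congr (by ring)
  have e3 : mean (dx (hilbert κ (dx v)) * (v * v * v))
      + 3 * mean (v * dx v * (v * hilbert κ (dx v))) = 0 := by
    rw [← mean_dx (v * v * v * hilbert κ (dx v)), dx_mul, dx_mul, dx_mul,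
      show (3 : ℂ) = 1 + 1 + 1 by norm_num, add_mul, add_mul, one_mul, ← map_add, ← map_add,
      ← map_add]
    exact mean_congr (by ring)
  have e4 : mean (v * dx v * (v * v * v)) = 0 := by
    have := mean_dx (v * v * (v * v) * v)
    simp only [dx_mul] at this
    rw [mean_congr (show ((dx v * v + v * dx v) * (v * v) + v * v * (dx v * v + v * dx v)) * v
      + v * v * (v * v) * dx v = (5 : ℂ) • (v * dx v * (v * v * v)) by
        rw [show (5 : ℂ) = 1 + 1 + 1 + 1 + 1 by norm_num]; simp only [add_smul, one_smul]; ring),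
      map_smul, smul_eq_mul] at this
    simpa using this
  have e5 : mean (dx v * dx (v * dx v)) = mean (dx v * (dx v * dx v))
      + mean (dx (dx v) * (v * dx v)) := by
    rw [dx_mul, ← map_add]; exact mean_congr (by ring)
  simp only [sub_mul, neg_mul, map_sub, map_neg]
  rw [e5, hiso, hself, e4]
  linear_combination (-3 / 4 : ℂ) * e1 + (-7 / 4 + 1 / 2 - 1 / 2 : ℂ) * e2 + (-1 / 2 : ℂ) * e3
    + (- 1 / 4 : ℂ) * hcube

/-- The differential of the cubic term of `energyThreeHalves`. -/
lemma differential_cubic (κ : ℝ) (v t : TrigPoly) :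
    3 / 2 * (mean (t * (dx v * dx v)) + 2 * mean (v * dx v * dx t))
      + 1 / 2 * (mean (t * (hilbert κ (dx v) * hilbert κ (dx v)))
        + 2 * mean (v * hilbert κ (dx v) * hilbert κ (dx t)))
    = 3 / 2 * mean (t * (dx v * dx v))
      + 1 / 2 * mean (t * (hilbert κ (dx v) * hilbert κ (dx v)))
      - 3 * mean (t * dx (v * dx v)) + mean (t * dx (hilbert κ (v * hilbert κ (dx v)))) := by
  rw [mean_mul_hilbert_dx, hilbert_dx κ (v * hilbert κ (dx v)), mean_mul_dx (v * dx v) t, mul_comm (dx (v * dx v)) t]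
  ring

/-- The differential of the quartic term of `energyThreeHalves`. -/
lemma differential_quartic (κ : ℝ) (v t : TrigPoly) :
    1 / 3 * (3 * mean (v * v * t * hilbert κ (dx v)) + mean (v * v * v * hilbert κ (dx t)))
      + 1 / 4 * (2 * mean (v * t * hilbert κ (v * dx v))
        + mean (v * v * hilbert κ (t * dx v + v * dx t)))
    = mean (t * (v * v * hilbert κ (dx v))) + mean (t * hilbert κ (v * v * dx v))
      + mean (t * (v * hilbert κ (v * dx v))) := by
  have h1 : mean (v * v * v * hilbert κ (dx t)) = 3 * mean (t * hilbert κ (v * v * dx v)) := by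
    rw [mean_mul_hilbert_dx, dx_mul, dx_mul, mean_congr (show t * hilbert κ ((dx v * v + v * dx v)
      * v + v * v * dx v) = t * hilbert κ (v * v * dx v) + t * hilbert κ (v * v * dx v)
        + t * hilbert κ (v * v * dx v) by
        rw [← mul_add, ← mul_add, ← hilbert_add, ← hilbert_add]; congr 2; ring), map_add, map_add]
    ring
  have h2 : mean (v * v * hilbert κ (t * dx v + v * dx t))
      = 2 * mean (t * (v * hilbert κ (v * dx v))) := by
    rw [show t * dx v + v * dx t = dx (v * t) by rw [dx_mul]; ring, mean_mul_hilbert_dx, dx_mul,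
      mean_congr (show v * t * hilbert κ (dx v * v + v * dx v)
      = t * (v * hilbert κ (v * dx v)) + t * (v * hilbert κ (v * dx v)) by
        rw [hilbert_add, mul_comm (dx v)]; ring), map_add]
    ring
  rw [h1, h2, mean_congr (show v * v * t * hilbert κ (dx v) = t * (v * v * hilbert κ (dx v)) by ring),
    mean_congr (show v * t * hilbert κ (v * dx v) = t * (v * hilbert κ (v * dx v)) by ring)]
  ring

/-- Conservation of `energyThreeHalves` by the Benjamin-Ono equation. -/
lemma conservation_energyThreeHalves (hκ : κ = 1 ∨ κ = -1) (v t : TrigPoly)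
    (ht : t = -hilbert κ (dx (dx v)) - v * dx v) :
    -2 * mean (hilbert κ (dx (dx v)) * dx (v * dx v))
      + (3 / 2 * mean (t * (dx v * dx v))
          + 1 / 2 * mean (t * (hilbert κ (dx v) * hilbert κ (dx v)))
          - 3 * mean (t * dx (v * dx v)) + mean (t * dx (hilbert κ (v * hilbert κ (dx v)))))
      + (mean (t * (v * v * hilbert κ (dx v))) + mean (t * hilbert κ (v * v * dx v))
          + mean (t * (v * hilbert κ (v * dx v))))
      + 1 / 4 * mean (t * (v * v * (v * v))) = 0 := by
  have hf0 : (dx v).coeff 0 = 0 := mean_dx v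
  have hcot := hilbert_cotlar hκ hf0 hf0
  subst ht
  rw [hilbert_dx κ (dx v)] at *
  set f := dx v with hf
  set g := hilbert κ f with hg
  have hiso1 : mean (dx g * dx (hilbert κ (v * g))) = mean (dx f * dx (v * g)) := by
    rw [hg, ← hilbert_dx, ← hilbert_dx]
    exact mean_hilbert_mul_hilbert hκ (mean_dx _) _
  have hiso2 : mean (dx g * hilbert κ (v * v * f)) = mean (dx f * (v * v * f)) := by
    rw [hg, ← hilbert_dx]
    exact mean_hilbert_mul_hilbert hκ (mean_dx _) _
  -- degree three
  have a1 : mean (f * f * dx g) + 2 * mean (f * dx f * g) = 0 := by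
    rw [← mean_dx (f * f * g), dx_mul, dx_mul, two_mul, ← map_add, ← map_add]
    exact mean_congr (by ring)
  have a2 : mean (dx g * (g * g)) = 0 := by
    have h := mean_dx (g * g * g)
    rw [dx_mul, dx_mul, mean_congr (show (dx g * g + g * dx g) * g + g * g * dx g
      = dx g * (g * g) + dx g * (g * g) + dx g * (g * g) by ring), map_add, map_add] at h
    linear_combination (1 / 3 : ℂ) * h
  have a3 : mean (dx g * dx (v * f)) = mean (f * f * dx g) + mean (v * dx f * dx g) := by
    rw [dx_mul, ← map_add]; exact mean_congr (by rw [← hf]; ring)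
  have a4 : mean (dx f * dx (v * g)) = mean (f * dx f * g) + mean (v * dx f * dx g) := by
    rw [dx_mul, ← map_add]; exact mean_congr (by rw [← hf]; ring)
  -- degree four
  have b1 : mean (v * f * dx (v * f)) = 0 := mean_mul_dx_self _
  have b2 : mean (v * f * (g * g)) + mean (dx g * (v * v * g)) = 0 := by
    have h := mean_dx (v * v * (g * g))
    rw [dx_mul, dx_mul, dx_mul, mean_congr (show (dx v * v + v * dx v) * (g * g)
      + v * v * (dx g * g + g * dx g) = v * f * (g * g) + dx g * (v * v * g) + (v * f * (g * g)
      + dx g * (v * v * g)) by rw [← hf]; ring), map_add] at h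
    rw [map_add] at h
    linear_combination (1 / 2 : ℂ) * h
  have b3 : mean (v * f * (f * f)) + mean (dx f * (v * v * f)) = 0 := by
    have h := mean_dx (v * v * (f * f))
    rw [dx_mul, dx_mul, dx_mul, mean_congr (show (dx v * v + v * dx v) * (f * f)
      + v * v * (dx f * f + f * dx f) = v * f * (f * f) + dx f * (v * v * f) + (v * f * (f * f)
      + dx f * (v * v * f)) by rw [← hf]; ring), map_add] at h
    rw [map_add] at h
    linear_combination (1 / 2 : ℂ) * h
  have b4 : mean (v * f * dx (hilbert κ (v * g))) = - mean (f * g * hilbert κ (v * f))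
      - mean (dx g * (v * hilbert κ (v * f))) := by
    rw [← hilbert_dx, mean_mul_hilbert, dx_mul, ← hf, mul_add, map_add,
      mean_congr (show hilbert κ (v * f) * (f * g) = f * g * hilbert κ (v * f) by ring),
      mean_congr (show hilbert κ (v * f) * (v * dx g) = dx g * (v * hilbert κ (v * f)) by ring)]
    ring
  -- This quartic term is not reached by integration by parts; the product identity for `f = vₓ`
  -- converts it into local terms.
  have b5 : -2 * mean (f * g * hilbert κ (v * f)) = mean (v * f * (g * g))
      - mean (v * f * (f * f)) := by
    rw [← map_sub, ← mul_sub, ← hcot, mul_comm (f * g), mean_mul_hilbert κ (v * f), mul_add,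
      map_add]
    ring
  -- degree five
  have c1 : mean (v * f * hilbert κ (v * v * f)) + mean (v * f * (v * hilbert κ (v * f))) = 0 := by
    rw [mean_mul_hilbert, mean_congr (show v * f * (v * hilbert κ (v * f))
      = hilbert κ (v * f) * (v * v * f) by ring)]
    ring
  have c2 : mean (dx g * (v * v * (v * v))) + 4 * mean (v * f * (v * v * g)) = 0 := by
    rw [← mean_dx (v * v * (v * v) * g), dx_mul, dx_mul, dx_mul,
      show (4 : ℂ) = 1 + 1 + 1 + 1 by norm_num, add_mul, add_mul, add_mul, one_mul, ← map_add,
      ← map_add, ← map_add, ← map_add]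
    exact mean_congr (by rw [← hf]; ring)
  -- degree six
  have d1 : mean (v * f * (v * v * (v * v))) = 0 := by
    have := mean_dx (v * v * (v * v) * (v * v))
    simp only [dx_mul, ← hf] at this
    rw [mean_congr (show ((f * v + v * f) * (v * v) + v * v * (f * v + v * f)) * (v * v)
      + v * v * (v * v) * (f * v + v * f) = (6 : ℂ) • (v * f * (v * v * (v * v))) by
        rw [show (6 : ℂ) = 1 + 1 + 1 + 1 + 1 + 1 by norm_num]
        simp only [add_smul, one_smul]; ring),
      map_smul, smul_eq_mul] at this
    simpa using this
  simp only [sub_mul, neg_mul, map_sub, map_neg]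
  rw [hiso1, hiso2, a3, a4, b1, b4, a2, d1, mean_congr (show dx g * (f * f) = f * f * dx g by ring)]
  linear_combination (-1 / 2 : ℂ) * a1 - b2 - b3 - c1 - (1 / 4 : ℂ) * c2 - (1 / 2 : ℂ) * b5

/-- Conservation of the Hamiltonian by the truncated equation. -/
lemma conservation_hamiltonian {φ : ℝ → ℝ} (hφ : ∀ x, φ x = φ |x|) (N : ℕ)
    (u v : TrigPoly) (hv : v = smooth φ N u) :
    2 * mean ((-hilbert κ (dx (dx u)) - smooth φ N (v * dx v)) * hilbert κ (dx u))
      + mean (v * v * smooth φ N (-hilbert κ (dx (dx u)) - smooth φ N (v * dx v))) = 0 := by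
  have h1 : mean (hilbert κ (dx (dx u)) * hilbert κ (dx u)) = 0 := by
    rw [hilbert_dx, mul_comm]; exact mean_mul_dx_self _
  have h2 : mean (smooth φ N (v * dx v) * hilbert κ (dx u)) = mean (v * dx v * hilbert κ (dx v)) := by
    rw [← mean_mul_smooth hφ, smooth_hilbert, smooth_dx, hv]
  have h3 : smooth φ N (hilbert κ (dx (dx u))) = dx (hilbert κ (dx v)) := by
    rw [hilbert_dx, smooth_dx, smooth_hilbert, smooth_dx, hv]
  -- `S (v vₓ)` is half the derivative of `S (v²)`, so moving one `S` to the left leaves a total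
  -- derivative.
  have h4 : mean (v * v * smooth φ N (smooth φ N (v * dx v))) = 0 := by
    have h := mean_mul_dx_self (smooth φ N (v * v))
    rw [← smooth_dx, dx_mul, mean_congr (show smooth φ N (v * v) * smooth φ N (dx v * v + v * dx v)
      = smooth φ N (v * v) * smooth φ N (v * dx v) + smooth φ N (v * v) * smooth φ N (v * dx v) by
      rw [← mul_add, ← smooth_add, mul_comm (dx v)]), map_add] at h
    rw [mean_mul_smooth hφ]
    linear_combination (1 / 2 : ℂ) * h
  have h5 : 2 * mean (v * dx v * hilbert κ (dx v)) + mean (v * v * dx (hilbert κ (dx v))) = 0 := by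
    rw [← mean_dx (v * v * hilbert κ (dx v)), dx_mul, dx_mul, two_mul, ← map_add, ← map_add]
    exact mean_congr (by ring)
  rw [smooth_sub, smooth_neg, h3, sub_mul, neg_mul, map_sub, map_neg, h1, h2,
    mul_sub (v * v), mul_neg, map_sub, map_neg, h4]
  linear_combination -h5

/-! ### Time derivatives -/

/-- `p` is a curve of trigonometric polynomials of bounded degree, each of whose coefficients is
differentiable at `t`, the derivative being `p'`. -/
structure HasCoeffDeriv (p : ℝ → TrigPoly) (p' : TrigPoly) (t : ℝ) : Prop where
  bounded : ∃ s : Finset ℤ, ∀ τ, (p τ).coeff.support ⊆ s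
  hasDerivAt : ∀ n, HasDerivAt (fun τ => (p τ).coeff n) (p'.coeff n) t

namespace HasCoeffDeriv

variable {p q : ℝ → TrigPoly} {p' q' : TrigPoly} {t : ℝ}

lemma mul (hp : HasCoeffDeriv p p' t) (hq : HasCoeffDeriv q q' t) :
    HasCoeffDeriv (fun τ => p τ * q τ) (p' * q t + p t * q') t := by
  classical
  obtain ⟨s, hs⟩ := hp.bounded
  obtain ⟨s', hs'⟩ := hq.bounded
  -- A coefficient that vanishes for all times has zero derivative.
  have hp' : p'.coeff.support ⊆ s := by
    intro k hk
    by_contra hks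
    refine Finsupp.mem_support_iff.mp hk ((hp.hasDerivAt k).unique ?_)
    have : (fun τ => (p τ).coeff k) = fun _ => 0 := by
      funext τ
      exact Finsupp.notMem_support_iff.mp fun h => hks (hs τ h)
    rw [this]; exact hasDerivAt_const _ _
  refine ⟨⟨Finset.image₂ (· + ·) s s', fun τ => ?_⟩, fun n => ?_⟩
  · refine (AddMonoidAlgebra.support_coeff_mul_subset _ _).trans ?_
    exact Finset.add_subset_add (hs τ) (hs' τ)
  · have : (fun τ => (p τ * q τ).coeff n)
        = fun τ => ∑ k ∈ s, (p τ).coeff k * (q τ).coeff (n - k) := by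
      funext τ; exact coeff_mul_eq_sum (hs τ) n
    rw [this, AddMonoidAlgebra.coeff_add, Finsupp.add_apply, coeff_mul_eq_sum hp',
      coeff_mul_eq_sum (hs t), ← Finset.sum_add_distrib]
    exact HasDerivAt.fun_sum fun k _ => (hp.hasDerivAt k).mul (hq.hasDerivAt (n - k))

lemma multiplier (hp : HasCoeffDeriv p p' t) (m : ℤ → ℂ) :
    HasCoeffDeriv (fun τ => TrigPoly.multiplier m (p τ)) (TrigPoly.multiplier m p') t := by
  obtain ⟨s, hs⟩ := hp.bounded
  refine ⟨⟨s, fun τ k hk => hs τ ?_⟩, fun n => ?_⟩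
  · rw [Finsupp.mem_support_iff] at hk ⊢
    rw [coeff_multiplier] at hk
    exact right_ne_zero_of_mul hk
  · simpa using (hp.hasDerivAt n).const_mul (m n)

lemma mean (hp : HasCoeffDeriv p p' t) :
    HasDerivAt (fun τ => TrigPoly.mean (p τ)) (TrigPoly.mean p') t := hp.hasDerivAt 0

end HasCoeffDeriv

end TrigPoly
end

section

namespace TrigPoly

open Finset

/-! ### Integrals and norms as mean values -/

/-- The trigonometric polynomials with real values. -/
def IsReal (p : TrigPoly) : Prop := ∀ n, p.coeff (-n) = conj (p.coeff n)

lemma IsReal.multiplier {p : TrigPoly} (hp : IsReal p) {m : ℤ → ℂ}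
    (hm : ∀ n, m (-n) = conj (m n)) : IsReal (multiplier m p) := by
  intro n; simp [hm, hp n]

lemma IsReal.smooth {p : TrigPoly} (hp : IsReal p) {φ : ℝ → ℝ} (hφ : ∀ x, φ x = φ |x|) (N : ℕ) :
    IsReal (smooth φ N p) := by
  refine hp.multiplier fun n => ?_
  rw [Complex.conj_ofReal, hφ, hφ ((n : ℝ) / N)]
  simp [abs_div]

lemma integral_exp_int (n : ℤ) :
    ∫ x in (0 : ℝ)..(2 * Real.pi), Complex.exp (Complex.I * n * x)
      = if n = 0 then 2 * Real.pi else 0 := by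
  split_ifs with h
  · simp [h]
  · have hc : Complex.I * n ≠ 0 := by simp [h]
    rw [integral_exp_mul_complex hc]
    have : Complex.exp (Complex.I * n * ((2 * Real.pi : ℝ) : ℂ)) = 1 := by
      rw [Complex.exp_eq_one_iff]
      exact ⟨n, by push_cast; ring⟩
    rw [this]; simp

lemma integral_eq_mean (lam : ℝ) (p : TrigPoly) :
    integral lam p = 2 * Real.pi * lam * (mean p).re := by
  have hcont : ∀ n : ℤ, Continuous fun x : ℝ => p.coeff n * Complex.exp (Complex.I * n * x) := by
    intro n; fun_prop
  have h1 : ∫ x in (0 : ℝ)..(2 * Real.pi), p.eval x = 2 * Real.pi * mean p := by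
    simp only [eval, Finsupp.sum]
    rw [intervalIntegral.integral_finsetSum
      fun n _ => (hcont n).intervalIntegrable _ _]
    simp only [intervalIntegral.integral_const_mul, integral_exp_int]
    rw [Finset.sum_eq_single 0 (fun n _ hn => by simp [hn])
      (fun h => by rw [Finsupp.notMem_support_iff.mp h, zero_mul]), mean_def]
    simp [mul_comm]
  have h2 : ∫ x in (0 : ℝ)..(2 * Real.pi), (p.eval x).re
      = (∫ x in (0 : ℝ)..(2 * Real.pi), p.eval x).re := by
    have hi : IntervalIntegrable p.eval volume 0 (2 * Real.pi) := by
      refine Continuous.intervalIntegrable ?_ _ _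
      unfold eval Finsupp.sum
      exact continuous_finsetSum _ fun n _ => hcont n
    rw [intervalIntegral.integral_of_le (by positivity),
      intervalIntegral.integral_of_le (by positivity)]
    exact integral_re hi.1
  rw [integral, h2, h1, show (2 * Real.pi : ℂ) = ((2 * Real.pi : ℝ) : ℂ) by push_cast; ring,
    Complex.re_ofReal_mul]
  ring

/-- For real `p` the conjugate of a coefficient is the coefficient at `-n`, so every factorization
`m(n) m'(-n)` of the weight expresses the norm as a bilinear mean value. In this form norms can be
differentiated in time and integrated by parts. -/
lemma normSq_eq_mean {p : TrigPoly} (hp : IsReal p) (lam s : ℝ) (m m' : ℤ → ℂ)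
    (h : ∀ n : ℤ, m n * m' (-n) = ((|(n : ℝ)| ^ (2 * s) : ℝ) : ℂ)) :
    normSq lam s p = 2 * Real.pi * lam * (mean (multiplier m p * multiplier m' p)).re := by
  rw [mean_mul (s := p.coeff.support), normSq, Finsupp.sum, Complex.re_sum, Finset.mul_sum,
    Finset.mul_sum]
  · refine Finset.sum_congr rfl fun n _ => ?_
    rw [coeff_multiplier, coeff_multiplier, hp n,
      show m n * p.coeff n * (m' (-n) * conj (p.coeff n))
        = m n * m' (-n) * (p.coeff n * conj (p.coeff n)) by ring, h, Complex.mul_conj,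
      ← Complex.ofReal_mul, Complex.ofReal_re, Complex.normSq_eq_norm_sq]
    ring
  · intro n hn
    rw [Finsupp.mem_support_iff] at hn ⊢
    rw [coeff_multiplier] at hn
    exact right_ne_zero_of_mul hn

lemma multiplier_one (p : TrigPoly) : multiplier (fun _ => 1) p = p := by ext n; simp

lemma normSq_zero_eq_mean {p : TrigPoly} (hp : IsReal p) (lam : ℝ) :
    normSq lam 0 p = 2 * Real.pi * lam * (mean (p * p)).re := by
  have := normSq_eq_mean hp lam 0 (fun _ => 1) (fun _ => 1) (by simp)
  rwa [multiplier_one] at this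

lemma normSq_one_eq_mean {p : TrigPoly} (hp : IsReal p) (lam : ℝ) :
    normSq lam 1 p = 2 * Real.pi * lam * (mean (dx p * dx p)).re := by
  refine normSq_eq_mean hp lam 1 _ _ fun n => ?_
  have h : |(n : ℝ)| ^ ((2 : ℝ) * 1) = (n : ℝ) ^ 2 := by
    rw [mul_one, ← Nat.cast_two, Real.rpow_natCast, sq_abs]
  rw [h]; push_cast
  linear_combination (-(n : ℂ) ^ 2) * Complex.I_mul_I

variable {κ : ℝ}

/-- The operator `κ H ∂ₓ` has symbol `|n|` in either sign convention. This is the origin of the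
factors `κ` in the half-integer energies. -/
lemma symbol_abs (hκ : κ = 1 ∨ κ = -1) (n : ℤ) :
    (κ : ℂ) * (hilbertSymbol κ (-n) * (Complex.I * ((-n : ℤ) : ℂ))) = ((|(n : ℝ)| : ℝ) : ℂ) := by
  have h2 : (κ : ℂ) * κ = 1 := by rcases hκ with rfl | rfl <;> norm_num
  have h3 : ((n.sign : ℤ) : ℂ) * n = ((|(n : ℝ)| : ℝ) : ℂ) := by
    rw [← Int.cast_mul, Int.sign_mul_self_eq_abs, ← Int.cast_abs, Complex.ofReal_intCast]
  rw [← h3, hilbertSymbol_neg, hilbertSymbol]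
  push_cast
  linear_combination (-(κ * κ * n.sign * n) : ℂ) * Complex.I_mul_I + (n.sign * n : ℂ) * h2

lemma normSq_half_eq_mean (hκ : κ = 1 ∨ κ = -1) {p : TrigPoly} (hp : IsReal p) (lam : ℝ) :
    normSq lam (1 / 2) p = 2 * Real.pi * lam * (κ * (mean (p * hilbert κ (dx p))).re) := by
  have := normSq_eq_mean hp lam (1 / 2) (fun _ => κ)
    (fun n => hilbertSymbol κ n * (Complex.I * n)) (by
      intro n
      rw [symbol_abs hκ, show (2 * (1 / 2) : ℝ) = 1 by norm_num, Real.rpow_one])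
  rw [this, ← multiplier_multiplier, show multiplier (fun _ => (κ : ℂ)) p = (κ : ℂ) • p by
    ext n; simp, smul_mul_assoc, map_smul, smul_eq_mul, Complex.re_ofReal_mul]
  rfl

lemma normSq_threeHalves_eq_mean (hκ : κ = 1 ∨ κ = -1) {p : TrigPoly} (hp : IsReal p) (lam : ℝ) :
    normSq lam (3 / 2) p
      = 2 * Real.pi * lam * (κ * (mean (dx p * hilbert κ (dx (dx p)))).re) := by
  have := normSq_eq_mean hp lam (3 / 2) (fun n => κ * (Complex.I * n))
    (fun n => hilbertSymbol κ n * ((Complex.I * n) * (Complex.I * n))) (by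
      intro n
      have h : |(n : ℝ)| ^ (2 * (3 / 2) : ℝ) = |(n : ℝ)| * (n : ℝ) ^ 2 := by
        rw [show (2 * (3 / 2) : ℝ) = ((3 : ℕ) : ℝ) by norm_num, Real.rpow_natCast, ← sq_abs]; ring
      rw [h]
      have hs := symbol_abs hκ n
      push_cast at hs ⊢
      rw [← hs]
      linear_combination
        (-(n : ℂ) ^ 2 * (κ * (hilbertSymbol κ (-n) * (Complex.I * (-n))))) * Complex.I_mul_I)
  rw [this, show multiplier (fun n => κ * (Complex.I * n)) p = (κ : ℂ) • dx p by
      ext n; simp; ring,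
    show multiplier (fun n => hilbertSymbol κ n * ((Complex.I * n) * (Complex.I * n))) p
      = hilbert κ (dx (dx p)) by ext n; simp; ring,
    smul_mul_assoc, map_smul, smul_eq_mul, Complex.re_ofReal_mul]

/-! ### The truncated flow on trigonometric polynomials -/

/-- The right hand side of the truncated equation. -/
def truncatedField (κ : ℝ) (φ : ℝ → ℝ) (N : ℕ) (u : TrigPoly) : TrigPoly :=
  -hilbert κ (dx (dx u)) - smooth φ N (smooth φ N u * dx (smooth φ N u))

/-- The part `(1 - S²)(v vₓ)` of the Burgers term that the truncation removes. -/
def removedPart (φ : ℝ → ℝ) (N : ℕ) (v : TrigPoly) : TrigPoly :=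
  v * dx v - smooth φ N (smooth φ N (v * dx v))

/-- The mean value of the time derivative of the modified `H¹` energy. -/
def defectOne (κ : ℝ) (v w : TrigPoly) : ℂ :=
  3 / 2 * (mean (w * (v * hilbert κ (dx v))) + mean (w * hilbert κ (v * dx v)))
    + 1 / 2 * mean (w * (v * v * v))

/-- The quartic part of the time derivative of the modified `H^{3/2}` energy. -/
def defectQuartic (κ : ℝ) (v w : TrigPoly) : ℂ :=
  3 / 2 * mean (w * (dx v * dx v)) + 1 / 2 * mean (w * (hilbert κ (dx v) * hilbert κ (dx v)))
    - 3 * mean (w * dx (v * dx v)) + mean (w * dx (hilbert κ (v * hilbert κ (dx v))))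

/-- The quintic and sextic parts of the time derivative of the modified `H^{3/2}` energy. -/
def defectHigher (κ : ℝ) (v w : TrigPoly) : ℂ :=
  (mean (w * (v * v * hilbert κ (dx v))) + mean (w * hilbert κ (v * v * dx v))
      + mean (w * (v * hilbert κ (v * dx v))))
    + 1 / 4 * mean (w * (v * v * (v * v)))

/-- The modified `H¹` energy. -/
def modifiedOne (κ lam : ℝ) (φ : ℝ → ℝ) (N : ℕ) (u : TrigPoly) : ℝ :=
  normSq lam 1 u - normSq lam 1 (smooth φ N u) + energyOne κ lam (smooth φ N u)

/-- The modified `H^{3/2}` energy. -/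
def modifiedThreeHalves (κ lam : ℝ) (φ : ℝ → ℝ) (N : ℕ) (u : TrigPoly) : ℝ :=
  normSq lam (3 / 2) u - normSq lam (3 / 2) (smooth φ N u) + energyThreeHalves κ lam (smooth φ N u)

/-- The Hamiltonian of the truncated equation. -/
def hamiltonian (κ lam : ℝ) (φ : ℝ → ℝ) (N : ℕ) (u : TrigPoly) : ℝ :=
  normSq lam (1 / 2) u + κ / 3 * integral lam (smooth φ N u ^ 3)

lemma two_mul_mean (p : TrigPoly) : 2 * mean p = mean (p + p) := by rw [map_add]; ring
lemma three_mul_mean (p : TrigPoly) : 3 * mean p = mean (p + p + p) := by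
  simp only [map_add]; ring
lemma four_mul_mean (p : TrigPoly) : 4 * mean p = mean (p + p + p + p) := by
  simp only [map_add]; ring
lemma five_mul_mean (p : TrigPoly) : 5 * mean p = mean (p + p + p + p + p) := by
  simp only [map_add]; ring

namespace HasCoeffDeriv

variable {u : ℝ → TrigPoly} {u' : TrigPoly} {t : ℝ} {φ : ℝ → ℝ} {N : ℕ}

lemma dx (hp : HasCoeffDeriv u u' t) :
    HasCoeffDeriv (fun τ => TrigPoly.dx (u τ)) (TrigPoly.dx u') t := hp.multiplier _

lemma hilbert (hp : HasCoeffDeriv u u' t) :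
    HasCoeffDeriv (fun τ => TrigPoly.hilbert κ (u τ)) (TrigPoly.hilbert κ u') t := hp.multiplier _

lemma smooth (hp : HasCoeffDeriv u u' t) :
    HasCoeffDeriv (fun τ => TrigPoly.smooth φ N (u τ)) (TrigPoly.smooth φ N u') t := hp.multiplier _

lemma _root_.HasDerivAt.complex_re {f : ℝ → ℂ} {f' : ℂ} {t : ℝ} (h : HasDerivAt f f' t) :
    HasDerivAt (fun τ => (f τ).re) f'.re t :=
  (Complex.reCLM.hasFDerivAt.comp_hasDerivAt t h)

variable {lam : ℝ}

lemma hasDerivAt_mass (hu : HasCoeffDeriv u (truncatedField κ φ N (u t)) t)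
    (hφ : ∀ x, φ x = φ |x|) (hr : ∀ τ, IsReal (u τ)) :
    HasDerivAt (fun τ => normSq lam 0 (u τ)) 0 t := by
  simp only [normSq_zero_eq_mean (hr _)]
  have h := ((hu.mul hu).mean.complex_re.const_mul (2 * Real.pi * lam))
  refine h.congr_deriv ?_
  have hz : TrigPoly.mean (u t * truncatedField κ φ N (u t)) = 0 := by
    rw [truncatedField, mul_sub, mul_neg, map_sub, map_neg, mean_mul_smooth hφ]
    set v := TrigPoly.smooth φ N (u t)
    have h1 : TrigPoly.mean (u t * TrigPoly.hilbert κ (TrigPoly.dx (TrigPoly.dx (u t)))) = 0 := by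
      rw [hilbert_dx, mean_mul_dx, mean_mul_hilbert_self, neg_zero]
    have h2 : TrigPoly.mean (v * (v * TrigPoly.dx v)) = 0 := by
      have := mean_dx (v * v * v)
      rw [dx_mul, dx_mul, mean_congr (show (TrigPoly.dx v * v + v * TrigPoly.dx v) * v
        + v * v * TrigPoly.dx v = v * (v * TrigPoly.dx v) + v * (v * TrigPoly.dx v)
          + v * (v * TrigPoly.dx v) by ring), map_add, map_add] at this
      linear_combination (1 / 3 : ℂ) * this
    rw [h1, h2]; ring
  rw [map_add, mul_comm (truncatedField κ φ N (u t)), hz]; simp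

lemma hasDerivAt_hamiltonian (hκ : κ = 1 ∨ κ = -1)
    (hu : HasCoeffDeriv u (truncatedField κ φ N (u t)) t)
    (hφ : ∀ x, φ x = φ |x|) (hr : ∀ τ, IsReal (u τ)) :
    HasDerivAt (fun τ => hamiltonian κ lam φ N (u τ)) 0 t := by
  simp only [hamiltonian, normSq_half_eq_mean hκ (hr _), integral_eq_mean, pow_succ, pow_zero,
    one_mul]
  have hS : HasCoeffDeriv (fun τ => TrigPoly.smooth φ N (u τ)) _ t := hu.smooth
  have h := (((hu.mul (hu.dx.hilbert (κ := κ))).mean.complex_re.const_mul κ).const_mul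
    (2 * Real.pi * lam)).add
    ((((hS.mul hS).mul hS).mean.complex_re.const_mul (2 * Real.pi * lam)).const_mul (κ / 3))
  refine h.congr_deriv ?_
  have hc := conservation_hamiltonian (κ := κ) hφ N (u t) _ rfl
  rw [← truncatedField] at hc
  set w := truncatedField κ φ N (u t)
  set v := TrigPoly.smooth φ N (u t)
  have e1 : TrigPoly.mean (w * TrigPoly.hilbert κ (TrigPoly.dx (u t))
      + u t * TrigPoly.hilbert κ (TrigPoly.dx w))
      = 2 * TrigPoly.mean (w * TrigPoly.hilbert κ (TrigPoly.dx (u t))) := by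
    rw [map_add, mean_mul_hilbert_dx κ (u t) w]; ring
  have e2 : TrigPoly.mean ((TrigPoly.smooth φ N w * v + v * TrigPoly.smooth φ N w) * v
      + v * v * TrigPoly.smooth φ N w) = 3 * TrigPoly.mean (v * v * TrigPoly.smooth φ N w) := by
    rw [three_mul_mean]
    exact mean_congr (by ring)
  rw [e1, e2]
  have hre := congrArg Complex.re hc
  simp only [Complex.add_re, Complex.mul_re, Complex.re_ofNat, Complex.im_ofNat, zero_mul, sub_zero,
    Complex.zero_re] at hre ⊢
  linear_combination (2 * Real.pi * lam * κ) * hre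

/-- `S` commutes with the linear part, hence `v = S u` satisfies the exact Benjamin-Ono equation
perturbed by `(1 - S²)(v vₓ)`. -/
lemma smooth_truncatedField (u : TrigPoly) :
    TrigPoly.smooth φ N (truncatedField κ φ N u)
      = (-TrigPoly.hilbert κ (TrigPoly.dx (TrigPoly.dx (TrigPoly.smooth φ N u)))
          - TrigPoly.smooth φ N u * TrigPoly.dx (TrigPoly.smooth φ N u))
        + removedPart φ N (TrigPoly.smooth φ N u) := by
  rw [truncatedField, removedPart, smooth_sub, smooth_neg, smooth_hilbert, smooth_dx, smooth_dx]
  ring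

/-- In the modified energy the quadratic part is that of `u`, not of `v`: moving `S` across the
pairing shows that it changes exactly as the exact conservation law for `v` requires. The forcing
`w` therefore enters only through the differential of the cubic and quartic terms. -/
lemma hasDerivAt_modifiedOne (hκ : κ = 1 ∨ κ = -1)
    (hu : HasCoeffDeriv u (truncatedField κ φ N (u t)) t)
    (hφ : ∀ x, φ x = φ |x|) (hr : ∀ τ, IsReal (u τ)) :
    HasDerivAt (fun τ => modifiedOne κ lam φ N (u τ))
      (2 * Real.pi * lam * (defectOne κ (TrigPoly.smooth φ N (u t))
        (removedPart φ N (TrigPoly.smooth φ N (u t)))).re) t := by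
  have e0 : ∀ τ, modifiedOne κ lam φ N (u τ) = 2 * Real.pi * lam *
      (TrigPoly.mean (TrigPoly.dx (u τ) * TrigPoly.dx (u τ))
        + (3 / 4 : ℝ) * TrigPoly.mean (TrigPoly.smooth φ N (u τ) * TrigPoly.smooth φ N (u τ)
            * TrigPoly.hilbert κ (TrigPoly.dx (TrigPoly.smooth φ N (u τ))))
        + (1 / 8 : ℝ) * TrigPoly.mean (TrigPoly.smooth φ N (u τ) * TrigPoly.smooth φ N (u τ)
            * TrigPoly.smooth φ N (u τ) * TrigPoly.smooth φ N (u τ))).re := by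
    intro τ
    rw [modifiedOne, energyOne, normSq_one_eq_mean (hr τ), integral_eq_mean, integral_eq_mean,
      Complex.add_re, Complex.add_re, Complex.re_ofReal_mul, Complex.re_ofReal_mul]
    simp only [pow_succ, pow_zero, one_mul]
    ring
  simp only [e0]
  have hS : HasCoeffDeriv (fun τ => TrigPoly.smooth φ N (u τ)) _ t := hu.smooth
  have h := ((((hu.dx.mul hu.dx).mean.add
    (((hS.mul hS).mul (hS.dx.hilbert (κ := κ))).mean.const_mul ((3 / 4 : ℝ) : ℂ))).add
    ((((hS.mul hS).mul hS).mul hS).mean.const_mul ((1 / 8 : ℝ) : ℂ))).complex_re).const_mul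
      (2 * Real.pi * lam)
  refine h.congr_deriv ?_
  congr 2
  rw [smooth_truncatedField]
  set v := TrigPoly.smooth φ N (u t) with hv
  set w := removedPart φ N v
  set t₀ := -TrigPoly.hilbert κ (TrigPoly.dx (TrigPoly.dx v)) - v * TrigPoly.dx v with ht₀
  have hcons := conservation_energyOne hκ v
  rw [← ht₀] at hcons
  have hd := differential_energyOne κ v (t₀ + w)
  -- The dispersive part drops out by antisymmetry, and the outer `S` of the nonlinearity falls on
  -- `u`, producing `v`.
  have e1 : TrigPoly.mean (TrigPoly.dx (u t) * TrigPoly.dx (truncatedField κ φ N (u t)))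
      = - TrigPoly.mean (TrigPoly.dx v * TrigPoly.dx (v * TrigPoly.dx v)) := by
    rw [truncatedField, dx_sub, dx_neg, mul_sub, mul_neg, map_sub, map_neg, ← smooth_dx,
      mean_mul_smooth hφ, smooth_dx, ← hv, ← hilbert_dx, mean_mul_hilbert_dx,
      mean_mul_hilbert_self]
    ring
  have e2 : TrigPoly.mean (TrigPoly.dx (truncatedField κ φ N (u t)) * TrigPoly.dx (u t)
      + TrigPoly.dx (u t) * TrigPoly.dx (truncatedField κ φ N (u t)))
      = -2 * TrigPoly.mean (TrigPoly.dx v * TrigPoly.dx (v * TrigPoly.dx v)) := by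
    rw [map_add, mul_comm (TrigPoly.dx (truncatedField κ φ N (u t))), e1]; ring
  have e3 : TrigPoly.mean (((t₀ + w) * v + v * (t₀ + w)) * TrigPoly.hilbert κ (TrigPoly.dx v)
      + v * v * TrigPoly.hilbert κ (TrigPoly.dx (t₀ + w)))
      = 2 * TrigPoly.mean (v * (t₀ + w) * TrigPoly.hilbert κ (TrigPoly.dx v))
        + TrigPoly.mean (v * v * TrigPoly.hilbert κ (TrigPoly.dx (t₀ + w))) := by
    rw [two_mul_mean, ← map_add]; exact mean_congr (by ring)
  have e4 : TrigPoly.mean ((((t₀ + w) * v + v * (t₀ + w)) * v + v * v * (t₀ + w)) * v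
      + v * v * v * (t₀ + w)) = 4 * TrigPoly.mean (v * v * v * (t₀ + w)) := by
    rw [four_mul_mean]
    exact mean_congr (by ring)
  rw [e2, e3, e4, defectOne]
  simp only [add_mul t₀ w, map_add] at hd
  push_cast
  linear_combination hcons + hd

/-- The mechanism is the same as for the `H¹` energy. As `w` is quadratic in `v`, the cubic term of
the energy produces the quartic defect, and the quartic and quintic terms produce `defectHigher`. -/
lemma hasDerivAt_modifiedThreeHalves (hκ : κ = 1 ∨ κ = -1)
    (hu : HasCoeffDeriv u (truncatedField κ φ N (u t)) t)
    (hφ : ∀ x, φ x = φ |x|) (hr : ∀ τ, IsReal (u τ)) :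
    HasDerivAt (fun τ => modifiedThreeHalves κ lam φ N (u τ))
      (2 * Real.pi * lam * (κ * (defectQuartic κ (TrigPoly.smooth φ N (u t))
          (removedPart φ N (TrigPoly.smooth φ N (u t)))
        + defectHigher κ (TrigPoly.smooth φ N (u t))
          (removedPart φ N (TrigPoly.smooth φ N (u t)))).re)) t := by
  have e0 : ∀ τ, modifiedThreeHalves κ lam φ N (u τ) = 2 * Real.pi * lam * (κ *
      (TrigPoly.mean (TrigPoly.dx (u τ) * TrigPoly.hilbert κ (TrigPoly.dx (TrigPoly.dx (u τ))))
        + (3 / 2 : ℝ) * TrigPoly.mean (TrigPoly.smooth φ N (u τ)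
            * (TrigPoly.dx (TrigPoly.smooth φ N (u τ)) * TrigPoly.dx (TrigPoly.smooth φ N (u τ))))
        + (1 / 2 : ℝ) * TrigPoly.mean (TrigPoly.smooth φ N (u τ)
            * (TrigPoly.hilbert κ (TrigPoly.dx (TrigPoly.smooth φ N (u τ)))
              * TrigPoly.hilbert κ (TrigPoly.dx (TrigPoly.smooth φ N (u τ)))))
        + (1 / 3 : ℝ) * TrigPoly.mean (TrigPoly.smooth φ N (u τ) * TrigPoly.smooth φ N (u τ)
            * TrigPoly.smooth φ N (u τ)
            * TrigPoly.hilbert κ (TrigPoly.dx (TrigPoly.smooth φ N (u τ))))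
        + (1 / 4 : ℝ) * TrigPoly.mean (TrigPoly.smooth φ N (u τ) * TrigPoly.smooth φ N (u τ)
            * TrigPoly.hilbert κ (TrigPoly.smooth φ N (u τ)
              * TrigPoly.dx (TrigPoly.smooth φ N (u τ))))
        + (1 / 20 : ℝ) * TrigPoly.mean (TrigPoly.smooth φ N (u τ) * TrigPoly.smooth φ N (u τ)
            * TrigPoly.smooth φ N (u τ) * TrigPoly.smooth φ N (u τ)
            * TrigPoly.smooth φ N (u τ))).re) := by
    intro τ
    rw [modifiedThreeHalves, energyThreeHalves, normSq_threeHalves_eq_mean hκ (hr τ)]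
    simp only [integral_eq_mean, Complex.add_re, Complex.re_ofReal_mul, pow_succ, pow_zero, one_mul]
    ring
  simp only [e0]
  have hS : HasCoeffDeriv (fun τ => TrigPoly.smooth φ N (u τ)) _ t := hu.smooth
  have hH := hS.dx.hilbert (κ := κ)
  have h := (((((((hu.dx.mul (hu.dx.dx.hilbert (κ := κ))).mean.add
    ((hS.mul (hS.dx.mul hS.dx)).mean.const_mul ((3 / 2 : ℝ) : ℂ))).add
    ((hS.mul (hH.mul hH)).mean.const_mul ((1 / 2 : ℝ) : ℂ))).add
    ((((hS.mul hS).mul hS).mul hH).mean.const_mul ((1 / 3 : ℝ) : ℂ))).add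
    (((hS.mul hS).mul ((hS.mul hS.dx).hilbert (κ := κ))).mean.const_mul ((1 / 4 : ℝ) : ℂ))).add
    (((((hS.mul hS).mul hS).mul hS).mul hS).mean.const_mul
      ((1 / 20 : ℝ) : ℂ))).complex_re.const_mul κ).const_mul (2 * Real.pi * lam)
  refine h.congr_deriv ?_
  congr 3
  rw [smooth_truncatedField]
  set v := TrigPoly.smooth φ N (u t) with hv
  set w := removedPart φ N v
  set t₀ := -TrigPoly.hilbert κ (TrigPoly.dx (TrigPoly.dx v)) - v * TrigPoly.dx v with ht₀
  have hcons := conservation_energyThreeHalves hκ v t₀ ht₀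
  have hd3 := differential_cubic κ v (t₀ + w)
  have hd4 := differential_quartic κ v (t₀ + w)
  set F := truncatedField κ φ N (u t) with hF
  have e1 : TrigPoly.mean (TrigPoly.dx F * TrigPoly.hilbert κ (TrigPoly.dx (TrigPoly.dx (u t))))
      = - TrigPoly.mean (TrigPoly.hilbert κ (TrigPoly.dx (TrigPoly.dx v))
          * TrigPoly.dx (v * TrigPoly.dx v)) := by
    have h1 : TrigPoly.mean (TrigPoly.dx (TrigPoly.hilbert κ (TrigPoly.dx (TrigPoly.dx (u t))))
        * TrigPoly.hilbert κ (TrigPoly.dx (TrigPoly.dx (u t)))) = 0 := by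
      rw [mul_comm]; exact mean_mul_dx_self _
    rw [hF, truncatedField, dx_sub, dx_neg, sub_mul, neg_mul, map_sub, map_neg, h1, ← smooth_dx,
      ← mean_mul_smooth hφ, smooth_hilbert, smooth_dx, smooth_dx, ← hv, mul_comm]
    ring
  have e2 : TrigPoly.mean (TrigPoly.dx F * TrigPoly.hilbert κ (TrigPoly.dx (TrigPoly.dx (u t)))
      + TrigPoly.dx (u t) * TrigPoly.hilbert κ (TrigPoly.dx (TrigPoly.dx F)))
      = -2 * TrigPoly.mean (TrigPoly.hilbert κ (TrigPoly.dx (TrigPoly.dx v))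
          * TrigPoly.dx (v * TrigPoly.dx v)) := by
    rw [map_add, mean_mul_hilbert_dx κ (TrigPoly.dx (u t)), e1]; ring
  set r := t₀ + w with hr'
  have e3 : TrigPoly.mean (r * (TrigPoly.dx v * TrigPoly.dx v)
      + v * (TrigPoly.dx r * TrigPoly.dx v + TrigPoly.dx v * TrigPoly.dx r))
      = TrigPoly.mean (r * (TrigPoly.dx v * TrigPoly.dx v))
        + 2 * TrigPoly.mean (v * TrigPoly.dx v * TrigPoly.dx r) := by
    rw [two_mul_mean, ← map_add]; exact mean_congr (by ring)
  have e4 : TrigPoly.mean (r * (TrigPoly.hilbert κ (TrigPoly.dx v)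
        * TrigPoly.hilbert κ (TrigPoly.dx v))
      + v * (TrigPoly.hilbert κ (TrigPoly.dx r) * TrigPoly.hilbert κ (TrigPoly.dx v)
        + TrigPoly.hilbert κ (TrigPoly.dx v) * TrigPoly.hilbert κ (TrigPoly.dx r)))
      = TrigPoly.mean (r * (TrigPoly.hilbert κ (TrigPoly.dx v) * TrigPoly.hilbert κ (TrigPoly.dx v)))
        + 2 * TrigPoly.mean (v * TrigPoly.hilbert κ (TrigPoly.dx v)
            * TrigPoly.hilbert κ (TrigPoly.dx r)) := by
    rw [two_mul_mean, ← map_add]; exact mean_congr (by ring)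
  have e5 : TrigPoly.mean (((r * v + v * r) * v + v * v * r) * TrigPoly.hilbert κ (TrigPoly.dx v)
      + v * v * v * TrigPoly.hilbert κ (TrigPoly.dx r))
      = 3 * TrigPoly.mean (v * v * r * TrigPoly.hilbert κ (TrigPoly.dx v))
        + TrigPoly.mean (v * v * v * TrigPoly.hilbert κ (TrigPoly.dx r)) := by
    rw [three_mul_mean, ← map_add]
    exact mean_congr (by ring)
  have e6 : TrigPoly.mean ((r * v + v * r) * TrigPoly.hilbert κ (v * TrigPoly.dx v)
      + v * v * TrigPoly.hilbert κ (r * TrigPoly.dx v + v * TrigPoly.dx r))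
      = 2 * TrigPoly.mean (v * r * TrigPoly.hilbert κ (v * TrigPoly.dx v))
        + TrigPoly.mean (v * v * TrigPoly.hilbert κ (r * TrigPoly.dx v + v * TrigPoly.dx r)) := by
    rw [two_mul_mean, ← map_add]; exact mean_congr (by ring)
  have e7 : TrigPoly.mean ((((r * v + v * r) * v + v * v * r) * v + v * v * v * r) * v
      + v * v * v * v * r) = 5 * TrigPoly.mean (r * (v * v * (v * v))) := by
    rw [five_mul_mean]
    exact mean_congr (by ring)
  rw [e2, e3, e4, e5, e6, e7, defectQuartic, defectHigher]
  have hs6 : TrigPoly.mean (r * (v * v * (v * v))) = TrigPoly.mean (t₀ * (v * v * (v * v)))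
      + TrigPoly.mean (w * (v * v * (v * v))) := by rw [hr', add_mul, map_add]
  rw [hs6]
  have hd3' := hd3
  have hd4' := hd4
  conv at hd3' => rhs; simp only [hr', add_mul t₀ w, map_add]
  conv at hd4' => rhs; simp only [hr', add_mul t₀ w, map_add]
  push_cast
  linear_combination hcons + hd3' + hd4'

end HasCoeffDeriv

end TrigPoly
end

section

namespace TrigPoly

open Finset

/-! ### Sobolev and Wiener norms -/

/-- The homogeneous Sobolev norm. -/
def sob (s : ℝ) (p : TrigPoly) : ℝ :=
  √(∑ n ∈ p.coeff.support, (|(n : ℝ)| ^ s * ‖p.coeff n‖) ^ 2)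

/-- The weighted Wiener norm. -/
def wie (s : ℝ) (p : TrigPoly) : ℝ := ∑ n ∈ p.coeff.support, |(n : ℝ)| ^ s * ‖p.coeff n‖

lemma sob_nonneg (s : ℝ) (p : TrigPoly) : 0 ≤ sob s p := Real.sqrt_nonneg _

lemma wie_nonneg (s : ℝ) (p : TrigPoly) : 0 ≤ wie s p := by unfold wie; positivity

lemma sq_sob (s : ℝ) {p : TrigPoly} {S : Finset ℤ} (h : p.coeff.support ⊆ S) :
    sob s p ^ 2 = ∑ n ∈ S, (|(n : ℝ)| ^ s * ‖p.coeff n‖) ^ 2 := by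
  rw [sob, Real.sq_sqrt (by positivity)]
  refine Finset.sum_subset h fun n _ hn => ?_
  simp [Finsupp.notMem_support_iff.mp hn]

lemma wie_eq_sum (s : ℝ) {p : TrigPoly} {S : Finset ℤ} (h : p.coeff.support ⊆ S) :
    wie s p = ∑ n ∈ S, |(n : ℝ)| ^ s * ‖p.coeff n‖ := by
  refine Finset.sum_subset h fun n _ hn => ?_
  simp [Finsupp.notMem_support_iff.mp hn]

lemma sob_eq_sqrt (s : ℝ) {p : TrigPoly} {S : Finset ℤ} (h : p.coeff.support ⊆ S) :
    sob s p = √(∑ n ∈ S, (|(n : ℝ)| ^ s * ‖p.coeff n‖) ^ 2) := by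
  rw [← sq_sob s h, Real.sqrt_sq (sob_nonneg _ _)]

lemma abs_rpow_two_mul (n : ℤ) (s : ℝ) : |(n : ℝ)| ^ (2 * s) = (|(n : ℝ)| ^ s) ^ 2 := by
  rw [mul_comm, Real.rpow_mul (abs_nonneg _), Real.rpow_two]

lemma normSq_eq_sob (lam s : ℝ) (p : TrigPoly) :
    normSq lam s p = 2 * Real.pi * lam * sob s p ^ 2 := by
  rw [normSq, sq_sob s subset_rfl, Finsupp.sum]
  simp only [mul_pow, abs_rpow_two_mul]
  ring

lemma sob_le_of_coeff {s t : ℝ} {p q : TrigPoly}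
    (h : ∀ n : ℤ, |(n : ℝ)| ^ s * ‖p.coeff n‖ ≤ |(n : ℝ)| ^ t * ‖q.coeff n‖) :
    sob s p ≤ sob t q := by
  classical
  rw [sob_eq_sqrt s (S := p.coeff.support ∪ q.coeff.support) subset_union_left,
    sob_eq_sqrt t (S := p.coeff.support ∪ q.coeff.support) subset_union_right]
  exact Real.sqrt_le_sqrt (Finset.sum_le_sum fun n _ =>
    pow_le_pow_left₀ (by positivity) (h n) 2)

lemma wie_le_of_coeff {s t : ℝ} {p q : TrigPoly}
    (h : ∀ n : ℤ, |(n : ℝ)| ^ s * ‖p.coeff n‖ ≤ |(n : ℝ)| ^ t * ‖q.coeff n‖) :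
    wie s p ≤ wie t q := by
  classical
  rw [wie_eq_sum s (S := p.coeff.support ∪ q.coeff.support) subset_union_left,
    wie_eq_sum t (S := p.coeff.support ∪ q.coeff.support) subset_union_right]
  exact Finset.sum_le_sum fun n _ => h n

lemma support_add_subset (p q : TrigPoly) :
    (p + q).coeff.support ⊆ p.coeff.support ∪ q.coeff.support := by
  intro n hn
  rw [Finset.mem_union, Finsupp.mem_support_iff, Finsupp.mem_support_iff]
  rw [Finsupp.mem_support_iff] at hn
  by_contra! h
  exact hn (by simp [h.1, h.2])

lemma sob_add_le (s : ℝ) (p q : TrigPoly) : sob s (p + q) ≤ sob s p + sob s q := by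
  set S := p.coeff.support ∪ q.coeff.support with hS
  let w : TrigPoly → EuclideanSpace ℂ S := fun r =>
    WithLp.toLp 2 fun n => ((|((n : ℤ) : ℝ)| ^ s : ℝ) : ℂ) * r.coeff n
  have key : ∀ r : TrigPoly, r.coeff.support ⊆ S → sob s r = ‖w r‖ := by
    intro r hr
    rw [sob_eq_sqrt s hr, EuclideanSpace.norm_eq, ← Finset.sum_coe_sort]
    congr 1
    refine Finset.sum_congr rfl fun n _ => ?_
    have h : (0 : ℝ) ≤ |((n : ℤ) : ℝ)| ^ s := by positivity
    simp [w, abs_of_nonneg h]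
  rw [key _ (support_add_subset p q), key p subset_union_left, key q subset_union_right]
  have : w (p + q) = w p + w q := by
    ext n; simp [w, mul_add]
  rw [this]; exact norm_add_le _ _

@[simp] lemma sob_zero (s : ℝ) : sob s 0 = 0 := by simp [sob]

lemma wie_add_le (s : ℝ) (p q : TrigPoly) : wie s (p + q) ≤ wie s p + wie s q := by
  rw [wie_eq_sum s (S := p.coeff.support ∪ q.coeff.support) (support_add_subset p q),
    wie_eq_sum s (S := p.coeff.support ∪ q.coeff.support) (p := p) subset_union_left,
    wie_eq_sum s (S := p.coeff.support ∪ q.coeff.support) (p := q) subset_union_right,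
    ← Finset.sum_add_distrib]
  refine Finset.sum_le_sum fun n _ => ?_
  rw [← mul_add, AddMonoidAlgebra.coeff_add, Finsupp.add_apply]
  gcongr
  exact norm_add_le _ _

lemma sob_sum_le {ι : Type*} (s : ℝ) (T : Finset ι) (p : ι → TrigPoly) :
    sob s (∑ i ∈ T, p i) ≤ ∑ i ∈ T, sob s (p i) :=
  Finset.le_sum_of_subadditive (sob s) (sob_zero s).le (sob_add_le s) T p

lemma sob_neg (s : ℝ) (p : TrigPoly) : sob s (-p) = sob s p := by
  apply le_antisymm <;> exact sob_le_of_coeff fun n => by simp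

lemma sob_sub_le (s : ℝ) (p q : TrigPoly) : sob s (p - q) ≤ sob s p + sob s q := by
  rw [sub_eq_add_neg, ← sob_neg s q]; exact sob_add_le _ _ _

lemma coeff_single_mul (k : ℤ) (a : ℂ) (q : TrigPoly) (n : ℤ) :
    (AddMonoidAlgebra.single k a * q : TrigPoly).coeff n = a * q.coeff (n - k) := by
  rw [AddMonoidAlgebra.coeff_single_mul_eq_mul_coeff (m₂ := n - k)]
  intro m' _; constructor <;> intro h <;> omega

lemma sob_single_mul (k : ℤ) (a : ℂ) (q : TrigPoly) :
    sob 0 (AddMonoidAlgebra.single k a * q) ≤ ‖a‖ * sob 0 q := by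
  classical
  refine abs_le_of_sq_le_sq' ?_ (mul_nonneg (norm_nonneg _) (sob_nonneg _ _)) |>.2
  have hs : (AddMonoidAlgebra.single k a * q : TrigPoly).coeff.support
      ⊆ q.coeff.support.image (fun n => n + k) := by
    intro n hn
    rw [Finsupp.mem_support_iff, coeff_single_mul] at hn
    refine Finset.mem_image.mpr ⟨n - k, ?_, by ring⟩
    exact Finsupp.mem_support_iff.mpr (right_ne_zero_of_mul hn)
  rw [sq_sob 0 hs, mul_pow, sq_sob 0 subset_rfl, Finset.sum_image (by intro a _ b _ h; simpa using h),
    Finset.mul_sum]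
  refine Finset.sum_le_sum fun n _ => ?_
  rw [coeff_single_mul]
  simp [mul_pow]

/-- Young's inequality. -/
lemma sob_mul_le (p q : TrigPoly) : sob 0 (p * q) ≤ wie 0 p * sob 0 q := by
  conv_lhs => rw [← sum_single_eq (p := p) subset_rfl, Finset.sum_mul]
  refine (sob_sum_le _ _ _).trans ?_
  rw [wie, Finset.sum_mul]
  refine Finset.sum_le_sum fun n _ => (sob_single_mul _ _ _).trans ?_
  simp

lemma sob_mul_le' (p q : TrigPoly) : sob 0 (p * q) ≤ sob 0 p * wie 0 q := by
  rw [mul_comm p, mul_comm (sob 0 p)]; exact sob_mul_le q p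

lemma wie_single_mul (k : ℤ) (a : ℂ) (q : TrigPoly) :
    wie 0 (AddMonoidAlgebra.single k a * q) ≤ ‖a‖ * wie 0 q := by
  classical
  have hs : (AddMonoidAlgebra.single k a * q : TrigPoly).coeff.support
      ⊆ q.coeff.support.image (fun n => n + k) := by
    intro n hn
    rw [Finsupp.mem_support_iff, coeff_single_mul] at hn
    refine Finset.mem_image.mpr ⟨n - k, ?_, by ring⟩
    exact Finsupp.mem_support_iff.mpr (right_ne_zero_of_mul hn)
  rw [wie_eq_sum 0 hs, wie, Finset.sum_image (by intro a _ b _ h; simpa using h), Finset.mul_sum]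
  refine Finset.sum_le_sum fun n _ => ?_
  rw [coeff_single_mul]
  simp

lemma wie_mul_le (p q : TrigPoly) : wie 0 (p * q) ≤ wie 0 p * wie 0 q := by
  conv_lhs => rw [← sum_single_eq (p := p) subset_rfl, Finset.sum_mul]
  refine (Finset.le_sum_of_subadditive (wie 0) (by simp [wie]) (wie_add_le 0) _ _).trans ?_
  rw [wie, Finset.sum_mul]
  refine Finset.sum_le_sum fun n _ => (wie_single_mul _ _ _).trans ?_
  simp

/-- The trigonometric polynomial with coefficients `|n|^s |aₙ|`. -/
def majorant (s : ℝ) (p : TrigPoly) : TrigPoly :=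
  ∑ n ∈ p.coeff.support, AddMonoidAlgebra.single n (((|(n : ℝ)| ^ s * ‖p.coeff n‖ : ℝ)) : ℂ)

@[simp] lemma coeff_majorant (s : ℝ) (p : TrigPoly) (n : ℤ) :
    (majorant s p).coeff n = ((|(n : ℝ)| ^ s * ‖p.coeff n‖ : ℝ) : ℂ) := by
  rw [majorant, AddMonoidAlgebra.coeff_sum, Finsupp.finsetSum_apply]
  simp only [AddMonoidAlgebra.coeff_single, Finsupp.single_apply, Finset.sum_ite_eq']
  split_ifs with h
  · rfl
  · simp [Finsupp.notMem_support_iff.mp h]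

lemma norm_coeff_majorant (s : ℝ) (p : TrigPoly) (n : ℤ) :
    ‖(majorant s p).coeff n‖ = |(n : ℝ)| ^ s * ‖p.coeff n‖ := by
  have h : (0 : ℝ) ≤ |(n : ℝ)| ^ s * ‖p.coeff n‖ := by positivity
  rw [coeff_majorant, Complex.norm_real, Real.norm_of_nonneg h]

lemma sob_majorant (s : ℝ) (p : TrigPoly) : sob 0 (majorant s p) = sob s p := by
  apply le_antisymm <;> exact sob_le_of_coeff fun n => by
      rw [norm_coeff_majorant, Real.rpow_zero, one_mul]

lemma wie_majorant (s : ℝ) (p : TrigPoly) : wie 0 (majorant s p) = wie s p := by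
  apply le_antisymm <;> exact wie_le_of_coeff fun n => by
      rw [norm_coeff_majorant, Real.rpow_zero, one_mul]

lemma abs_add_rpow_le {s : ℝ} (hs : 0 < s) (hs1 : s ≤ 1) (a b : ℝ) :
    |a + b| ^ s ≤ |a| ^ s + |b| ^ s :=
  (Real.rpow_le_rpow (abs_nonneg _) (abs_add_le a b) hs.le).trans
    (Real.rpow_add_le_add_rpow (abs_nonneg _) (abs_nonneg _) hs.le hs1)

/-- For `0 < s ≤ 1` one has `|n|^s ≤ |k|^s + |n - k|^s`. The majorants have nonnegative
coefficients, so their convolutions involve no cancellation and the bound survives summation. -/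
lemma leibniz_coeff {s : ℝ} (hs : 0 < s) (hs1 : s ≤ 1) (p q : TrigPoly) (n : ℤ) :
    |(n : ℝ)| ^ s * ‖(p * q).coeff n‖
      ≤ ‖(majorant s p * majorant 0 q + majorant 0 p * majorant s q).coeff n‖ := by
  have hsup : ∀ t, (majorant t p).coeff.support ⊆ p.coeff.support := by
    intro t k hk
    rw [Finsupp.mem_support_iff] at hk ⊢
    intro h0
    exact hk (by simp [h0])
  rw [AddMonoidAlgebra.coeff_add, Finsupp.add_apply, coeff_mul_eq_sum (hsup s),
    coeff_mul_eq_sum (hsup 0), coeff_mul_eq_finsum, ← Finset.sum_add_distrib]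
  have e : ∑ k ∈ p.coeff.support, ((majorant s p).coeff k * (majorant 0 q).coeff (n - k)
      + (majorant 0 p).coeff k * (majorant s q).coeff (n - k))
      = ((∑ k ∈ p.coeff.support, (|(k : ℝ)| ^ s + |((n - k : ℤ) : ℝ)| ^ s) *
          (‖p.coeff k‖ * ‖q.coeff (n - k)‖) : ℝ) : ℂ) := by
    rw [Complex.ofReal_sum]
    refine Finset.sum_congr rfl fun k _ => ?_
    simp only [coeff_majorant, ← Complex.ofReal_mul, ← Complex.ofReal_add, Real.rpow_zero]
    congr 1; ring
  have hpos : 0 ≤ ∑ k ∈ p.coeff.support, (|(k : ℝ)| ^ s + |((n - k : ℤ) : ℝ)| ^ s) *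
          (‖p.coeff k‖ * ‖q.coeff (n - k)‖) := by positivity
  rw [e, Complex.norm_real, Real.norm_of_nonneg hpos]
  calc |(n : ℝ)| ^ s * ‖∑ k ∈ p.coeff.support, p.coeff k * q.coeff (n - k)‖
      ≤ |(n : ℝ)| ^ s * ∑ k ∈ p.coeff.support, ‖p.coeff k‖ * ‖q.coeff (n - k)‖ := by
        gcongr
        refine (norm_sum_le _ _).trans (le_of_eq ?_)
        simp
    _ ≤ _ := by
        rw [Finset.mul_sum]
        refine Finset.sum_le_sum fun k _ => ?_
        gcongr
        have := abs_add_rpow_le hs hs1 (k : ℝ) ((n - k : ℤ) : ℝ)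
        simpa using this

lemma sob_mul_le_majorant {s : ℝ} (hs : 0 < s) (hs1 : s ≤ 1) (p q : TrigPoly) :
    sob s (p * q) ≤ sob 0 (majorant s p * majorant 0 q) + sob 0 (majorant 0 p * majorant s q) :=
  (sob_le_of_coeff fun n => by
    simpa using leibniz_coeff hs hs1 p q n).trans (sob_add_le 0 _ _)

/-- Fractional Leibniz rule. -/
lemma sob_mul_leibniz {s : ℝ} (hs : 0 < s) (hs1 : s ≤ 1) (p q : TrigPoly) :
    sob s (p * q) ≤ wie s p * sob 0 q + wie 0 p * sob s q := by
  refine (sob_mul_le_majorant hs hs1 p q).trans (add_le_add ?_ ?_)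
  · exact (sob_mul_le _ _).trans (by simp only [sob_majorant, wie_majorant]; exact le_rfl)
  · exact (sob_mul_le _ _).trans (by simp only [sob_majorant, wie_majorant]; exact le_rfl)

/-- Fractional Leibniz rule, the other distribution of norms. -/
lemma sob_mul_leibniz' {s : ℝ} (hs : 0 < s) (hs1 : s ≤ 1) (p q : TrigPoly) :
    sob s (p * q) ≤ sob s p * wie 0 q + wie 0 p * sob s q := by
  refine (sob_mul_le_majorant hs hs1 p q).trans (add_le_add ?_ ?_)
  · exact (sob_mul_le' _ _).trans (by simp only [sob_majorant, wie_majorant]; exact le_rfl)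
  · exact (sob_mul_le _ _).trans (by simp only [sob_majorant, wie_majorant]; exact le_rfl)

/-- Duality of Sobolev norms. -/
lemma norm_mean_mul_le (s : ℝ) {p q : TrigPoly} (h : p.coeff 0 = 0 ∨ q.coeff 0 = 0) :
    ‖mean (p * q)‖ ≤ sob s p * sob (-s) q := by
  classical
  set S := p.coeff.support ∪ q.coeff.support.image (fun n => -n) with hS
  have hp : p.coeff.support ⊆ S := subset_union_left
  have hq : q.coeff.support ⊆ S.image (fun n => -n) := by
    intro n hn
    refine Finset.mem_image.mpr ⟨-n, ?_, by simp⟩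
    exact Finset.mem_union_right _ (Finset.mem_image_of_mem _ hn)
  rw [mean_mul hp, sob_eq_sqrt s hp, sob_eq_sqrt (-s) hq,
    Finset.sum_image (by intro a _ b _ h; simpa using h)]
  refine (norm_sum_le _ _).trans ?_
  refine le_trans (Finset.sum_le_sum fun k _ => ?_) (Real.sum_mul_le_sqrt_mul_sqrt S _ _)
  rw [norm_mul]
  rcases eq_or_ne k 0 with rfl | hk
  · have : ‖p.coeff 0‖ * ‖q.coeff (-0)‖ = 0 := by
      rcases h with h | h <;> simp [h]
    rw [this]; positivity
  · have h1 : |(k : ℝ)| ^ s * |((-k : ℤ) : ℝ)| ^ (-s) = 1 := by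
      have : 0 < |(k : ℝ)| := by positivity
      rw [Int.cast_neg, abs_neg, ← Real.rpow_add this, add_neg_cancel, Real.rpow_zero]
    calc ‖p.coeff k‖ * ‖q.coeff (-k)‖
        = (|(k : ℝ)| ^ s * |((-k : ℤ) : ℝ)| ^ (-s)) * (‖p.coeff k‖ * ‖q.coeff (-k)‖) := by
          rw [h1, one_mul]
      _ ≤ _ := le_of_eq (by ring)

/-- No mean zero assumption is needed for `s = 0`, since `|0|^0 = 1` makes `sob 0` count the zero
mode. -/
lemma norm_mean_mul_le_zero (p q : TrigPoly) : ‖mean (p * q)‖ ≤ sob 0 p * sob 0 q := by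
  classical
  set S := p.coeff.support ∪ q.coeff.support.image (fun n => -n) with hS
  have hp : p.coeff.support ⊆ S := subset_union_left
  have hq : q.coeff.support ⊆ S.image (fun n => -n) := by
    intro n hn
    refine Finset.mem_image.mpr ⟨-n, ?_, by simp⟩
    exact Finset.mem_union_right _ (Finset.mem_image_of_mem _ hn)
  rw [mean_mul hp, sob_eq_sqrt 0 hp, sob_eq_sqrt 0 hq,
    Finset.sum_image (by intro a _ b _ h; simpa using h)]
  refine (norm_sum_le _ _).trans ?_
  refine le_trans (Finset.sum_le_sum fun k _ => ?_) (Real.sum_mul_le_sqrt_mul_sqrt S _ _)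
  simp

lemma sob_mono {s t : ℝ} (hst : s ≤ t) {p : TrigPoly} (hp : p.coeff 0 = 0) : sob s p ≤ sob t p := by
  refine sob_le_of_coeff fun n => ?_
  rcases eq_or_ne n 0 with rfl | hn
  · simp [hp]
  · gcongr
    have : (1 : ℤ) ≤ |n| := Int.one_le_abs hn
    exact_mod_cast this

lemma summable_abs_rpow {r : ℝ} (hr : r < -1) : Summable fun n : ℤ => |(n : ℝ)| ^ r := by
  have h := Real.summable_abs_int_rpow (b := -r) (by linarith)
  simpa using h

/-- The Sobolev embedding into weighted Wiener spaces. -/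
lemma wie_le_sob {s t : ℝ} (hst : 2 * (s - t) < -1) {p : TrigPoly} (hp : p.coeff 0 = 0) :
    wie s p ≤ √(∑' n : ℤ, |(n : ℝ)| ^ (2 * (s - t))) * sob t p := by
  have h1 : wie s p ≤ ∑ n ∈ p.coeff.support, |(n : ℝ)| ^ (s - t) * (|(n : ℝ)| ^ t * ‖p.coeff n‖) := by
    refine Finset.sum_le_sum fun n hn => le_of_eq ?_
    have hn0 : n ≠ 0 := by rintro rfl; exact Finsupp.mem_support_iff.mp hn hp
    have : 0 < |(n : ℝ)| := by positivity
    rw [← mul_assoc, ← Real.rpow_add this]; simp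
  refine h1.trans ((Real.sum_mul_le_sqrt_mul_sqrt _ _ _).trans ?_)
  rw [sob]
  gcongr
  simp only [← abs_rpow_two_mul]
  exact (summable_abs_rpow hst).sum_le_tsum _ fun n _ => by positivity

lemma sob_multiplier_le (s : ℝ) {m : ℤ → ℂ} (hm : ∀ n, ‖m n‖ ≤ 1) (p : TrigPoly) :
    sob s (multiplier m p) ≤ sob s p := by
  refine sob_le_of_coeff fun n => ?_
  rw [coeff_multiplier, norm_mul]
  have := hm n
  gcongr
  exact mul_le_of_le_one_left (norm_nonneg _) this

variable {κ : ℝ}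

lemma sob_hilbert_le (hκ : κ = 1 ∨ κ = -1) (s : ℝ) (p : TrigPoly) :
    sob s (hilbert κ p) ≤ sob s p := sob_multiplier_le s (norm_hilbertSymbol_le hκ) p

lemma sob_smooth_le {φ : ℝ → ℝ} (hφ : ∀ x, |φ x| ≤ 1) (N : ℕ) (s : ℝ) (p : TrigPoly) :
    sob s (smooth φ N p) ≤ sob s p := sob_multiplier_le s (fun n => by simpa using hφ _) p

lemma sob_dx_le (s : ℝ) {p : TrigPoly} (hp : p.coeff 0 = 0) : sob s (dx p) ≤ sob (s + 1) p := by
  refine sob_le_of_coeff fun n => ?_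
  rcases eq_or_ne n 0 with rfl | hn
  · simp [hp]
  · have : 0 < |(n : ℝ)| := by positivity
    rw [Real.rpow_add this, Real.rpow_one]
    simp [mul_assoc]

/-- The projector onto frequencies larger than `M`. -/
def highPart (M : ℝ) (p : TrigPoly) : TrigPoly :=
  multiplier (fun n => if M < |(n : ℝ)| then 1 else 0) p

lemma coeff_highPart (M : ℝ) (p : TrigPoly) (n : ℤ) :
    (highPart M p).coeff n = if M < |(n : ℝ)| then p.coeff n else 0 := by
  rw [highPart, coeff_multiplier]; split_ifs <;> simp

lemma sob_highPart_le (s M : ℝ) (p : TrigPoly) : sob s (highPart M p) ≤ sob s p :=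
  sob_multiplier_le s (fun n => by split_ifs <;> simp) p

lemma highPart_hilbert (M : ℝ) (p : TrigPoly) :
    highPart M (hilbert κ p) = hilbert κ (highPart M p) := by
  ext n; simp [coeff_highPart]

lemma highPart_dx (M : ℝ) (p : TrigPoly) : highPart M (dx p) = dx (highPart M p) := by
  ext n; simp [coeff_highPart]

lemma highPart_smooth (φ : ℝ → ℝ) (N : ℕ) (M : ℝ) (p : TrigPoly) :
    highPart M (smooth φ N p) = smooth φ N (highPart M p) := by
  ext n; simp [coeff_highPart]

lemma highPart_add (M : ℝ) (p q : TrigPoly) : highPart M (p + q) = highPart M p + highPart M q :=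
  multiplier_add _ _ _

/-- High frequencies of a product come from high frequencies of one of the factors. -/
lemma sob_highPart_mul_le (M L : ℝ) (f q : TrigPoly) :
    sob 0 (highPart M (f * q)) ≤ wie 0 f * sob 0 (highPart (M - L) q)
      + wie 0 (highPart L f) * sob 0 q := by
  set g := f - highPart L f with hg
  have hgc : ∀ n, g.coeff n = if L < |(n : ℝ)| then 0 else f.coeff n := by
    intro n; rw [hg]; simp [coeff_highPart]; split_ifs <;> simp
  -- Here `g` is the part of `f` at frequencies at most `L`. If `|n| > M` and `|k| ≤ L`, then `|n -
  -- k| > M - L`, so only the high part of `q` contributes.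
  have e : highPart M (f * q) = highPart M (g * highPart (M - L) q) + highPart M (highPart L f * q) := by
    have h1 : f * q = g * q + highPart L f * q := by rw [hg]; ring
    rw [h1, highPart_add]
    congr 1
    ext n
    rw [coeff_highPart, coeff_highPart]
    split_ifs with hn
    · rw [coeff_mul_eq_finsum, coeff_mul_eq_finsum]
      refine Finset.sum_congr rfl fun k _ => ?_
      rw [hgc, coeff_highPart]
      split_ifs with h2 h3 h3
      · rfl
      · simp
      · rfl
      · exfalso
        push Not at h2 h3
        have h4 : |(n : ℝ)| ≤ |(k : ℝ)| + |((n - k : ℤ) : ℝ)| := by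
          have := abs_add_le (k : ℝ) ((n - k : ℤ) : ℝ)
          simpa using this
        linarith
    · rfl
  rw [e]
  refine (sob_add_le _ _ _).trans (add_le_add ?_ ?_)
  · refine (sob_highPart_le _ _ _).trans ((sob_mul_le _ _).trans ?_)
    gcongr
    · exact sob_nonneg _ _
    · refine wie_le_of_coeff fun n => ?_
      rw [hgc]; split_ifs
      · simp
      · exact le_rfl
  · exact (sob_highPart_le _ _ _).trans (sob_mul_le _ _)

lemma wie_highPart_le {M r : ℝ} (hM : 0 < M) (hr : 0 ≤ r) (s : ℝ) (p : TrigPoly) :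
    wie s (highPart M p) ≤ M ^ (-r) * wie (s + r) p := by
  rw [wie_eq_sum s (S := p.coeff.support), wie, Finset.mul_sum]
  · refine Finset.sum_le_sum fun n _ => ?_
    rw [coeff_highPart]
    split_ifs with h
    · have hn : 0 < |(n : ℝ)| := hM.trans h
      rw [← mul_assoc]
      gcongr
      rw [Real.rpow_add hn, Real.rpow_neg hM.le, mul_comm (|(n : ℝ)| ^ s), ← mul_assoc,
        inv_mul_eq_div]
      refine le_mul_of_one_le_left (by positivity) ?_
      rw [one_le_div (by positivity)]
      gcongr
    · simp; positivity
  · intro n hn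
    rw [Finsupp.mem_support_iff] at hn ⊢
    rw [coeff_highPart] at hn
    split_ifs at hn with h
    · exact hn
    · exact absurd rfl hn

lemma sob_highPart_le_rpow {M r : ℝ} (hM : 0 < M) (hr : 0 ≤ r) (s : ℝ) (p : TrigPoly) :
    sob s (highPart M p) ≤ M ^ (-r) * sob (s + r) p := by
  have hsup : (highPart M p).coeff.support ⊆ p.coeff.support := by
    intro n hn
    rw [Finsupp.mem_support_iff] at hn ⊢
    rw [coeff_highPart] at hn
    split_ifs at hn with h
    · exact hn
    · exact absurd rfl hn
  refine abs_le_of_sq_le_sq' ?_ (mul_nonneg (by positivity) (sob_nonneg _ _)) |>.2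
  rw [sq_sob s hsup, mul_pow, sq_sob (s + r) subset_rfl, Finset.mul_sum]
  refine Finset.sum_le_sum fun n _ => ?_
  rw [← mul_pow]
  refine pow_le_pow_left₀ (by positivity) ?_ 2
  rw [coeff_highPart]
  split_ifs with h
  · have hn : 0 < |(n : ℝ)| := hM.trans h
    rw [← mul_assoc]
    gcongr
    rw [Real.rpow_add hn, Real.rpow_neg hM.le, mul_comm (|(n : ℝ)| ^ s), ← mul_assoc,
      inv_mul_eq_div]
    refine le_mul_of_one_le_left (by positivity) ?_
    rw [one_le_div (by positivity)]
    gcongr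
  · simp; positivity

/-- Inverse inequality for trigonometric polynomials of degree at most `N`. -/
lemma sob_le_of_degree {N : ℕ} {s r : ℝ} (hr : 0 ≤ r) {p : TrigPoly} (h0 : p.coeff 0 = 0)
    (hp : ∀ n : ℤ, (N : ℝ) < |(n : ℝ)| → p.coeff n = 0) :
    sob (s + r) p ≤ (N : ℝ) ^ r * sob s p := by
  refine abs_le_of_sq_le_sq' ?_ (mul_nonneg (by positivity) (sob_nonneg _ _)) |>.2
  rw [sq_sob (s + r) subset_rfl, mul_pow, sq_sob s subset_rfl, Finset.mul_sum]
  refine Finset.sum_le_sum fun n hn => ?_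
  have hn' := Finsupp.mem_support_iff.mp hn
  have hnN : |(n : ℝ)| ≤ N := by
    by_contra! h
    exact hn' (hp n h)
  have hn0 : n ≠ 0 := by rintro rfl; exact hn' h0
  have : 0 < |(n : ℝ)| := by positivity
  rw [← mul_pow, ← mul_assoc]
  refine pow_le_pow_left₀ (by positivity) ?_ 2
  gcongr
  rw [Real.rpow_add this, mul_comm]
  gcongr

end TrigPoly
end

/-! ### Flows of bounded Lipschitz vector fields and Liouville's theorem -/

section

open Set Metric Filter Topology
open scoped NNReal

section Flow

variable {E : Type*} [NormedAddCommGroup E] [NormedSpace ℝ E]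

/-- `Φ` is a global flow of the vector field `b`. -/
structure IsGlobalFlow (b : E → E) (Φ : ℝ → E → E) : Prop where
  zero : ∀ x, Φ 0 x = x
  hasDerivAt : ∀ x t, HasDerivAt (fun τ => Φ τ x) (b (Φ t x)) t

/-- The Picard–Lindelöf theorem applies on every interval `[-(n+1), n+1]`, and uniqueness makes
these solutions agree on overlaps, so they glue. -/
lemma exists_globalFlow [CompleteSpace E] {b : E → E} {K B : ℝ≥0} (hK : LipschitzWith K b)
    (hB : ∀ x, ‖b x‖ ≤ B) : ∃ Φ, IsGlobalFlow b Φ := by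
  have key : ∀ x : E, ∃ α : ℝ → E, α 0 = x ∧ ∀ t, HasDerivAt α (b (α t)) t := by
    intro x
    have h1 : ∀ n : ℕ, ∃ α : ℝ → E, α 0 = x ∧
        ∀ t ∈ Ioo (-(n + 1 : ℝ)) (n + 1), HasDerivAt α (b (α t)) t := by
      intro n
      have h0 : (0 : ℝ) ∈ Icc (-(n + 1 : ℝ)) (n + 1) := ⟨by linarith, by positivity⟩
      -- At speed at most `B` a solution stays in the ball of radius `B (n + 1)` up to time `n + 1`,
      -- so the time interval is not shortened.
      have hp : IsPicardLindelof (fun _ => b) ⟨0, h0⟩ x (B * (n + 1)) 0 B K :=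
        { lipschitzOnWith := fun _ _ => hK.lipschitzOnWith
          continuousOn := fun _ _ => continuousOn_const
          norm_le := fun _ _ y _ => hB y
          mul_max_le := by simp }
      obtain ⟨α, h2, h3⟩ := hp.exists_eq_forall_mem_Icc_hasDerivWithinAt₀
      exact ⟨α, h2, fun t ht => (h3 t (Ioo_subset_Icc_self ht)).hasDerivAt
        (Icc_mem_nhds ht.1 ht.2)⟩
    choose α h2 h3 using h1
    have hagree : ∀ m n : ℕ, m ≤ n → ∀ t ∈ Ioo (-(m + 1 : ℝ)) (m + 1), α m t = α n t := by
      intro m n hmn t ht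
      have hmn' : (m : ℝ) ≤ n := by exact_mod_cast hmn
      refine ODE_solution_unique_of_mem_Ioo (v := fun _ => b) (s := fun _ => univ) (K := K)
        (t₀ := 0) (fun _ _ => hK.lipschitzOnWith) ⟨by linarith, by positivity⟩
        (fun s hs => ⟨h3 m s hs, trivial⟩) (fun s hs => ⟨h3 n s ⟨?_, ?_⟩, trivial⟩) ?_ ht
      · linarith [hs.1]
      · linarith [hs.2]
      · rw [h2, h2]
    have hmem : ∀ t : ℝ, t ∈ Ioo (-((⌈|t|⌉₊ : ℝ) + 1)) ((⌈|t|⌉₊ : ℝ) + 1) := by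
      intro t
      have := Nat.le_ceil |t|
      have h4 := abs_le.mp this
      constructor <;> linarith [h4.1, h4.2]
    -- The solution of index `⌈|t|⌉` lives on an open interval around `t`; near `t` the indices may
    -- differ, but the values agree.
    refine ⟨fun t => α ⌈|t|⌉₊ t, h2 _, fun t => ?_⟩
    refine (h3 _ t (hmem t)).congr_of_eventuallyEq ?_
    filter_upwards [Ioo_mem_nhds (hmem t).1 (hmem t).2] with s hs
    rcases le_total ⌈|s|⌉₊ ⌈|t|⌉₊ with h | h
    · exact hagree _ _ h s (hmem s)
    · exact (hagree _ _ h s hs).symm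
  choose Φ h1 h2 using key
  exact ⟨fun t x => Φ x t, fun x => h1 x, fun x t => h2 x t⟩

namespace IsGlobalFlow

variable {b : E → E} {Φ : ℝ → E → E} {K : ℝ≥0}

lemma eq_of_hasDerivAt (h : IsGlobalFlow b Φ) (hK : LipschitzWith K b) {γ : ℝ → E}
    (hγ : ∀ t, HasDerivAt γ (b (γ t)) t) (t : ℝ) : γ t = Φ t (γ 0) := by
  have := ODE_solution_unique_univ (v := fun _ => b) (s := fun _ => univ) (K := K) (t₀ := 0)
    (f := γ) (g := fun t => Φ t (γ 0)) (fun _ => hK.lipschitzOnWith)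
    (fun t => ⟨hγ t, trivial⟩) (fun t => ⟨h.hasDerivAt _ t, trivial⟩) (h.zero _).symm
  exact congrFun this t

lemma add (h : IsGlobalFlow b Φ) (hK : LipschitzWith K b) (s t : ℝ) (x : E) :
    Φ (s + t) x = Φ s (Φ t x) := by
  have := h.eq_of_hasDerivAt hK (γ := fun s => Φ (s + t) x)
    (fun s => (h.hasDerivAt x (s + t)).comp_add_const s t) s
  simpa using this

lemma neg_apply (h : IsGlobalFlow b Φ) (hK : LipschitzWith K b) (t : ℝ) (x : E) :
    Φ (-t) (Φ t x) = x := by rw [← h.add hK]; simp [h.zero]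

lemma apply_neg (h : IsGlobalFlow b Φ) (hK : LipschitzWith K b) (t : ℝ) (x : E) :
    Φ t (Φ (-t) x) = x := by rw [← h.add hK]; simp [h.zero]

lemma time_neg (h : IsGlobalFlow b Φ) : IsGlobalFlow (fun x => -b x) (fun t => Φ (-t)) where
  zero x := by simp [h.zero]
  hasDerivAt x t := by
    have := (h.hasDerivAt x (-t)).scomp t (hasDerivAt_neg t)
    rw [neg_one_smul] at this
    exact this

/-- Grönwall's inequality for positive times, and the same for the reversed field `-b` for negative
times. -/
lemma dist_le (h : IsGlobalFlow b Φ) (hK : LipschitzWith K b) (t : ℝ) (x y : E) :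
    dist (Φ t x) (Φ t y) ≤ dist x y * Real.exp (K * |t|) := by
  have pos : ∀ (b : E → E) (Φ : ℝ → E → E), IsGlobalFlow b Φ → LipschitzWith K b → ∀ t, 0 ≤ t →
      dist (Φ t x) (Φ t y) ≤ dist x y * Real.exp (K * t) := by
    intro b Φ h hK t ht
    have := dist_le_of_trajectories_ODE (v := fun _ => b) (f := fun t => Φ t x)
      (g := fun t => Φ t y) (a := 0) (b := t) (fun _ => hK)
      (HasDerivAt.continuousOn fun s _ => h.hasDerivAt x s)
      (fun s _ => (h.hasDerivAt x s).hasDerivWithinAt)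
      (HasDerivAt.continuousOn fun s _ => h.hasDerivAt y s)
      (fun s _ => (h.hasDerivAt y s).hasDerivWithinAt) (δ := dist x y)
      (le_of_eq (by simp only [h.zero])) t ⟨ht, le_rfl⟩
    simpa using this
  rcases le_total 0 t with ht | ht
  · rw [abs_of_nonneg ht]; exact pos b Φ h hK t ht
  · have := pos _ _ h.time_neg hK.neg (-t) (by linarith)
    rw [abs_of_nonpos ht]; simpa using this

lemma lipschitzWith (h : IsGlobalFlow b Φ) (hK : LipschitzWith K b) (t : ℝ) :
    LipschitzWith (Real.exp (K * |t|)).toNNReal (Φ t) :=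
  LipschitzWith.of_dist_le_mul fun x y => by
    rw [Real.coe_toNNReal _ (Real.exp_pos _).le, mul_comm]; exact h.dist_le hK t x y

lemma dist_time_le (h : IsGlobalFlow b Φ) {B : ℝ≥0} (hB : ∀ x, ‖b x‖ ≤ B) (x : E) :
    LipschitzWith B (fun t => Φ t x) := by
  refine lipschitzWith_of_nnnorm_deriv_le (fun t => (h.hasDerivAt x t).differentiableAt) fun t => ?_
  rw [(h.hasDerivAt x t).deriv]; exact_mod_cast hB _

/-- The time `t` map as a homeomorphism. -/
def homeomorph (h : IsGlobalFlow b Φ) (hK : LipschitzWith K b) (t : ℝ) : E ≃ₜ E where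
  toFun := Φ t
  invFun := Φ (-t)
  left_inv := h.neg_apply hK t
  right_inv := h.apply_neg hK t
  continuous_toFun := (h.lipschitzWith hK t).continuous
  continuous_invFun := (h.lipschitzWith hK (-t)).continuous

variable [FiniteDimensional ℝ E] [MeasurableSpace E] [BorelSpace E] {μ : Measure E}
  [μ.IsAddHaarMeasure] {ι : Type*} [Fintype ι]

/-- Integration by parts against a divergence free vector field. -/
lemma _root_.LipschitzWith.integral_fderiv_apply_eq_zero (e : Module.Basis ι ℝ E)
    (hK : LipschitzWith K b)
    (hb : Differentiable ℝ b) (hdiv : ∀ x, ∑ i, e.coord i (fderiv ℝ b x (e i)) = 0)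
    {g : E → ℝ} {C : ℝ≥0} (hg : LipschitzWith C g) (hgc : HasCompactSupport g) :
    ∫ x, fderiv ℝ g x (b x) ∂μ = 0 := by
  have hc : ∀ i, ∃ D : ℝ≥0, LipschitzWith D fun x => e.coord i (b x) := fun i =>
    ⟨_, (LinearMap.toContinuousLinearMap (e.coord i)).lipschitz.comp hK⟩
  have hbc : Continuous b := hK.continuous
  have h1 : ∀ i, Integrable (fun x => lineDeriv ℝ g x (e i) * e.coord i (b x)) μ := by
    intro i
    obtain ⟨D, hD⟩ := hc i
    have hzero : ∀ x, x ∉ tsupport g → lineDeriv ℝ g x (e i) = 0 := by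
      intro x hx
      have : g =ᶠ[𝓝 x] fun _ => 0 := notMem_tsupport_iff_eventuallyEq.mp hx
      rw [this.lineDeriv_eq]; simp [lineDeriv]
    obtain ⟨M, hM⟩ := (hgc.isCompact).exists_bound_of_continuousOn hD.continuous.continuousOn
    have hint : Integrable ((tsupport g).indicator fun _ => (C * ‖e i‖) * M : E → ℝ) μ :=
      (integrable_indicator_iff hgc.isCompact.measurableSet).mpr
        (integrableOn_const (hgc.isCompact.measure_lt_top.ne) enorm_ne_top)
    refine hint.mono ?_ (ae_of_all _ fun x => ?_)
    · exact ((measurable_lineDeriv hg.continuous).mul hD.continuous.measurable).aestronglyMeasurable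
    · by_cases hx : x ∈ tsupport g
      · rw [indicator_of_mem hx, norm_mul]
        refine le_trans ?_ (le_abs_self _)
        refine mul_le_mul (norm_lineDeriv_le_of_lipschitz ℝ hg) (hM x hx) (norm_nonneg _)
          (by positivity)
      · simp [hzero x hx]
  -- By Rademacher's theorem `g` is differentiable almost everywhere, and there the derivative
  -- splits along the basis into line derivatives.
  have h2 : ∀ᵐ x ∂μ, fderiv ℝ g x (b x) = ∑ i, lineDeriv ℝ g x (e i) * e.coord i (b x) := by
    filter_upwards [hg.ae_differentiableAt] with x hx
    conv_lhs => rw [← e.sum_repr (b x), map_sum]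
    refine Finset.sum_congr rfl fun i _ => ?_
    rw [map_smul, hx.lineDeriv_eq_fderiv, smul_eq_mul, mul_comm, e.coord_apply]
  rw [integral_congr_ae h2, integral_finsetSum _ fun i _ => h1 i]
  have h3 : ∀ i, ∫ x, lineDeriv ℝ g x (e i) * e.coord i (b x) ∂μ
      = -∫ x, e.coord i (fderiv ℝ b x (e i)) * g x ∂μ := by
    intro i
    obtain ⟨D, hD⟩ := hc i
    have := hD.integral_lineDeriv_mul_eq (μ := μ) hg hgc (e i)
    simp only [lineDeriv_neg, neg_mul, integral_neg] at this
    rw [eq_comm, neg_eq_iff_eq_neg, ← this]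
    congr 1; ext x; congr 1
    have hd : HasFDerivAt (fun x => e.coord i (b x))
        ((LinearMap.toContinuousLinearMap (e.coord i)).comp (fderiv ℝ b x)) x :=
      (LinearMap.toContinuousLinearMap (e.coord i)).hasFDerivAt.comp x (hb x).hasFDerivAt
    rw [(hd.hasLineDerivAt (e i)).lineDeriv]; rfl
  rw [Finset.sum_congr rfl fun i _ => h3 i, Finset.sum_neg_distrib, ← integral_finsetSum]
  · simp only [← Finset.sum_mul, hdiv, zero_mul, integral_zero, neg_zero]
  · intro i _
    obtain ⟨D, hD⟩ := hc i
    have hfun : (fun x => e.coord i (fderiv ℝ b x (e i)))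
        = fun x => lineDeriv ℝ (fun x => e.coord i (b x)) x (e i) := by
      ext x
      have hd : HasFDerivAt (fun x => e.coord i (b x))
          ((LinearMap.toContinuousLinearMap (e.coord i)).comp (fderiv ℝ b x)) x :=
        (LinearMap.toContinuousLinearMap (e.coord i)).hasFDerivAt.comp x (hb x).hasFDerivAt
      rw [(hd.hasLineDerivAt (e i)).lineDeriv]; rfl
    refine (hg.continuous.integrable_of_hasCompactSupport hgc).bdd_mul (c := D * ‖e i‖) ?_
      (ae_of_all _ fun x => ?_)
    · rw [hfun]; exact (measurable_lineDeriv hD.continuous).aestronglyMeasurable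
    · rw [congrFun hfun x]; exact norm_lineDeriv_le_of_lipschitz ℝ hD

/-- **Liouville's theorem**, against Lipschitz test functions. -/
lemma integral_comp_eq (h : IsGlobalFlow b Φ) (e : Module.Basis ι ℝ E) (hK : LipschitzWith K b)
    {B : ℝ≥0} (hB : ∀ x, ‖b x‖ ≤ B)
    (hb : Differentiable ℝ b) (hdiv : ∀ x, ∑ i, e.coord i (fderiv ℝ b x (e i)) = 0)
    {f : E → ℝ} {C : ℝ≥0} (hf : LipschitzWith C f) (hfc : HasCompactSupport f) (t : ℝ) :
    ∫ x, f (Φ t x) ∂μ = ∫ x, f x ∂μ := by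
  have hder0 : ∀ (g : E → ℝ) (C : ℝ≥0), LipschitzWith C g → HasCompactSupport g →
      HasDerivAt (fun s => ∫ x, g (Φ s x) ∂μ) 0 0 := by
    intro g C hg hgc
    have hbc : Continuous b := hK.continuous
    -- Trajectories move by at most `B` during times `|s| < 1`, so all the functions `g ∘ Φ s`
    -- vanish outside this compact set; this gives the dominating function.
    set T : Set E := cthickening B (tsupport g) with hT
    have hTc : IsCompact T := hgc.isCompact.cthickening
    have hint : Integrable (T.indicator fun _ => ((C * B : ℝ≥0) : ℝ) : E → ℝ) μ :=
      (integrable_indicator_iff hTc.measurableSet).mpr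
        (integrableOn_const (hTc.measure_lt_top.ne) enorm_ne_top)
    have := hasDerivAt_integral_of_dominated_loc_of_lip (μ := μ) (F := fun s x => g (Φ s x))
      (x₀ := (0 : ℝ)) (s := Ioo (-1) 1) (F' := fun x => fderiv ℝ g x (b x))
      (bound := T.indicator fun _ => ((C * B : ℝ≥0) : ℝ)) (Ioo_mem_nhds (by norm_num) (by norm_num))
      (Eventually.of_forall fun s =>
        (hg.continuous.comp (h.lipschitzWith hK s).continuous).aestronglyMeasurable)
      (by simpa [h.zero] using hg.continuous.integrable_of_hasCompactSupport hgc)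
      (by
        have h1 : (fun x => fderiv ℝ g x (b x))
            = fun x => ∑ i, e.coord i (b x) * fderiv ℝ g x (e i) := by
          ext x
          conv_lhs => rw [← e.sum_repr (b x), map_sum]
          simp
        rw [h1]
        refine (Finset.measurable_fun_sum _ fun i _ => ?_).aestronglyMeasurable
        exact (((LinearMap.toContinuousLinearMap (e.coord i)).continuous.comp hbc).measurable).mul
          (measurable_fderiv_apply_const ℝ g (e i)))
      (ae_of_all _ fun x => by
        by_cases hx : x ∈ T
        · rw [indicator_of_mem hx, Real.nnabs_of_nonneg (NNReal.coe_nonneg _), Real.toNNReal_coe]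
          exact ((hg.comp (h.dist_time_le hB x))).lipschitzOnWith
        · have : ∀ s ∈ Ioo (-1 : ℝ) 1, g (Φ s x) = 0 := by
            intro s hs
            by_contra hne
            apply hx
            refine mem_cthickening_of_dist_le x (Φ s x) _ _ (subset_tsupport g hne) ?_
            have h1 := (h.dist_time_le hB x).dist_le_mul 0 s
            simp only [h.zero] at h1
            refine h1.trans ?_
            have : dist 0 s ≤ 1 := by
              rw [Real.dist_eq, zero_sub, abs_neg]; exact (abs_lt.mpr hs).le
            calc (B : ℝ) * dist 0 s ≤ B * 1 := by gcongr
              _ = B := mul_one _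
          intro s hs s' hs'
          simp [this s hs, this s' hs'])
      hint
      (by
        filter_upwards [hg.ae_differentiableAt] with x hx
        have h1 : HasFDerivAt g (fderiv ℝ g x) (Φ 0 x) := by rw [h.zero]; exact hx.hasFDerivAt
        have h2 := h1.comp_hasDerivAt (0 : ℝ) (h.hasDerivAt x 0)
        rwa [h.zero] at h2)
    rw [hK.integral_fderiv_apply_eq_zero e hb hdiv hg hgc] at this
    exact this.2
  -- The group property reduces time `s` to time `0` for the test function `f ∘ Φ s`. Lipschitz test
  -- functions are used because this class, unlike `C¹`, is stable under composition with a merely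
  -- Lipschitz flow.
  have hder : ∀ s, HasDerivAt (fun s => ∫ x, f (Φ s x) ∂μ) 0 s := by
    intro s
    have hL := hf.comp (h.lipschitzWith hK s)
    have h1 := hder0 (f ∘ Φ s) _ hL
      (hfc.comp_homeomorph (h.homeomorph hK s))
    have h2 : (fun r => ∫ x, (f ∘ Φ s) (Φ r x) ∂μ) = fun r => ∫ x, f (Φ (s + r) x) ∂μ := by
      ext r; congr 1; ext x; rw [h.add hK]; rfl
    rw [h2] at h1
    have h3 := HasDerivAt.comp_add_const s (-s) (f := fun r => ∫ x, f (Φ (s + r) x) ∂μ) (f' := 0)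
      (by simpa using h1)
    simpa using h3
  have hconst := is_const_of_deriv_eq_zero (fun s => (hder s).differentiableAt)
    (fun s => (hder s).deriv) t 0
  simpa [h.zero] using hconst

/-- **Liouville's theorem.** -/
lemma measurePreserving (h : IsGlobalFlow b Φ) (e : Module.Basis ι ℝ E) (hK : LipschitzWith K b)
    {B : ℝ≥0} (hB : ∀ x, ‖b x‖ ≤ B)
    (hb : Differentiable ℝ b) (hdiv : ∀ x, ∑ i, e.coord i (fderiv ℝ b x (e i)) = 0) (t : ℝ) :
    MeasurePreserving (Φ t) μ μ := by
  have hcont := (h.lipschitzWith hK t).continuous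
  refine ⟨hcont.measurable, ?_⟩
  have hcomp : ∀ k : Set E, IsCompact k → μ (Φ t ⁻¹' k) = μ k := by
    intro k hk
    have hδ : ∀ n : ℕ, 0 < 1 / ((n : ℝ) + 1) := fun n => by positivity
    -- Lipschitz functions with support in a fixed compact set that converge pointwise to the
    -- indicator of the compact set `k`.
    let f : ℕ → E → ℝ := fun n x => (thickenedIndicator (hδ n) k x : ℝ)
    have hlim : ∀ x, Tendsto (fun n => f n x) atTop (𝓝 (k.indicator (fun _ => (1 : ℝ)) x)) := by
      intro x
      have h1 := tendsto_pi_nhds.mp (thickenedIndicator_tendsto_indicator_closure hδ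
        tendsto_one_div_add_atTop_nhds_zero_nat k) x
      rw [hk.isClosed.closure_eq] at h1
      have h2 := (NNReal.continuous_coe.tendsto _).comp h1
      refine h2.congr' (Eventually.of_forall fun n => rfl) |>.trans (le_of_eq ?_)
      congr 1
      by_cases hx : x ∈ k <;> simp [hx]
    have hsupp : ∀ n, ∀ x, x ∉ cthickening 1 k → f n x = 0 := by
      intro n x hx
      have : x ∉ thickening (1 / ((n : ℝ) + 1)) k := fun h' =>
        hx (thickening_subset_cthickening_of_le (by
          rw [div_le_one (by positivity)]; linarith [Nat.cast_nonneg (α := ℝ) n]) k h')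
      simp only [f, thickenedIndicator_zero (hδ n) k this, NNReal.coe_zero]
    have hck : IsCompact (cthickening 1 k) := hk.cthickening
    have hfc : ∀ n, HasCompactSupport (f n) := fun n =>
      HasCompactSupport.intro hck (hsupp n)
    have hfl : ∀ n, ∃ C : ℝ≥0, LipschitzWith C (f n) := fun n =>
      ⟨_, LipschitzWith.of_dist_le_mul (K := (1 / ((n : ℝ) + 1)).toNNReal⁻¹) fun x y => by
        have := (lipschitzWith_thickenedIndicator (hδ n) k).dist_le_mul x y
        simpa [f, NNReal.dist_eq, Real.dist_eq] using this⟩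
    have hf1 : ∀ n x, ‖f n x‖ ≤ (cthickening 1 k).indicator (fun _ => (1 : ℝ)) x := by
      intro n x
      by_cases hx : x ∈ cthickening 1 k
      · rw [indicator_of_mem hx, Real.norm_of_nonneg (NNReal.coe_nonneg _)]
        exact_mod_cast thickenedIndicator_le_one (hδ n) k x
      · rw [hsupp n x hx, indicator_of_notMem hx, norm_zero]
    have hlim1 : Tendsto (fun n => ∫ x, f n x ∂μ) atTop
        (𝓝 (∫ x, k.indicator (fun _ => (1 : ℝ)) x ∂μ)) := by
      refine tendsto_integral_of_dominated_convergence
        ((cthickening 1 k).indicator fun _ => (1 : ℝ)) (fun n => ?_) ?_ (fun n => ae_of_all _ (hf1 n))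
        (ae_of_all _ hlim)
      · exact ((hfl n).choose_spec.continuous).aestronglyMeasurable
      · exact (integrable_indicator_iff hck.measurableSet).mpr
          (integrableOn_const (hck.measure_lt_top.ne) enorm_ne_top)
    have hck' : IsCompact (Φ t ⁻¹' cthickening 1 k) :=
      ((h.homeomorph hK t).isCompact_preimage).mpr hck
    have hk' : IsCompact (Φ t ⁻¹' k) := ((h.homeomorph hK t).isCompact_preimage).mpr hk
    have hlim2 : Tendsto (fun n => ∫ x, f n (Φ t x) ∂μ) atTop
        (𝓝 (∫ x, k.indicator (fun _ => (1 : ℝ)) (Φ t x) ∂μ)) := by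
      refine tendsto_integral_of_dominated_convergence
        ((Φ t ⁻¹' cthickening 1 k).indicator fun _ => (1 : ℝ)) (fun n => ?_) ?_
        (fun n => ae_of_all _ fun x => hf1 n _) (ae_of_all _ fun x => hlim _)
      · exact ((hfl n).choose_spec.continuous.comp hcont).aestronglyMeasurable
      · exact (integrable_indicator_iff hck'.measurableSet).mpr
          (integrableOn_const (hck'.measure_lt_top.ne) enorm_ne_top)
    have heq : ∀ n, ∫ x, f n (Φ t x) ∂μ = ∫ x, f n x ∂μ := fun n =>
      h.integral_comp_eq e hK hB hb hdiv (hfl n).choose_spec (hfc n) t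
    simp only [heq] at hlim2
    have hfin := tendsto_nhds_unique hlim2 hlim1
    have h5 : (fun x => k.indicator (fun _ => (1 : ℝ)) (Φ t x))
        = (Φ t ⁻¹' k).indicator fun _ => (1 : ℝ) := rfl
    rw [h5, integral_indicator_const _ hk.measurableSet,
      integral_indicator_const _ hk'.measurableSet] at hfin
    simp only [smul_eq_mul, mul_one] at hfin
    exact (measureReal_eq_measureReal_iff hk'.measure_lt_top.ne hk.measure_lt_top.ne).mp hfin
  -- Compact sets form a π-system generating the Borel sets, and balls of finite measure exhaust the
  -- space.
  refine Measure.ext_of_generateFrom_of_iUnion {k : Set E | IsCompact k}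
    (fun n : ℕ => closedBall 0 n) ?_ ?_ ?_ (fun n => isCompact_closedBall _ _) ?_ ?_
  · refine le_antisymm ?_ ?_
    · rw [BorelSpace.measurable_eq (α := E), borel_eq_generateFrom_isClosed]
      refine MeasurableSpace.generateFrom_le fun s hs => ?_
      have : s = ⋃ n : ℕ, s ∩ closedBall 0 n := by
        rw [← inter_iUnion, iUnion_closedBall_nat, inter_univ]
      rw [this]
      exact MeasurableSet.iUnion fun n => MeasurableSpace.measurableSet_generateFrom
        ((isCompact_closedBall _ _).inter_left hs)
    · exact MeasurableSpace.generateFrom_le fun s hs => IsCompact.measurableSet hs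
  · exact fun s hs t ht _ => IsCompact.inter hs ht
  · exact iUnion_closedBall_nat 0
  · intro n
    rw [Measure.map_apply hcont.measurable measurableSet_closedBall, hcomp _ (isCompact_closedBall _ _)]
    exact (isCompact_closedBall _ _).measure_lt_top.ne
  · intro s hs
    rw [Measure.map_apply hcont.measurable (IsCompact.measurableSet hs), hcomp s hs]

end IsGlobalFlow

end Flow

end

/-! ### Prékopa–Leindler inequality and property `(τ)` of the Gaussian noise -/

section

open Set
open scoped ENNReal NNReal

section PropertyTau

/-- Property `(τ)` of Maurey: the inf-convolution inequality for the cost `c`. -/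
def HasTau {X : Type*} [MeasurableSpace X] (μ : Measure X) (c : X → X → ℝ) : Prop :=
  ∀ f g : X → ℝ≥0∞, Measurable f → Measurable g →
    (∀ x y, f x * g y ≤ ENNReal.ofReal (Real.exp (c x y))) →
    (∫⁻ x, f x ∂μ) * ∫⁻ x, g x ∂μ ≤ 1

namespace HasTau

variable {X Y : Type*} [MeasurableSpace X] [MeasurableSpace Y] {μ : Measure X} {ν : Measure Y}
  {c : X → X → ℝ} {d : Y → Y → ℝ}

lemma of_measurePreserving (h : HasTau μ c) {φ : X → Y} (hφ : MeasurePreserving φ μ ν)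
    (hcd : ∀ x x', c x x' = d (φ x) (φ x')) : HasTau ν d := by
  intro f g hf hg hfg
  rw [← hφ.lintegral_comp hf, ← hφ.lintegral_comp hg]
  exact h _ _ (hf.comp hφ.measurable) (hg.comp hφ.measurable) fun x y => by
    rw [hcd]; exact hfg _ _

/-- Tensorization: for fixed `x, x'` the property of `ν` applies to `f(x, ·)` and `exp (-c(x, x'))
g(x', ·)`. It says exactly that the fibre integrals satisfy the hypothesis of the property of `μ`.
-/
lemma prod [SFinite μ] [SFinite ν] (h : HasTau μ c) (h' : HasTau ν d) :
    HasTau (μ.prod ν) fun p q => c p.1 q.1 + d p.2 q.2 := by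
  intro f g hf hg hfg
  rw [lintegral_prod _ hf.aemeasurable, lintegral_prod _ hg.aemeasurable]
  refine h _ _ hf.lintegral_prod_right' hg.lintegral_prod_right' fun x x' => ?_
  have h1 := h' (fun y => f (x, y)) (fun y => ENNReal.ofReal (Real.exp (-c x x')) * g (x', y))
    (by fun_prop) (by fun_prop) fun y y' => by
      calc f (x, y) * (ENNReal.ofReal (Real.exp (-c x x')) * g (x', y'))
          = ENNReal.ofReal (Real.exp (-c x x')) * (f (x, y) * g (x', y')) := by ring
        _ ≤ ENNReal.ofReal (Real.exp (-c x x'))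
            * ENNReal.ofReal (Real.exp (c x x' + d y y')) := by
          gcongr; exact hfg (x, y) (x', y')
        _ = ENNReal.ofReal (Real.exp (d y y')) := by
          rw [← ENNReal.ofReal_mul (Real.exp_pos _).le, ← Real.exp_add]; congr 2; ring
  rw [lintegral_const_mul _ (by fun_prop)] at h1
  have h2 : ENNReal.ofReal (Real.exp (c x x')) * ENNReal.ofReal (Real.exp (-c x x')) = 1 := by
    rw [← ENNReal.ofReal_mul (Real.exp_pos _).le, ← Real.exp_add]; simp
  calc (∫⁻ y, f (x, y) ∂ν) * ∫⁻ y, g (x', y) ∂ν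
      = ENNReal.ofReal (Real.exp (c x x')) * ((∫⁻ y, f (x, y) ∂ν)
          * (ENNReal.ofReal (Real.exp (-c x x')) * ∫⁻ y, g (x', y) ∂ν)) := by
        rw [← one_mul ((∫⁻ y, f (x, y) ∂ν) * ∫⁻ y, g (x', y) ∂ν), ← h2]; ring
    _ ≤ ENNReal.ofReal (Real.exp (c x x')) * 1 := by gcongr
    _ = _ := mul_one _

lemma pi_fin [SigmaFinite μ] (h : HasTau μ c) (n : ℕ) :
    HasTau (Measure.pi fun _ : Fin n => μ) fun x y => ∑ i, c (x i) (y i) := by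
  induction n with
  | zero =>
    intro f g _ _ hfg
    rw [Measure.pi_of_empty (fun _ : Fin 0 => μ), lintegral_dirac, lintegral_dirac]
    refine (hfg _ _).trans ?_
    simp
  | succ n ih =>
    refine (h.prod ih).of_measurePreserving
      (measurePreserving_piFinSuccAbove (fun _ : Fin (n + 1) => μ) 0).symm fun x x' => ?_
    rw [Fin.sum_univ_succ]
    simp [MeasurableEquiv.piFinSuccAbove]

lemma pi [SigmaFinite μ] (h : HasTau μ c) (ι : Type*) [Fintype ι] :
    HasTau (Measure.pi fun _ : ι => μ) fun x y => ∑ i, c (x i) (y i) := by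
  let e := (Fintype.equivFin ι).symm
  refine (h.pi_fin _).of_measurePreserving
    (measurePreserving_piCongrLeft (fun _ : ι => μ) e) fun x x' => ?_
  rw [← e.sum_comp]
  refine Finset.sum_congr rfl fun i _ => ?_
  rw [MeasurableEquiv.coe_piCongrLeft, Equiv.piCongrLeft_apply_apply,
    Equiv.piCongrLeft_apply_apply]

end HasTau

/-- The Brunn–Minkowski inequality on the line. -/
lemma volume_add_le {A B C : Set ℝ} (hA : MeasurableSet A) (hB : MeasurableSet B)
    (hA0 : A.Nonempty) (hB0 : B.Nonempty) (h : ∀ a ∈ A, ∀ b ∈ B, a + b ∈ C) :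
    volume A + volume B ≤ volume C := by
  have htr : ∀ (a : ℝ) (S : Set ℝ), volume ((fun x => a + x) '' S) = volume S := fun a S => by
    simp
  have key : ∀ K ⊆ A, IsCompact K → ∀ L ⊆ B, IsCompact L → volume K + volume L ≤ volume C := by
    intro K hKA hK L hLB hL
    rcases K.eq_empty_or_nonempty with rfl | hK0
    · obtain ⟨a, ha⟩ := hA0
      rw [measure_empty, zero_add, ← htr a L]
      exact measure_mono (by rintro _ ⟨x, hx, rfl⟩; exact h a ha x (hLB hx))
    rcases L.eq_empty_or_nonempty with rfl | hL0
    · obtain ⟨b, hb⟩ := hB0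
      rw [measure_empty, add_zero, ← htr b K]
      refine measure_mono ?_
      rintro _ ⟨x, hx, rfl⟩
      have := h x (hKA hx) b hb
      rwa [add_comm] at this
    obtain ⟨M, hM, hM'⟩ := hK.exists_isGreatest hK0
    obtain ⟨m, hm, hm'⟩ := hL.exists_isLeast hL0
    -- With `M = max K` and `m = min L`, the translates `m + K` and `M + L` lie on the two sides of
    -- `m + M`, and both are contained in `C`.
    have hae : AEDisjoint volume ((fun x => m + x) '' K) ((fun x => M + x) '' L) := by
      refine measure_mono_null (t := {m + M}) ?_ (by simp)
      rintro _ ⟨⟨x, hx, rfl⟩, ⟨y, hy, hxy⟩⟩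
      have h1 := hM' hx
      have h2 := hm' hy
      simp only at hxy
      rw [mem_singleton_iff]; simp only; linarith
    rw [← htr m K, ← htr M L, ← measure_union₀ _ hae]
    · refine measure_mono (union_subset ?_ ?_)
      · rintro _ ⟨x, hx, rfl⟩
        have := h x (hKA hx) m (hLB hm)
        rwa [add_comm] at this
      · rintro _ ⟨x, hx, rfl⟩
        exact h M (hKA hM) x (hLB hx)
    · exact ((hL.image (by fun_prop)).measurableSet).nullMeasurableSet
  rw [hA.measure_eq_iSup_isCompact, hB.measure_eq_iSup_isCompact]
  simp only [iSup_and']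
  exact ENNReal.biSup_add_biSup_le' ⟨∅, empty_subset _, isCompact_empty⟩
    ⟨∅, empty_subset _, isCompact_empty⟩ fun K hK L hL => key K hK.1 hK.2 L hL.1 hL.2

/-- The Prékopa–Leindler inequality on the line, for normalized functions. -/
lemma lintegral_add_lintegral_le {u v w : ℝ → ℝ} (hu : Measurable u) (hv : Measurable v)
    (hw : Measurable w) (hu0 : ∀ x, 0 ≤ u x) (hv0 : ∀ x, 0 ≤ v x) (hw0 : ∀ x, 0 ≤ w x)
    (hu1 : ∀ x, u x ≤ 1) (hv1 : ∀ x, v x ≤ 1) (hus : ∀ t < 1, ∃ x, t < u x)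
    (hvs : ∀ t < 1, ∃ x, t < v x) (h : ∀ x y, u x * v y ≤ w ((x + y) / 2) ^ 2) :
    (∫⁻ x, ENNReal.ofReal (u x)) + ∫⁻ x, ENNReal.ofReal (v x)
      ≤ 2 * ∫⁻ x, ENNReal.ofReal (w x) := by
  rw [lintegral_eq_lintegral_meas_lt _ (ae_of_all _ hu0) hu.aemeasurable,
    lintegral_eq_lintegral_meas_lt _ (ae_of_all _ hv0) hv.aemeasurable,
    lintegral_eq_lintegral_meas_lt _ (ae_of_all _ hw0) hw.aemeasurable]
  have hanti : ∀ f : ℝ → ℝ, Measurable fun t : ℝ => volume {a | t < f a} := fun f =>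
    Antitone.measurable fun s t hst => measure_mono fun a (ha : t < f a) => lt_of_le_of_lt hst ha
  rw [← lintegral_add_left (hanti u), ← lintegral_const_mul _ (hanti w)]
  -- Layer by layer: for `t < 1` the superlevel sets of `u` and `v` are nonempty by normalization
  -- and their sum lies in twice that of `w`; for `t ≥ 1` they are empty.
  refine setLIntegral_mono ((hanti w).const_mul 2) fun t (ht : 0 < t) => ?_
  rcases lt_or_ge t 1 with ht1 | ht1
  · have h1 := volume_add_le (A := {a | t < u a}) (B := {a | t < v a})
      (C := (fun x : ℝ => x * (1 / 2)) ⁻¹' {a | t < w a}) (measurableSet_lt measurable_const hu)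
      (measurableSet_lt measurable_const hv) (hus t ht1) (hvs t ht1) (fun a ha b hb => by
        simp only [mem_ofPred_eq, mem_preimage] at ha hb ⊢
        have h2 := h a b
        rw [show (a + b) * (1 / 2) = (a + b) / 2 by ring]
        refine lt_of_pow_lt_pow_left₀ 2 (hw0 _) (lt_of_lt_of_le ?_ h2)
        nlinarith)
    rwa [Real.volume_preimage_mul_right (by norm_num), show |(1 / 2 : ℝ)⁻¹| = 2 by norm_num,
      ENNReal.ofReal_ofNat] at h1
  · have h1 : {a | t < u a} = ∅ := by
      ext a; simpa using (hu1 a).trans ht1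
    have h2 : {a | t < v a} = ∅ := by
      ext a; simpa using (hv1 a).trans ht1
    simp [h1, h2]

/-- With variance `1/2` the density is proportional to `exp (-x²)`, and `x² + y² - (x - y)²/2 = (x +
y)²/2`. This identity fixes the constant in the cost. -/
lemma gaussianPDFReal_half_mul (x y : ℝ) :
    Real.exp ((x - y) ^ 2 / 2) * (gaussianPDFReal 0 (1 / 2) x * gaussianPDFReal 0 (1 / 2) y)
      = gaussianPDFReal 0 (1 / 2) ((x + y) / 2) ^ 2 := by
  simp only [gaussianPDFReal]
  rw [mul_pow, ← Real.exp_nat_mul]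
  have : ∀ a b c d : ℝ, a * (b * c * (b * d)) = b ^ 2 * (a * c * d) := fun a b c d => by ring
  rw [this, ← Real.exp_add, ← Real.exp_add]
  congr 2
  push_cast
  ring

/-- Let `a, b` be the suprema of `f p` and `g p`, where `p` is the Gaussian density.
Prékopa–Leindler for `f p / a`, `g p / b` and `p / √(ab)` gives `I/a + J/b ≤ 2/√(ab)` for the two
integrals, and the inequality of arithmetic and geometric means turns this into `I J ≤ 1`. -/
lemma lintegral_gaussian_mul_le {f g : ℝ → ℝ} (hf : Measurable f) (hg : Measurable g)
    (hf0 : ∀ x, 0 ≤ f x) (hg0 : ∀ x, 0 ≤ g x) {M : ℝ} (hfM : ∀ x, f x ≤ M) (hgM : ∀ x, g x ≤ M)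
    (h : ∀ x y, f x * g y ≤ Real.exp ((x - y) ^ 2 / 2)) :
    (∫⁻ x, ENNReal.ofReal (f x) ∂gaussianReal 0 (1 / 2))
      * ∫⁻ x, ENNReal.ofReal (g x) ∂gaussianReal 0 (1 / 2) ≤ 1 := by
  set p := gaussianPDFReal 0 (1 / 2) with hp
  have hp0 : ∀ x, 0 ≤ p x := gaussianPDFReal_nonneg _ _
  have hpm : Measurable p := measurable_gaussianPDFReal _ _
  obtain ⟨P, hP⟩ : ∃ P, ∀ x, p x ≤ P := by
    refine ⟨(√(2 * Real.pi * ((1 / 2 : ℝ≥0) : ℝ)))⁻¹, fun x => ?_⟩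
    rw [hp, gaussianPDFReal]
    refine mul_le_of_le_one_right (by positivity) (Real.exp_le_one_iff.mpr ?_)
    rw [neg_div, neg_nonpos]; positivity
  have hM0 : 0 ≤ M := (hf0 0).trans (hfM 0)
  have conv : ∀ q : ℝ → ℝ, Measurable q → (∀ x, 0 ≤ q x) →
      ∫⁻ x, ENNReal.ofReal (q x) ∂gaussianReal 0 (1 / 2)
        = ∫⁻ x, ENNReal.ofReal (q x * p x) := by
    intro q hq hq0
    rw [gaussianReal_of_var_ne_zero _ (by norm_num : (1 / 2 : ℝ≥0) ≠ 0),
      lintegral_withDensity_eq_lintegral_mul _ (measurable_gaussianPDF _ _) (by fun_prop)]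
    congr 1; ext x
    rw [Pi.mul_apply, gaussianPDF, ← ENNReal.ofReal_mul (hp0 x), mul_comm]
  have hsup : ∀ q : ℝ → ℝ, (∀ x, 0 ≤ q x) → (∀ x, q x ≤ M) → (∃ x, q x * p x ≠ 0) →
      ∃ a, 0 < a ∧ (∀ x, q x * p x ≤ a) ∧ ∀ t < 1, ∃ x, t < q x * p x / a := by
    intro q hq0 hqM ⟨x0, hx0⟩
    have hbdd : BddAbove (range fun x => q x * p x) := ⟨M * P, by
      rintro _ ⟨x, rfl⟩; exact mul_le_mul (hqM x) (hP x) (hp0 x) hM0⟩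
    have ha : 0 < ⨆ x, q x * p x :=
      lt_of_lt_of_le (lt_of_le_of_ne (mul_nonneg (hq0 x0) (hp0 x0)) hx0.symm) (le_ciSup hbdd x0)
    refine ⟨_, ha, fun x => le_ciSup hbdd x, fun t ht => ?_⟩
    obtain ⟨x, hx⟩ := exists_lt_of_lt_ciSup (mul_lt_of_lt_one_left ha ht)
    exact ⟨x, (lt_div_iff₀ ha).mpr hx⟩
  rw [conv f hf hf0, conv g hg hg0]
  by_cases hfz : ∃ x, f x * p x ≠ 0
  swap
  · push Not at hfz; simp only [hfz]; simp
  by_cases hgz : ∃ x, g x * p x ≠ 0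
  swap
  · push Not at hgz; simp only [hgz]; simp
  obtain ⟨a, ha, hfa, hfs⟩ := hsup f hf0 hfM hfz
  obtain ⟨b, hb, hgb, hgs⟩ := hsup g hg0 hgM hgz
  have hab : 0 < √(a * b) := Real.sqrt_pos.mpr (mul_pos ha hb)
  have key := lintegral_add_lintegral_le (u := fun x => f x * p x / a)
    (v := fun x => g x * p x / b) (w := fun x => p x / √(a * b)) (by fun_prop) (by fun_prop)
    (by fun_prop) (fun x => div_nonneg (mul_nonneg (hf0 x) (hp0 x)) ha.le)
    (fun x => div_nonneg (mul_nonneg (hg0 x) (hp0 x)) hb.le)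
    (fun x => div_nonneg (hp0 x) hab.le) (fun x => (div_le_one ha).mpr (hfa x))
    (fun x => (div_le_one hb).mpr (hgb x)) hfs hgs (fun x y => by
      rw [div_pow, Real.sq_sqrt (mul_pos ha hb).le, ← gaussianPDFReal_half_mul,
        div_mul_div_comm]
      refine div_le_div_of_nonneg_right ?_ (mul_pos ha hb).le
      calc f x * p x * (g y * p y) = f x * g y * (p x * p y) := by ring
        _ ≤ _ := mul_le_mul_of_nonneg_right (h x y) (mul_nonneg (hp0 _) (hp0 _)))
  have hdiv : ∀ (q : ℝ → ℝ) (k : ℝ), 0 < k → Measurable q → ∫⁻ x, ENNReal.ofReal (q x / k)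
      = ENNReal.ofReal k⁻¹ * ∫⁻ x, ENNReal.ofReal (q x) := by
    intro q k hk hq
    rw [← lintegral_const_mul _ (by fun_prop)]
    congr 1; ext x
    rw [← ENNReal.ofReal_mul (by positivity)]; congr 1; ring
  have hp1 : ∫⁻ x, ENNReal.ofReal (p x) = 1 :=
    lintegral_gaussianPDFReal_eq_one 0 (by norm_num)
  rw [hdiv _ _ ha (by fun_prop), hdiv _ _ hb (by fun_prop), hdiv _ _ hab hpm, hp1, mul_one] at key
  set I := ∫⁻ x, ENNReal.ofReal (f x * p x)
  set J := ∫⁻ x, ENNReal.ofReal (g x * p x)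
  have hfin : ∀ k : ℝ, 0 < k → ∀ I : ℝ≥0∞, ENNReal.ofReal k⁻¹ * I ≤ 2 * ENNReal.ofReal (√(a * b))⁻¹ →
      I ≠ ⊤ := by
    rintro k hk I hI rfl
    rw [ENNReal.mul_top (ENNReal.ofReal_pos.mpr (inv_pos.mpr hk)).ne', top_le_iff] at hI
    exact ENNReal.mul_ne_top (by simp) ENNReal.ofReal_ne_top hI
  have hI := hfin a ha I (le_self_add.trans key)
  have hJ := hfin b hb J (le_add_self.trans key)
  lift I to ℝ≥0 using hI with i
  lift J to ℝ≥0 using hJ with j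
  rw [← ENNReal.ofReal_coe_nnreal, ← ENNReal.ofReal_coe_nnreal,
    ← ENNReal.ofReal_mul (by positivity), ← ENNReal.ofReal_mul (by positivity),
    ← ENNReal.ofReal_add (by positivity) (by positivity), ← ENNReal.ofReal_ofNat 2,
    ← ENNReal.ofReal_mul (by positivity), ENNReal.ofReal_le_ofReal_iff (by positivity)] at key
  rw [← ENNReal.coe_mul, ← ENNReal.coe_one, ENNReal.coe_le_coe, ← NNReal.coe_le_coe]
  push_cast
  have hs : (√(a * b))⁻¹ ^ 2 = a⁻¹ * b⁻¹ := by
    rw [inv_pow, Real.sq_sqrt (mul_pos ha hb).le, mul_inv]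
  -- Arithmetic and geometric means, with `(1/√(ab))² = 1/(ab)`.
  have h3 : a⁻¹ * i * (b⁻¹ * j) ≤ a⁻¹ * b⁻¹ := by
    rw [← hs]
    have : 0 ≤ a⁻¹ * i := by positivity
    have : 0 ≤ b⁻¹ * j := by positivity
    nlinarith [sq_nonneg (a⁻¹ * i - b⁻¹ * j)]
  have h4 : 0 < a⁻¹ * b⁻¹ := by positivity
  have h5 : a⁻¹ * b⁻¹ * (i * j) ≤ a⁻¹ * b⁻¹ * 1 := by rw [mul_one]; convert h3 using 1; ring
  exact le_of_mul_le_mul_left h5 h4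

/-- The bounded case applies to the truncations `min f n` and `min g m`, whose product only
decreases; monotone convergence removes the truncation. -/
lemma hasTau_gaussianReal : HasTau (gaussianReal 0 (1 / 2)) fun x y => (x - y) ^ 2 / 2 := by
  intro f g hf hg h
  have hmono : ∀ (f : ℝ → ℝ≥0∞), Measurable f →
      ∫⁻ x, f x ∂gaussianReal 0 (1 / 2)
        = ⨆ n : ℕ, ∫⁻ x, min (f x) n ∂gaussianReal 0 (1 / 2) := by
    intro f hf
    rw [← lintegral_iSup (fun n => hf.min measurable_const)
      (fun m n hmn x => min_le_min le_rfl (by exact_mod_cast hmn))]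
    congr 1; ext x
    have : (⨆ n : ℕ, min (f x) n) = min (f x) (⨆ n : ℕ, (n : ℝ≥0∞)) := by
      rw [inf_iSup_eq]
    rw [this, ENNReal.iSup_natCast, min_top_right]
  rw [hmono f hf, hmono g hg, ENNReal.iSup_mul]
  refine iSup_le fun n => ?_
  rw [ENNReal.mul_iSup]
  refine iSup_le fun m => ?_
  have hne : ∀ (x : ℝ≥0∞) (n : ℕ), min x n ≠ ⊤ := fun x n =>
    ne_top_of_le_ne_top (ENNReal.natCast_ne_top n) (min_le_right _ _)
  have := lintegral_gaussian_mul_le (f := fun x => (min (f x) n).toReal)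
    (g := fun x => (min (g x) m).toReal) (hf.min measurable_const).ennreal_toReal
    (hg.min measurable_const).ennreal_toReal (fun _ => ENNReal.toReal_nonneg)
    (fun _ => ENNReal.toReal_nonneg) (M := max n m)
    (fun x => ((ENNReal.toReal_mono (ENNReal.natCast_ne_top n) (min_le_right _ _)).trans
      (le_of_eq (by simp))).trans (le_max_left _ _))
    (fun x => ((ENNReal.toReal_mono (ENNReal.natCast_ne_top m) (min_le_right _ _)).trans
      (le_of_eq (by simp))).trans (le_max_right _ _))
    (fun x y => by
      rw [← ENNReal.toReal_mul]
      refine ENNReal.toReal_le_of_le_ofReal (Real.exp_pos _).le ((mul_le_mul' (min_le_left _ _)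
        (min_le_left _ _)).trans (h x y)))
  simpa only [ENNReal.ofReal_toReal (hne _ _)] using this

lemma hasTau_complexGaussian : HasTau complexGaussian fun x y => ‖x - y‖ ^ 2 / 2 := by
  refine (hasTau_gaussianReal.prod hasTau_gaussianReal).of_measurePreserving
    (φ := Complex.measurableEquivRealProd.symm)
    ⟨Complex.measurableEquivRealProd.symm.measurable, rfl⟩ fun x y => ?_
  rw [← Complex.normSq_eq_norm_sq, Complex.normSq_apply]
  simp [Complex.measurableEquivRealProd]
  ring

/-- Property `(τ)` for the noise, for functions of finitely many coordinates. -/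
lemma lintegral_noise_mul_le (s : Finset ℕ) (f g : (s → ℂ) → ℝ≥0∞) (hf : Measurable f)
    (hg : Measurable g)
    (h : ∀ x y, f x * g y ≤ ENNReal.ofReal (Real.exp (∑ i, ‖x i - y i‖ ^ 2 / 2))) :
    (∫⁻ z, f (s.restrict z) ∂noise) * ∫⁻ z, g (s.restrict z) ∂noise ≤ 1 := by
  have e : ∀ f : (s → ℂ) → ℝ≥0∞, Measurable f → ∫⁻ z, f (s.restrict z) ∂noise
      = ∫⁻ x, f x ∂Measure.pi fun _ : s => complexGaussian := fun f hf =>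
    lintegral_restrict_infinitePi (fun _ => complexGaussian) hf
  rw [e f hf, e g hg]
  exact hasTau_complexGaussian.pi s f g hf hg h

end PropertyTau

end

/-! ### Rotation invariance, moments and orthogonality for the Gaussian noise -/

section

open Set
open scoped ENNReal NNReal

section ComplexGaussian

lemma complexGaussian_eq_withDensity : complexGaussian
    = (volume : Measure ℂ).withDensity
        fun z => ENNReal.ofReal (Real.pi⁻¹ * Real.exp (-‖z‖ ^ 2)) := by
  have h1 : (gaussianReal 0 (1 / 2)).prod (gaussianReal 0 (1 / 2))
      = ((volume : Measure ℝ).prod (volume : Measure ℝ)).withDensity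
        fun p => gaussianPDF 0 (1 / 2) p.1 * gaussianPDF 0 (1 / 2) p.2 := by
    rw [gaussianReal_of_var_ne_zero _ (by norm_num : (1 / 2 : ℝ≥0) ≠ 0)]
    exact prod_withDensity (measurable_gaussianPDF _ _) (measurable_gaussianPDF _ _)
  have h2 := Complex.volume_preserving_equiv_real_prod.symm
  ext s hs
  rw [complexGaussian, h1, Measure.map_apply Complex.measurableEquivRealProd.symm.measurable hs,
    withDensity_apply _ (Complex.measurableEquivRealProd.symm.measurable hs),
    withDensity_apply _ hs, ← h2.setLIntegral_comp_preimage hs (by fun_prop)]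
  refine lintegral_congr fun p => ?_
  rw [gaussianPDF, gaussianPDF, ← ENNReal.ofReal_mul (gaussianPDFReal_nonneg _ _ _),
    gaussianPDFReal, gaussianPDFReal]
  congr 1
  have h3 : ‖Complex.measurableEquivRealProd.symm p‖ ^ 2 = p.1 ^ 2 + p.2 ^ 2 := by
    rw [← Complex.normSq_eq_norm_sq, Complex.normSq_apply]
    simp [Complex.measurableEquivRealProd]
    ring
  have h4 : ((1 / 2 : ℝ≥0) : ℝ) = 1 / 2 := by norm_num
  rw [h3, h4, mul_mul_mul_comm, ← Real.exp_add, ← mul_inv, Real.mul_self_sqrt (by positivity)]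
  congr 2 <;> ring

/-- The density depends on `|z|` only, and multiplication by a unit preserves Lebesgue measure. This
symmetry yields both the orthogonality of monomials and the invariance of the high modes. -/
lemma map_mul_complexGaussian {c : ℂ} (hc : ‖c‖ = 1) :
    complexGaussian.map (fun z => c * z) = complexGaussian := by
  have hm : Measurable fun z : ℂ => c * z := by fun_prop
  have hv : MeasurePreserving (fun z : ℂ => c * z) volume volume := by
    let e : Circle := ⟨c, by simpa [Submonoid.unitSphere] using hc⟩
    have h := (rotation e).measurePreserving
    exact h
  ext s hs
  rw [Measure.map_apply hm hs, complexGaussian_eq_withDensity, withDensity_apply _ (hm hs),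
    withDensity_apply _ hs, ← hv.setLIntegral_comp_preimage hs (by fun_prop)]
  simp [hc]

lemma integrable_norm_pow_complexGaussian (k : ℕ) :
    Integrable (fun w : ℂ => ‖w‖ ^ k) complexGaussian := by
  have h0 : Integrable (fun x : ℝ => |x| ^ k) (gaussianReal 0 (1 / 2)) := by
    simpa using (memLp_id_gaussianReal (μ := 0) (v := 1 / 2) (k : ℝ≥0)).integrable_norm_pow'
  rw [complexGaussian, integrable_map_measure (by fun_prop) (by fun_prop)]
  refine Integrable.mono' (((h0.comp_fst (gaussianReal 0 (1 / 2))).add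
    (h0.comp_snd (gaussianReal 0 (1 / 2)))).const_mul (2 ^ (k - 1))) (by fun_prop)
    (ae_of_all _ fun p => ?_)
  have h1 : ‖Complex.measurableEquivRealProd.symm p‖ ≤ |p.1| + |p.2| := by
    refine (Complex.norm_le_abs_re_add_abs_im _).trans (le_of_eq ?_)
    simp [Complex.measurableEquivRealProd]
  simp only [Function.comp_apply, norm_pow, norm_norm, Pi.add_apply]
  exact (pow_le_pow_left₀ (norm_nonneg _) h1 k).trans
    (add_pow_le (abs_nonneg _) (abs_nonneg _) k)

/-- The absolute moments of a standard complex Gaussian variable. -/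
def gaussMoment (k : ℕ) : ℝ := ∫ w, ‖w‖ ^ k ∂complexGaussian

lemma gaussMoment_nonneg (k : ℕ) : 0 ≤ gaussMoment k := integral_nonneg fun _ => by positivity

end ComplexGaussian

section Noise

instance : IsProbabilityMeasure noise := inferInstanceAs (IsProbabilityMeasure (Measure.infinitePi _))

lemma measurePreserving_eval_noise (j : ℕ) :
    MeasurePreserving (fun z : ℕ → ℂ => z j) noise complexGaussian :=
  measurePreserving_eval_infinitePi (fun _ : ℕ => complexGaussian) j

lemma measurePreserving_mul_noise {c : ℕ → ℂ} (hc : ∀ j, ‖c j‖ = 1) :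
    MeasurePreserving (fun (z : ℕ → ℂ) j => c j * z j) noise noise := by
  refine ⟨by fun_prop, ?_⟩
  have h := Measure.infinitePi_map_pi (μ := fun _ : ℕ => complexGaussian)
    (f := fun j w => c j * w) (fun j => by fun_prop)
  rw [noise, h]
  congr 1; ext1 j
  exact map_mul_complexGaussian (hc j)

@[fun_prop]
lemma measurable_g (n : ℤ) : Measurable fun z => g z n := by
  unfold g
  split_ifs
  · fun_prop
  · exact Complex.continuous_conj.measurable.comp (measurable_pi_apply _)
  · fun_prop

lemma g_zero (z : ℕ → ℂ) : g z 0 = 0 := by simp [g]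

lemma norm_g {n : ℤ} (hn : n ≠ 0) (z : ℕ → ℂ) : ‖g z n‖ = ‖z n.natAbs‖ := by
  unfold g
  rcases lt_or_gt_of_ne hn with h | h
  · simp [h, h.not_gt]
  · simp [h]

lemma norm_g_le (n : ℤ) (z : ℕ → ℂ) : ‖g z n‖ ≤ ‖z n.natAbs‖ := by
  rcases eq_or_ne n 0 with rfl | hn
  · simp [g_zero]
  · exact (norm_g hn z).le

lemma integrable_norm_pow_noise (j k : ℕ) : Integrable (fun z : ℕ → ℂ => ‖z j‖ ^ k) noise :=
  (measurePreserving_eval_noise j).integrable_comp_of_integrable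
    (integrable_norm_pow_complexGaussian k)

lemma integral_norm_pow_noise (j k : ℕ) : ∫ z, ‖z j‖ ^ k ∂noise = gaussMoment k := by
  have h := (measurePreserving_eval_noise j)
  rw [gaussMoment, ← h.map_eq, integral_map h.measurable.aemeasurable (by fun_prop)]

lemma integrable_norm_g_pow (n : ℤ) (k : ℕ) : Integrable (fun z => ‖g z n‖ ^ k) noise := by
  refine (integrable_norm_pow_noise n.natAbs k).mono' (by fun_prop) (ae_of_all _ fun z => ?_)
  rw [norm_pow, norm_norm]
  exact pow_le_pow_left₀ (norm_nonneg _) (norm_g_le n z) k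

lemma integral_norm_g_pow_le (n : ℤ) (k : ℕ) : ∫ z, ‖g z n‖ ^ k ∂noise ≤ gaussMoment k := by
  rw [← integral_norm_pow_noise n.natAbs k]
  exact integral_mono (integrable_norm_g_pow n k) (integrable_norm_pow_noise _ k) fun z =>
    pow_le_pow_left₀ (norm_nonneg _) (norm_g_le n z) k

/-- Jensen's inequality for the power function with the weights `a i / ∑ a`. -/
lemma sum_mul_pow_le {ι : Type*} (S : Finset ι) (a x : ι → ℝ) (ha : ∀ i ∈ S, 0 ≤ a i)
    (hx : ∀ i ∈ S, 0 ≤ x i) (k : ℕ) :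
    (∑ i ∈ S, a i * x i) ^ (k + 1) ≤ (∑ i ∈ S, a i) ^ k * ∑ i ∈ S, a i * x i ^ (k + 1) := by
  set A := ∑ i ∈ S, a i with hA
  rcases (Finset.sum_nonneg ha).eq_or_lt with h0 | h0
  · have h1 := (Finset.sum_eq_zero_iff_of_nonneg ha).mp h0.symm
    rw [Finset.sum_eq_zero fun i hi => by rw [h1 i hi, zero_mul],
      Finset.sum_eq_zero fun i hi => by rw [h1 i hi, zero_mul]]
    simp
  · have h1 := Real.pow_arith_mean_le_arith_mean_pow S (fun i => a i / A) x
      (fun i hi => div_nonneg (ha i hi) h0.le) (by rw [← Finset.sum_div, ← hA]; exact div_self h0.ne')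
      hx (k + 1)
    simp only [div_mul_eq_mul_div, ← Finset.sum_div] at h1
    rw [div_pow, div_le_div_iff₀ (by positivity) h0] at h1
    have h2 : (∑ i ∈ S, a i * x i) ^ (k + 1) * A
        ≤ (A ^ k * ∑ i ∈ S, a i * x i ^ (k + 1)) * A := by
      refine h1.trans (le_of_eq ?_); ring
    exact le_of_mul_le_mul_right h2 h0

lemma integrable_quadratic_pow (S : Finset ℤ) (a : ℤ → ℝ) (k : ℕ) (ha : ∀ i ∈ S, 0 ≤ a i) :
    Integrable (fun z => (∑ n ∈ S, a n * ‖g z n‖ ^ 2) ^ k) noise := by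
  rcases k with _ | k
  · simp
  · refine Integrable.mono' (g := fun z => (∑ i ∈ S, a i) ^ k * ∑ i ∈ S, a i * ‖g z i‖ ^ (2 * (k + 1)))
      ((integrable_finsetSum _ fun i _ => (integrable_norm_g_pow i _).const_mul _).const_mul _)
      (by fun_prop) (ae_of_all _ fun z => ?_)
    rw [Real.norm_of_nonneg (pow_nonneg (Finset.sum_nonneg fun i hi =>
      mul_nonneg (ha i hi) (by positivity)) _)]
    simp only [pow_mul]
    exact sum_mul_pow_le S a _ ha (fun _ _ => by positivity) k

/-- Jensen's inequality reduces the moment of a quadratic form to a moment of a single Gaussian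
variable. No independence is needed, and the constant does not depend on the index set. -/
lemma integral_quadratic_pow_le (S : Finset ℤ) (a : ℤ → ℝ) (k : ℕ) (ha : ∀ i ∈ S, 0 ≤ a i) :
    ∫ z, (∑ n ∈ S, a n * ‖g z n‖ ^ 2) ^ k ∂noise ≤ (∑ n ∈ S, a n) ^ k * gaussMoment (2 * k) := by
  rcases k with _ | k
  · simp [gaussMoment]
  · calc ∫ z, (∑ n ∈ S, a n * ‖g z n‖ ^ 2) ^ (k + 1) ∂noise
        ≤ ∫ z, (∑ i ∈ S, a i) ^ k * ∑ i ∈ S, a i * ‖g z i‖ ^ (2 * (k + 1)) ∂noise := by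
          refine integral_mono (integrable_quadratic_pow S a _ ha)
            ((integrable_finsetSum _ fun i _ =>
              (integrable_norm_g_pow i _).const_mul _).const_mul _) fun z => ?_
          simp only [pow_mul]
          exact sum_mul_pow_le S a _ ha (fun _ _ => by positivity) k
      _ = (∑ i ∈ S, a i) ^ k * ∑ i ∈ S, a i * ∫ z, ‖g z i‖ ^ (2 * (k + 1)) ∂noise := by
          rw [integral_const_mul, integral_finsetSum _ fun i _ =>
            (integrable_norm_g_pow i _).const_mul _]
          simp only [integral_const_mul]
      _ ≤ (∑ i ∈ S, a i) ^ k * ∑ i ∈ S, a i * gaussMoment (2 * (k + 1)) := by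
          refine mul_le_mul_of_nonneg_left (Finset.sum_le_sum fun i hi => ?_)
            (pow_nonneg (Finset.sum_nonneg ha) _)
          exact mul_le_mul_of_nonneg_left (integral_norm_g_pow_le _ _) (ha i hi)
      _ = _ := by rw [← Finset.sum_mul]; ring

/-! ### The second moment of multilinear expressions -/

/-- The monomial `g_{n₁} ⋯ g_{n_d}`. -/
def monomial {d : ℕ} (n : Fin d → ℤ) (z : ℕ → ℂ) : ℂ := ∏ i, g z (n i)

@[fun_prop]
lemma measurable_monomial {d : ℕ} (n : Fin d → ℤ) : Measurable (monomial n) := by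
  unfold monomial; fun_prop

/-- A product is at most the power of its largest factor, so moments of monomials need no
independence. -/
lemma norm_monomial_sq_le {d : ℕ} (hd : 0 < d) (n : Fin d → ℤ) (z : ℕ → ℂ) :
    ‖monomial n z‖ ^ 2 ≤ ∑ i, ‖g z (n i)‖ ^ (2 * d) := by
  have : Nonempty (Fin d) := ⟨⟨0, hd⟩⟩
  obtain ⟨j, -, hj⟩ := Finset.exists_max_image Finset.univ (fun i => ‖g z (n i)‖)
    Finset.univ_nonempty
  calc ‖monomial n z‖ ^ 2 = (∏ i, ‖g z (n i)‖) ^ 2 := by rw [monomial, norm_prod]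
    _ ≤ (∏ _i : Fin d, ‖g z (n j)‖) ^ 2 := by
        gcongr with i hi
        exact hj i hi
    _ = ‖g z (n j)‖ ^ (2 * d) := by
        rw [Finset.prod_const, Finset.card_univ, Fintype.card_fin, ← pow_mul, mul_comm]
    _ ≤ _ := Finset.single_le_sum (f := fun i => ‖g z (n i)‖ ^ (2 * d))
        (fun _ _ => by positivity) (Finset.mem_univ j)

lemma integrable_norm_monomial_sq {d : ℕ} (hd : 0 < d) (n : Fin d → ℤ) :
    Integrable (fun z => ‖monomial n z‖ ^ 2) noise := by
  refine (integrable_finsetSum Finset.univ fun i _ =>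
    integrable_norm_g_pow (n i) (2 * d)).mono' (by fun_prop) (ae_of_all _ fun z => ?_)
  rw [Real.norm_of_nonneg (by positivity)]
  exact norm_monomial_sq_le hd n z

lemma integral_norm_monomial_sq_le {d : ℕ} (hd : 0 < d) (n : Fin d → ℤ) :
    ∫ z, ‖monomial n z‖ ^ 2 ∂noise ≤ d * gaussMoment (2 * d) := by
  calc ∫ z, ‖monomial n z‖ ^ 2 ∂noise ≤ ∫ z, ∑ i, ‖g z (n i)‖ ^ (2 * d) ∂noise :=
        integral_mono (integrable_norm_monomial_sq hd n)
          (integrable_finsetSum _ fun i _ => integrable_norm_g_pow (n i) (2 * d))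
          (norm_monomial_sq_le hd n)
    _ = ∑ i, ∫ z, ‖g z (n i)‖ ^ (2 * d) ∂noise :=
        integral_finsetSum _ fun i _ => integrable_norm_g_pow (n i) (2 * d)
    _ ≤ ∑ _i : Fin d, gaussMoment (2 * d) := Finset.sum_le_sum fun i _ =>
        integral_norm_g_pow_le _ _
    _ = _ := by simp

/-- The charge of the monomial `n` with respect to the rotation of `z_a`. -/
def charge {d : ℕ} (a : ℤ) (n : Fin d → ℤ) : ℤ :=
  ∑ i, ((if n i = a then 1 else 0) - if n i = -a then 1 else 0)

lemma g_rotate {a : ℤ} (ha : 0 < a) (c : ℂ) (hc : ‖c‖ = 1) (z : ℕ → ℂ) (n : ℤ) :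
    g (fun j => (if j = a.natAbs then c else 1) * z j) n
      = c ^ ((if n = a then 1 else 0) - (if n = -a then 1 else 0) : ℤ) * g z n := by
  have hci : c⁻¹ = conj c := Complex.inv_eq_conj hc
  unfold g
  rcases lt_trichotomy n 0 with h | h | h
  · have h1 : n ≠ a := by omega
    have h2 : (n.natAbs = a.natAbs) ↔ n = -a := by omega
    simp only [h, h.not_gt, if_true, if_false, h1, h2, map_mul]
    split_ifs <;> simp [hci]
  · simp [h]
  · have h1 : n ≠ -a := by omega
    have h2 : (n.natAbs = a.natAbs) ↔ n = a := by omega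
    simp only [h, if_true, h1, h2, if_false]
    split_ifs <;> simp

lemma monomial_rotate {d : ℕ} {a : ℤ} (ha : 0 < a) (c : ℂ) (hc : ‖c‖ = 1) (z : ℕ → ℂ)
    (n : Fin d → ℤ) :
    monomial n (fun j => (if j = a.natAbs then c else 1) * z j)
      = c ^ charge a n * monomial n z := by
  have hc0 : c ≠ 0 := by rintro rfl; simp at hc
  have : ∀ s : Finset (Fin d), ∏ i ∈ s, g (fun j => (if j = a.natAbs then c else 1) * z j) (n i)
      = c ^ (∑ i ∈ s, ((if n i = a then 1 else 0) - if n i = -a then 1 else 0 : ℤ))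
        * ∏ i ∈ s, g z (n i) := by
    intro s
    induction s using Finset.cons_induction with
    | empty => simp
    | cons i s hi ih =>
      rw [Finset.prod_cons, Finset.sum_cons, Finset.prod_cons, ih, g_rotate ha c hc,
        zpow_add₀ hc0]
      ring
  exact this Finset.univ

lemma charge_neg {d : ℕ} (a : ℤ) (n : Fin d → ℤ) : charge (-a) n = -charge a n := by
  unfold charge
  rw [← Finset.sum_neg_distrib]
  refine Finset.sum_congr rfl fun i _ => ?_
  rw [neg_neg]; ring

/-- Rotating the single coordinate of index `a` preserves the noise and multiplies the integrand by
a power of the phase, the difference `k` of the charges. A phase `c` with `c^k = -1` makes the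
integral its own negative. -/
lemma integral_monomial_mul_conj {d : ℕ} {a : ℤ} (ha : a ≠ 0) {n n' : Fin d → ℤ}
    (h : charge a n ≠ charge a n') : ∫ z, monomial n z * conj (monomial n' z) ∂noise = 0 := by
  wlog hpos : 0 < a generalizing a
  · exact this (neg_ne_zero.mpr ha) (by rw [charge_neg, charge_neg]; simpa using h) (by omega)
  set k : ℤ := charge a n - charge a n' with hk
  have hk0 : (k : ℂ) ≠ 0 := by
    rw [Int.cast_ne_zero]; omega
  -- The choice `c = exp (iπ/k)` gives `c^k = -1`.
  set c : ℂ := Complex.exp (Real.pi / k * Complex.I) with hc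
  have hc1 : ‖c‖ = 1 := by
    have : (Real.pi / k * Complex.I : ℂ) = ((Real.pi / k : ℝ) : ℂ) * Complex.I := by push_cast; rfl
    rw [hc, this, Complex.norm_exp_ofReal_mul_I]
  have hc0 : c ≠ 0 := Complex.exp_ne_zero _
  have hck : c ^ k = -1 := by
    rw [hc, ← Complex.exp_int_mul]
    rw [show (k : ℂ) * (Real.pi / k * Complex.I) = Real.pi * Complex.I by field_simp]
    exact Complex.exp_pi_mul_I
  have hmp := measurePreserving_mul_noise (c := fun j => if j = a.natAbs then c else 1)
    (fun j => by split_ifs <;> simp [hc1])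
  have h1 : ∫ z, monomial n z * conj (monomial n' z) ∂noise
      = ∫ z, -(monomial n z * conj (monomial n' z)) ∂noise := by
    conv_lhs => rw [← hmp.map_eq]
    rw [integral_map hmp.measurable.aemeasurable (by
      refine Measurable.aestronglyMeasurable ?_
      exact (measurable_monomial n).mul
        (Complex.continuous_conj.measurable.comp (measurable_monomial n')))]
    refine integral_congr_ae (ae_of_all _ fun z => ?_)
    simp only
    rw [monomial_rotate hpos c hc1, monomial_rotate hpos c hc1, map_mul, map_zpow₀,
      ← Complex.inv_eq_conj hc1, inv_zpow, ← zpow_neg]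
    calc _ = c ^ charge a n * c ^ (-charge a n') * (monomial n z * conj (monomial n' z)) := by ring
      _ = _ := by rw [← zpow_add₀ hc0, ← sub_eq_add_neg, hck]; ring
  rw [integral_neg] at h1
  exact self_eq_neg.mp h1

/-- Without pairings the conjugate variable of index `-n j` does not occur, so the charge is a
multiplicity. -/
lemma charge_pos {d : ℕ} {n : Fin d → ℤ} (h : ∀ i j, n i + n j ≠ 0) (j : Fin d) :
    0 < charge (n j) n := by
  unfold charge
  have h1 : ∀ i, n i ≠ -n j := fun i hi => h i j (by rw [hi]; ring)
  simp only [h1, if_false, sub_zero]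
  exact Finset.sum_pos' (fun i _ => by split_ifs <;> simp) ⟨j, Finset.mem_univ _, by simp⟩

lemma mem_range_of_charge_pos {d : ℕ} {n : Fin d → ℤ} {a : ℤ} (h : 0 < charge a n) :
    ∃ i, n i = a := by
  by_contra hcon
  push Not at hcon
  have : charge a n ≤ 0 := by
    unfold charge
    refine Finset.sum_nonpos fun i _ => ?_
    rw [if_neg (hcon i)]
    split_ifs <;> simp
  omega

/-- The second moment of a multilinear expression in the `gₙ` without pairings. -/
lemma integral_norm_sum_monomial_sq_le (d : ℕ) : ∃ C : ℝ, 0 ≤ C ∧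
    ∀ (J : Finset (Fin d → ℤ)) (_ : ∀ n ∈ J, ∀ i j, n i + n j ≠ 0) (m : (Fin d → ℤ) → ℂ),
      Integrable (fun z => ‖∑ n ∈ J, m n * monomial n z‖ ^ 2) noise ∧
      ∫ z, ‖∑ n ∈ J, m n * monomial n z‖ ^ 2 ∂noise ≤ C * ∑ n ∈ J, ‖m n‖ ^ 2 := by
  classical
  rcases Nat.eq_zero_or_pos d with rfl | hd
  · refine ⟨1, zero_le_one, fun J _ m => ?_⟩
    have hJ : ∀ z, ‖∑ n ∈ J, m n * monomial n z‖ ^ 2 = ∑ n ∈ J, ‖m n‖ ^ 2 := by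
      intro z
      rcases J.eq_empty_or_nonempty with rfl | ⟨n, hn⟩
      · simp
      · have : J = {n} := Finset.eq_singleton_iff_unique_mem.mpr
          ⟨hn, fun x _ => Subsingleton.elim _ _⟩
        simp [this, monomial]
    simp [hJ]
  set D : ℝ := d * gaussMoment (2 * d) with hD
  have hD0 : 0 ≤ D := mul_nonneg (Nat.cast_nonneg _) (gaussMoment_nonneg _)
  refine ⟨D * (d : ℝ) ^ d, by positivity, fun J hJ m => ?_⟩
  have hint2 := fun n : Fin d → ℤ => integrable_norm_monomial_sq hd n
  have hmeas : ∀ n n' : Fin d → ℤ, Measurable fun z => monomial n z * conj (monomial n' z) :=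
    fun n n' => (measurable_monomial n).mul
      (Complex.continuous_conj.measurable.comp (measurable_monomial n'))
  have hpt : ∀ (n n' : Fin d → ℤ) z, ‖monomial n z * conj (monomial n' z)‖
      ≤ (‖monomial n z‖ ^ 2 + ‖monomial n' z‖ ^ 2) / 2 := by
    intro n n' z
    rw [norm_mul, RCLike.norm_conj]
    nlinarith [sq_nonneg (‖monomial n z‖ - ‖monomial n' z‖)]
  have hint : ∀ n n' : Fin d → ℤ, Integrable (fun z => monomial n z * conj (monomial n' z)) noise :=
    fun n n' => (((hint2 n).add (hint2 n')).div_const 2).mono'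
      (hmeas n n').aestronglyMeasurable (ae_of_all _ (hpt n n'))
  have hbd : ∀ n n' : Fin d → ℤ, ‖∫ z, monomial n z * conj (monomial n' z) ∂noise‖ ≤ D := by
    intro n n'
    refine (norm_integral_le_integral_norm _).trans ?_
    refine (integral_mono (hint n n').norm (((hint2 n).add (hint2 n')).div_const 2)
      (hpt n n')).trans ?_
    simp only [Pi.add_apply]
    rw [integral_div, integral_add (hint2 n) (hint2 n')]
    have h1 := integral_norm_monomial_sq_le hd n
    have h2 := integral_norm_monomial_sq_le hd n'
    linarith
  -- Two monomials that are not orthogonal have the same charges. Without pairings the positive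
  -- charges determine the set of frequencies.
  have hrel : ∀ n ∈ J, ∀ n' ∈ J, Finset.univ.image n ≠ Finset.univ.image n' →
      ∫ z, monomial n z * conj (monomial n' z) ∂noise = 0 := by
    intro n hn n' hn' hne
    by_contra hcon
    refine hne ?_
    have hch : ∀ a ≠ 0, charge a n = charge a n' := fun a ha => by
      by_contra hc; exact hcon (integral_monomial_mul_conj ha hc)
    have hnz : ∀ n ∈ J, ∀ j, n j ≠ 0 := fun n hn j h => hJ n hn j j (by rw [h, add_zero])
    ext a
    simp only [Finset.mem_image, Finset.mem_univ, true_and]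
    constructor
    · rintro ⟨j, rfl⟩
      exact mem_range_of_charge_pos (by rw [← hch _ (hnz n hn j)]; exact charge_pos (hJ n hn) j)
    · rintro ⟨j, rfl⟩
      exact mem_range_of_charge_pos (by rw [hch _ (hnz n' hn' j)]; exact charge_pos (hJ n' hn') j)
  -- A tuple with the same set of frequencies is `n ∘ σ` for some map `σ` of `Fin d`, and there are
  -- `d^d` such maps.
  have hcard : ∀ n ∈ J, ((J.filter fun n' => Finset.univ.image n = Finset.univ.image n').card : ℝ)
      ≤ (d : ℝ) ^ d := by
    intro n _
    have h1 : (J.filter fun n' => Finset.univ.image n = Finset.univ.image n')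
        ⊆ Finset.univ.image fun σ : Fin d → Fin d => n ∘ σ := by
      intro n' hn'
      rw [Finset.mem_filter] at hn'
      have h2 : ∀ i, ∃ j, n j = n' i := by
        intro i
        have : n' i ∈ Finset.univ.image n := by
          rw [hn'.2]; exact Finset.mem_image_of_mem _ (Finset.mem_univ i)
        simpa using this
      choose σ hσ using h2
      exact Finset.mem_image.mpr ⟨σ, Finset.mem_univ _, funext hσ⟩
    have h3 := (Finset.card_le_card h1).trans Finset.card_image_le
    rw [Finset.card_univ, Fintype.card_pi_const, Fintype.card_fin] at h3
    exact_mod_cast h3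
  have hexp : ∀ z, ((‖∑ n ∈ J, m n * monomial n z‖ ^ 2 : ℝ) : ℂ)
      = ∑ n ∈ J, ∑ n' ∈ J, m n * conj (m n') * (monomial n z * conj (monomial n' z)) := by
    intro z
    rw [Complex.ofReal_pow, ← Complex.mul_conj', map_sum, Finset.sum_mul_sum]
    refine Finset.sum_congr rfl fun n _ => Finset.sum_congr rfl fun n' _ => ?_
    rw [map_mul]; ring
  have hintC : Integrable (fun z => ((‖∑ n ∈ J, m n * monomial n z‖ ^ 2 : ℝ) : ℂ)) noise := by
    simp only [hexp]
    exact integrable_finsetSum _ fun n _ => integrable_finsetSum _ fun n' _ =>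
      (hint n n').const_mul _
  have hintR : Integrable (fun z => ‖∑ n ∈ J, m n * monomial n z‖ ^ 2) noise := by
    have h := hintC.re
    simpa only [RCLike.re_to_complex, Complex.ofReal_re] using h
  refine ⟨hintR, ?_⟩
  have h1 : ((∫ z, ‖∑ n ∈ J, m n * monomial n z‖ ^ 2 ∂noise : ℝ) : ℂ)
      = ∑ n ∈ J, ∑ n' ∈ J, m n * conj (m n')
        * ∫ z, monomial n z * conj (monomial n' z) ∂noise := by
    rw [← integral_complex_ofReal]
    simp only [hexp]
    rw [integral_finsetSum _ fun n _ => integrable_finsetSum _ fun n' _ =>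
      (hint n n').const_mul _]
    refine Finset.sum_congr rfl fun n _ => ?_
    rw [integral_finsetSum _ fun n' _ => (hint n n').const_mul _]
    simp only [integral_const_mul]
  have h0 : 0 ≤ ∫ z, ‖∑ n ∈ J, m n * monomial n z‖ ^ 2 ∂noise :=
    integral_nonneg fun z => by positivity
  calc ∫ z, ‖∑ n ∈ J, m n * monomial n z‖ ^ 2 ∂noise
      = ‖((∫ z, ‖∑ n ∈ J, m n * monomial n z‖ ^ 2 ∂noise : ℝ) : ℂ)‖ := by
        rw [Complex.norm_real, Real.norm_of_nonneg h0]
    _ ≤ ∑ n ∈ J, ∑ n' ∈ J, if Finset.univ.image n = Finset.univ.image n' then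
          (‖m n‖ ^ 2 + ‖m n'‖ ^ 2) / 2 * D else 0 := by
        rw [h1]
        refine (norm_sum_le _ _).trans (Finset.sum_le_sum fun n hn => ?_)
        refine (norm_sum_le _ _).trans (Finset.sum_le_sum fun n' hn' => ?_)
        split_ifs with h
        · rw [norm_mul, norm_mul, RCLike.norm_conj]
          refine mul_le_mul ?_ (hbd n n') (norm_nonneg _) (by positivity)
          nlinarith [sq_nonneg (‖m n‖ - ‖m n'‖)]
        · rw [hrel n hn n' hn' h]; simp
    _ = ∑ n ∈ J, ∑ n' ∈ J, if Finset.univ.image n = Finset.univ.image n' then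
          ‖m n‖ ^ 2 * D else 0 := by
        -- The relation is symmetric, so the average of the two squares may be replaced by the first
        -- one.
        have hsymm : ∑ n ∈ J, ∑ n' ∈ J, (if Finset.univ.image n = Finset.univ.image n' then
              ‖m n'‖ ^ 2 * D else 0)
            = ∑ n ∈ J, ∑ n' ∈ J, if Finset.univ.image n = Finset.univ.image n' then
              ‖m n‖ ^ 2 * D else 0 := by
          rw [Finset.sum_comm]
          refine Finset.sum_congr rfl fun n _ => Finset.sum_congr rfl fun n' _ => ?_
          simp only [eq_comm]
        have hsplit : ∀ n n' : Fin d → ℤ, (if Finset.univ.image n = Finset.univ.image n' then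
              (‖m n‖ ^ 2 + ‖m n'‖ ^ 2) / 2 * D else 0)
            = (1 / 2) * (if Finset.univ.image n = Finset.univ.image n' then ‖m n‖ ^ 2 * D else 0)
              + (1 / 2) * (if Finset.univ.image n = Finset.univ.image n' then
                  ‖m n'‖ ^ 2 * D else 0) := by
          intro n n'; split_ifs <;> ring
        simp only [hsplit, Finset.sum_add_distrib, ← Finset.mul_sum]
        rw [hsymm]; ring
    _ = ∑ n ∈ J, ((J.filter fun n' => Finset.univ.image n = Finset.univ.image n').card : ℝ)
          * (‖m n‖ ^ 2 * D) := by
        refine Finset.sum_congr rfl fun n _ => ?_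
        rw [← Finset.sum_filter, Finset.sum_const, nsmul_eq_mul]
    _ ≤ ∑ n ∈ J, (d : ℝ) ^ d * (‖m n‖ ^ 2 * D) := by
        refine Finset.sum_le_sum fun n hn => ?_
        exact mul_le_mul_of_nonneg_right (hcard n hn) (by positivity)
    _ = D * (d : ℝ) ^ d * ∑ n ∈ J, ‖m n‖ ^ 2 := by
        rw [Finset.mul_sum]
        exact Finset.sum_congr rfl fun n _ => by ring

end Noise

end

section

open TrigPoly
open scoped ENNReal NNReal

/-! ### The truncated random series -/

/-- The partial sum of the random series. -/
def series (lam : ℝ) (N : ℕ) (z : ℕ → ℂ) : TrigPoly :=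
  ∑ n ∈ Finset.Icc (-(N : ℤ)) N, AddMonoidAlgebra.single n (seriesCoeff lam z n)

section Series

variable {lam : ℝ} {N : ℕ}

lemma coeff_series (lam : ℝ) (N : ℕ) (z : ℕ → ℂ) (n : ℤ) :
    (series lam N z).coeff n
      = if n ∈ Finset.Icc (-(N : ℤ)) N then seriesCoeff lam z n else 0 := by
  rw [series, AddMonoidAlgebra.coeff_sum, Finsupp.finsetSum_apply]
  simp only [AddMonoidAlgebra.coeff_single, Finsupp.single_apply, Finset.sum_ite_eq']

lemma seriesCoeff_zero (lam : ℝ) (z : ℕ → ℂ) : seriesCoeff lam z 0 = 0 := by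
  simp [seriesCoeff, g_zero]

lemma coeff_series_zero (lam : ℝ) (N : ℕ) (z : ℕ → ℂ) : (series lam N z).coeff 0 = 0 := by
  rw [coeff_series, seriesCoeff_zero, ite_self]

lemma isReal_series (lam : ℝ) (N : ℕ) (z : ℕ → ℂ) : IsReal (series lam N z) := by
  intro n
  rw [coeff_series, coeff_series, seriesCoeff_neg]
  have : -n ∈ Finset.Icc (-(N : ℤ)) N ↔ n ∈ Finset.Icc (-(N : ℤ)) N := by
    simp only [Finset.mem_Icc]; omega
  simp only [this]
  split_ifs <;> simp

lemma coeff_series_of_lt (z : ℕ → ℂ) {n : ℤ} (hn : (N : ℝ) < |(n : ℝ)|) :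
    (series lam N z).coeff n = 0 := by
  rw [coeff_series, if_neg]
  intro h
  rw [Finset.mem_Icc] at h
  have : |(n : ℝ)| ≤ N := abs_le.mpr ⟨by exact_mod_cast h.1, by exact_mod_cast h.2⟩
  linarith

lemma support_series_subset (z : ℕ → ℂ) :
    (series lam N z).coeff.support ⊆ Finset.Icc (-(N : ℤ)) N := by
  intro n hn
  by_contra h
  rw [Finsupp.mem_support_iff, coeff_series, if_neg h] at hn
  exact hn rfl

lemma support_multiplier_subset (m : ℤ → ℂ) {p : TrigPoly} {S : Finset ℤ}
    (h : p.coeff.support ⊆ S) : (multiplier m p).coeff.support ⊆ S := by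
  intro n hn
  refine h ?_
  rw [Finsupp.mem_support_iff] at hn ⊢
  rw [coeff_multiplier] at hn
  exact right_ne_zero_of_mul hn

lemma norm_seriesCoeff (lam : ℝ) (z : ℕ → ℂ) (n : ℤ) :
    ‖seriesCoeff lam z n‖ = ‖g z n‖ / (√(4 * Real.pi * lam) * |(n : ℝ)| ^ (3 / 2 : ℝ)) := by
  rw [seriesCoeff, norm_div, Complex.norm_real, Real.norm_of_nonneg (by positivity)]

/-- The coefficient at `n` has variance at most `|n|⁻³ / (4πλ)`, whence the exponent `2s - 3`. The
zero mode drops out since `g` vanishes there. -/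
lemma sq_sob_multiplier_series (hlam : 0 < lam) (s : ℝ) (m : ℤ → ℂ) (z : ℕ → ℂ) :
    sob s (multiplier m (series lam N z)) ^ 2
      = ∑ n ∈ Finset.Icc (-(N : ℤ)) N,
        (|(n : ℝ)| ^ (2 * s - 3) * ‖m n‖ ^ 2 / (4 * Real.pi * lam)) * ‖g z n‖ ^ 2 := by
  rw [sq_sob s (support_multiplier_subset m (support_series_subset z))]
  refine Finset.sum_congr rfl fun n hn => ?_
  rw [coeff_multiplier, coeff_series, if_pos hn, norm_mul, norm_seriesCoeff]
  rcases eq_or_ne n 0 with rfl | h0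
  · simp [g_zero]
  · have h1 : 0 < |(n : ℝ)| := abs_pos.mpr (Int.cast_ne_zero.mpr h0)
    have h2 : |(n : ℝ)| ^ (2 * s - 3)
        = (|(n : ℝ)| ^ s) ^ 2 / (|(n : ℝ)| ^ (3 / 2 : ℝ)) ^ 2 := by
      rw [Real.rpow_sub h1, abs_rpow_two_mul, ← abs_rpow_two_mul n (3 / 2)]
      norm_num
    rw [h2, mul_pow, mul_pow, div_pow, mul_pow, Real.sq_sqrt (by positivity)]
    field_simp

end Series

/-! ### Measurability -/

/-- A random trigonometric polynomial of bounded degree with measurable coefficients. -/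
structure CoeffMeasurable {Ω : Type*} [MeasurableSpace Ω] (p : Ω → TrigPoly) : Prop where
  bounded : ∃ s : Finset ℤ, ∀ z, (p z).coeff.support ⊆ s
  measurable : ∀ n, Measurable fun z => (p z).coeff n

namespace CoeffMeasurable

variable {Ω : Type*} [MeasurableSpace Ω] {p q : Ω → TrigPoly}

lemma mul (hp : CoeffMeasurable p) (hq : CoeffMeasurable q) :
    CoeffMeasurable fun z => p z * q z := by
  classical
  obtain ⟨s, hs⟩ := hp.bounded
  obtain ⟨s', hs'⟩ := hq.bounded
  refine ⟨⟨Finset.image₂ (· + ·) s s', fun τ => ?_⟩, fun n => ?_⟩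
  · exact (AddMonoidAlgebra.support_coeff_mul_subset _ _).trans
      (Finset.add_subset_add (hs τ) (hs' τ))
  · have : (fun τ => (p τ * q τ).coeff n)
        = fun τ => ∑ k ∈ s, (p τ).coeff k * (q τ).coeff (n - k) := by
      funext τ; exact coeff_mul_eq_sum (hs τ) n
    rw [this]
    exact Finset.measurable_fun_sum _ fun k _ => (hp.measurable k).mul (hq.measurable _)

lemma multiplier (hp : CoeffMeasurable p) (m : ℤ → ℂ) :
    CoeffMeasurable fun z => TrigPoly.multiplier m (p z) := by
  obtain ⟨s, hs⟩ := hp.bounded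
  refine ⟨⟨s, fun z => support_multiplier_subset m (hs z)⟩, fun n => ?_⟩
  simpa using (hp.measurable n).const_mul (m n)

lemma dx (hp : CoeffMeasurable p) : CoeffMeasurable fun z => TrigPoly.dx (p z) := hp.multiplier _
lemma hilbert (hp : CoeffMeasurable p) (κ : ℝ) :
    CoeffMeasurable fun z => TrigPoly.hilbert κ (p z) := hp.multiplier _
lemma smooth (hp : CoeffMeasurable p) (φ : ℝ → ℝ) (N : ℕ) :
    CoeffMeasurable fun z => TrigPoly.smooth φ N (p z) := hp.multiplier _

lemma sub (hp : CoeffMeasurable p) (hq : CoeffMeasurable q) :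
    CoeffMeasurable fun z => p z - q z := by
  classical
  obtain ⟨s, hs⟩ := hp.bounded
  obtain ⟨s', hs'⟩ := hq.bounded
  refine ⟨⟨s ∪ s', fun z n hn => ?_⟩, fun n => ?_⟩
  · rw [Finset.mem_union]
    by_contra hcon
    push Not at hcon
    have h1 := Finsupp.notMem_support_iff.mp fun h => hcon.1 (hs z h)
    have h2 := Finsupp.notMem_support_iff.mp fun h => hcon.2 (hs' z h)
    rw [Finsupp.mem_support_iff] at hn
    simp [h1, h2] at hn
  · simp only [AddMonoidAlgebra.coeff_sub, Finsupp.sub_apply]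
    exact (hp.measurable n).sub (hq.measurable n)

lemma pow (hp : CoeffMeasurable p) (k : ℕ) : CoeffMeasurable fun z => p z ^ (k + 1) := by
  induction k with
  | zero => simpa using hp
  | succ k ih => simp only [pow_succ _ (k + 1)]; exact ih.mul hp

lemma mean (hp : CoeffMeasurable p) : Measurable fun z => TrigPoly.mean (p z) := hp.measurable 0

lemma integral (hp : CoeffMeasurable p) (lam : ℝ) :
    Measurable fun z => TrigPoly.integral lam (p z) := by
  simp only [integral_eq_mean]
  exact (Complex.measurable_re.comp hp.mean).const_mul _

lemma sob (hp : CoeffMeasurable p) (s : ℝ) : Measurable fun z => TrigPoly.sob s (p z) := by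
  obtain ⟨S, hS⟩ := hp.bounded
  have : (fun z => TrigPoly.sob s (p z))
      = fun z => √(∑ n ∈ S, (|(n : ℝ)| ^ s * ‖(p z).coeff n‖) ^ 2) :=
    funext fun z => sob_eq_sqrt s (hS z)
  rw [this]
  refine (Finset.measurable_fun_sum _ fun n _ => ?_).sqrt
  exact ((hp.measurable n).norm.const_mul _).pow_const 2

lemma normSq (hp : CoeffMeasurable p) (lam s : ℝ) :
    Measurable fun z => TrigPoly.normSq lam s (p z) := by
  simp only [normSq_eq_sob]
  exact ((hp.sob s).pow_const 2).const_mul _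

lemma energyOne (hp : CoeffMeasurable p) (κ lam : ℝ) :
    Measurable fun z => TrigPoly.energyOne κ lam (p z) := by
  unfold TrigPoly.energyOne
  exact ((hp.normSq lam 1).add ((((hp.pow 1).mul (hp.dx.hilbert κ)).integral lam).const_mul _)).add
    (((hp.pow 3).integral lam).const_mul _)

lemma energyThreeHalves (hp : CoeffMeasurable p) (κ lam : ℝ) :
    Measurable fun z => TrigPoly.energyThreeHalves κ lam (p z) := by
  unfold TrigPoly.energyThreeHalves
  refine (hp.normSq lam _).add (Measurable.const_mul (Measurable.add (Measurable.add ?_ ?_) ?_) _)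
  · exact (((hp.mul (hp.dx.pow 1)).integral lam).const_mul _).add
      (((hp.mul ((hp.dx.hilbert κ).pow 1)).integral lam).const_mul _)
  · exact ((((hp.pow 2).mul (hp.dx.hilbert κ)).integral lam).const_mul _).add
      ((((hp.pow 1).mul ((hp.mul hp.dx).hilbert κ)).integral lam).const_mul _)
  · exact ((hp.pow 4).integral lam).const_mul _

end CoeffMeasurable

lemma measurable_seriesCoeff (lam : ℝ) (n : ℤ) : Measurable fun z => seriesCoeff lam z n := by
  unfold seriesCoeff; exact (measurable_g n).div_const _

lemma coeffMeasurable_series (lam : ℝ) (N : ℕ) : CoeffMeasurable (series lam N) := by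
  refine ⟨⟨_, support_series_subset⟩, fun n => ?_⟩
  simp only [coeff_series]
  split_ifs
  · exact measurable_seriesCoeff lam n
  · exact measurable_const

/-! ### Moments -/

section Moments

variable {lam : ℝ}

/-- The moments of a Sobolev norm of the random series, after application of a multiplier. -/
lemma integral_sob_multiplier_pow_le (hlam : 0 < lam) (N : ℕ) (s : ℝ) (m : ℤ → ℂ) (k : ℕ) :
    Integrable (fun z => sob s (multiplier m (series lam N z)) ^ (2 * k)) noise ∧
    ∫ z, sob s (multiplier m (series lam N z)) ^ (2 * k) ∂noise
      ≤ (∑ n ∈ Finset.Icc (-(N : ℤ)) N, |(n : ℝ)| ^ (2 * s - 3) * ‖m n‖ ^ 2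
          / (4 * Real.pi * lam)) ^ k * gaussMoment (2 * k) := by
  simp only [pow_mul, sq_sob_multiplier_series hlam]
  exact ⟨integrable_quadratic_pow _ _ _ fun n _ => by positivity, by
    simpa only [pow_mul] using integral_quadratic_pow_le (Finset.Icc (-(N : ℤ)) N)
      (fun n => |(n : ℝ)| ^ (2 * s - 3) * ‖m n‖ ^ 2 / (4 * Real.pi * lam)) k
      fun n _ => by positivity⟩

/-- All moments of the `H^{7/8}` norm of the random series are bounded. -/
lemma integral_one_add_sob_pow_le (hlam : 0 < lam) (k : ℕ) : ∃ C : ℝ, 0 ≤ C ∧ ∀ N : ℕ,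
    Integrable (fun z => (1 + sob (7 / 8) (series lam N z)) ^ k) noise ∧
    ∫ z, (1 + sob (7 / 8) (series lam N z)) ^ k ∂noise ≤ C := by
  set A : ℝ := (∑' n : ℤ, |(n : ℝ)| ^ (-5 / 4 : ℝ)) / (4 * Real.pi * lam) with hA
  have hA0 : 0 ≤ A := div_nonneg (tsum_nonneg fun n => by positivity) (by positivity)
  refine ⟨2 ^ (2 * k - 1) * (1 + A ^ k * gaussMoment (2 * k)), ?_, fun N => ?_⟩
  · have := gaussMoment_nonneg (2 * k); positivity
  have h := integral_sob_multiplier_pow_le hlam N (7 / 8) (fun _ => 1) k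
  simp only [multiplier_one] at h
  have hpt : ∀ z, (1 + sob (7 / 8) (series lam N z)) ^ k
      ≤ 2 ^ (2 * k - 1) * (1 + sob (7 / 8) (series lam N z) ^ (2 * k)) := by
    intro z
    have h0 := sob_nonneg (7 / 8) (series lam N z)
    calc _ ≤ (1 + sob (7 / 8) (series lam N z)) ^ (2 * k) :=
          pow_le_pow_right₀ (by linarith) (by omega)
      _ ≤ _ := by simpa using add_pow_le zero_le_one h0 (2 * k)
  have hint : Integrable (fun z => 2 ^ (2 * k - 1) * (1 + sob (7 / 8) (series lam N z) ^ (2 * k)))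
      noise := ((integrable_const 1).add h.1).const_mul _
  have hint' : Integrable (fun z => (1 + sob (7 / 8) (series lam N z)) ^ k) noise := by
    refine hint.mono' ((((coeffMeasurable_series lam N).sob (7 / 8)).const_add 1).pow_const k
      |>.aestronglyMeasurable) (ae_of_all _ fun z => ?_)
    rw [Real.norm_of_nonneg (pow_nonneg (by linarith [sob_nonneg (7 / 8) (series lam N z)]) _)]
    exact hpt z
  refine ⟨hint', (integral_mono hint' hint hpt).trans ?_⟩
  rw [integral_const_mul, integral_add (integrable_const 1) h.1]
  simp only [integral_const, probReal_univ, one_smul]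
  gcongr
  refine h.2.trans ?_
  have := gaussMoment_nonneg (2 * k)
  gcongr
  rw [hA, ← Finset.sum_div]
  gcongr
  have e : ∀ n : ℤ, |(n : ℝ)| ^ (2 * (7 / 8 : ℝ) - 3) * ‖(1 : ℂ)‖ ^ 2
      = |(n : ℝ)| ^ (-5 / 4 : ℝ) := by intro n; norm_num
  simp only [e]
  exact (summable_abs_rpow (by norm_num)).sum_le_tsum _ fun n _ => by positivity

/-- There are at most `2 (2εN + 1)` integers with `(1 - 2ε) N < |n| ≤ N`. Each contributes `1/|n| ≤
2/N`, because `ε ≤ 1/4` keeps `|n|` above `N/2`. -/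
lemma sum_highPart_le {ε : ℝ} (hε : 0 < ε) (hε4 : ε ≤ 1 / 4) {N : ℕ} (hN : 0 < N) :
    ∑ n ∈ Finset.Icc (-(N : ℤ)) N, |(n : ℝ)| ^ (2 * (1 : ℝ) - 3)
        * ‖(if (1 - 2 * ε) * N < |(n : ℝ)| then 1 else 0 : ℂ)‖ ^ 2
      ≤ 8 * ε + 4 / N := by
  classical
  have hN' : (0 : ℝ) < N := by exact_mod_cast hN
  set M : ℝ := (1 - 2 * ε) * N with hM
  have hM2 : (N : ℝ) / 2 ≤ M := by rw [hM]; nlinarith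
  set k : ℕ := ⌊M⌋₊ with hk
  have hkM : (k : ℝ) ≤ M := Nat.floor_le (by linarith)
  have hMk : M < k + 1 := Nat.lt_floor_add_one M
  have hsub : ∀ n ∈ Finset.Icc (-(N : ℤ)) N, M < |(n : ℝ)| →
      n ∈ Finset.Icc (k + 1 : ℤ) N ∪ Finset.Icc (-(N : ℤ)) (-(k + 1)) := by
    intro n hn hMn
    rw [Finset.mem_Icc] at hn
    have h1 : (k : ℝ) < |(n : ℝ)| := lt_of_le_of_lt hkM hMn
    have h2 : (k : ℤ) < |n| := by exact_mod_cast h1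
    rw [Finset.mem_union, Finset.mem_Icc, Finset.mem_Icc]
    rcases abs_cases n with h | h <;> omega
  calc _ ≤ ∑ n ∈ Finset.Icc (k + 1 : ℤ) N ∪ Finset.Icc (-(N : ℤ)) (-(k + 1)), 2 / (N : ℝ) := by
        rw [← Finset.sum_filter_add_sum_filter_not _ fun n : ℤ => M < |(n : ℝ)|]
        rw [Finset.sum_eq_zero (s := Finset.filter (fun n : ℤ => ¬ M < |(n : ℝ)|) _), add_zero]
        · refine (Finset.sum_le_sum fun n hn => ?_).trans
            (Finset.sum_le_sum_of_subset_of_nonneg (fun n hn => ?_) fun _ _ _ => by positivity)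
          · rw [Finset.mem_filter] at hn
            rw [if_pos hn.2, norm_one, one_pow, mul_one]
            have h3 : (N : ℝ) / 2 ≤ |(n : ℝ)| := hM2.trans hn.2.le
            have h4 : |(n : ℝ)| ^ (2 * (1 : ℝ) - 3) = |(n : ℝ)|⁻¹ := by
              rw [show (2 * (1 : ℝ) - 3) = -1 by norm_num, Real.rpow_neg_one]
            rw [h4, ← inv_div]
            exact inv_anti₀ (by positivity) h3
          · rw [Finset.mem_filter] at hn
            exact hsub n hn.1 hn.2
        · intro n hn
          rw [Finset.mem_filter] at hn
          rw [if_neg hn.2]; simp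
    _ ≤ (2 * (2 * ε * N + 1)) * (2 / N) := by
        rw [Finset.sum_const, nsmul_eq_mul]
        refine mul_le_mul_of_nonneg_right ?_ (by positivity)
        have h5 : k ≤ N := by
          have : (k : ℝ) ≤ N := hkM.trans (by rw [hM]; nlinarith)
          exact_mod_cast this
        have h6 := Finset.card_union_le (Finset.Icc (k + 1 : ℤ) N)
          (Finset.Icc (-(N : ℤ)) (-(k + 1)))
        rw [Int.card_Icc, Int.card_Icc] at h6
        have h7 : (Finset.Icc (k + 1 : ℤ) N ∪ Finset.Icc (-(N : ℤ)) (-(k + 1))).card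
            ≤ 2 * (N - k) := by omega
        have h8 : ((Finset.Icc (k + 1 : ℤ) N ∪ Finset.Icc (-(N : ℤ)) (-(k + 1))).card : ℝ)
            ≤ 2 * (N - k) := by
          have : ((N - k : ℕ) : ℝ) = N - k := Nat.cast_sub h5
          rw [← this]; exact_mod_cast h7
        rw [hM] at hMk
        nlinarith
    _ = 8 * ε + 4 / N := by field_simp; ring

/-- The high frequencies carry little of the logarithmically divergent `H¹` norm. -/
lemma integral_sob_highPart_pow_le (hlam : 0 < lam) : ∃ C : ℝ, 0 ≤ C ∧
    ∀ (ε : ℝ) (_ : 0 < ε) (_ : ε ≤ 1 / 4) (N : ℕ) (_ : 0 < N),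
    Integrable (fun z => sob 1 (highPart ((1 - 2 * ε) * N) (series lam N z)) ^ 8) noise ∧
    ∫ z, sob 1 (highPart ((1 - 2 * ε) * N) (series lam N z)) ^ 8 ∂noise
      ≤ C * (ε + 1 / N) ^ 4 := by
  refine ⟨(8 / (4 * Real.pi * lam)) ^ 4 * gaussMoment 8, mul_nonneg (by positivity)
    (gaussMoment_nonneg _), fun ε hε hε4 N hN => ?_⟩
  have h := integral_sob_multiplier_pow_le hlam N 1
    (fun n => if (1 - 2 * ε) * N < |(n : ℝ)| then 1 else 0) 4
  refine ⟨h.1, h.2.trans ?_⟩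
  rw [mul_right_comm (_ ^ 4) (gaussMoment 8), ← mul_pow, ← Finset.sum_div]
  have hN' : (0 : ℝ) < N := by exact_mod_cast hN
  refine mul_le_mul_of_nonneg_right (pow_le_pow_left₀ (div_nonneg (Finset.sum_nonneg fun _ _ =>
    by positivity) (by positivity)) ?_ 4) (gaussMoment_nonneg _)
  rw [div_mul_eq_mul_div]
  refine div_le_div_of_nonneg_right ((sum_highPart_le hε hε4 hN).trans ?_) (by positivity)
  have : 0 < 1 / (N : ℝ) := by positivity
  have h4 : 4 / (N : ℝ) = 4 * (1 / N) := by ring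
  rw [h4]; nlinarith

/-- The second moment of a multilinear expression without pairings, over a general index set. -/
lemma integral_norm_sum_monomial_sq_le' (d : ℕ) : ∃ C : ℝ, 0 ≤ C ∧
    ∀ {ι : Type} (J : Finset ι) (e : ι → Fin d → ℤ) (_ : Set.InjOn e J)
      (_ : ∀ x ∈ J, ∀ i j, e x i + e x j ≠ 0) (m : ι → ℂ),
      Integrable (fun z => ‖∑ x ∈ J, m x * monomial (e x) z‖ ^ 2) noise ∧
      ∫ z, ‖∑ x ∈ J, m x * monomial (e x) z‖ ^ 2 ∂noise ≤ C * ∑ x ∈ J, ‖m x‖ ^ 2 := by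
  classical
  obtain ⟨C, hC, h⟩ := integral_norm_sum_monomial_sq_le d
  refine ⟨C, hC, fun {ι} J e he hJ m => ?_⟩
  rcases isEmpty_or_nonempty ι with hι | hι
  · have : J = ∅ := Finset.eq_empty_of_isEmpty J
    subst this; simp
  have h1 := h (J.image e) (by
    intro n hn
    obtain ⟨x, hx, rfl⟩ := Finset.mem_image.mp hn
    exact hJ x hx) (fun n => m (Function.invFunOn e J n))
  have h2 : ∀ x ∈ J, Function.invFunOn e J (e x) = x := fun x hx =>
    he.leftInvOn_invFunOn hx
  have h3 : ∀ z, ∑ n ∈ J.image e, m (Function.invFunOn e J n) * monomial n z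
      = ∑ x ∈ J, m x * monomial (e x) z := by
    intro z
    rw [Finset.sum_image he]
    exact Finset.sum_congr rfl fun x hx => by rw [h2 x hx]
  have h4 : ∑ n ∈ J.image e, ‖m (Function.invFunOn e J n)‖ ^ 2 = ∑ x ∈ J, ‖m x‖ ^ 2 := by
    rw [Finset.sum_image he]
    exact Finset.sum_congr rfl fun x hx => by rw [h2 x hx]
  simpa only [h3, h4] using h1

/-- Negative regularity of the square of a multiple of the derivative of the random series. -/
lemma integral_sob_sq_multiplier_le (hlam : 0 < lam) : ∃ C : ℝ, 0 ≤ C ∧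
    ∀ (N : ℕ) (m : ℤ → ℂ) (_ : ∀ n : ℤ, ‖m n‖ ≤ |(n : ℝ)|),
    Integrable (fun z => sob (-(3 / 2)) (multiplier m (series lam N z)
      * multiplier m (series lam N z)) ^ 2) noise ∧
    ∫ z, sob (-(3 / 2)) (multiplier m (series lam N z) * multiplier m (series lam N z)) ^ 2 ∂noise
      ≤ C := by
  classical
  obtain ⟨C, hC, hmom⟩ := integral_norm_sum_monomial_sq_le' 2
  set T2 : ℝ := ∑' n : ℤ, |(n : ℝ)| ^ (-2 : ℝ) with hT2
  set T3 : ℝ := ∑' n : ℤ, |(n : ℝ)| ^ (-3 : ℝ) with hT3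
  have hT20 : 0 ≤ T2 := tsum_nonneg fun n => by positivity
  have hT30 : 0 ≤ T3 := tsum_nonneg fun n => by positivity
  set K : ℝ := (4 * Real.pi * lam)⁻¹ with hK
  have hK0 : 0 < K := by positivity
  refine ⟨T3 * (C * (K ^ 2 * T2)), by positivity, fun N m hm => ?_⟩
  set S := Finset.Icc (-(N : ℤ)) N with hS
  set S2 := Finset.Icc (-(2 * N : ℤ)) (2 * N) with hS2
  let a : ℤ → ℂ := fun n => m n / ((√(4 * Real.pi * lam) * |(n : ℝ)| ^ (3 / 2 : ℝ) : ℝ) : ℂ)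
  -- The decompositions `n = k + (n - k)` into nonzero frequencies; those with a zero frequency
  -- contribute nothing since `g z 0 = 0`.
  let J : ℤ → Finset ℤ := fun n => S.filter fun k => n - k ∈ S ∧ k ≠ 0 ∧ n - k ≠ 0
  have hanorm : ∀ n : ℤ, n ≠ 0 → ‖a n‖ ^ 2 ≤ K * |(n : ℝ)|⁻¹ := by
    intro n hn
    have h1 : 0 < |(n : ℝ)| := abs_pos.mpr (Int.cast_ne_zero.mpr hn)
    have h2 : (|(n : ℝ)| ^ (3 / 2 : ℝ)) ^ 2 = |(n : ℝ)| ^ 3 := by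
      rw [← abs_rpow_two_mul, ← Real.rpow_natCast]; norm_num
    simp only [a]
    rw [norm_div, Complex.norm_real, Real.norm_of_nonneg (by positivity), div_pow, mul_pow,
      Real.sq_sqrt (by positivity), h2, hK, div_le_iff₀ (by positivity)]
    have h3 := pow_le_pow_left₀ (norm_nonneg _) (hm n) 2
    refine h3.trans (le_of_eq ?_)
    field_simp
  have hcoef : ∀ (z : ℕ → ℂ) (k : ℤ), (multiplier m (series lam N z)).coeff k
      = if k ∈ S then a k * g z k else 0 := by
    intro z k
    rw [coeff_multiplier, coeff_series]
    split_ifs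
    · simp only [a, seriesCoeff]; ring
    · simp
  have hsq : ∀ (z : ℕ → ℂ) (n : ℤ), (multiplier m (series lam N z)
      * multiplier m (series lam N z)).coeff n
      = ∑ k ∈ J n, (a k * a (n - k)) * monomial ![k, n - k] z := by
    intro z n
    rw [coeff_mul_eq_sum (support_multiplier_subset m (support_series_subset z)),
      Finset.sum_filter]
    refine Finset.sum_congr rfl fun k hk => ?_
    rw [hcoef, hcoef, if_pos hk]
    split_ifs with h1 h2 h2
    · simp [monomial, Fin.prod_univ_two]; ring
    · rcases eq_or_ne k 0 with rfl | hk0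
      · simp [g_zero]
      · have : n - k = 0 := by by_contra hc; exact h2 ⟨h1, hk0, hc⟩
        simp [this, g_zero]
    · exact absurd h2.1 h1
    · simp
  have hsupp : ∀ z : ℕ → ℂ, (multiplier m (series lam N z)
      * multiplier m (series lam N z)).coeff.support ⊆ S2 := by
    intro z n hn
    by_contra hcon
    refine Finsupp.mem_support_iff.mp hn ?_
    rw [hsq]
    refine Finset.sum_eq_zero fun k hk => ?_
    exfalso
    rw [Finset.mem_filter, hS, Finset.mem_Icc, Finset.mem_Icc] at hk
    rw [hS2, Finset.mem_Icc] at hcon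
    omega
  have hform : ∀ z : ℕ → ℂ, sob (-(3 / 2)) (multiplier m (series lam N z)
      * multiplier m (series lam N z)) ^ 2
      = ∑ n ∈ S2, |(n : ℝ)| ^ (-3 : ℝ)
        * ‖∑ k ∈ J n, (a k * a (n - k)) * monomial ![k, n - k] z‖ ^ 2 := by
    intro z
    rw [sq_sob _ (hsupp z)]
    refine Finset.sum_congr rfl fun n _ => ?_
    rw [mul_pow, ← abs_rpow_two_mul, hsq]
    norm_num
  -- For `n ≠ 0` the pair `k, n - k` has no pairing. The paired terms all sit at `n = 0`, whose
  -- weight `0 ^ (-3)` is zero, so the divergent mean of the square never appears.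
  have hmom' : ∀ n : ℤ, n ≠ 0 → _ := fun n hn => hmom (J n) (fun k => ![k, n - k])
    (fun k _ k' _ h => by simpa using congrFun h 0)
    (fun k hk i j => by
      have hk' := (Finset.mem_filter.mp hk).2
      fin_cases i <;> fin_cases j <;> simp <;> omega)
    (fun k => a k * a (n - k))
  have hint : ∀ n ∈ S2, Integrable (fun z => |(n : ℝ)| ^ (-3 : ℝ)
        * ‖∑ k ∈ J n, (a k * a (n - k)) * monomial ![k, n - k] z‖ ^ 2) noise := by
    intro n _
    rcases eq_or_ne n 0 with rfl | hn
    · simp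
    · exact (hmom' n hn).1.const_mul _
  have hsum : ∀ n : ℤ, n ≠ 0 → ∑ k ∈ J n, ‖a k * a (n - k)‖ ^ 2 ≤ K ^ 2 * T2 := by
    intro n _
    have hs2 : Summable fun k : ℤ => |(k : ℝ)| ^ (-2 : ℝ) := summable_abs_rpow (by norm_num)
    have hs2' : Summable fun k : ℤ => |((n - k : ℤ) : ℝ)| ^ (-2 : ℝ) :=
      hs2.comp_injective (i := fun k : ℤ => n - k) (sub_right_injective)
    have ht2' : ∑' k : ℤ, |((n - k : ℤ) : ℝ)| ^ (-2 : ℝ) = T2 :=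
      (Equiv.subLeft n).tsum_eq fun k : ℤ => |(k : ℝ)| ^ (-2 : ℝ)
    calc ∑ k ∈ J n, ‖a k * a (n - k)‖ ^ 2
        ≤ ∑ k ∈ J n, K ^ 2 * ((|(k : ℝ)| ^ (-2 : ℝ) + |((n - k : ℤ) : ℝ)| ^ (-2 : ℝ)) / 2) := by
          refine Finset.sum_le_sum fun k hk => ?_
          have hk' := (Finset.mem_filter.mp hk).2
          rw [norm_mul, mul_pow]
          have e : ∀ x : ℤ, |(x : ℝ)| ^ (-2 : ℝ) = (|(x : ℝ)|⁻¹) ^ 2 := by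
            intro x
            rw [Real.rpow_neg (abs_nonneg _), Real.rpow_two, inv_pow]
          rw [e, e]
          calc ‖a k‖ ^ 2 * ‖a (n - k)‖ ^ 2
              ≤ (K * |(k : ℝ)|⁻¹) * (K * |((n - k : ℤ) : ℝ)|⁻¹) :=
                mul_le_mul (hanorm k hk'.2.1) (hanorm _ hk'.2.2) (by positivity) (by positivity)
            _ = K ^ 2 * (|(k : ℝ)|⁻¹ * |((n - k : ℤ) : ℝ)|⁻¹) := by ring
            _ ≤ _ := by
                refine mul_le_mul_of_nonneg_left ?_ (by positivity)
                nlinarith [sq_nonneg (|(k : ℝ)|⁻¹ - |((n - k : ℤ) : ℝ)|⁻¹)]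
      _ = K ^ 2 * ((∑ k ∈ J n, |(k : ℝ)| ^ (-2 : ℝ)
            + ∑ k ∈ J n, |((n - k : ℤ) : ℝ)| ^ (-2 : ℝ)) / 2) := by
          rw [← Finset.mul_sum, ← Finset.sum_div, Finset.sum_add_distrib]
      _ ≤ K ^ 2 * ((T2 + T2) / 2) := by
          have h1 := hs2.sum_le_tsum (J n) fun _ _ => by positivity
          have h2 := hs2'.sum_le_tsum (J n) fun _ _ => by positivity
          rw [ht2'] at h2
          gcongr
      _ = _ := by ring
  refine ⟨?_, ?_⟩
  · simp only [hform]
    exact integrable_finsetSum _ hint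
  · simp only [hform]
    rw [integral_finsetSum _ hint]
    calc _ ≤ ∑ n ∈ S2, |(n : ℝ)| ^ (-3 : ℝ) * (C * (K ^ 2 * T2)) := by
          refine Finset.sum_le_sum fun n _ => ?_
          rw [integral_const_mul]
          rcases eq_or_ne n 0 with rfl | hn
          · simp
          · refine mul_le_mul_of_nonneg_left ?_ (by positivity)
            exact (hmom' n hn).2.trans (mul_le_mul_of_nonneg_left (hsum n hn) hC)
      _ = (∑ n ∈ S2, |(n : ℝ)| ^ (-3 : ℝ)) * (C * (K ^ 2 * T2)) := by rw [Finset.sum_mul]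
      _ ≤ _ := by
          refine mul_le_mul_of_nonneg_right ?_ (by positivity)
          exact (summable_abs_rpow (by norm_num)).sum_le_tsum _ fun _ _ => by positivity

end Moments

end

/-! ### Deterministic estimates for the lower order part of the `H^{3/2}` energy -/

section

open TrigPoly
open scoped ENNReal NNReal

lemma young {η : ℝ} (hη : 0 < η) (a b : ℝ) : a * b ≤ η * a ^ 2 + b ^ 2 / (4 * η) := by
  have h : 0 ≤ (2 * η * a - b) ^ 2 / (4 * η) := by positivity
  have e : (2 * η * a - b) ^ 2 / (4 * η) = η * a ^ 2 - a * b + b ^ 2 / (4 * η) := by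
    field_simp; ring
  linarith

/-- Absorption of the terms of low homogeneity in the energy estimate. -/
lemma absorb {θ K : ℝ} (hθ : 0 < θ) (hK : 0 ≤ K) : ∃ C : ℝ, 0 ≤ C ∧
    ∀ D q p r X z : ℝ, 1 ≤ D → 0 ≤ q → 0 ≤ p → 0 ≤ r → 0 ≤ X → 0 ≤ z →
      q ^ 2 ≤ D * p → p ^ 2 ≤ D * X → r ^ 2 ≤ p * X →
      K * (z * X + D * (D + q) * r + (D + q) * p ^ 2 + (D + q) ^ 2 + (D + q) ^ 3)
        ≤ θ * X ^ 2 + C * (D ^ 6 + z ^ 2) := by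
  -- In powers of `X` the interpolation hypotheses say `q ≲ X^{1/4}`, `p ≲ X^{1/2}`, `r ≲ X^{3/4}`,
  -- so every term on the left grows more slowly than `X²` and Young's inequality absorbs it. The
  -- total coefficient found below is `13 K η ≤ θ`.
  set η : ℝ := θ / (40 * (K + 1)) with hη
  have hη0 : 0 < η := by positivity
  set B : ℝ := 1 / η + 1 / η ^ 3 + η + 1 with hB
  refine ⟨40 * K * B, by positivity, fun D q p r X z hD hq hp hr hX hz h1 h2 h3 => ?_⟩
  have hBη : 1 / η ≤ B := by rw [hB]; have : 0 < 1 / η ^ 3 := by positivity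
                             linarith
  have hBη3 : 1 / η ^ 3 ≤ B := by rw [hB]; have : 0 < 1 / η := by positivity
                                  linarith
  have hBη1 : η ≤ B := by rw [hB]; have : 0 < 1 / η := by positivity
                          have : 0 < 1 / η ^ 3 := by positivity
                          linarith
  have hB1 : 1 ≤ B := by rw [hB]; have : 0 < 1 / η := by positivity
                         have : 0 < 1 / η ^ 3 := by positivity
                         linarith
  set P : ℝ := D ^ 6 + z ^ 2 with hP
  have hDk : ∀ k ≤ 6, D ^ k ≤ P := fun k hk => by
    have := pow_le_pow_right₀ hD hk
    rw [hP]; nlinarith [sq_nonneg z]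
  have hzP : z ^ 2 ≤ P := by rw [hP]; have : 0 ≤ D ^ 6 := by positivity
                             linarith
  have hP0 : 0 ≤ P := by positivity
  have yb : ∀ a b : ℝ, b ^ 2 ≤ P → a * b ≤ η * a ^ 2 + B * P := by
    intro a b hb
    refine (young hη0 a b).trans ?_
    have : b ^ 2 / (4 * η) ≤ B * P := by
      rw [show b ^ 2 / (4 * η) = (1 / η) * (b ^ 2 / 4) by field_simp]
      exact mul_le_mul hBη (by linarith [sq_nonneg b]) (by positivity) (by positivity)
    linarith
  have hBP : P ≤ B * P := le_mul_of_one_le_left hP0 hB1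
  have hηP : η * P ≤ B * P := mul_le_mul_of_nonneg_right hBη1 hP0
  have t1 : z * X ≤ η * X ^ 2 + B * P := by rw [mul_comm]; exact yb X z hzP
  have hp2 : p ^ 2 ≤ X ^ 2 + P := by
    have := hDk 2 (by norm_num)
    have := two_mul_le_add_sq D X
    linarith [sq_nonneg X, sq_nonneg D]
  have hDX : D * X ≤ η * X ^ 2 + B * P := by rw [mul_comm]; exact yb X D (hDk 2 (by norm_num))
  have hD2X : D ^ 2 * X ≤ η * X ^ 2 + B * P := by
    rw [mul_comm]; exact yb X (D ^ 2) (by rw [← pow_mul]; exact hDk 4 (by norm_num))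
  have hD3X : D ^ 3 * X ≤ η * X ^ 2 + B * P := by
    rw [mul_comm]; exact yb X (D ^ 3) (by rw [← pow_mul]; exact hDk 6 (by norm_num))
  have hqr : q * r ≤ D * X := by
    refine abs_le_of_sq_le_sq' ?_ (by positivity) |>.2
    calc (q * r) ^ 2 = q ^ 2 * r ^ 2 := by ring
      _ ≤ (D * p) * (p * X) := mul_le_mul h1 h3 (by positivity) (by positivity)
      _ = D * X * p ^ 2 := by ring
      _ ≤ D * X * (D * X) := mul_le_mul_of_nonneg_left h2 (by positivity)
      _ = _ := by ring
  have t2 : D * (D + q) * r ≤ 3 * η * X ^ 2 + 4 * (B * P) := by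
    have hD0 : 0 ≤ D := by linarith
    have a1 : D * q * r ≤ D ^ 2 * X := by
      have := mul_le_mul_of_nonneg_left hqr hD0
      linarith
    have a2 : D ^ 2 * r ≤ η * r ^ 2 + B * P := by
      rw [mul_comm]; exact yb r (D ^ 2) (by rw [← pow_mul]; exact hDk 4 (by norm_num))
    have a3 : r ^ 2 ≤ X ^ 2 + P := by
      have := two_mul_le_add_sq p X
      linarith
    have a4 := mul_le_mul_of_nonneg_left a3 hη0.le
    have a5 : D * (D + q) * r = D ^ 2 * r + D * q * r := by ring
    have a6 : 0 ≤ η * X ^ 2 := by positivity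
    linarith
  have hD3p : ∀ E : ℝ, E ^ 2 ≤ P → p * E / (4 * η) ≤ η * X ^ 2 + 2 * (B * P) := by
    intro E hE
    have b1 := young hη0 p (E / (4 * η))
    have b2 : (E / (4 * η)) ^ 2 / (4 * η) = (1 / η ^ 3) * (E ^ 2 / 64) := by field_simp; ring
    have b3 : (1 / η ^ 3) * (E ^ 2 / 64) ≤ B * P :=
      mul_le_mul hBη3 (by linarith [sq_nonneg E]) (by positivity) (by positivity)
    have b4 := mul_le_mul_of_nonneg_left hp2 hη0.le
    rw [← mul_div_assoc] at b1
    linarith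
  have t3 : (D + q) * p ^ 2 ≤ 3 * η * X ^ 2 + 3 * (B * P) := by
    have c1 := mul_le_mul_of_nonneg_left h2 (by linarith : 0 ≤ D)
    have c2 := mul_le_mul_of_nonneg_left h2 hq
    have c3 := young hη0 X (q * D)
    have c4 : (q * D) ^ 2 / (4 * η) ≤ p * D ^ 3 / (4 * η) := by
      refine div_le_div_of_nonneg_right ?_ (by positivity)
      calc (q * D) ^ 2 = q ^ 2 * D ^ 2 := by ring
        _ ≤ D * p * D ^ 2 := mul_le_mul_of_nonneg_right h1 (by positivity)
        _ = _ := by ring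
    have c5 := hD3p (D ^ 3) (by rw [← pow_mul]; exact hDk 6 (by norm_num))
    have c6 : (D + q) * p ^ 2 = D * p ^ 2 + q * p ^ 2 := by ring
    linarith
  have hq2 : q ^ 2 ≤ η * X ^ 2 + 3 * (B * P) := by
    have d1 : D * p ≤ η * p ^ 2 + B * P := by
      rw [mul_comm]; exact yb p D (hDk 2 (by norm_num))
    have d2 := mul_le_mul_of_nonneg_left hp2 hη0.le
    have d3 := mul_nonneg (by linarith : (0:ℝ) ≤ B) hP0
    linarith
  have hq4 : q ^ 4 ≤ η * X ^ 2 + B * P := by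
    calc q ^ 4 = (q ^ 2) ^ 2 := by ring
      _ ≤ (D * p) ^ 2 := pow_le_pow_left₀ (by positivity) h1 2
      _ = D ^ 2 * p ^ 2 := by ring
      _ ≤ D ^ 2 * (D * X) := mul_le_mul_of_nonneg_left h2 (by positivity)
      _ = D ^ 3 * X := by ring
      _ ≤ _ := hD3X
  have t4 : (D + q) ^ 2 ≤ 2 * η * X ^ 2 + 8 * (B * P) := by
    have := hDk 2 (by norm_num)
    have := two_mul_le_add_sq D q
    have : (D + q) ^ 2 = D ^ 2 + 2 * D * q + q ^ 2 := by ring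
    linarith
  have t5 : (D + q) ^ 3 ≤ 4 * η * X ^ 2 + 12 * (B * P) := by
    have e1 : (D + q) ^ 3 ≤ 4 * (D ^ 3 + q ^ 3) := by
      simpa using add_pow_le (by linarith : (0 : ℝ) ≤ D) hq 3 |>.trans (le_of_eq (by norm_num))
    have e2 : q ^ 3 ≤ (q ^ 2 + q ^ 4) / 2 := by
      have := sq_nonneg (q - q ^ 2)
      have : (q - q ^ 2) ^ 2 = q ^ 2 - 2 * q ^ 3 + q ^ 4 := by ring
      linarith
    have := hDk 3 (by norm_num)
    linarith
  have tot : z * X + D * (D + q) * r + (D + q) * p ^ 2 + (D + q) ^ 2 + (D + q) ^ 3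
      ≤ 13 * η * X ^ 2 + 28 * (B * P) := by linarith
  calc _ ≤ K * (13 * η * X ^ 2 + 28 * (B * P)) := mul_le_mul_of_nonneg_left tot hK
    _ = 13 * (K * η) * X ^ 2 + 28 * K * B * P := by ring
    _ ≤ θ * X ^ 2 + 40 * K * B * P := by
      have f1 : 13 * (K * η) ≤ θ := by
        have : η * (40 * (K + 1)) = θ := by rw [hη]; field_simp
        have : 0 < η := hη0
        linarith
      have f2 : 0 ≤ K * B * P := by positivity
      have f3 := mul_le_mul_of_nonneg_right f1 (sq_nonneg X)
      linarith

namespace TrigPoly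

/-- Interpolation at the midpoint of the exponents, by Cauchy–Schwarz. -/
lemma sob_sq_le_mul (a b : ℝ) {p : TrigPoly} (hp : p.coeff 0 = 0) :
    sob ((a + b) / 2) p ^ 2 ≤ sob a p * sob b p := by
  rw [sq_sob _ subset_rfl, sob, sob]
  refine le_trans (Finset.sum_le_sum fun n hn => ?_) (Real.sum_mul_le_sqrt_mul_sqrt _ _ _)
  rw [mul_pow, mul_mul_mul_comm, ← sq ‖_‖, ← abs_rpow_two_mul]
  rcases eq_or_ne n 0 with rfl | h0
  · simp [hp]
  · rw [← Real.rpow_add (abs_pos.mpr (Int.cast_ne_zero.mpr h0))]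
    apply le_of_eq; congr 2; ring

lemma sob_multiplier_le_add {m : ℤ → ℂ} (hm : ∀ n : ℤ, ‖m n‖ ≤ |(n : ℝ)|) (s : ℝ) {p : TrigPoly}
    (hp : p.coeff 0 = 0) : sob s (multiplier m p) ≤ sob (s + 1) p := by
  refine sob_le_of_coeff fun n => ?_
  rcases eq_or_ne n 0 with rfl | hn
  · simp [hp]
  · rw [coeff_multiplier, norm_mul, Real.rpow_add_one (abs_pos.mpr (Int.cast_ne_zero.mpr hn)).ne',
      mul_assoc]
    gcongr
    exact hm n

lemma norm_symbol_dx (n : ℤ) : ‖Complex.I * (n : ℂ)‖ ≤ |(n : ℝ)| := by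
  rw [norm_mul, Complex.norm_I, one_mul, Complex.norm_intCast]

lemma norm_symbol_hilbert_dx {κ : ℝ} (hκ : κ = 1 ∨ κ = -1) (n : ℤ) :
    ‖hilbertSymbol κ n * (Complex.I * (n : ℂ))‖ ≤ |(n : ℝ)| := by
  rw [norm_mul]
  exact (mul_le_of_le_one_left (norm_nonneg _) (norm_hilbertSymbol_le hκ n)).trans
    (norm_symbol_dx n)

lemma hilbert_dx_eq (κ : ℝ) (p : TrigPoly) :
    hilbert κ (dx p) = multiplier (fun n => hilbertSymbol κ n * (Complex.I * n)) p :=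
  multiplier_multiplier _ _ _

/-- The trilinear energy `∫ v (M v)²`. -/
def trilinear (m : ℤ → ℂ) (v : TrigPoly) : ℂ := mean (v * (multiplier m v * multiplier m v))

lemma trilinear_neg (m : ℤ → ℂ) (v : TrigPoly) : trilinear m (-v) = -trilinear m v := by
  rw [trilinear, trilinear, multiplier_neg, neg_mul_neg, neg_mul, map_neg]

lemma wie_le_sob_threeFourths : ∃ c : ℝ, 1 ≤ c ∧ ∀ p : TrigPoly, p.coeff 0 = 0 →
    wie 0 p ≤ c * sob (3 / 4) p ∧ wie (1 / 8) p ≤ c * sob (3 / 4) p := by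
  refine ⟨1 + √(∑' n : ℤ, |(n : ℝ)| ^ (2 * (0 - 3 / 4 : ℝ)))
    + √(∑' n : ℤ, |(n : ℝ)| ^ (2 * (1 / 8 - 3 / 4 : ℝ))), ?_, fun p hp => ⟨?_, ?_⟩⟩
  · have := Real.sqrt_nonneg (∑' n : ℤ, |(n : ℝ)| ^ (2 * (0 - 3 / 4 : ℝ)))
    have := Real.sqrt_nonneg (∑' n : ℤ, |(n : ℝ)| ^ (2 * (1 / 8 - 3 / 4 : ℝ)))
    linarith
  · refine (wie_le_sob (s := 0) (t := 3 / 4) (by norm_num) hp).trans ?_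
    have := Real.sqrt_nonneg (∑' n : ℤ, |(n : ℝ)| ^ (2 * (1 / 8 - 3 / 4 : ℝ)))
    exact mul_le_mul_of_nonneg_right (by linarith) (sob_nonneg _ _)
  · refine (wie_le_sob (s := 1 / 8) (t := 3 / 4) (by norm_num) hp).trans ?_
    have := Real.sqrt_nonneg (∑' n : ℤ, |(n : ℝ)| ^ (2 * (0 - 3 / 4 : ℝ)))
    exact mul_le_mul_of_nonneg_right (by linarith) (sob_nonneg _ _)

/-- The variation of the trilinear energy. -/
lemma norm_trilinear_sub_le {c : ℝ} (hc1 : 1 ≤ c) (hc : ∀ p : TrigPoly, p.coeff 0 = 0 →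
    wie 0 p ≤ c * sob (3 / 4) p ∧ wie (1 / 8) p ≤ c * sob (3 / 4) p)
    {m : ℤ → ℂ} (hm : ∀ n : ℤ, ‖m n‖ ≤ |(n : ℝ)|) {Y k : TrigPoly}
    (hY : Y.coeff 0 = 0) (hk : k.coeff 0 = 0) :
    ‖trilinear m (Y + k) - trilinear m Y‖
      ≤ sob (-(3 / 2)) (multiplier m Y * multiplier m Y) * sob (3 / 2) k
        + 4 * c * sob (7 / 8) Y * sob (3 / 4) (Y + k) * sob (5 / 4) k
        + c * sob (3 / 4) (Y + k) * sob 1 k ^ 2 := by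
  set v := Y + k with hv
  have hv0 : v.coeff 0 = 0 := by simp [hv, hY, hk]
  set MY := multiplier m Y
  set Mk := multiplier m k
  -- The factor `v = Y + k` is kept whole in the last two terms. Only the first pairs `k` with `(M
  -- Y)²`, which is rough and will be controlled probabilistically in `H^{-3/2}`; in the second `M Y
  -- ∈ H^{-1/8}` is dual to `v M k ∈ H^{1/8}`.
  have e : trilinear m v - trilinear m Y
      = mean (k * (MY * MY)) + 2 * mean (MY * (v * Mk)) + mean (v * Mk * Mk) := by
    have h1 : v * (multiplier m v * multiplier m v)
        = Y * (MY * MY) + k * (MY * MY) + (MY * (v * Mk) + MY * (v * Mk)) + v * Mk * Mk := by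
      rw [show multiplier m v = MY + Mk from multiplier_add _ _ _]
      conv_lhs => rw [show v * ((MY + Mk) * (MY + Mk))
        = v * (MY * MY) + (MY * (v * Mk) + MY * (v * Mk)) + v * Mk * Mk by ring]
      rw [show v * (MY * MY) = Y * (MY * MY) + k * (MY * MY) by rw [hv]; ring]
    rw [trilinear, trilinear, h1, map_add, map_add, map_add, map_add]
    ring
  have hm0 : m 0 = 0 := by simpa using hm 0
  have hMY : MY.coeff 0 = 0 := by simp [MY, hY]
  have hw := hc v hv0
  have b1 : ‖mean (k * (MY * MY))‖ ≤ sob (-(3 / 2)) (MY * MY) * sob (3 / 2) k := by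
    rw [mul_comm (sob _ _)]
    exact norm_mean_mul_le (3 / 2) (Or.inl hk)
  have b3 : ‖mean (v * Mk * Mk)‖ ≤ c * sob (3 / 4) v * sob 1 k ^ 2 := by
    have h0 : sob 0 Mk ≤ sob 1 k := by simpa using sob_multiplier_le_add hm 0 hk
    calc _ ≤ sob 0 (v * Mk) * sob 0 Mk := norm_mean_mul_le_zero _ _
      _ ≤ (wie 0 v * sob 0 Mk) * sob 0 Mk :=
          mul_le_mul_of_nonneg_right (sob_mul_le _ _) (sob_nonneg _ _)
      _ = wie 0 v * sob 0 Mk ^ 2 := by ring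
      _ ≤ _ := mul_le_mul hw.1 (pow_le_pow_left₀ (sob_nonneg _ _) h0 2) (by positivity)
          (by have := sob_nonneg (3 / 4) v; positivity)
  have b2 : ‖mean (MY * (v * Mk))‖ ≤ 2 * c * sob (7 / 8) Y * sob (3 / 4) v * sob (5 / 4) k := by
    have h1 : sob (-(1 / 8)) MY ≤ sob (7 / 8) Y := by
      have := sob_multiplier_le_add hm (-(1 / 8)) hY
      rwa [show (-(1 / 8) + 1 : ℝ) = 7 / 8 by norm_num] at this
    have h2 : sob 0 Mk ≤ sob (5 / 4) k :=
      (sob_multiplier_le_add hm 0 hk).trans (sob_mono (by norm_num) hk)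
    have h3 : sob (1 / 8) Mk ≤ sob (5 / 4) k :=
      (sob_multiplier_le_add hm (1 / 8) hk).trans (sob_mono (by norm_num) hk)
    have h4 : sob (1 / 8) (v * Mk) ≤ 2 * c * sob (3 / 4) v * sob (5 / 4) k := by
      refine (sob_mul_leibniz (by norm_num) (by norm_num) v Mk).trans ?_
      have k0 := sob_nonneg (3 / 4) v
      have := mul_le_mul hw.2 h2 (sob_nonneg _ _) (by positivity)
      have := mul_le_mul hw.1 h3 (sob_nonneg _ _) (by positivity)
      linarith
    have h5 := norm_mean_mul_le (-(1 / 8)) (p := MY) (q := v * Mk) (Or.inl hMY)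
    rw [neg_neg] at h5
    refine h5.trans ((mul_le_mul h1 h4 (sob_nonneg _ _) (sob_nonneg _ _)).trans (le_of_eq ?_))
    ring
  rw [e]
  refine (norm_add₃_le).trans ?_
  rw [norm_mul, Complex.norm_ofNat]
  linarith

/-- The quartic part of the `H^{3/2}` energy. -/
def quarticEnergy (κ : ℝ) (v : TrigPoly) : ℂ :=
  1 / 3 * mean (v ^ 3 * hilbert κ (dx v)) + 1 / 4 * mean (v ^ 2 * hilbert κ (v * dx v))

lemma sob_half_sq_le {s : ℝ} (hs : 0 < s) (hs1 : s ≤ 1) (v : TrigPoly) :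
    sob s (v * v) ≤ 2 * wie 0 v * sob s v := by
  refine (sob_mul_leibniz' hs hs1 v v).trans (le_of_eq ?_); ring

lemma sob_cube_le {s : ℝ} (hs : 0 < s) (hs1 : s ≤ 1) (v : TrigPoly) :
    sob s (v * (v * v)) ≤ 3 * wie 0 v ^ 2 * sob s v := by
  refine (sob_mul_leibniz' hs hs1 v (v * v)).trans ?_
  have h1 := mul_le_mul_of_nonneg_left (wie_mul_le v v) (sob_nonneg s v)
  have h2 := mul_le_mul_of_nonneg_left (sob_half_sq_le hs hs1 v) (wie_nonneg 0 v)
  nlinarith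

/-- There is one derivative, half of which is put on each factor by `H^{1/2}` duality; in the second
term `v vₓ` is half the derivative of `v²`, which makes it symmetric. -/
lemma norm_quarticEnergy_le {κ : ℝ} (hκ : κ = 1 ∨ κ = -1) {v : TrigPoly} (hv : v.coeff 0 = 0) :
    ‖quarticEnergy κ v‖ ≤ 2 * wie 0 v ^ 2 * sob (1 / 2) v ^ 2 := by
  have hw := wie_nonneg 0 v
  have hs := sob_nonneg (1 / 2) v
  have a1 : ‖mean (v ^ 3 * hilbert κ (dx v))‖ ≤ 3 * wie 0 v ^ 2 * sob (1 / 2) v ^ 2 := by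
    have h1 : sob (-(1 / 2)) (hilbert κ (dx v)) ≤ sob (1 / 2) v := by
      refine (sob_hilbert_le hκ _ _).trans ?_
      have := sob_dx_le (-(1 / 2)) hv
      rwa [show (-(1 / 2) + 1 : ℝ) = 1 / 2 by norm_num] at this
    have h2 : v ^ 3 = v * (v * v) := by ring
    rw [h2]
    refine (norm_mean_mul_le (1 / 2) (Or.inr (by simp [hv]))).trans ?_
    refine (mul_le_mul (sob_cube_le (by norm_num) (by norm_num) v) h1 (sob_nonneg _ _)
      (by positivity)).trans (le_of_eq (by ring))
  have a2 : ‖mean (v ^ 2 * hilbert κ (v * dx v))‖ ≤ 2 * wie 0 v ^ 2 * sob (1 / 2) v ^ 2 := by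
    have h2 : v ^ 2 * hilbert κ (v * dx v)
        = ((1 / 2 : ℂ)) • ((v * v) * hilbert κ (dx (v * v))) := by
      have : dx (v * v) = (2 : ℂ) • (v * dx v) := by
        rw [dx_mul, two_smul]; ring
      rw [this, hilbert_smul, mul_smul_comm, smul_smul, sq]
      norm_num
    have h1 : sob (-(1 / 2)) (hilbert κ (dx (v * v))) ≤ sob (1 / 2) (v * v) := by
      refine (sob_hilbert_le hκ _ _).trans ?_
      refine sob_le_of_coeff fun n => ?_
      rcases eq_or_ne n 0 with rfl | hn
      · simp
      · have hn' : 0 < |(n : ℝ)| := abs_pos.mpr (Int.cast_ne_zero.mpr hn)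
        rw [coeff_dx, norm_mul, ← mul_assoc]
        refine mul_le_mul_of_nonneg_right ?_ (norm_nonneg _)
        calc _ ≤ |(n : ℝ)| ^ (-(1 / 2) : ℝ) * |(n : ℝ)| :=
              mul_le_mul_of_nonneg_left (norm_symbol_dx n) (by positivity)
          _ = _ := by
              rw [← Real.rpow_add_one hn'.ne']; norm_num
    rw [h2, map_smul, norm_smul]
    have h3 := norm_mean_mul_le (1 / 2) (p := v * v) (q := hilbert κ (dx (v * v)))
      (Or.inr (by simp))
    have h4 := sob_half_sq_le (s := 1 / 2) (by norm_num) (by norm_num) v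
    have h5 : ‖(1 / 2 : ℂ)‖ = 1 / 2 := by norm_num
    rw [h5]
    have h6 : sob (1 / 2) (v * v) * sob (-(1 / 2)) (hilbert κ (dx (v * v)))
        ≤ (2 * wie 0 v * sob (1 / 2) v) * (2 * wie 0 v * sob (1 / 2) v) :=
      mul_le_mul h4 (h1.trans h4) (sob_nonneg _ _) (by positivity)
    nlinarith
  rw [quarticEnergy]
  refine (norm_add_le _ _).trans ?_
  rw [norm_mul, norm_mul]
  have e3 : ‖(1 / 3 : ℂ)‖ = 1 / 3 := by norm_num
  have e4 : ‖(1 / 4 : ℂ)‖ = 1 / 4 := by norm_num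
  rw [e3, e4]
  have : 0 ≤ wie 0 v ^ 2 * sob (1 / 2) v ^ 2 := by positivity
  linarith

lemma norm_mean_pow_five_le (v : TrigPoly) :
    ‖mean (v ^ 5)‖ ≤ wie 0 v ^ 3 * sob 0 v ^ 2 := by
  have hw := wie_nonneg 0 v
  have hs := sob_nonneg 0 v
  have h1 : v ^ 5 = (v * (v * (v * v))) * v := by ring
  rw [h1]
  calc _ ≤ sob 0 (v * (v * (v * v))) * sob 0 v := norm_mean_mul_le_zero _ _
    _ ≤ (wie 0 v * (wie 0 v * (wie 0 v * sob 0 v))) * sob 0 v := by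
        refine mul_le_mul_of_nonneg_right ((sob_mul_le _ _).trans ?_) hs
        refine mul_le_mul_of_nonneg_left ((sob_mul_le _ _).trans ?_) hw
        exact mul_le_mul_of_nonneg_left (sob_mul_le _ _) hw
    _ = _ := by ring

/-- The cubic part of the `H^{3/2}` energy. -/
def cubicEnergy (κ : ℝ) (v : TrigPoly) : ℂ :=
  3 / 2 * trilinear (fun n => Complex.I * n) v
    + 1 / 2 * trilinear (fun n => hilbertSymbol κ n * (Complex.I * n)) v

lemma energyThreeHalves_eq (κ lam : ℝ) (v : TrigPoly) :
    energyThreeHalves κ lam v = normSq lam (3 / 2) v + 2 * Real.pi * lam * κ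
      * (cubicEnergy κ v + quarticEnergy κ v + 1 / 20 * mean (v ^ 5)).re := by
  have e : ∀ (r : ℝ) (z : ℂ), ((r : ℂ) * z).re = r * z.re := fun r z => Complex.re_ofReal_mul r z
  have c1 : (3 / 2 : ℂ) = ((3 / 2 : ℝ) : ℂ) := by norm_num
  have c2 : (1 / 2 : ℂ) = ((1 / 2 : ℝ) : ℂ) := by norm_num
  have c3 : (1 / 3 : ℂ) = ((1 / 3 : ℝ) : ℂ) := by norm_num
  have c4 : (1 / 4 : ℂ) = ((1 / 4 : ℝ) : ℂ) := by norm_num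
  have c5 : (1 / 20 : ℂ) = ((1 / 20 : ℝ) : ℂ) := by norm_num
  rw [energyThreeHalves, cubicEnergy, quarticEnergy, trilinear, trilinear, ← hilbert_dx_eq,
    c1, c2, c3, c4, c5]
  simp only [Complex.add_re, e, integral_eq_mean]
  rw [show multiplier (fun n : ℤ => Complex.I * (n : ℂ)) v = dx v from rfl, sq (dx v),
    sq (hilbert κ (dx v))]
  ring

end TrigPoly

end

/-! ### Uniform exponential integrability -/

section

open TrigPoly
open scoped ENNReal NNReal

namespace TrigPoly

/-- The lower order part of the `H^{3/2}` energy at `Y + k` is controlled by its cubic part at `Y`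
and by the Cameron–Martin norm of `k`. -/
lemma neg_remainder_le {κ lam : ℝ} (hκ : κ = 1 ∨ κ = -1) (hlam : 0 < lam) {C₀ : ℝ} (hC₀ : 0 ≤ C₀) :
    ∃ C : ℝ, 0 ≤ C ∧ ∀ Y k : TrigPoly, Y.coeff 0 = 0 → k.coeff 0 = 0 →
      sob 0 (Y + k) ≤ C₀ → sob (1 / 2) (Y + k) ≤ C₀ →
      -2 * (energyThreeHalves κ lam (Y + k) - normSq lam (3 / 2) (Y + k))
        ≤ -(4 * Real.pi * lam * κ) * (cubicEnergy κ Y).re + Real.pi * lam * sob (3 / 2) k ^ 2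
          + C * ((1 + sob (7 / 8) Y) ^ 6
            + sob (-(3 / 2)) (dx Y * dx Y) ^ 2
            + sob (-(3 / 2)) (hilbert κ (dx Y) * hilbert κ (dx Y)) ^ 2) := by
  obtain ⟨c, hc1, hc⟩ := wie_le_sob_threeFourths
  have hπ : 0 < Real.pi * lam := by positivity
  set K₀ : ℝ := 3 / 2 + 8 * c + 2 * c ^ 2 * C₀ ^ 2 + c ^ 3 * C₀ ^ 2 with hK₀
  have hc0 : 0 ≤ c := by linarith
  have hK₀0 : 0 ≤ K₀ := by positivity
  -- The coefficient `πλ` of `‖k‖²_{Ḣ^{3/2}}` is exactly what the quadratic cost of property `(τ)`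
  -- pays for.
  obtain ⟨C, hC, habs⟩ := absorb (θ := Real.pi * lam) (K := 4 * (Real.pi * lam) * K₀) hπ
    (by positivity)
  refine ⟨C * ((1 + C₀) ^ 6 + 2), by positivity, fun Y k hY hk h0 h1 => ?_⟩
  set v := Y + k with hv
  have hv0 : v.coeff 0 = 0 := by simp [hv, hY, hk]
  set y := sob (7 / 8) Y with hy
  set D := 1 + C₀ + y with hD
  set q := sob (3 / 4) k
  set p := sob 1 k
  set r := sob (5 / 4) k
  set X := sob (3 / 2) k
  set z1 := sob (-(3 / 2)) (dx Y * dx Y)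
  set z2 := sob (-(3 / 2)) (hilbert κ (dx Y) * hilbert κ (dx Y))
  have hy0 : 0 ≤ y := sob_nonneg _ _
  have hq0 : 0 ≤ q := sob_nonneg _ _
  have hp0 : 0 ≤ p := sob_nonneg _ _
  have hr0 : 0 ≤ r := sob_nonneg _ _
  have hX0 : 0 ≤ X := sob_nonneg _ _
  have hz1 : 0 ≤ z1 := sob_nonneg _ _
  have hz2 : 0 ≤ z2 := sob_nonneg _ _
  have hD1 : 1 ≤ D := by linarith
  -- The assumption bounds `Y + k`, not `k`; since `k = v - Y`, the `H^{1/2}` norm of `k` is bounded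
  -- up to the norm of `Y`. This feeds the interpolation inequalities below.
  have hkD : sob (1 / 2) k ≤ D := by
    have e : k = v - Y := by rw [hv]; ring
    have h2 : sob (1 / 2) k ≤ sob (1 / 2) v + sob (1 / 2) Y := by
      conv_lhs => rw [e]
      exact sob_sub_le _ _ _
    have h3 : sob (1 / 2) Y ≤ y := sob_mono (by norm_num) hY
    linarith
  have i1 : q ^ 2 ≤ D * p := by
    have := sob_sq_le_mul (1 / 2) 1 hk
    rw [show ((1 / 2 + 1) / 2 : ℝ) = 3 / 4 by norm_num] at this
    exact this.trans (mul_le_mul_of_nonneg_right hkD hp0)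
  have i2 : p ^ 2 ≤ D * X := by
    have := sob_sq_le_mul (1 / 2) (3 / 2) hk
    rw [show ((1 / 2 + 3 / 2) / 2 : ℝ) = 1 by norm_num] at this
    exact this.trans (mul_le_mul_of_nonneg_right hkD hX0)
  have i3 : r ^ 2 ≤ p * X := by
    have := sob_sq_le_mul 1 (3 / 2) hk
    rwa [show ((1 + 3 / 2) / 2 : ℝ) = 5 / 4 by norm_num] at this
  have hvq : sob (3 / 4) v ≤ D + q := by
    have h3 : sob (3 / 4) Y ≤ y := sob_mono (by norm_num) hY
    have := sob_add_le (3 / 4) Y k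
    linarith
  have hsv := sob_nonneg (3 / 4) v
  have hwv : wie 0 v ≤ c * (D + q) := (hc v hv0).1.trans (mul_le_mul_of_nonneg_left hvq hc0)
  have hwv0 := wie_nonneg 0 v
  have tri : ∀ (m : ℤ → ℂ), (∀ n : ℤ, ‖m n‖ ≤ |(n : ℝ)|) →
      ‖trilinear m v - trilinear m Y‖ ≤ sob (-(3 / 2)) (multiplier m Y * multiplier m Y) * X
        + 4 * c * (D * (D + q) * r) + c * ((D + q) * p ^ 2) := by
    intro m hm
    refine (norm_trilinear_sub_le hc1 hc hm hY hk).trans ?_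
    have hyD : y ≤ D := by linarith
    have e1 : 4 * c * y * sob (3 / 4) v * r ≤ 4 * c * (D * (D + q) * r) := by
      have : y * sob (3 / 4) v ≤ D * (D + q) := mul_le_mul hyD hvq hsv (by linarith)
      have := mul_le_mul_of_nonneg_right this hr0
      have := mul_le_mul_of_nonneg_left this (by positivity : 0 ≤ 4 * c)
      linarith
    have e2 : c * sob (3 / 4) v * p ^ 2 ≤ c * ((D + q) * p ^ 2) := by
      rw [mul_assoc]
      exact mul_le_mul_of_nonneg_left (mul_le_mul_of_nonneg_right hvq (sq_nonneg p)) hc0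
    linarith
  have t1 := tri (fun n => Complex.I * n) norm_symbol_dx
  have t2 := tri (fun n => hilbertSymbol κ n * (Complex.I * n)) (norm_symbol_hilbert_dx hκ)
  rw [← hilbert_dx_eq] at t2
  have t1' : ‖trilinear (fun n => Complex.I * n) v - trilinear (fun n => Complex.I * n) Y‖
      ≤ z1 * X + 4 * c * (D * (D + q) * r) + c * ((D + q) * p ^ 2) := t1
  have hcub : ‖cubicEnergy κ v - cubicEnergy κ Y‖ ≤ (z1 + z2) * (3 / 2) * X
      + 8 * c * (D * (D + q) * r) + 2 * c * ((D + q) * p ^ 2) := by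
    have e : cubicEnergy κ v - cubicEnergy κ Y
        = 3 / 2 * (trilinear (fun n => Complex.I * n) v - trilinear (fun n => Complex.I * n) Y)
          + 1 / 2 * (trilinear (fun n => hilbertSymbol κ n * (Complex.I * n)) v
            - trilinear (fun n => hilbertSymbol κ n * (Complex.I * n)) Y) := by
      rw [cubicEnergy, cubicEnergy]; ring
    rw [e]
    refine (norm_add_le _ _).trans ?_
    rw [norm_mul, norm_mul, show ‖(3 / 2 : ℂ)‖ = 3 / 2 by norm_num,
      show ‖(1 / 2 : ℂ)‖ = 1 / 2 by norm_num]
    have : 0 ≤ z2 * X := mul_nonneg hz2 hX0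
    linarith
  have hquart : ‖quarticEnergy κ v‖ ≤ 2 * c ^ 2 * C₀ ^ 2 * (D + q) ^ 2 := by
    refine (norm_quarticEnergy_le hκ hv0).trans ?_
    have e1 := pow_le_pow_left₀ hwv0 hwv 2
    have e2 := pow_le_pow_left₀ (sob_nonneg _ _) h1 2
    calc 2 * wie 0 v ^ 2 * sob (1 / 2) v ^ 2 ≤ 2 * (c * (D + q)) ^ 2 * C₀ ^ 2 := by gcongr
      _ = _ := by ring
  have hquint : ‖(1 / 20 : ℂ) * mean (v ^ 5)‖ ≤ c ^ 3 * C₀ ^ 2 * (D + q) ^ 3 := by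
    rw [norm_mul, show ‖(1 / 20 : ℂ)‖ = 1 / 20 by norm_num]
    have h3 := norm_mean_pow_five_le v
    have e1 := pow_le_pow_left₀ hwv0 hwv 3
    have e2 := pow_le_pow_left₀ (sob_nonneg _ _) h0 2
    have h4 : wie 0 v ^ 3 * sob 0 v ^ 2 ≤ (c * (D + q)) ^ 3 * C₀ ^ 2 := by gcongr
    have h5 : 0 ≤ (c * (D + q)) ^ 3 * C₀ ^ 2 := by positivity
    calc _ ≤ 1 / 20 * ((c * (D + q)) ^ 3 * C₀ ^ 2) := by linarith
      _ ≤ (c * (D + q)) ^ 3 * C₀ ^ 2 := by linarith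
      _ = _ := by ring
  set T := (z1 + z2) * X + D * (D + q) * r + (D + q) * p ^ 2 + (D + q) ^ 2 + (D + q) ^ 3 with hT
  have a1 : 0 ≤ (z1 + z2) * X := by positivity
  have a2 : 0 ≤ D * (D + q) * r := by positivity
  have a3 : 0 ≤ (D + q) * p ^ 2 := by positivity
  have a4 : 0 ≤ (D + q) ^ 2 := by positivity
  have a5 : 0 ≤ (D + q) ^ 3 := by positivity
  have b2 : 0 ≤ c ^ 2 * C₀ ^ 2 := by positivity
  have b3 : 0 ≤ c ^ 3 * C₀ ^ 2 := by positivity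
  have hsum : ‖cubicEnergy κ v - cubicEnergy κ Y‖ + ‖quarticEnergy κ v‖
      + ‖(1 / 20 : ℂ) * mean (v ^ 5)‖ ≤ K₀ * T := by
    have k1 : 3 / 2 * ((z1 + z2) * X) ≤ K₀ * ((z1 + z2) * X) :=
      mul_le_mul_of_nonneg_right (by rw [hK₀]; linarith) a1
    have k2 : 8 * c * (D * (D + q) * r) ≤ K₀ * (D * (D + q) * r) :=
      mul_le_mul_of_nonneg_right (by rw [hK₀]; linarith) a2
    have k3 : 2 * c * ((D + q) * p ^ 2) ≤ K₀ * ((D + q) * p ^ 2) :=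
      mul_le_mul_of_nonneg_right (by rw [hK₀]; linarith) a3
    have k4 : 2 * c ^ 2 * C₀ ^ 2 * (D + q) ^ 2 ≤ K₀ * (D + q) ^ 2 :=
      mul_le_mul_of_nonneg_right (by rw [hK₀]; linarith) a4
    have k5 : c ^ 3 * C₀ ^ 2 * (D + q) ^ 3 ≤ K₀ * (D + q) ^ 3 :=
      mul_le_mul_of_nonneg_right (by rw [hK₀]; linarith) a5
    have : K₀ * T = K₀ * ((z1 + z2) * X) + K₀ * (D * (D + q) * r) + K₀ * ((D + q) * p ^ 2)
      + K₀ * (D + q) ^ 2 + K₀ * (D + q) ^ 3 := by rw [hT]; ring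
    linarith
  have hab := habs D q p r X (z1 + z2) hD1 hq0 hp0 hr0 hX0 (by positivity) i1 i2 i3
  rw [← hT] at hab
  have hκ1 : |κ| = 1 := by rcases hκ with rfl | rfl <;> simp
  set W := (cubicEnergy κ v - cubicEnergy κ Y) + quarticEnergy κ v + 1 / 20 * mean (v ^ 5) with hW
  have hWn : ‖W‖ ≤ K₀ * T := norm_add₃_le.trans hsum
  have hWre : -(κ * W.re) ≤ K₀ * T := by
    have h3 := (neg_le_abs (κ * W.re))
    rw [abs_mul, hκ1, one_mul] at h3
    exact h3.trans ((Complex.abs_re_le_norm W).trans hWn)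
  have hre : (cubicEnergy κ v + quarticEnergy κ v + 1 / 20 * mean (v ^ 5)).re
      = (cubicEnergy κ Y).re + W.re := by
    rw [← Complex.add_re]; congr 1; rw [hW]; ring
  rw [energyThreeHalves_eq, hre]
  have hD6 : D ^ 6 ≤ (1 + C₀) ^ 6 * (1 + y) ^ 6 := by
    rw [← mul_pow]
    refine pow_le_pow_left₀ (by linarith) ?_ 6
    have : 0 ≤ C₀ * y := by positivity
    linarith
  have hzz : (z1 + z2) ^ 2 ≤ 2 * (z1 ^ 2 + z2 ^ 2) := by
    have := two_mul_le_add_sq z1 z2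
    have : (z1 + z2) ^ 2 = z1 ^ 2 + 2 * z1 * z2 + z2 ^ 2 := by ring
    linarith
  have hfin : D ^ 6 + (z1 + z2) ^ 2 ≤ ((1 + C₀) ^ 6 + 2) * ((1 + y) ^ 6 + z1 ^ 2 + z2 ^ 2) := by
    have : 0 ≤ (1 + C₀) ^ 6 := by positivity
    have : 0 ≤ (1 + y) ^ 6 := by positivity
    have := mul_nonneg ‹0 ≤ (1 + C₀) ^ 6› (add_nonneg (sq_nonneg z1) (sq_nonneg z2))
    linarith
  have hfin2 := mul_le_mul_of_nonneg_left hfin hC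
  have h7 := mul_le_mul_of_nonneg_left hWre (by positivity : 0 ≤ 4 * (Real.pi * lam))
  calc _ = -(4 * Real.pi * lam * κ) * (cubicEnergy κ Y).re
        + 4 * (Real.pi * lam) * (-(κ * W.re)) := by ring
    _ ≤ -(4 * Real.pi * lam * κ) * (cubicEnergy κ Y).re
        + 4 * (Real.pi * lam) * K₀ * T := by linarith
    _ ≤ _ := by linarith

/-- This crude bound only serves to show that the cubic energy is integrable for fixed `N`; it is
not uniform in `N`. -/
lemma norm_trilinear_le {c : ℝ} (hc : ∀ p : TrigPoly, p.coeff 0 = 0 →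
    wie 0 p ≤ c * sob (3 / 4) p ∧ wie (1 / 8) p ≤ c * sob (3 / 4) p) (hc1 : 1 ≤ c)
    {m : ℤ → ℂ} (hm : ∀ n : ℤ, ‖m n‖ ≤ |(n : ℝ)|) {v : TrigPoly} (hv : v.coeff 0 = 0) :
    ‖trilinear m v‖ ≤ c * sob (3 / 4) v * sob 1 v ^ 2 := by
  have h0 : sob 0 (multiplier m v) ≤ sob 1 v := by simpa using sob_multiplier_le_add hm 0 hv
  have h1 : trilinear m v = mean (v * multiplier m v * multiplier m v) := by
    rw [trilinear, mul_assoc]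
  rw [h1]
  have := sob_nonneg (3 / 4) v
  calc _ ≤ sob 0 (v * multiplier m v) * sob 0 (multiplier m v) := norm_mean_mul_le_zero _ _
    _ ≤ (wie 0 v * sob 0 (multiplier m v)) * sob 0 (multiplier m v) :=
        mul_le_mul_of_nonneg_right (sob_mul_le _ _) (sob_nonneg _ _)
    _ = wie 0 v * sob 0 (multiplier m v) ^ 2 := by ring
    _ ≤ _ := mul_le_mul (hc v hv).1 (pow_le_pow_left₀ (sob_nonneg _ _) h0 2) (by positivity)
        (by positivity)

end TrigPoly

/-! ### Dependence of the truncated series on finitely many coordinates -/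

lemma g_add (z z' : ℕ → ℂ) (n : ℤ) : g (z + z') n = g z n + g z' n := by
  unfold g; split_ifs <;> simp

lemma g_neg_fun (z : ℕ → ℂ) (n : ℤ) : g (-z) n = -g z n := by
  unfold g; split_ifs <;> simp

lemma seriesCoeff_add (lam : ℝ) (z z' : ℕ → ℂ) (n : ℤ) :
    seriesCoeff lam (z + z') n = seriesCoeff lam z n + seriesCoeff lam z' n := by
  rw [seriesCoeff, g_add, add_div]; rfl

lemma seriesCoeff_neg_fun (lam : ℝ) (z : ℕ → ℂ) (n : ℤ) :
    seriesCoeff lam (-z) n = -seriesCoeff lam z n := by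
  rw [seriesCoeff, g_neg_fun, neg_div]; rfl

lemma series_add (lam : ℝ) (N : ℕ) (z z' : ℕ → ℂ) :
    series lam N (z + z') = series lam N z + series lam N z' := by
  simp only [series, seriesCoeff_add, AddMonoidAlgebra.single_add, Finset.sum_add_distrib]

lemma series_neg (lam : ℝ) (N : ℕ) (z : ℕ → ℂ) : series lam N (-z) = -series lam N z := by
  simp only [series, seriesCoeff_neg_fun, AddMonoidAlgebra.single_neg, Finset.sum_neg_distrib]

lemma series_sub (lam : ℝ) (N : ℕ) (z z' : ℕ → ℂ) :
    series lam N (z - z') = series lam N z - series lam N z' := by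
  rw [sub_eq_add_neg, series_add, series_neg, sub_eq_add_neg]

/-- The truncated series depends only on the coordinates `1, …, N`, so property `(τ)` in finitely
many coordinates applies to its functionals. -/
lemma series_congr (lam : ℝ) {N : ℕ} {z z' : ℕ → ℂ} (h : ∀ j, 1 ≤ j → j ≤ N → z j = z' j) :
    series lam N z = series lam N z' := by
  refine Finset.sum_congr rfl fun n hn => ?_
  rw [Finset.mem_Icc] at hn
  rcases eq_or_ne n 0 with rfl | h0
  · rw [seriesCoeff_zero, seriesCoeff_zero]
  · have : z n.natAbs = z' n.natAbs := h _ (by omega) (by omega)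
    rw [seriesCoeff, seriesCoeff, g, g, this]

lemma sum_Icc_neg (f : ℤ → ℝ) (N : ℕ) : ∑ n ∈ Finset.Icc (-(N : ℤ)) N, f n
    = f 0 + ∑ j ∈ Finset.range N, (f (j + 1) + f (-(j + 1))) := by
  induction N with
  | zero => simp
  | succ N ih =>
    have h : Finset.Icc (-((N + 1 : ℕ) : ℤ)) ((N + 1 : ℕ) : ℤ)
        = insert ((N : ℤ) + 1) (insert (-((N : ℤ) + 1)) (Finset.Icc (-(N : ℤ)) N)) := by
      ext n
      simp only [Finset.mem_Icc, Finset.mem_insert]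
      push_cast
      omega
    rw [h, Finset.sum_insert, Finset.sum_insert, ih, Finset.sum_range_succ]
    · ring
    · simp only [Finset.mem_Icc]; omega
    · simp only [Finset.mem_insert, Finset.mem_Icc]; omega

/-- The Cameron–Martin norm of the truncated series. -/
lemma normSq_series {lam : ℝ} (hlam : 0 < lam) (N : ℕ) (z : ℕ → ℂ) :
    normSq lam (3 / 2) (series lam N z) = ∑ j ∈ Finset.range N, ‖z (j + 1)‖ ^ 2 := by
  have h := sq_sob_multiplier_series (N := N) hlam (3 / 2) (fun _ => 1) z
  rw [multiplier_one] at h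
  rw [normSq_eq_sob, h, sum_Icc_neg, g_zero]
  have e : ∀ n : ℤ, n ≠ 0 → |(n : ℝ)| ^ (2 * (3 / 2 : ℝ) - 3) * ‖(1 : ℂ)‖ ^ 2 / (4 * Real.pi * lam)
      * ‖g z n‖ ^ 2 = ‖z n.natAbs‖ ^ 2 / (4 * Real.pi * lam) := by
    intro n hn
    rw [norm_g hn]; norm_num; ring
  have e1 : ∀ j : ℕ, ((j : ℤ) + 1).natAbs = j + 1 := fun j => by omega
  have e2 : ∀ j : ℕ, (-((j : ℤ) + 1)).natAbs = j + 1 := fun j => by omega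
  have e3 : ∀ j ∈ Finset.range N,
      (|(((j : ℤ) + 1 : ℤ) : ℝ)| ^ (2 * (3 / 2 : ℝ) - 3) * ‖(1 : ℂ)‖ ^ 2 / (4 * Real.pi * lam)
        * ‖g z ((j : ℤ) + 1)‖ ^ 2
      + |((-((j : ℤ) + 1) : ℤ) : ℝ)| ^ (2 * (3 / 2 : ℝ) - 3) * ‖(1 : ℂ)‖ ^ 2 / (4 * Real.pi * lam)
        * ‖g z (-((j : ℤ) + 1))‖ ^ 2) = ‖z (j + 1)‖ ^ 2 / (2 * Real.pi * lam) := by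
    intro j _
    rw [e _ (by omega), e _ (by omega), e1, e2]
    field_simp; norm_num; ring
  rw [Finset.sum_congr rfl e3, ← Finset.sum_div]
  simp only [norm_zero]
  field_simp
  ring

section Restriction

variable (s : Finset ℕ)

/-- Extension by zero of a finite family of coordinates. -/
def extendZero (x : s → ℂ) (j : ℕ) : ℂ := if h : j ∈ s then x ⟨j, h⟩ else 0

lemma measurable_extendZero : Measurable (extendZero s) := by
  refine measurable_pi_lambda _ fun j => ?_
  unfold extendZero
  split_ifs
  · fun_prop
  · fun_prop

lemma extendZero_restrict (z : ℕ → ℂ) {j : ℕ} (hj : j ∈ s) :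
    extendZero s (s.restrict z) j = z j := by
  rw [extendZero, dif_pos hj, Finset.restrict]

end Restriction

/-- Uniform exponential integrability of the lower order part of the `H^{3/2}` energy. -/
theorem lintegral_exp_remainder_le {κ lam : ℝ} (hκ : κ = 1 ∨ κ = -1) (hlam : 0 < lam) {C₀ : ℝ}
    (hC₀ : 0 ≤ C₀) : ∃ C : ℝ, 0 < C ∧ ∀ (φ : ℝ → ℝ) (_ : ∀ x, |φ x| ≤ 1) (N : ℕ),
      ∫⁻ z, Set.indicator {z | sob 0 (series lam N z) ≤ C₀ ∧ sob (1 / 2) (series lam N z) ≤ C₀}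
        (fun z => ENNReal.ofReal (Real.exp (-2 * (energyThreeHalves κ lam (smooth φ N (series lam N z))
          - normSq lam (3 / 2) (smooth φ N (series lam N z)))))) z ∂noise ≤ ENNReal.ofReal C := by
  obtain ⟨C, hC, hrem⟩ := neg_remainder_le hκ hlam hC₀
  obtain ⟨c, hc1, hc⟩ := wie_le_sob_threeFourths
  obtain ⟨C6, hC6, hmom⟩ := integral_one_add_sob_pow_le hlam 6
  obtain ⟨Cz, hCz, hZ⟩ := integral_sob_sq_multiplier_le hlam
  refine ⟨Real.exp (C * (C6 + Cz + Cz)), Real.exp_pos _, fun φ hφ N => ?_⟩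
  set v : (ℕ → ℂ) → TrigPoly := fun z => smooth φ N (series lam N z) with hv
  have hvm : CoeffMeasurable v := (coeffMeasurable_series lam N).smooth φ N
  have hv0 : ∀ z, (v z).coeff 0 = 0 := fun z => by simp [hv, coeff_series_zero]
  set Z1 : (ℕ → ℂ) → ℝ := fun z => sob (-(3 / 2)) (dx (v z) * dx (v z)) ^ 2 with hZ1
  set Z2 : (ℕ → ℂ) → ℝ := fun z =>
    sob (-(3 / 2)) (hilbert κ (dx (v z)) * hilbert κ (dx (v z))) ^ 2 with hZ2
  set y : (ℕ → ℂ) → ℝ := fun z => sob (7 / 8) (series lam N z) with hy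
  set cub : (ℕ → ℂ) → ℝ := fun z => (cubicEnergy κ (v z)).re with hcub
  set G : (ℕ → ℂ) → ℝ := fun z => -(4 * Real.pi * lam * κ) * cub z
    + C * ((1 + y z) ^ 6 + Z1 z + Z2 z) with hG
  have hZ1' := hZ N (fun n => Complex.I * n * (φ ((n : ℝ) / N) : ℂ)) fun n => by
    rw [norm_mul]
    refine (mul_le_of_le_one_right (norm_nonneg _) ?_).trans (norm_symbol_dx n)
    rw [Complex.norm_real]; exact hφ _
  have hZ2' := hZ N (fun n => hilbertSymbol κ n * (Complex.I * n) * (φ ((n : ℝ) / N) : ℂ))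
    fun n => by
      rw [norm_mul]
      refine (mul_le_of_le_one_right (norm_nonneg _) ?_).trans (norm_symbol_hilbert_dx hκ n)
      rw [Complex.norm_real]; exact hφ _
  have e1 : ∀ z, multiplier (fun n => Complex.I * n * (φ ((n : ℝ) / N) : ℂ)) (series lam N z)
      = dx (v z) := fun z => (multiplier_multiplier _ _ _).symm
  have e2 : ∀ z, multiplier (fun n => hilbertSymbol κ n * (Complex.I * n) * (φ ((n : ℝ) / N) : ℂ))
      (series lam N z) = hilbert κ (dx (v z)) := fun z => by
    rw [hilbert_dx_eq]; exact (multiplier_multiplier _ _ _).symm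
  simp only [e1] at hZ1'
  simp only [e2] at hZ2'
  have hcubm : Measurable cub := by
    refine Complex.measurable_re.comp ?_
    simp only [cubicEnergy, trilinear]
    refine Measurable.add (Measurable.const_mul ?_ _) (Measurable.const_mul ?_ _)
    · exact (hvm.mul ((hvm.multiplier _).mul (hvm.multiplier _))).mean
    · exact (hvm.mul ((hvm.multiplier _).mul (hvm.multiplier _))).mean
  -- The constant may grow with `N`: only integrability is needed, as the mean will vanish.
  have hcubint : Integrable cub noise := by
    obtain ⟨C3, hC3, h3⟩ := integral_one_add_sob_pow_le hlam 3
    refine ((h3 N).1.const_mul (2 * c * ((N : ℝ) ^ (1 / 8 : ℝ)) ^ 2)).mono'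
      hcubm.aestronglyMeasurable (ae_of_all _ fun z => ?_)
    have hyz : sob (7 / 8) (v z) ≤ y z := sob_smooth_le hφ N _ _
    have hy0 : 0 ≤ y z := sob_nonneg _ _
    have b1 : sob (3 / 4) (v z) ≤ y z := (sob_mono (by norm_num) (hv0 z)).trans hyz
    have b2 : sob 1 (v z) ≤ (N : ℝ) ^ (1 / 8 : ℝ) * y z := by
      have := sob_le_of_degree (N := N) (s := 7 / 8) (r := 1 / 8) (by norm_num) (hv0 z)
        (fun n hn => by simp [hv, coeff_series_of_lt z hn])
      rw [show (7 / 8 + 1 / 8 : ℝ) = 1 by norm_num] at this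
      exact this.trans (mul_le_mul_of_nonneg_left hyz (by positivity))
    have b3 : ∀ m : ℤ → ℂ, (∀ n : ℤ, ‖m n‖ ≤ |(n : ℝ)|) → ‖trilinear m (v z)‖
        ≤ c * ((N : ℝ) ^ (1 / 8 : ℝ)) ^ 2 * (1 + y z) ^ 3 := by
      intro m hm
      refine (norm_trilinear_le hc hc1 hm (hv0 z)).trans ?_
      have := sob_nonneg (3 / 4) (v z)
      have := sob_nonneg 1 (v z)
      calc c * sob (3 / 4) (v z) * sob 1 (v z) ^ 2
          ≤ c * y z * ((N : ℝ) ^ (1 / 8 : ℝ) * y z) ^ 2 := by gcongr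
        _ = c * ((N : ℝ) ^ (1 / 8 : ℝ)) ^ 2 * y z ^ 3 := by ring
        _ ≤ _ := by gcongr; linarith
    refine (Complex.abs_re_le_norm _).trans ?_
    rw [cubicEnergy]
    refine (norm_add_le _ _).trans ?_
    rw [norm_mul, norm_mul, show ‖(3 / 2 : ℂ)‖ = 3 / 2 by norm_num,
      show ‖(1 / 2 : ℂ)‖ = 1 / 2 by norm_num]
    have := b3 _ norm_symbol_dx
    have := b3 _ (norm_symbol_hilbert_dx hκ)
    linarith
  -- The cubic energy is odd and the noise is invariant under `z ↦ -z`.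
  have hcub0 : ∫ z, cub z ∂noise = 0 := by
    have hmp := measurePreserving_mul_noise (c := fun _ => -1) (fun _ => by simp)
    have h1 : ∫ z, cub z ∂noise = ∫ z, -cub z ∂noise := by
      conv_lhs => rw [← hmp.map_eq]
      rw [integral_map hmp.measurable.aemeasurable hcubm.aestronglyMeasurable]
      refine integral_congr_ae (ae_of_all _ fun z => ?_)
      have h2 : (fun j => -1 * z j) = -z := by ext j; simp
      have h3 : v (-z) = -v z := by
        simp only [hv]
        rw [series_neg]; exact multiplier_neg _ _
      simp only [hcub]
      rw [h2, h3, cubicEnergy, cubicEnergy, trilinear_neg, trilinear_neg, ← Complex.neg_re]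
      congr 1; ring
    rw [integral_neg] at h1
    exact self_eq_neg.mp h1
  have hGint : Integrable G noise :=
    (hcubint.const_mul _).add ((((hmom N).1.add hZ1'.1).add hZ2'.1).const_mul _)
  have hGm : Measurable G := by
    have m1 : Measurable Z1 := ((hvm.dx.mul hvm.dx).sob _).pow_const 2
    have m2 : Measurable Z2 := (((hvm.dx.hilbert κ).mul (hvm.dx.hilbert κ)).sob _).pow_const 2
    have m3 : Measurable y := (coeffMeasurable_series lam N).sob _
    fun_prop
  have hGle : ∫ z, G z ∂noise ≤ C * (C6 + Cz + Cz) := by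
    have h1 : ∫ z, G z ∂noise = -(4 * Real.pi * lam * κ) * ∫ z, cub z ∂noise
        + C * (∫ z, (1 + y z) ^ 6 ∂noise + ∫ z, Z1 z ∂noise + ∫ z, Z2 z ∂noise) := by
      have i1 : Integrable (fun z => (1 + y z) ^ 6 + Z1 z) noise := (hmom N).1.add hZ1'.1
      have i2 : Integrable (fun z => (1 + y z) ^ 6 + Z1 z + Z2 z) noise := i1.add hZ2'.1
      have a1 : ∫ z, ((1 + y z) ^ 6 + Z1 z + Z2 z) ∂noise
          = ∫ z, ((1 + y z) ^ 6 + Z1 z) ∂noise + ∫ z, Z2 z ∂noise := integral_add i1 hZ2'.1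
      have a2 : ∫ z, ((1 + y z) ^ 6 + Z1 z) ∂noise
          = ∫ z, (1 + y z) ^ 6 ∂noise + ∫ z, Z1 z ∂noise := integral_add (hmom N).1 hZ1'.1
      rw [← a2, ← a1, ← integral_const_mul, ← integral_const_mul]
      exact integral_add (hcubint.const_mul _) (i2.const_mul _)
    rw [h1, hcub0, mul_zero, zero_add]
    exact mul_le_mul_of_nonneg_left (add_le_add (add_le_add (hmom N).2 hZ1'.2) hZ2'.2) hC
  set M := C * (C6 + Cz + Cz) with hM
  set S : Set (ℕ → ℂ) := {z | sob 0 (series lam N z) ≤ C₀ ∧ sob (1 / 2) (series lam N z) ≤ C₀}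
    with hS
  have hSm : MeasurableSet S :=
    (measurableSet_le ((coeffMeasurable_series lam N).sob _) measurable_const).inter
      (measurableSet_le ((coeffMeasurable_series lam N).sob _) measurable_const)
  set F : (ℕ → ℂ) → ℝ≥0∞ := S.indicator fun z => ENNReal.ofReal (Real.exp
    (-2 * (energyThreeHalves κ lam (v z) - normSq lam (3 / 2) (v z)))) with hF
  have hFm : Measurable F := by
    refine Measurable.indicator ?_ hSm
    have := hvm.energyThreeHalves κ lam
    have := hvm.normSq lam (3 / 2)
    fun_prop
  -- The coordinate `0` does not enter the series; it only adds a nonnegative term to the cost.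
  set s : Finset ℕ := Finset.range (N + 1) with hs
  have hser : ∀ z, series lam N (extendZero s (s.restrict z)) = series lam N z := fun z =>
    series_congr lam fun j _ hj => extendZero_restrict s z (by rw [hs, Finset.mem_range]; omega)
  have hFs : ∀ z, F (extendZero s (s.restrict z)) = F z := by
    intro z
    have hmem : extendZero s (s.restrict z) ∈ S ↔ z ∈ S := by
      simp only [hS, Set.mem_ofPred_eq, hser]
    by_cases hz : z ∈ S
    · rw [hF, Set.indicator_of_mem hz, Set.indicator_of_mem (hmem.mpr hz)]
      simp only [hv, hser]
    · rw [hF, Set.indicator_of_notMem hz, Set.indicator_of_notMem (mt hmem.mp hz)]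
  have hGs : ∀ z, G (extendZero s (s.restrict z)) = G z := by
    intro z
    simp only [hG, hcub, hZ1, hZ2, hy, hv, hser]
  -- With `Y = v z'` and `k = v z - v z'`, the deterministic estimate gives `F z · exp (-G z') ≤ exp
  -- (cost)`, the hypothesis of property `(τ)`.
  have htau := lintegral_noise_mul_le s (fun x => F (extendZero s x))
    (fun x => ENNReal.ofReal (Real.exp (-G (extendZero s x))))
    (hFm.comp (measurable_extendZero s))
    ((hGm.comp (measurable_extendZero s)).neg.exp.ennreal_ofReal) (fun x x' => by
      set z := extendZero s x
      set z' := extendZero s x'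
      by_cases hz : z ∈ S
      · rw [hF, Set.indicator_of_mem hz, ← ENNReal.ofReal_mul (Real.exp_pos _).le, ← Real.exp_add]
        refine ENNReal.ofReal_le_ofReal (Real.exp_le_exp.mpr ?_)
        set k := smooth φ N (series lam N (z - z')) with hk
        have hsplit : v z = v z' + k := by
          rw [hk, series_sub, smooth, multiplier_sub]
          simp only [hv, smooth]
          ring
        have h1 := hrem (v z') k (hv0 z') (by simp [hk, coeff_series_zero])
          (by rw [← hsplit]; exact (sob_smooth_le hφ N _ _).trans hz.1)
          (by rw [← hsplit]; exact (sob_smooth_le hφ N _ _).trans hz.2)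
        rw [← hsplit] at h1
        have h2 : C * ((1 + sob (7 / 8) (v z')) ^ 6 + Z1 z' + Z2 z')
            ≤ C * ((1 + y z') ^ 6 + Z1 z' + Z2 z') := by
          have := sob_smooth_le hφ N (7 / 8) (series lam N z')
          have := sob_nonneg (7 / 8) (v z')
          gcongr
        have h3 : Real.pi * lam * sob (3 / 2) k ^ 2 ≤ ∑ i, ‖x i - x' i‖ ^ 2 / 2 := by
          have h4 : sob (3 / 2) k ^ 2 ≤ sob (3 / 2) (series lam N (z - z')) ^ 2 :=
            pow_le_pow_left₀ (sob_nonneg _ _) (sob_smooth_le hφ N _ _) 2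
          have h5 := normSq_series hlam N (z - z')
          rw [normSq_eq_sob] at h5
          have h6 : ∑ i, ‖x i - x' i‖ ^ 2 / 2
              = ∑ j ∈ Finset.range (N + 1), ‖(z - z') j‖ ^ 2 / 2 := by
            rw [← hs, ← Finset.sum_coe_sort s]
            refine Finset.sum_congr rfl fun i _ => ?_
            simp [z, z', extendZero]
          rw [h6, Finset.sum_range_succ', ← Finset.sum_div, ← h5]
          have h7 := mul_le_mul_of_nonneg_left h4 (by positivity : 0 ≤ Real.pi * lam)
          have h8 : 0 ≤ ‖(z - z') 0‖ ^ 2 / 2 := by positivity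
          linarith
        simp only [hG, hcub]
        linarith
      · rw [hF, Set.indicator_of_notMem hz, zero_mul]; exact zero_le)
  simp only [hFs, hGs] at htau
  -- Jensen's inequality in the form `exp (-G) ≥ exp (-M) (1 + M - G)`, integrated with `E G ≤ M`.
  have hlow : ENNReal.ofReal (Real.exp (-M)) ≤ ∫⁻ z, ENNReal.ofReal (Real.exp (-G z)) ∂noise := by
    have hint : Integrable (fun z => Real.exp (-M) * (1 + M - G z)) noise :=
      ((integrable_const _).sub hGint).const_mul _
    calc ENNReal.ofReal (Real.exp (-M))
        ≤ ENNReal.ofReal (∫ z, Real.exp (-M) * (1 + M - G z) ∂noise) := by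
          refine ENNReal.ofReal_le_ofReal ?_
          rw [integral_const_mul, integral_sub (integrable_const _) hGint]
          simp only [integral_const, probReal_univ, one_smul]
          nlinarith [Real.exp_pos (-M)]
      _ ≤ ∫⁻ z, ENNReal.ofReal (Real.exp (-M) * (1 + M - G z)) ∂noise := by
          rw [integral_eq_lintegral_pos_part_sub_lintegral_neg_part hint]
          refine (ENNReal.ofReal_le_ofReal (sub_le_self _ ENNReal.toReal_nonneg)).trans
            ENNReal.ofReal_toReal_le
      _ ≤ _ := by
          refine lintegral_mono fun z => ENNReal.ofReal_le_ofReal ?_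
          have h1 := Real.add_one_le_exp (M - G z)
          calc Real.exp (-M) * (1 + M - G z) ≤ Real.exp (-M) * Real.exp (M - G z) := by
                refine mul_le_mul_of_nonneg_left (by linarith) (Real.exp_pos _).le
            _ = Real.exp (-G z) := by rw [← Real.exp_add]; congr 1; ring
  calc ∫⁻ z, F z ∂noise
      = (∫⁻ z, F z ∂noise) * ENNReal.ofReal (Real.exp (-M)) * ENNReal.ofReal (Real.exp M) := by
        rw [mul_assoc, ← ENNReal.ofReal_mul (Real.exp_pos _).le, ← Real.exp_add]; simp
    _ ≤ (∫⁻ z, F z ∂noise) * (∫⁻ z, ENNReal.ofReal (Real.exp (-G z)) ∂noise)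
          * ENNReal.ofReal (Real.exp M) := by gcongr
    _ ≤ 1 * ENNReal.ofReal (Real.exp M) := by gcongr
    _ = _ := one_mul _

end

/-! ### Pathwise estimates of the defects other than the quartic one -/

section

namespace TrigPoly

lemma wie_mul_leibniz {s : ℝ} (hs : 0 < s) (hs1 : s ≤ 1) (p q : TrigPoly) :
    wie s (p * q) ≤ wie s p * wie 0 q + wie 0 p * wie s q := by
  calc wie s (p * q) ≤ wie 0 (majorant s p * majorant 0 q + majorant 0 p * majorant s q) :=
        wie_le_of_coeff fun n => by simpa using leibniz_coeff hs hs1 p q n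
    _ ≤ wie 0 (majorant s p * majorant 0 q) + wie 0 (majorant 0 p * majorant s q) :=
        wie_add_le _ _ _
    _ ≤ wie 0 (majorant s p) * wie 0 (majorant 0 q)
          + wie 0 (majorant 0 p) * wie 0 (majorant s q) :=
        add_le_add (wie_mul_le _ _) (wie_mul_le _ _)
    _ = _ := by simp only [wie_majorant]

lemma sob_highPart_anti (s : ℝ) {M M' : ℝ} (h : M' ≤ M) (p : TrigPoly) :
    sob s (highPart M p) ≤ sob s (highPart M' p) := by
  refine sob_le_of_coeff fun n => ?_
  refine mul_le_mul_of_nonneg_left ?_ (by positivity)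
  rw [coeff_highPart, coeff_highPart]
  split_ifs with h1 h2
  · exact le_rfl
  · exact absurd (h.trans_lt h1) h2
  · simp
  · simp

lemma coeff_removedPart (φ : ℝ → ℝ) (N : ℕ) (v : TrigPoly) (n : ℤ) :
    (removedPart φ N v).coeff n
      = (1 - (φ ((n : ℝ) / N) : ℂ) ^ 2) * (v * dx v).coeff n := by
  rw [removedPart, AddMonoidAlgebra.coeff_sub, Finsupp.sub_apply, coeff_smooth, coeff_smooth]
  ring

lemma norm_one_sub_sq_le {r : ℝ} (hr : |r| ≤ 1) : ‖(1 - (r : ℂ) ^ 2 : ℂ)‖ ≤ 1 := by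
  have : (1 - (r : ℂ) ^ 2 : ℂ) = ((1 - r ^ 2 : ℝ) : ℂ) := by push_cast; ring
  rw [this, Complex.norm_real, Real.norm_eq_abs, abs_le]
  have := (sq_le_one_iff_abs_le_one r).mpr hr
  constructor <;> nlinarith [sq_nonneg r]

lemma coeff_removedPart_of_le {ε : ℝ} {φ : ℝ → ℝ} (hφ : IsProfile ε φ) {N : ℕ} (hN : 0 < N)
    (v : TrigPoly) {n : ℤ} (hn : |(n : ℝ)| ≤ (1 - ε) * N) : (removedPart φ N v).coeff n = 0 := by
  have hN' : (0 : ℝ) < N := by exact_mod_cast hN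
  have : φ ((n : ℝ) / N) = 1 := by
    rw [hφ.even, abs_div, Nat.abs_cast]
    exact hφ.eq_one _ ⟨by positivity, (div_le_iff₀ hN').mpr hn⟩
  rw [coeff_removedPart, this]; simp

lemma highPart_removedPart {ε : ℝ} {φ : ℝ → ℝ} (hφ : IsProfile ε φ) {N : ℕ} (hN : 0 < N)
    (v : TrigPoly) : highPart ((1 - ε) * N) (removedPart φ N v) = removedPart φ N v := by
  ext n
  rw [coeff_highPart]
  split_ifs with h
  · rfl
  · exact (coeff_removedPart_of_le hφ hN v (not_lt.mp h)).symm

/-- The symbol `1 - φ²` vanishes for `|n| ≤ (1 - ε) N` and has modulus at most one, so both factors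
may be restricted to higher frequencies. -/
lemma norm_mean_removedPart_mul_le {ε : ℝ} {φ : ℝ → ℝ} (hφ : IsProfile ε φ) {N : ℕ} (hN : 0 < N)
    (v q : TrigPoly) : ‖mean (removedPart φ N v * q)‖
      ≤ sob 0 (highPart ((1 - ε) * N) (v * dx v)) * sob 0 (highPart ((1 - ε) * N) q) := by
  have h1 : mean (removedPart φ N v * q)
      = mean (removedPart φ N v * highPart ((1 - ε) * N) q) := by
    rw [highPart, mean_mul_multiplier]
    conv_lhs => rw [← highPart_removedPart hφ hN v]
    simp [highPart]
  rw [h1]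
  refine (norm_mean_mul_le_zero _ _).trans (mul_le_mul_of_nonneg_right ?_ (sob_nonneg _ _))
  refine sob_le_of_coeff fun n => mul_le_mul_of_nonneg_left ?_ (by positivity)
  rw [coeff_highPart]
  split_ifs with h
  · rw [coeff_removedPart, norm_mul]
    exact mul_le_of_le_one_left (norm_nonneg _) (norm_one_sub_sq_le (hφ.abs_le_one _))
  · rw [coeff_removedPart_of_le hφ hN v (not_lt.mp h)]

/-- The basic estimate of a high frequency product with a low regularity factor `q`. -/
lemma sob_highPart_mul_le_of_bounds {M L : ℝ} (hL : 0 < L) {f q : TrigPoly} {F₀ F₁ b Q : ℝ}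
    (h0 : wie 0 f ≤ F₀) (h1 : wie (1 / 4) f ≤ F₁) (hb : sob 0 (highPart (M - L) q) ≤ b)
    (hQ : sob 0 q ≤ Q) :
    sob 0 (highPart M (f * q)) ≤ F₀ * b + L ^ (-(1 / 4) : ℝ) * F₁ * Q := by
  refine (sob_highPart_mul_le M L f q).trans (add_le_add ?_ ?_)
  · exact mul_le_mul h0 hb (sob_nonneg _ _) ((wie_nonneg _ _).trans h0)
  · have h2 := wie_highPart_le hL (by norm_num : (0 : ℝ) ≤ 1 / 4) 0 f
    rw [zero_add] at h2
    refine mul_le_mul (h2.trans (mul_le_mul_of_nonneg_left h1 (by positivity))) hQ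
      (sob_nonneg _ _) (mul_nonneg (by positivity) ((wie_nonneg _ _).trans h1))

lemma wie_le_sob_sevenEighths : ∃ c : ℝ, 1 ≤ c ∧ ∀ p : TrigPoly, p.coeff 0 = 0 →
    wie 0 p ≤ c * sob (7 / 8) p ∧ wie (1 / 4) p ≤ c * sob (7 / 8) p := by
  refine ⟨max 1 (max (√(∑' n : ℤ, |(n : ℝ)| ^ (2 * ((0 : ℝ) - 7 / 8))))
    (√(∑' n : ℤ, |(n : ℝ)| ^ (2 * ((1 / 4 : ℝ) - 7 / 8))))), le_max_left _ _, fun p hp => ⟨?_, ?_⟩⟩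
  · exact (wie_le_sob (by norm_num) hp).trans (mul_le_mul_of_nonneg_right
      ((le_max_left _ _).trans (le_max_right _ _)) (sob_nonneg _ _))
  · exact (wie_le_sob (by norm_num) hp).trans (mul_le_mul_of_nonneg_right
      ((le_max_right _ _).trans (le_max_right _ _)) (sob_nonneg _ _))

set_option maxHeartbeats 1000000 in
/-- The nonquartic defects are small when the energy `b` of the modes close to `N` is small. -/
lemma norm_defect_le {κ : ℝ} (hκ : κ = 1 ∨ κ = -1) : ∃ C : ℝ, 0 ≤ C ∧
    ∀ (ε : ℝ) (_ : 0 < ε) (_ : ε ≤ 1 / 4) (φ : ℝ → ℝ) (_ : IsProfile ε φ) (N : ℕ) (_ : 0 < N)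
      (u : TrigPoly) (_ : u.coeff 0 = 0) (_ : ∀ n : ℤ, (N : ℝ) < |(n : ℝ)| → u.coeff n = 0),
    ‖defectOne κ (smooth φ N u) (removedPart φ N (smooth φ N u))‖
        ≤ C * (1 + sob (7 / 8) u) ^ 6 * (sob 1 (highPart ((1 - 2 * ε) * N) u)
          + (ε * N / 2) ^ (-(1 / 4) : ℝ) * (N : ℝ) ^ (1 / 8 : ℝ)) ^ 2 ∧
    ‖defectHigher κ (smooth φ N u) (removedPart φ N (smooth φ N u))‖
        ≤ C * (1 + sob (7 / 8) u) ^ 6 * (sob 1 (highPart ((1 - 2 * ε) * N) u)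
          + (ε * N / 2) ^ (-(1 / 4) : ℝ) * (N : ℝ) ^ (1 / 8 : ℝ)) ^ 2 := by
  obtain ⟨c, hc1, hc⟩ := wie_le_sob_sevenEighths
  refine ⟨7 * c ^ 6, by positivity, fun ε hε hε4 φ hφ N hN u hu0 huN => ?_⟩
  have hN' : (1 : ℝ) ≤ N := by exact_mod_cast hN
  set v := smooth φ N u with hv
  set M := (1 - ε) * (N : ℝ) with hM
  -- Half of the margin `εN`: two successive losses of `L` from `(1 - ε) N`, needed for nested
  -- products, end exactly at `(1 - 2ε) N`.
  set L := ε * (N : ℝ) / 2 with hL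
  have hLpos : 0 < L := by positivity
  set b := sob 1 (highPart ((1 - 2 * ε) * N) u) with hb
  have hb0 : 0 ≤ b := sob_nonneg _ _
  set K := L ^ (-(1 / 4) : ℝ) * (N : ℝ) ^ (1 / 8 : ℝ) with hK
  have hLr : 0 ≤ L ^ (-(1 / 4) : ℝ) := by positivity
  have hNr : 1 ≤ (N : ℝ) ^ (1 / 8 : ℝ) := Real.one_le_rpow hN' (by norm_num)
  have hLK : L ^ (-(1 / 4) : ℝ) ≤ K := le_mul_of_one_le_right hLr hNr
  have hK0 : 0 ≤ K := hLr.trans hLK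
  set Y := c * (1 + sob (7 / 8) u) with hY
  have hy0 := sob_nonneg (7 / 8) u
  have hY1 : 1 ≤ Y := by nlinarith
  have hyY : sob (7 / 8) u ≤ Y := by nlinarith
  have hv0 : v.coeff 0 = 0 := by simp [hv, hu0]
  have hvy : sob (7 / 8) v ≤ sob (7 / 8) u := sob_smooth_le hφ.abs_le_one _ _ _
  have hcy : c * sob (7 / 8) v ≤ Y :=
    mul_le_mul_of_nonneg_left (by linarith) (by linarith)
  have w0 : wie 0 v ≤ Y := (hc v hv0).1.trans hcy
  have w1 : wie (1 / 4) v ≤ Y := (hc v hv0).2.trans hcy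
  have sq : sob (1 / 4) v ≤ Y := (sob_mono (by norm_num) hv0).trans (hvy.trans hyY)
  -- The `H¹` norm is not uniformly bounded, but the degree is at most `N` and this costs only
  -- `N^{1/8}`. The gain `L^{-1/4}` from the smoother factor compensates it, which is the quantity
  -- `K`.
  have s1 : sob 1 v ≤ (N : ℝ) ^ (1 / 8 : ℝ) * Y := by
    have := sob_le_of_degree (N := N) (s := 7 / 8) (r := 1 / 8) (by norm_num) hv0
      (fun n hn => by simp [hv, huN n hn])
    norm_num at this
    refine this.trans ?_
    norm_num
    exact mul_le_mul_of_nonneg_left (hvy.trans hyY) (by positivity)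
  have d1 : sob 0 (dx v) ≤ (N : ℝ) ^ (1 / 8 : ℝ) * Y := by
    have := sob_dx_le 0 hv0
    rw [zero_add] at this
    exact this.trans s1
  have d2 : sob 0 (hilbert κ (dx v)) ≤ (N : ℝ) ^ (1 / 8 : ℝ) * Y := (sob_hilbert_le hκ _ _).trans d1
  have hbd : ∀ M', (1 - 2 * ε) * N ≤ M' → sob 0 (highPart M' (dx v)) ≤ b := by
    intro M' hM'
    refine (sob_highPart_anti 0 hM' _).trans ?_
    rw [highPart_dx, hv, highPart_smooth]
    have h0 : (smooth φ N (highPart ((1 - 2 * ε) * N) u)).coeff 0 = 0 := by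
      rw [coeff_smooth, coeff_highPart, hu0]; simp
    have := sob_dx_le 0 h0
    rw [zero_add] at this
    exact this.trans (sob_smooth_le hφ.abs_le_one _ _ _)
  have hbh : ∀ M', (1 - 2 * ε) * N ≤ M' → sob 0 (highPart M' (hilbert κ (dx v))) ≤ b := by
    intro M' hM'
    rw [highPart_hilbert]
    exact (sob_hilbert_le hκ _ _).trans (hbd M' hM')
  have hML : (1 - 2 * ε) * N ≤ M - L := by rw [hM, hL]; nlinarith
  have hMLL : (1 - 2 * ε) * N ≤ M - L - L := by rw [hM, hL]; nlinarith
  -- Either the rough factor `q` carries a frequency above `M' - L`, which costs `b`, or `v` carries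
  -- one above `L`, which costs `K`.
  have key : ∀ (M' : ℝ) (_ : (1 - 2 * ε) * N ≤ M' - L) (q : TrigPoly)
      (_ : sob 0 (highPart (M' - L) q) ≤ b) (_ : sob 0 q ≤ (N : ℝ) ^ (1 / 8 : ℝ) * Y),
      sob 0 (highPart M' (v * q)) ≤ Y ^ 2 * (b + K) := by
    intro M' hM' q hq hq'
    refine (sob_highPart_mul_le_of_bounds hLpos w0 w1 hq hq').trans ?_
    have : L ^ (-(1 / 4) : ℝ) * Y * ((N : ℝ) ^ (1 / 8 : ℝ) * Y) = Y ^ 2 * K := by rw [hK]; ring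
    rw [this]
    have := mul_le_mul_of_nonneg_right (le_self_pow₀ hY1 two_ne_zero) hb0
    linarith
  have hB : sob 0 (highPart M (v * dx v)) ≤ Y ^ 2 * (b + K) := key M hML _ (hbd _ hML) d1
  have hB' : sob 0 (highPart M (v * hilbert κ (dx v))) ≤ Y ^ 2 * (b + K) :=
    key M hML _ (hbh _ hML) d2
  have ww0 : wie 0 (v * v) ≤ Y ^ 2 := (wie_mul_le v v).trans (by
    rw [pow_two]; exact mul_le_mul w0 w0 (wie_nonneg _ _) (by linarith))
  have ww1 : wie (1 / 4) (v * v) ≤ 2 * Y ^ 2 :=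
    (wie_mul_leibniz (by norm_num) (by norm_num) v v).trans (by
      have e1 := mul_le_mul w1 w0 (wie_nonneg _ _) (by linarith)
      have e2 := mul_le_mul w0 w1 (wie_nonneg _ _) (by linarith)
      linarith)
  have key2 : ∀ (q : TrigPoly) (_ : sob 0 (highPart (M - L) q) ≤ b)
      (_ : sob 0 q ≤ (N : ℝ) ^ (1 / 8 : ℝ) * Y),
      sob 0 (highPart M (v * v * q)) ≤ 2 * Y ^ 3 * (b + K) := by
    intro q hq hq'
    refine (sob_highPart_mul_le_of_bounds hLpos ww0 ww1 hq hq').trans ?_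
    have : L ^ (-(1 / 4) : ℝ) * (2 * Y ^ 2) * ((N : ℝ) ^ (1 / 8 : ℝ) * Y) = 2 * Y ^ 3 * K := by
      rw [hK]; ring
    rw [this]
    have := mul_le_mul_of_nonneg_right
      (pow_le_pow_right₀ hY1 (by norm_num : 2 ≤ 3)) hb0
    have : 0 ≤ Y ^ 3 * b := by positivity
    linarith
  have hq1 := key2 _ (hbh _ hML) d2
  have hq2 : sob 0 (highPart M (hilbert κ (v * v * dx v))) ≤ 2 * Y ^ 3 * (b + K) := by
    rw [highPart_hilbert]
    exact (sob_hilbert_le hκ _ _).trans (key2 _ (hbd _ hML) d1)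
  -- The nested product uses the margin twice, first at level `M` and then at level `M - L`.
  have hq3 : sob 0 (highPart M (v * hilbert κ (v * dx v))) ≤ 2 * Y ^ 3 * (b + K) := by
    have e1 : sob 0 (highPart (M - L) (hilbert κ (v * dx v))) ≤ Y ^ 2 * (b + K) := by
      rw [highPart_hilbert]
      exact (sob_hilbert_le hκ _ _).trans (key (M - L) hMLL _ (hbd _ hMLL) d1)
    have e2 : sob 0 (hilbert κ (v * dx v)) ≤ Y * ((N : ℝ) ^ (1 / 8 : ℝ) * Y) :=
      (sob_hilbert_le hκ _ _).trans ((sob_mul_le _ _).trans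
        (mul_le_mul w0 d1 (sob_nonneg _ _) (by linarith)))
    refine (sob_highPart_mul_le_of_bounds hLpos w0 w1 e1 e2).trans ?_
    have : L ^ (-(1 / 4) : ℝ) * Y * (Y * ((N : ℝ) ^ (1 / 8 : ℝ) * Y)) = Y ^ 3 * K := by
      rw [hK]; ring
    rw [this]
    have : 0 ≤ Y ^ 3 * b := by positivity
    have : 0 ≤ Y ^ 3 * K := by positivity
    have : Y * (Y ^ 2 * (b + K)) = Y ^ 3 * b + Y ^ 3 * K := by ring
    linarith
  -- Powers of `v` without derivatives are bounded in `H^{1/4}`, so their high frequencies are small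
  -- without any use of `b`.
  have hlow : ∀ p : TrigPoly, sob 0 (highPart M p) ≤ K * sob (1 / 4) p := by
    intro p
    have hLM : L ≤ M := by rw [hM, hL]; nlinarith
    have := sob_highPart_le_rpow hLpos (by norm_num : (0 : ℝ) ≤ 1 / 4) 0 p
    rw [zero_add] at this
    exact (sob_highPart_anti 0 hLM p).trans (this.trans
      (mul_le_mul_of_nonneg_right hLK (sob_nonneg _ _)))
  have hc3 : sob 0 (highPart M (v * v * v)) ≤ 3 * Y ^ 3 * K := by
    rw [mul_assoc]
    refine (hlow _).trans ?_
    have h3 : sob (1 / 4) (v * (v * v)) ≤ 3 * Y ^ 2 * Y :=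
      (sob_cube_le (by norm_num) (by norm_num) v).trans (mul_le_mul
        (mul_le_mul_of_nonneg_left (pow_le_pow_left₀ (wie_nonneg _ _) w0 2) (by norm_num)) sq
        (sob_nonneg _ _) (by positivity))
    have := mul_le_mul_of_nonneg_left h3 hK0
    linarith
  have hc4 : sob 0 (highPart M (v * v * (v * v))) ≤ 4 * Y ^ 4 * K := by
    refine (hlow _).trans ?_
    have h2 : sob (1 / 4) (v * v) ≤ 2 * Y * Y :=
      (sob_half_sq_le (by norm_num) (by norm_num) v).trans (mul_le_mul
        (mul_le_mul_of_nonneg_left w0 (by norm_num)) sq (sob_nonneg _ _) (by positivity))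
    have h4 : sob (1 / 4) (v * v * (v * v)) ≤ 2 * Y ^ 2 * (2 * Y * Y) :=
      (sob_half_sq_le (by norm_num) (by norm_num) (v * v)).trans (mul_le_mul
        (mul_le_mul_of_nonneg_left ww0 (by norm_num)) h2 (sob_nonneg _ _) (by positivity))
    have := mul_le_mul_of_nonneg_left h4 hK0
    linarith
  have hbnd : ∀ {q : TrigPoly} {Q : ℝ}, sob 0 (highPart M q) ≤ Q →
      ‖mean (removedPart φ N v * q)‖ ≤ Y ^ 2 * (b + K) * Q := fun {q Q} hQ =>
    (norm_mean_removedPart_mul_le hφ hN v q).trans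
      (mul_le_mul hB hQ (sob_nonneg _ _) (by positivity))
  have hBH : sob 0 (highPart M (hilbert κ (v * dx v))) ≤ Y ^ 2 * (b + K) := by
    rw [highPart_hilbert]
    exact (sob_hilbert_le hκ _ _).trans hB
  have hbK : 0 ≤ b + K := by positivity
  have hKb : K ≤ b + K := by linarith
  have hY5 : Y ^ 4 ≤ Y ^ 6 := pow_le_pow_right₀ hY1 (by norm_num)
  have hY6 : Y ^ 5 ≤ Y ^ 6 := pow_le_pow_right₀ hY1 (by norm_num)
  have hX : 0 ≤ (b + K) ^ 2 := sq_nonneg _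
  have hX1 : (b + K) * K ≤ (b + K) ^ 2 := by
    rw [pow_two]; exact mul_le_mul_of_nonneg_left hKb hbK
  have goal_eq : 7 * c ^ 6 * (1 + sob (7 / 8) u) ^ 6 * (b + K) ^ 2 = 7 * (Y ^ 6 * (b + K) ^ 2) := by
    rw [hY]; ring
  rw [goal_eq]
  have n3 : ‖(3 / 2 : ℂ)‖ = 3 / 2 := by norm_num
  have n2 : ‖(1 / 2 : ℂ)‖ = 1 / 2 := by norm_num
  have n4 : ‖(1 / 4 : ℂ)‖ = 1 / 4 := by norm_num
  have p4 := mul_le_mul_of_nonneg_right hY5 hX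
  have p5 := mul_le_mul_of_nonneg_right hY6 hX
  have p5' := mul_le_mul_of_nonneg_left hX1 (by positivity : 0 ≤ Y ^ 5)
  have p6' := mul_le_mul_of_nonneg_left hX1 (by positivity : 0 ≤ Y ^ 6)
  constructor
  · have t1 := hbnd hB'
    have t2 := hbnd hBH
    have t3 := hbnd hc3
    rw [defectOne]
    refine (norm_add_le _ _).trans ?_
    rw [norm_mul, norm_mul, n3, n2]
    have := norm_add_le (mean (removedPart φ N v * (v * hilbert κ (dx v))))
      (mean (removedPart φ N v * hilbert κ (v * dx v)))
    have r1 : Y ^ 2 * (b + K) * (Y ^ 2 * (b + K)) = Y ^ 4 * (b + K) ^ 2 := by ring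
    have r3 : Y ^ 2 * (b + K) * (3 * Y ^ 3 * K) = 3 * (Y ^ 5 * ((b + K) * K)) := by ring
    rw [r1] at t1 t2
    rw [r3] at t3
    have hpos : 0 ≤ Y ^ 6 * (b + K) ^ 2 := by positivity
    linarith
  · have t1 := hbnd hq1
    have t2 := hbnd hq2
    have t3 := hbnd hq3
    have t4 := hbnd hc4
    rw [defectHigher]
    refine (norm_add_le _ _).trans ?_
    rw [norm_mul, n4]
    have := norm_add₃_le (a := mean (removedPart φ N v * (v * v * hilbert κ (dx v))))
      (b := mean (removedPart φ N v * hilbert κ (v * v * dx v)))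
      (c := mean (removedPart φ N v * (v * hilbert κ (v * dx v))))
    have r1 : Y ^ 2 * (b + K) * (2 * Y ^ 3 * (b + K)) = 2 * (Y ^ 5 * (b + K) ^ 2) := by ring
    have r3 : Y ^ 2 * (b + K) * (4 * Y ^ 4 * K) = 4 * (Y ^ 6 * ((b + K) * K)) := by ring
    rw [r1] at t1 t2 t3
    rw [r3] at t4
    linarith

end TrigPoly

end

/-! ### Algebraic structure of the quartic defect -/

section

open TrigPoly

namespace TrigPoly

/-- The symbol of the quadratic factor of the quartic defect. -/
def quadraticSymbol (κ : ℝ) (c d : ℤ) : ℂ :=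
  3 / 2 * ((Complex.I * c) * (Complex.I * d))
    + 1 / 2 * ((hilbertSymbol κ c * (Complex.I * c)) * (hilbertSymbol κ d * (Complex.I * d)))
    + Complex.I * (c + d : ℤ) * (hilbertSymbol κ (c + d) * hilbertSymbol κ d + 1) * (Complex.I * d)

lemma quadraticSymbol_neg (κ : ℝ) (c d : ℤ) :
    quadraticSymbol κ (-c) (-d) = quadraticSymbol κ c d := by
  have : -c + -d = -(c + d) := by ring
  simp only [quadraticSymbol, this, hilbertSymbol_neg]
  push_cast
  ring

/-- The first two terms visibly have size `|c| |d|`. In the last one the factor `1 - sgn(c + d) sgn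
d` vanishes when `d` and `c + d` have the same nonzero sign; otherwise `|c + d| ≤ |c|` or `c + d =
0`, so the outer derivative costs at most `2 |c|`. -/
lemma norm_quadraticSymbol_le {κ : ℝ} (hκ : κ = 1 ∨ κ = -1) (c d : ℤ) :
    ‖quadraticSymbol κ c d‖ ≤ 4 * (|(c : ℝ)| * |(d : ℝ)|) := by
  have nI : ∀ n : ℤ, ‖Complex.I * (n : ℂ)‖ = |(n : ℝ)| := fun n => by simp
  have h3 : ‖Complex.I * ((c + d : ℤ) : ℂ)
      * (hilbertSymbol κ (c + d) * hilbertSymbol κ d + 1)‖ ≤ 2 * |(c : ℝ)| := by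
    have hκ2 : (κ : ℂ) * κ = 1 := by rcases hκ with rfl | rfl <;> simp
    have e : hilbertSymbol κ (c + d) * hilbertSymbol κ d + 1
        = ((1 - (c + d).sign * d.sign : ℤ) : ℂ) := by
      have : hilbertSymbol κ (c + d) * hilbertSymbol κ d
          = Complex.I * Complex.I * ((κ : ℂ) * κ) * ((c + d).sign * d.sign) := by
        simp only [hilbertSymbol]; ring
      rw [this, hκ2, Complex.I_mul_I]; push_cast; ring
    rw [e, norm_mul, nI, Complex.norm_intCast, ← abs_mul, ← Int.cast_mul, ← Int.cast_abs,
      ← Int.cast_abs]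
    have : |(c + d) * (1 - (c + d).sign * d.sign)| ≤ 2 * |c| := by
      rw [abs_le]
      rcases lt_trichotomy (c + d) 0 with h | h | h <;>
        [rw [Int.sign_eq_neg_one_of_neg h]; rw [h]; rw [Int.sign_eq_one_of_pos h]] <;>
        rcases lt_trichotomy d 0 with h' | h' | h' <;>
        [rw [Int.sign_eq_neg_one_of_neg h']; rw [h', Int.sign_zero];
          rw [Int.sign_eq_one_of_pos h']; rw [Int.sign_eq_neg_one_of_neg h']; skip;
          rw [Int.sign_eq_one_of_pos h']; rw [Int.sign_eq_neg_one_of_neg h'];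
          rw [h', Int.sign_zero]; rw [Int.sign_eq_one_of_pos h']] <;>
        rcases abs_cases c with ⟨h2, _⟩ | ⟨h2, _⟩ <;> constructor <;> omega
    exact_mod_cast this
  have hh : ∀ n : ℤ, ‖hilbertSymbol κ n * (Complex.I * (n : ℂ))‖ ≤ |(n : ℝ)| :=
    norm_symbol_hilbert_dx hκ
  have h2 := mul_le_mul (hh c) (hh d) (norm_nonneg _) (abs_nonneg _)
  have h4 := mul_le_mul_of_nonneg_right h3 (abs_nonneg (d : ℝ))
  refine (norm_add₃_le).trans ?_
  rw [norm_mul, norm_mul (1 / 2 : ℂ), norm_mul (Complex.I * (c : ℂ)), nI, nI,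
    norm_mul (_ * _ * _) (Complex.I * (d : ℂ)), norm_mul (_ * (_ * _)) (_ * (_ * _)), nI,
    show ‖(3 / 2 : ℂ)‖ = 3 / 2 by norm_num, show ‖(1 / 2 : ℂ)‖ = 1 / 2 by norm_num]
  linarith

/-- The quartic defect, written with the antisymmetric part removed. -/
lemma defectQuartic_eq {φ : ℝ → ℝ} (hφ : ∀ x, φ x = φ |x|) (κ : ℝ) (N : ℕ) (v : TrigPoly) :
    defectQuartic κ v (removedPart φ N v) = mean (removedPart φ N v
      * ((3 / 2 : ℂ) • (dx v * dx v) + (1 / 2 : ℂ) • (hilbert κ (dx v) * hilbert κ (dx v))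
        + dx (hilbert κ (v * hilbert κ (dx v)) + v * dx v))) := by
  -- Since the removed part is `(1 - S²)(v vₓ)` with `S` symmetric, this pairing is a total
  -- derivative. Its coefficient `-3` may thus be replaced by `+1`, which creates the
  -- commutator-like cancellation in `quadraticSymbol`.
  have h0 : mean (removedPart φ N v * dx (v * dx v)) = 0 := by
    have h1 := mean_mul_dx_self (v * dx v)
    have h2 := mean_mul_dx_self (smooth φ N (v * dx v))
    rw [← smooth_dx, mean_mul_smooth hφ] at h2
    rw [removedPart, sub_mul, map_sub, h1, h2, sub_zero]
  rw [defectQuartic, h0, dx_add, mul_add, mul_add, map_add, map_add, mul_add, map_add, h0,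
    mul_smul_comm, mul_smul_comm, map_smul, map_smul, smul_eq_mul, smul_eq_mul]
  ring

/-- In a triple `(k, a, c)`, the removed part has frequency `k = a + (k - a)` and the quadratic
factor has frequency `-k = c + (-k - c)`. -/
lemma mean_removedPart_mul_eq {φ : ℝ → ℝ} (κ : ℝ) (N : ℕ) {v : TrigPoly}
    (hv : v.coeff.support ⊆ Finset.Icc (-(N : ℤ)) N) :
    mean (removedPart φ N v
      * ((3 / 2 : ℂ) • (dx v * dx v) + (1 / 2 : ℂ) • (hilbert κ (dx v) * hilbert κ (dx v))
        + dx (hilbert κ (v * hilbert κ (dx v)) + v * dx v)))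
      = ∑ x ∈ Finset.Icc (-(2 * N : ℤ)) (2 * N) ×ˢ (Finset.Icc (-(N : ℤ)) N
          ×ˢ Finset.Icc (-(N : ℤ)) N),
        (1 - (φ ((x.1 : ℝ) / N) : ℂ) ^ 2) * (Complex.I * (x.1 - x.2.1 : ℤ))
          * quadraticSymbol κ x.2.2 (-x.1 - x.2.2)
          * (v.coeff x.2.1 * v.coeff (x.1 - x.2.1) * v.coeff x.2.2 * v.coeff (-x.1 - x.2.2)) := by
  set S := Finset.Icc (-(N : ℤ)) N with hS
  have hout : ∀ n : ℤ, n ∉ S → v.coeff n = 0 := fun n hn =>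
    Finsupp.notMem_support_iff.mp fun h => hn (hv h)
  have hw : ∀ k, (removedPart φ N v).coeff k = ∑ a ∈ S, (1 - (φ ((k : ℝ) / N) : ℂ) ^ 2)
      * (Complex.I * (k - a : ℤ)) * (v.coeff a * v.coeff (k - a)) := by
    intro k
    rw [coeff_removedPart, coeff_mul_eq_sum hv, Finset.mul_sum]
    refine Finset.sum_congr rfl fun a _ => ?_
    rw [coeff_dx]; ring
  have hsupp : (removedPart φ N v).coeff.support ⊆ Finset.Icc (-(2 * N : ℤ)) (2 * N) := by
    intro k hk
    by_contra hk'
    refine Finsupp.mem_support_iff.mp hk ?_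
    rw [hw]
    refine Finset.sum_eq_zero fun a ha => ?_
    rw [hout (k - a), mul_zero, mul_zero]
    rw [hS, Finset.mem_Icc] at ha ⊢
    rw [Finset.mem_Icc] at hk'
    omega
  have hq : ∀ n, ((3 / 2 : ℂ) • (dx v * dx v) + (1 / 2 : ℂ) • (hilbert κ (dx v) * hilbert κ (dx v))
        + dx (hilbert κ (v * hilbert κ (dx v)) + v * dx v)).coeff n
      = ∑ c ∈ S, quadraticSymbol κ c (n - c) * (v.coeff c * v.coeff (n - c)) := by
    intro n
    have hd : (dx v).coeff.support ⊆ S := support_multiplier_subset _ hv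
    have hh : (hilbert κ (dx v)).coeff.support ⊆ S := support_multiplier_subset _ hd
    simp only [AddMonoidAlgebra.coeff_add, AddMonoidAlgebra.coeff_smul, Finsupp.add_apply,
      Finsupp.smul_apply, coeff_dx, coeff_hilbert, coeff_mul_eq_sum hd, coeff_mul_eq_sum hh,
      coeff_mul_eq_sum hv, smul_eq_mul, Finset.mul_sum, ← Finset.sum_add_distrib]
    refine Finset.sum_congr rfl fun c _ => ?_
    rw [quadraticSymbol, show c + (n - c) = n by ring]
    ring
  rw [mean_mul hsupp, Finset.sum_product]
  refine Finset.sum_congr rfl fun k _ => ?_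
  rw [hw, hq, Finset.sum_mul_sum, Finset.sum_product]
  refine Finset.sum_congr rfl fun a _ => Finset.sum_congr rfl fun c _ => ?_
  ring

end TrigPoly

/-- As the four frequencies sum to zero, one pairing of distinct positions forces the complementary
one, and the frequencies are symmetric under `n ↦ -n`. A position paired with itself has frequency
zero, and then both monomials vanish. -/
lemma monomial_neg_of_paired {n : Fin 4 → ℤ} (hn : n 0 + n 1 + n 2 + n 3 = 0) {i j : Fin 4}
    (h : n i + n j = 0) (z : ℕ → ℂ) : monomial (-n) z = monomial n z := by
  have hz : ∀ i : Fin 4, n i = 0 → monomial (-n) z = monomial n z := by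
    intro i hi
    rw [monomial, monomial, Finset.prod_eq_zero (Finset.mem_univ i),
      Finset.prod_eq_zero (Finset.mem_univ i)]
    · rw [hi, g_zero]
    · rw [Pi.neg_apply, hi, neg_zero, g_zero]
  have hp : ∀ a b c d : ℤ, a + b = 0 → c + d = 0 →
      g z (-a) * g z (-b) * g z (-c) * g z (-d) = g z a * g z b * g z c * g z d := by
    intro a b c d h1 h2
    obtain rfl : b = -a := by omega
    obtain rfl : d = -c := by omega
    rw [neg_neg, neg_neg]; ring
  rw [monomial, monomial, Fin.prod_univ_four, Fin.prod_univ_four]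
  simp only [Pi.neg_apply]
  rcases Decidable.eq_or_ne i j with rfl | hij
  · have := hz i (by omega)
    simpa [monomial, Fin.prod_univ_four] using this
  · have h01 := hp (n 0) (n 1) (n 2) (n 3)
    have h02 := hp (n 0) (n 2) (n 1) (n 3)
    have h03 := hp (n 0) (n 3) (n 1) (n 2)
    have hcase : (n 0 + n 1 = 0 ∧ n 2 + n 3 = 0) ∨ (n 0 + n 2 = 0 ∧ n 1 + n 3 = 0)
        ∨ (n 0 + n 3 = 0 ∧ n 1 + n 2 = 0) := by
      fin_cases i <;> fin_cases j <;> simp at h hij ⊢ <;> omega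
    rcases hcase with ⟨a, b⟩ | ⟨a, b⟩ | ⟨a, b⟩
    · exact h01 a b
    · linear_combination h02 a b
    · linear_combination h03 a b

/-- One of `A, B ≥ 1` is at least `N/4`, so `A B ≥ N/4` and the powers of order `1/2` of both yield
`N^{-1/2}`. A factor `N^{1/4}` of this gain is spent on making the sum over `C ≤ N` converge. -/
lemma rpow_quartic_le {A B C D N : ℝ} (hA : 1 ≤ A) (hB : 1 ≤ B) (hC : 1 ≤ C) (hD : 1 ≤ D)
    (hCN : C ≤ N) (hN : 0 < N) (hAB : N / 2 ≤ A + B) :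
    A ^ (-3 : ℝ) * B ^ (-1 : ℝ) * C ^ (-1 : ℝ) * D ^ (-1 : ℝ)
      ≤ 2 * N ^ (-(1 / 4) : ℝ) * (A ^ (-(5 / 2) : ℝ) * C ^ (-(5 / 4) : ℝ)
        * (B ^ (-(3 / 2) : ℝ) + D ^ (-(3 / 2) : ℝ))) := by
  have hA0 : 0 < A := by linarith
  have hB0 : 0 < B := by linarith
  have hC0 : 0 < C := by linarith
  have hD0 : 0 < D := by linarith
  have h1 : A ^ (-(1 / 2) : ℝ) * B ^ (-(1 / 2) : ℝ) ≤ 2 * N ^ (-(1 / 2) : ℝ) := by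
    rw [← Real.mul_rpow hA0.le hB0.le]
    have : N / 4 ≤ A * B := by nlinarith
    calc (A * B) ^ (-(1 / 2) : ℝ) ≤ (N / 4) ^ (-(1 / 2) : ℝ) :=
          Real.rpow_le_rpow_of_nonpos (by positivity) this (by norm_num)
      _ = 2 * N ^ (-(1 / 2) : ℝ) := by
          rw [Real.div_rpow hN.le (by norm_num), show (4 : ℝ) = 2 ^ (2 : ℝ) by norm_num,
            ← Real.rpow_mul (by norm_num)]
          norm_num [Real.rpow_neg_one]
          ring
  have h2 : C ^ (-1 : ℝ) ≤ N ^ (1 / 4 : ℝ) * C ^ (-(5 / 4) : ℝ) := by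
    rw [show (-1 : ℝ) = 1 / 4 + -(5 / 4) by norm_num, Real.rpow_add hC0]
    exact mul_le_mul_of_nonneg_right (Real.rpow_le_rpow hC0.le hCN (by norm_num)) (by positivity)
  have h3 : B ^ (-(1 / 2) : ℝ) * D ^ (-1 : ℝ) ≤ B ^ (-(3 / 2) : ℝ) + D ^ (-(3 / 2) : ℝ) := by
    rcases le_total B D with h | h
    · have : D ^ (-1 : ℝ) ≤ B ^ (-1 : ℝ) := Real.rpow_le_rpow_of_nonpos hB0 h (by norm_num)
      have e : B ^ (-(3 / 2) : ℝ) = B ^ (-(1 / 2) : ℝ) * B ^ (-1 : ℝ) := by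
        rw [← Real.rpow_add hB0]; norm_num
      have := mul_le_mul_of_nonneg_left this (by positivity : 0 ≤ B ^ (-(1 / 2) : ℝ))
      have : 0 ≤ D ^ (-(3 / 2) : ℝ) := by positivity
      linarith
    · have : B ^ (-(1 / 2) : ℝ) ≤ D ^ (-(1 / 2) : ℝ) :=
        Real.rpow_le_rpow_of_nonpos hD0 h (by norm_num)
      have e : D ^ (-(3 / 2) : ℝ) = D ^ (-(1 / 2) : ℝ) * D ^ (-1 : ℝ) := by
        rw [← Real.rpow_add hD0]; norm_num
      have := mul_le_mul_of_nonneg_right this (by positivity : 0 ≤ D ^ (-1 : ℝ))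
      have : 0 ≤ B ^ (-(3 / 2) : ℝ) := by positivity
      linarith
  have eA : A ^ (-3 : ℝ) = A ^ (-(5 / 2) : ℝ) * A ^ (-(1 / 2) : ℝ) := by
    rw [← Real.rpow_add hA0]; norm_num
  have eB : B ^ (-1 : ℝ) = B ^ (-(1 / 2) : ℝ) * B ^ (-(1 / 2) : ℝ) := by
    rw [← Real.rpow_add hB0]; norm_num
  have eN : N ^ (-(1 / 4) : ℝ) = N ^ (-(1 / 2) : ℝ) * N ^ (1 / 4 : ℝ) := by
    rw [← Real.rpow_add hN]; norm_num
  calc A ^ (-3 : ℝ) * B ^ (-1 : ℝ) * C ^ (-1 : ℝ) * D ^ (-1 : ℝ)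
      = A ^ (-(5 / 2) : ℝ) * (A ^ (-(1 / 2) : ℝ) * B ^ (-(1 / 2) : ℝ)) * C ^ (-1 : ℝ)
        * (B ^ (-(1 / 2) : ℝ) * D ^ (-1 : ℝ)) := by rw [eA, eB]; ring
    _ ≤ A ^ (-(5 / 2) : ℝ) * (2 * N ^ (-(1 / 2) : ℝ)) * (N ^ (1 / 4 : ℝ) * C ^ (-(5 / 4) : ℝ))
        * (B ^ (-(3 / 2) : ℝ) + D ^ (-(3 / 2) : ℝ)) := by gcongr
    _ = _ := by rw [eN]; ring

lemma sum_sub_le_tsum {f : ℤ → ℝ} (hf : Summable f) (h0 : ∀ n, 0 ≤ f n) (S : Finset ℤ) (a : ℤ) :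
    ∑ k ∈ S, f (k - a) ≤ ∑' n, f n := by
  have h := (Equiv.subRight a).summable_iff.mpr hf
  rw [← (Equiv.subRight a).tsum_eq f]
  exact h.sum_le_tsum S fun k _ => h0 _

end

/-! ### Second moments of the defects -/

section

open TrigPoly

/-- The deterministic factor in the Fourier coefficients of the smoothed random series. -/
def smoothFactor (lam : ℝ) (φ : ℝ → ℝ) (N : ℕ) (n : ℤ) : ℂ :=
  if n ∈ Finset.Icc (-(N : ℤ)) N then
    (φ ((n : ℝ) / N) : ℂ) / ((√(4 * Real.pi * lam) * |(n : ℝ)| ^ (3 / 2 : ℝ) : ℝ) : ℂ) else 0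

lemma coeff_smooth_series (lam : ℝ) (φ : ℝ → ℝ) (N : ℕ) (z : ℕ → ℂ) (n : ℤ) :
    (smooth φ N (series lam N z)).coeff n = smoothFactor lam φ N n * g z n := by
  rw [coeff_smooth, coeff_series, smoothFactor]
  split_ifs
  · rw [seriesCoeff]; ring
  · simp

lemma smoothFactor_neg (lam : ℝ) {φ : ℝ → ℝ} (hφ : ∀ x, φ x = φ |x|) (N : ℕ) (n : ℤ) :
    smoothFactor lam φ N (-n) = smoothFactor lam φ N n := by
  have h1 : -n ∈ Finset.Icc (-(N : ℤ)) N ↔ n ∈ Finset.Icc (-(N : ℤ)) N := by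
    simp only [Finset.mem_Icc]; omega
  have h2 : φ (((-n : ℤ) : ℝ) / N) = φ ((n : ℝ) / N) := by
    rw [hφ, hφ ((n : ℝ) / N)]; congr 1; push_cast; rw [neg_div, abs_neg]
  rw [smoothFactor, smoothFactor, h2]
  simp only [h1]
  push_cast
  rw [abs_neg]

lemma norm_smoothFactor_sq_le {lam : ℝ} (hlam : 0 < lam) {φ : ℝ → ℝ} (hφ : ∀ x, |φ x| ≤ 1) (N : ℕ)
    {n : ℤ} (hn : n ≠ 0) :
    ‖smoothFactor lam φ N n‖ ^ 2 ≤ (4 * Real.pi * lam)⁻¹ * |(n : ℝ)| ^ (-3 : ℝ) := by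
  rw [smoothFactor]
  split_ifs
  · have hn' : 0 < |(n : ℝ)| := abs_pos.mpr (by exact_mod_cast hn)
    have hp : 0 < 4 * Real.pi * lam := by positivity
    rw [norm_div, Complex.norm_real, Complex.norm_real, div_pow, Real.norm_eq_abs, Real.norm_eq_abs,
      sq_abs (√_ * _), mul_pow, Real.sq_sqrt hp.le, ← Real.rpow_mul_natCast hn'.le,
      Real.rpow_neg hn'.le, ← mul_inv, div_eq_mul_inv]
    norm_num
    exact mul_le_of_le_one_left (by positivity) ((sq_le_one_iff_abs_le_one _).mpr (hφ _))
  · rw [norm_zero, zero_pow two_ne_zero]; positivity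

lemma smoothFactor_of_lt (lam : ℝ) (φ : ℝ → ℝ) {N : ℕ} {n : ℤ} (hn : (N : ℝ) < |(n : ℝ)|) :
    smoothFactor lam φ N n = 0 := by
  rw [smoothFactor, if_neg]
  intro h
  rw [Finset.mem_Icc] at h
  have : |n| ≤ N := abs_le.mpr h
  have : |(n : ℝ)| ≤ N := by exact_mod_cast this
  linarith

lemma smoothFactor_zero (lam : ℝ) (φ : ℝ → ℝ) (N : ℕ) : smoothFactor lam φ N 0 = 0 := by
  simp [smoothFactor]

/-- The symbol of the quartic defect in terms of the Gaussian variables. -/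
def quarticCoeff (κ lam : ℝ) (φ : ℝ → ℝ) (N : ℕ) (x : ℤ × ℤ × ℤ) : ℂ :=
  (1 - (φ ((x.1 : ℝ) / N) : ℂ) ^ 2) * (Complex.I * (x.1 - x.2.1 : ℤ))
    * quadraticSymbol κ x.2.2 (-x.1 - x.2.2)
    * (smoothFactor lam φ N x.2.1 * smoothFactor lam φ N (x.1 - x.2.1)
      * smoothFactor lam φ N x.2.2 * smoothFactor lam φ N (-x.1 - x.2.2))

/-- The frequencies of the quartic defect. -/
def quarticFreq (x : ℤ × ℤ × ℤ) : Fin 4 → ℤ := ![x.2.1, x.1 - x.2.1, x.2.2, -x.1 - x.2.2]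

lemma quarticFreq_injective : Function.Injective quarticFreq := by
  rintro ⟨k, a, c⟩ ⟨k', a', c'⟩ h
  have h0 := congrFun h 0
  have h1 := congrFun h 1
  have h2 := congrFun h 2
  simp only [quarticFreq, Matrix.cons_val_zero, Matrix.cons_val_one, Matrix.cons_val] at h0 h1 h2
  simp only [Prod.mk.injEq]
  omega

lemma quarticFreq_neg (x : ℤ × ℤ × ℤ) : quarticFreq (-x) = -quarticFreq x := by
  ext i
  fin_cases i <;> simp [quarticFreq] <;> ring

lemma quarticFreq_sum (x : ℤ × ℤ × ℤ) :
    quarticFreq x 0 + quarticFreq x 1 + quarticFreq x 2 + quarticFreq x 3 = 0 := by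
  simp [quarticFreq]

/-- All factors are even except the single derivative in `v vₓ`. -/
lemma quarticCoeff_neg (κ lam : ℝ) {φ : ℝ → ℝ} (hφ : ∀ x, φ x = φ |x|) (N : ℕ) (x : ℤ × ℤ × ℤ) :
    quarticCoeff κ lam φ N (-x) = -quarticCoeff κ lam φ N x := by
  obtain ⟨k, a, c⟩ := x
  have h2 : φ (((-k : ℤ) : ℝ) / N) = φ ((k : ℝ) / N) := by
    rw [hφ, hφ ((k : ℝ) / N)]; congr 1; push_cast; rw [neg_div, abs_neg]
  have e1 : -k - -a = -(k - a) := by ring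
  have e2 : - -k - -c = -(-k - c) := by ring
  simp only [quarticCoeff, Prod.neg_mk, h2, e1, e2, smoothFactor_neg lam hφ, quadraticSymbol_neg]
  push_cast
  ring

/-- The index set of the quartic defect. -/
def quarticIndex (N : ℕ) : Finset (ℤ × ℤ × ℤ) :=
  Finset.Icc (-(2 * N : ℤ)) (2 * N) ×ˢ (Finset.Icc (-(N : ℤ)) N ×ˢ Finset.Icc (-(N : ℤ)) N)

lemma neg_mem_quarticIndex {N : ℕ} {x : ℤ × ℤ × ℤ} (hx : x ∈ quarticIndex N) :
    -x ∈ quarticIndex N := by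
  simp only [quarticIndex, Finset.mem_product, Finset.mem_Icc, Prod.fst_neg, Prod.snd_neg] at *
  omega

-- Under `x ↦ -x` the coefficients are odd while the paired monomials are even, so the paired part
-- of the sum is its own negative and vanishes.
open Classical in
lemma defectQuartic_series_eq {φ : ℝ → ℝ} (hφ : ∀ x, φ x = φ |x|) (κ lam : ℝ) (N : ℕ)
    (z : ℕ → ℂ) :
    defectQuartic κ (smooth φ N (series lam N z)) (removedPart φ N (smooth φ N (series lam N z)))
      = ∑ x ∈ (quarticIndex N).filter (fun x => ∀ i j, quarticFreq x i + quarticFreq x j ≠ 0),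
        quarticCoeff κ lam φ N x * monomial (quarticFreq x) z := by
  have h1 : defectQuartic κ (smooth φ N (series lam N z))
      (removedPart φ N (smooth φ N (series lam N z)))
      = ∑ x ∈ quarticIndex N, quarticCoeff κ lam φ N x * monomial (quarticFreq x) z := by
    rw [defectQuartic_eq hφ, mean_removedPart_mul_eq κ N
      (v := smooth φ N (series lam N z)) (support_multiplier_subset _ (support_series_subset z))]
    refine Finset.sum_congr rfl fun x _ => ?_
    simp only [coeff_smooth_series, quarticCoeff, monomial, Fin.prod_univ_four, quarticFreq,
      Matrix.cons_val_zero, Matrix.cons_val_one, Matrix.cons_val]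
    ring
  rw [h1, ← Finset.sum_filter_add_sum_filter_not _
    (fun x => ∀ i j, quarticFreq x i + quarticFreq x j ≠ 0), add_eq_left]
  refine self_eq_neg.mp ?_
  rw [← Finset.sum_neg_distrib]
  refine Finset.sum_nbij' (fun x => -x) (fun x => -x) ?_ ?_ (fun x _ => neg_neg x)
    (fun x _ => neg_neg x) ?_
  · intro x hx
    simp only [Finset.mem_filter, quarticFreq_neg, Pi.neg_apply] at hx ⊢
    refine ⟨neg_mem_quarticIndex hx.1, fun h => hx.2 fun i j hij => h i j (by omega)⟩
  · intro x hx
    simp only [Finset.mem_filter, quarticFreq_neg, Pi.neg_apply] at hx ⊢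
    refine ⟨neg_mem_quarticIndex hx.1, fun h => hx.2 fun i j hij => h i j (by omega)⟩
  · intro x hx
    obtain ⟨i, j, hij⟩ : ∃ i j, quarticFreq x i + quarticFreq x j = 0 := by
      have := (Finset.mem_filter.mp hx).2
      push Not at this
      exact this
    rw [quarticCoeff_neg κ lam hφ, quarticFreq_neg, monomial_neg_of_paired (quarticFreq_sum x) hij,
      neg_mul, neg_neg]

/-- Nonzero coefficients have `|k| > (1 - ε) N ≥ N/2`, which forces `|a| + |b| ≥ N/2` for `b = k -
a`. The squared symbol is at most `16 b² c² d²`, and each Gaussian factor brings a power `-3`,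
leaving the quantity bounded in `rpow_quartic_le`. -/
lemma norm_quarticCoeff_sq_le {κ lam : ℝ} (hκ : κ = 1 ∨ κ = -1) (hlam : 0 < lam) {ε : ℝ}
    (hε4 : ε ≤ 1 / 4) {φ : ℝ → ℝ} (hφ : IsProfile ε φ) {N : ℕ} (hN : 0 < N)
    {x : ℤ × ℤ × ℤ} :
    ‖quarticCoeff κ lam φ N x‖ ^ 2 ≤ 32 * (4 * Real.pi * lam)⁻¹ ^ 4 * (N : ℝ) ^ (-(1 / 4) : ℝ)
      * (|(x.2.1 : ℝ)| ^ (-(5 / 2) : ℝ) * |(x.2.2 : ℝ)| ^ (-(5 / 4) : ℝ)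
        * (|((x.1 - x.2.1 : ℤ) : ℝ)| ^ (-(3 / 2) : ℝ)
          + |((x.1 - -x.2.2 : ℤ) : ℝ)| ^ (-(3 / 2) : ℝ))) := by
  obtain ⟨k, a, c⟩ := x
  have hd : (k - -c : ℤ) = -(-k - c) := by ring
  simp only [hd]
  rw [Int.cast_neg, abs_neg]
  set b := k - a with hb
  set d := -k - c with hdd
  have hN' : (0 : ℝ) < N := by exact_mod_cast hN
  have hp : 0 < 4 * Real.pi * lam := by positivity
  by_cases hq : quarticCoeff κ lam φ N (k, a, c) = 0
  · rw [hq, norm_zero, zero_pow two_ne_zero]; positivity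
  simp only [quarticCoeff, ← hb, ← hdd, mul_eq_zero, not_or] at hq
  obtain ⟨⟨⟨hq1, -⟩, -⟩, ⟨⟨ha, hb'⟩, hc⟩, hd'⟩ := hq
  have ne : ∀ {n : ℤ}, smoothFactor lam φ N n ≠ 0 → n ≠ 0 ∧ 1 ≤ |(n : ℝ)| ∧ |(n : ℝ)| ≤ N := by
    intro n hn
    have h0 : n ≠ 0 := by rintro rfl; exact hn (smoothFactor_zero _ _ _)
    refine ⟨h0, by exact_mod_cast Int.one_le_abs h0, ?_⟩
    by_contra! h
    exact hn (smoothFactor_of_lt _ _ h)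
  obtain ⟨a0, a1, aN⟩ := ne ha
  obtain ⟨b0, b1, bN⟩ := ne hb'
  obtain ⟨c0, c1, cN⟩ := ne hc
  obtain ⟨d0, d1, dN⟩ := ne hd'
  have hk : (1 - ε) * N < |(k : ℝ)| := by
    by_contra! h
    have : φ ((k : ℝ) / N) = 1 := by
      rw [hφ.even, abs_div, Nat.abs_cast]
      exact hφ.eq_one _ ⟨by positivity, (div_le_iff₀ hN').mpr h⟩
    simp [this] at hq1
  have hAB : (N : ℝ) / 2 ≤ |(a : ℝ)| + |(b : ℝ)| := by
    have : (k : ℝ) = a + b := by rw [hb]; push_cast; ring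
    have := abs_add_le (a : ℝ) b
    rw [← ‹(k : ℝ) = a + b›] at this
    nlinarith
  have hquad := norm_quadraticSymbol_le hκ c d
  have hpi := norm_one_sub_sq_le (hφ.abs_le_one ((k : ℝ) / N))
  have rA := norm_smoothFactor_sq_le hlam hφ.abs_le_one N a0
  have rB := norm_smoothFactor_sq_le hlam hφ.abs_le_one N b0
  have rC := norm_smoothFactor_sq_le hlam hφ.abs_le_one N c0
  have rD := norm_smoothFactor_sq_le hlam hφ.abs_le_one N d0
  have hB : ‖Complex.I * (b : ℂ)‖ = |(b : ℝ)| := by simp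
  have e : ‖quarticCoeff κ lam φ N (k, a, c)‖ ^ 2
      = ‖(1 - (φ ((k : ℝ) / N) : ℂ) ^ 2)‖ ^ 2 * |(b : ℝ)| ^ 2 * ‖quadraticSymbol κ c d‖ ^ 2
        * (‖smoothFactor lam φ N a‖ ^ 2 * ‖smoothFactor lam φ N b‖ ^ 2
          * ‖smoothFactor lam φ N c‖ ^ 2 * ‖smoothFactor lam φ N d‖ ^ 2) := by
    rw [quarticCoeff]
    simp only [← hb, ← hdd]
    rw [← hB]
    simp only [norm_mul]
    ring
  rw [e]
  have sq : ∀ {y : ℝ}, 1 ≤ y → y ^ 2 * y ^ (-3 : ℝ) = y ^ (-1 : ℝ) := by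
    intro y hy
    rw [← Real.rpow_natCast, ← Real.rpow_add (by linarith)]; norm_num
  have key := rpow_quartic_le a1 b1 c1 d1 cN hN' hAB
  calc _ ≤ 1 ^ 2 * |(b : ℝ)| ^ 2 * (4 * (|(c : ℝ)| * |(d : ℝ)|)) ^ 2
        * (((4 * Real.pi * lam)⁻¹ * |(a : ℝ)| ^ (-3 : ℝ)) * ((4 * Real.pi * lam)⁻¹ * |(b : ℝ)| ^ (-3 : ℝ))
          * ((4 * Real.pi * lam)⁻¹ * |(c : ℝ)| ^ (-3 : ℝ))
          * ((4 * Real.pi * lam)⁻¹ * |(d : ℝ)| ^ (-3 : ℝ))) := by gcongr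
    _ = 16 * (4 * Real.pi * lam)⁻¹ ^ 4 * (|(a : ℝ)| ^ (-3 : ℝ) * (|(b : ℝ)| ^ 2 * |(b : ℝ)| ^ (-3 : ℝ))
        * (|(c : ℝ)| ^ 2 * |(c : ℝ)| ^ (-3 : ℝ)) * (|(d : ℝ)| ^ 2 * |(d : ℝ)| ^ (-3 : ℝ))) := by ring
    _ ≤ 16 * (4 * Real.pi * lam)⁻¹ ^ 4 * (2 * (N : ℝ) ^ (-(1 / 4) : ℝ)
        * (|(a : ℝ)| ^ (-(5 / 2) : ℝ) * |(c : ℝ)| ^ (-(5 / 4) : ℝ)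
        * (|(b : ℝ)| ^ (-(3 / 2) : ℝ) + |(d : ℝ)| ^ (-(3 / 2) : ℝ)))) := by
      rw [sq b1, sq c1, sq d1]
      exact mul_le_mul_of_nonneg_left key (by positivity)
    _ = _ := by ring

/-- For fixed `a` and `c` the sum over `k` is a shifted convergent series in either of the two
terms; the sums over `a` and `c` then factor. -/
lemma sum_norm_quarticCoeff_sq_le {κ lam : ℝ} (hκ : κ = 1 ∨ κ = -1) (hlam : 0 < lam) :
    ∃ C : ℝ, 0 ≤ C ∧ ∀ (ε : ℝ) (_ : ε ≤ 1 / 4) (φ : ℝ → ℝ) (_ : IsProfile ε φ) (N : ℕ) (_ : 0 < N),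
      ∑ x ∈ quarticIndex N, ‖quarticCoeff κ lam φ N x‖ ^ 2 ≤ C * (N : ℝ) ^ (-(1 / 4) : ℝ) := by
  have sA := summable_abs_rpow (by norm_num : (-(5 / 2) : ℝ) < -1)
  have sC := summable_abs_rpow (by norm_num : (-(5 / 4) : ℝ) < -1)
  have sB := summable_abs_rpow (by norm_num : (-(3 / 2) : ℝ) < -1)
  set TA := ∑' n : ℤ, |(n : ℝ)| ^ (-(5 / 2) : ℝ)
  set TC := ∑' n : ℤ, |(n : ℝ)| ^ (-(5 / 4) : ℝ)
  set TB := ∑' n : ℤ, |(n : ℝ)| ^ (-(3 / 2) : ℝ)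
  have pA : 0 ≤ TA := tsum_nonneg fun n => by positivity
  have pB : 0 ≤ TB := tsum_nonneg fun n => by positivity
  have pC : 0 ≤ TC := tsum_nonneg fun n => by positivity
  have hp : 0 < 4 * Real.pi * lam := by positivity
  refine ⟨32 * (4 * Real.pi * lam)⁻¹ ^ 4 * (TA * TC * (TB + TB)), by positivity,
    fun ε hε φ hφ N hN => ?_⟩
  refine (Finset.sum_le_sum fun x _ => norm_quarticCoeff_sq_le hκ hlam hε hφ hN).trans ?_
  rw [← Finset.mul_sum, quarticIndex, Finset.sum_product_right]
  have hsum : ∑ y ∈ Finset.Icc (-(N : ℤ)) N ×ˢ Finset.Icc (-(N : ℤ)) N,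
      ∑ k ∈ Finset.Icc (-(2 * N : ℤ)) (2 * N), (|(y.1 : ℝ)| ^ (-(5 / 2) : ℝ)
        * |(y.2 : ℝ)| ^ (-(5 / 4) : ℝ) * (|((k - y.1 : ℤ) : ℝ)| ^ (-(3 / 2) : ℝ)
          + |((k - -y.2 : ℤ) : ℝ)| ^ (-(3 / 2) : ℝ))) ≤ TA * TC * (TB + TB) := by
    calc _ ≤ ∑ y ∈ Finset.Icc (-(N : ℤ)) N ×ˢ Finset.Icc (-(N : ℤ)) N,
        (|(y.1 : ℝ)| ^ (-(5 / 2) : ℝ) * |(y.2 : ℝ)| ^ (-(5 / 4) : ℝ)) * (TB + TB) := by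
          refine Finset.sum_le_sum fun y _ => ?_
          rw [← Finset.mul_sum, Finset.sum_add_distrib]
          refine mul_le_mul_of_nonneg_left (add_le_add ?_ ?_) (by positivity)
          · exact sum_sub_le_tsum (f := fun n : ℤ => |(n : ℝ)| ^ (-(3 / 2) : ℝ)) sB
              (fun n => by positivity) _ _
          · exact sum_sub_le_tsum (f := fun n : ℤ => |(n : ℝ)| ^ (-(3 / 2) : ℝ)) sB
              (fun n => by positivity) _ _
      _ ≤ _ := by
          have ep : ∑ y ∈ Finset.Icc (-(N : ℤ)) N ×ˢ Finset.Icc (-(N : ℤ)) N,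
              |(y.1 : ℝ)| ^ (-(5 / 2) : ℝ) * |(y.2 : ℝ)| ^ (-(5 / 4) : ℝ)
              = (∑ a ∈ Finset.Icc (-(N : ℤ)) N, |(a : ℝ)| ^ (-(5 / 2) : ℝ))
                * ∑ c ∈ Finset.Icc (-(N : ℤ)) N, |(c : ℝ)| ^ (-(5 / 4) : ℝ) := by
            rw [Finset.sum_mul_sum]; exact Finset.sum_product _ _ _
          rw [← Finset.sum_mul, ep]
          refine mul_le_mul_of_nonneg_right (mul_le_mul (sA.sum_le_tsum _ fun n _ => by positivity)
            (sC.sum_le_tsum _ fun n _ => by positivity) (Finset.sum_nonneg fun n _ => by positivity)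
            pA) (by positivity)
  have := mul_le_mul_of_nonneg_left hsum (by positivity :
    0 ≤ 32 * (4 * Real.pi * lam)⁻¹ ^ 4 * (N : ℝ) ^ (-(1 / 4) : ℝ))
  linarith

/-- Only unpaired monomials remain, so the second moment is comparable to the sum of the squared
coefficients. -/
lemma integral_defectQuartic_sq_le {κ lam : ℝ} (hκ : κ = 1 ∨ κ = -1) (hlam : 0 < lam) :
    ∃ C : ℝ, 0 ≤ C ∧ ∀ (ε : ℝ) (_ : ε ≤ 1 / 4) (φ : ℝ → ℝ) (_ : IsProfile ε φ) (N : ℕ) (_ : 0 < N),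
      Integrable (fun z => ‖defectQuartic κ (smooth φ N (series lam N z))
        (removedPart φ N (smooth φ N (series lam N z)))‖ ^ 2) noise ∧
      ∫ z, ‖defectQuartic κ (smooth φ N (series lam N z))
        (removedPart φ N (smooth φ N (series lam N z)))‖ ^ 2 ∂noise
        ≤ C * (N : ℝ) ^ (-(1 / 4) : ℝ) := by
  classical
  obtain ⟨C₁, hC₁, h₁⟩ := integral_norm_sum_monomial_sq_le' 4
  obtain ⟨C₂, hC₂, h₂⟩ := sum_norm_quarticCoeff_sq_le hκ hlam
  refine ⟨C₁ * C₂, by positivity, fun ε hε φ hφ N hN => ?_⟩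
  simp only [defectQuartic_series_eq hφ.even]
  obtain ⟨hi, hb⟩ := h₁ ((quarticIndex N).filter
    (fun x => ∀ i j, quarticFreq x i + quarticFreq x j ≠ 0)) quarticFreq
    quarticFreq_injective.injOn (fun x hx => (Finset.mem_filter.mp hx).2) (quarticCoeff κ lam φ N)
  refine ⟨hi, hb.trans ?_⟩
  rw [mul_assoc]
  refine mul_le_mul_of_nonneg_left (le_trans ?_ (h₂ ε hε φ hφ N hN)) hC₁
  exact Finset.sum_le_sum_of_subset_of_nonneg (Finset.filter_subset _ _) fun _ _ _ => by positivity

lemma CoeffMeasurable.measurable_defectOne {Ω : Type*} [MeasurableSpace Ω] {p q : Ω → TrigPoly}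
    (hp : CoeffMeasurable p) (hq : CoeffMeasurable q) (κ : ℝ) :
    Measurable fun z => defectOne κ (p z) (q z) := by
  have h1 := (hq.mul (hp.mul (hp.dx.hilbert κ))).mean
  have h2 := (hq.mul ((hp.mul hp.dx).hilbert κ)).mean
  have h3 := (hq.mul ((hp.mul hp).mul hp)).mean
  exact ((h1.add h2).const_mul _).add (h3.const_mul _)

lemma CoeffMeasurable.measurable_defectHigher {Ω : Type*} [MeasurableSpace Ω] {p q : Ω → TrigPoly}
    (hp : CoeffMeasurable p) (hq : CoeffMeasurable q) (κ : ℝ) :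
    Measurable fun z => defectHigher κ (p z) (q z) := by
  have h1 := (hq.mul ((hp.mul hp).mul (hp.dx.hilbert κ))).mean
  have h2 := (hq.mul (((hp.mul hp).mul hp.dx).hilbert κ)).mean
  have h3 := (hq.mul (hp.mul ((hp.mul hp.dx).hilbert κ))).mean
  have h4 := (hq.mul ((hp.mul hp).mul (hp.mul hp))).mean
  exact ((h1.add h2).add h3).add (h4.const_mul _)

lemma CoeffMeasurable.removedPart {Ω : Type*} [MeasurableSpace Ω] {p : Ω → TrigPoly}
    (hp : CoeffMeasurable p) (φ : ℝ → ℝ) (N : ℕ) :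
    CoeffMeasurable fun z => removedPart φ N (p z) :=
  (hp.mul hp.dx).sub (((hp.mul hp.dx).smooth φ N).smooth φ N)

/-- The weight `e` separates the two dependent factors. It is balanced for `b⁸` with mean of order
`e⁴`, when both `e² y²⁴` and `b⁸ / e²` have mean of order `e²`. -/
lemma sq_le_young {D C y b K e : ℝ} (hD : 0 ≤ D) (he : 0 < e)
    (h : D ≤ C * y ^ 6 * (b + K) ^ 2) :
    D ^ 2 ≤ C ^ 2 * (8 * (e ^ 2 * y ^ 24 + b ^ 8 / e ^ 2 + K ^ 4 * y ^ 12)) := by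
  have h1 : D ^ 2 ≤ C ^ 2 * (y ^ 12 * (b + K) ^ 4) := by
    calc D ^ 2 ≤ (C * y ^ 6 * (b + K) ^ 2) ^ 2 := pow_le_pow_left₀ hD h 2
      _ = _ := by ring
  refine h1.trans (mul_le_mul_of_nonneg_left ?_ (sq_nonneg _))
  have h2 : (b + K) ^ 4 ≤ 8 * (b ^ 4 + K ^ 4) := by
    have s1 : (b + K) ^ 2 ≤ 2 * (b ^ 2 + K ^ 2) := by nlinarith [sq_nonneg (b - K)]
    have s2 := pow_le_pow_left₀ (sq_nonneg (b + K)) s1 2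
    nlinarith [sq_nonneg (b ^ 2 - K ^ 2)]
  have h3 : y ^ 12 * b ^ 4 ≤ e ^ 2 * y ^ 24 + b ^ 8 / e ^ 2 := by
    have : 2 * (e * y ^ 12) * (b ^ 4 / e) ≤ (e * y ^ 12) ^ 2 + (b ^ 4 / e) ^ 2 := two_mul_le_add_sq _ _
    have e1 : 2 * (e * y ^ 12) * (b ^ 4 / e) = 2 * (y ^ 12 * b ^ 4) := by field_simp
    have e2 : (e * y ^ 12) ^ 2 + (b ^ 4 / e) ^ 2 = e ^ 2 * y ^ 24 + b ^ 8 / e ^ 2 := by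
      rw [div_pow]; ring
    have : 0 ≤ y ^ 12 * b ^ 4 := by positivity
    linarith
  have h4 : y ^ 12 * (b + K) ^ 4 ≤ y ^ 12 * (8 * (b ^ 4 + K ^ 4)) :=
    mul_le_mul_of_nonneg_left h2 (by positivity)
  linarith

lemma integral_defect_sq_le {κ lam : ℝ} (hκ : κ = 1 ∨ κ = -1) (hlam : 0 < lam) :
    ∃ C : ℝ, 0 ≤ C ∧ ∀ (ε : ℝ) (_ : 0 < ε) (_ : ε ≤ 1 / 4) (φ : ℝ → ℝ) (_ : IsProfile ε φ) (N : ℕ)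
      (_ : 0 < N) (D : (ℕ → ℂ) → ℂ) (_ : D = (fun z => defectOne κ (smooth φ N (series lam N z))
        (removedPart φ N (smooth φ N (series lam N z)))) ∨
        D = fun z => defectHigher κ (smooth φ N (series lam N z))
        (removedPart φ N (smooth φ N (series lam N z)))),
      Integrable (fun z => ‖D z‖ ^ 2) noise ∧
      ∫ z, ‖D z‖ ^ 2 ∂noise ≤ C * ((ε + 1 / N) ^ 2
        + ((ε * N / 2) ^ (-(1 / 4) : ℝ) * (N : ℝ) ^ (1 / 8 : ℝ)) ^ 4) := by
  obtain ⟨C, hC, hD⟩ := norm_defect_le hκ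
  obtain ⟨C₁, hC₁, h₁⟩ := integral_one_add_sob_pow_le hlam 24
  obtain ⟨C₂, hC₂, h₂⟩ := integral_one_add_sob_pow_le hlam 12
  obtain ⟨C₃, hC₃, h₃⟩ := integral_sob_highPart_pow_le hlam
  refine ⟨C ^ 2 * (8 * (C₁ + C₃ + C₂)), by positivity, fun ε hε hε4 φ hφ N hN D hDef => ?_⟩
  have hN' : (0 : ℝ) < N := by exact_mod_cast hN
  set K := (ε * N / 2) ^ (-(1 / 4) : ℝ) * (N : ℝ) ^ (1 / 8 : ℝ) with hK
  -- The eighth moment of the high frequency `H¹` norm is of order `e⁴`, which matches the weight in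
  -- `sq_le_young`.
  set e := ε + 1 / (N : ℝ) with he
  have he0 : 0 < e := by positivity
  have hb : ∀ z, ‖D z‖ ≤ C * (1 + sob (7 / 8) (series lam N z)) ^ 6
      * (sob 1 (highPart ((1 - 2 * ε) * N) (series lam N z)) + K) ^ 2 := by
    intro z
    have := hD ε hε hε4 φ hφ N hN (series lam N z) (coeff_series_zero _ _ _)
      (fun n hn => coeff_series_of_lt z hn)
    rcases hDef with rfl | rfl
    exacts [this.1, this.2]
  have hDm : Measurable D := by
    have hv := (coeffMeasurable_series lam N).smooth φ N
    rcases hDef with rfl | rfl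
    · exact hv.measurable_defectOne (hv.removedPart φ N) κ
    · exact hv.measurable_defectHigher (hv.removedPart φ N) κ
  have hle := fun z => sq_le_young (norm_nonneg (D z)) he0 (hb z)
  have i1 := (h₁ N).1
  have i2 := (h₂ N).1
  have i3 := (h₃ ε hε hε4 N hN).1
  have i12 : Integrable (fun z => e ^ 2 * (1 + sob (7 / 8) (series lam N z)) ^ 24
      + sob 1 (highPart ((1 - 2 * ε) * N) (series lam N z)) ^ 8 / e ^ 2) noise :=
    (i1.const_mul _).add (i3.div_const _)
  have i123 : Integrable (fun z => e ^ 2 * (1 + sob (7 / 8) (series lam N z)) ^ 24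
      + sob 1 (highPart ((1 - 2 * ε) * N) (series lam N z)) ^ 8 / e ^ 2
      + K ^ 4 * (1 + sob (7 / 8) (series lam N z)) ^ 12) noise := i12.add (i2.const_mul _)
  have hint : Integrable (fun z => ‖D z‖ ^ 2) noise := by
    refine ((i123.const_mul 8).const_mul (C ^ 2)).mono'
      (hDm.norm.pow_const 2).aestronglyMeasurable (ae_of_all _ fun z => ?_)
    rw [Real.norm_of_nonneg (by positivity)]
    exact hle z
  refine ⟨hint, ?_⟩
  refine (integral_mono hint ((i123.const_mul 8).const_mul (C ^ 2)) hle).trans ?_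
  rw [integral_const_mul, integral_const_mul]
  have ev : ∫ z, (e ^ 2 * (1 + sob (7 / 8) (series lam N z)) ^ 24
      + sob 1 (highPart ((1 - 2 * ε) * N) (series lam N z)) ^ 8 / e ^ 2
      + K ^ 4 * (1 + sob (7 / 8) (series lam N z)) ^ 12) ∂noise
      = e ^ 2 * ∫ z, (1 + sob (7 / 8) (series lam N z)) ^ 24 ∂noise
        + (∫ z, sob 1 (highPart ((1 - 2 * ε) * N) (series lam N z)) ^ 8 ∂noise) / e ^ 2
        + K ^ 4 * ∫ z, (1 + sob (7 / 8) (series lam N z)) ^ 12 ∂noise := by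
    rw [integral_add i12 (i2.const_mul _), integral_add (i1.const_mul _) (i3.div_const _),
      integral_const_mul, integral_const_mul, integral_div]
  rw [ev]
  have j1 := mul_le_mul_of_nonneg_left (h₁ N).2 (sq_nonneg e)
  have j2 := mul_le_mul_of_nonneg_left (h₂ N).2 (by positivity : 0 ≤ K ^ 4)
  have j3 : (∫ z, sob 1 (highPart ((1 - 2 * ε) * N) (series lam N z)) ^ 8 ∂noise) / e ^ 2
      ≤ C₃ * e ^ 2 := by
    rw [div_le_iff₀ (by positivity)]
    refine (h₃ ε hε hε4 N hN).2.trans (le_of_eq ?_)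
    rw [he]; ring
  have j4 : 0 ≤ C₁ * K ^ 4 := by positivity
  have j5 : 0 ≤ C₂ * e ^ 2 := by positivity
  have j6 : 0 ≤ C₃ * K ^ 4 := by positivity
  rw [mul_assoc (C ^ 2), mul_assoc 8]
  refine mul_le_mul_of_nonneg_left (mul_le_mul_of_nonneg_left ?_ (by norm_num)) (sq_nonneg _)
  linarith

end

/-! ### The truncated equation as an ODE for the Fourier modes `1 ≤ n ≤ N` -/

section

open TrigPoly
open scoped NNReal

lemma TrigPoly.IsReal.mul {p q : TrigPoly} (hp : IsReal p) (hq : IsReal q) : IsReal (p * q) := by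
  intro n
  set S := p.coeff.support ∪ p.coeff.support.image Neg.neg with hS
  have hsub : p.coeff.support ⊆ S := Finset.subset_union_left
  have hneg : ∀ k ∈ S, -k ∈ S := by
    intro k hk
    rcases Finset.mem_union.mp hk with h | h
    · exact Finset.mem_union_right _ (Finset.mem_image_of_mem _ h)
    · obtain ⟨m, hm, rfl⟩ := Finset.mem_image.mp h
      rw [neg_neg]; exact Finset.mem_union_left _ hm
  rw [coeff_mul_eq_sum hsub, coeff_mul_eq_sum hsub, map_sum]
  refine Finset.sum_nbij' (fun k => -k) (fun k => -k) hneg hneg (fun k _ => neg_neg k)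
    (fun k _ => neg_neg k) fun k _ => ?_
  rw [map_mul, ← hp, ← hq, neg_neg]
  congr 2; ring

lemma TrigPoly.isReal_truncatedField {κ : ℝ} {φ : ℝ → ℝ} (hφ : ∀ x, φ x = φ |x|) (N : ℕ)
    {u : TrigPoly} (hu : IsReal u) : IsReal (truncatedField κ φ N u) := by
  have hd : ∀ {p : TrigPoly}, IsReal p → IsReal (dx p) := fun hp => hp.multiplier fun n => by simp
  have hh : IsReal (hilbert κ (dx (dx u))) := (hd (hd hu)).multiplier fun n => by
    rw [hilbertSymbol_neg]; simp [hilbertSymbol]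
  have hs := ((hu.smooth hφ N).mul (hd (hu.smooth hφ N))).smooth hφ N
  intro n
  simp only [truncatedField, AddMonoidAlgebra.coeff_sub, AddMonoidAlgebra.coeff_neg,
    Finsupp.sub_apply, Finsupp.neg_apply, map_sub, map_neg, hh n, hs n]

/-- The space of the coordinates of the Fourier modes `1 ≤ n ≤ N`. -/
abbrev LowModes (N : ℕ) : Type := Finset.Icc 1 N → ℂ

section LowModes

variable {κ lam : ℝ} {φ : ℝ → ℝ} {N : ℕ}

/-- The variable `gₙ` as a linear form of the low modes. -/
def gLow (N : ℕ) (n : ℤ) : LowModes N →L[ℝ] ℂ :=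
  LinearMap.toContinuousLinearMap
    { toFun := fun x => g (extendZero (Finset.Icc 1 N) x) n
      map_add' := fun x y => by
        rw [← g_add]; congr 1; ext j
        simp only [extendZero, Pi.add_apply]; split_ifs <;> simp
      map_smul' := fun r x => by
        simp only [g, extendZero, Pi.smul_apply, RingHom.id_apply]
        split_ifs <;> simp }

lemma gLow_apply (n : ℤ) (x : LowModes N) : gLow N n x = g (extendZero (Finset.Icc 1 N) x) n := rfl

lemma gLow_natCast (j : Finset.Icc 1 N) (x : LowModes N) : gLow N ((j : ℕ) : ℤ) x = x j := by
  have h := Finset.mem_Icc.mp j.2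
  rw [gLow_apply, g, if_pos (by omega), Int.natAbs_natCast, extendZero, dif_pos j.2]

lemma gLow_single (n : ℤ) (j : Finset.Icc 1 N) (h : ℂ) : gLow N n (Pi.single j h)
    = if n = ((j : ℕ) : ℤ) then h else if n = -((j : ℕ) : ℤ) then conj h else 0 := by
  have hj := Finset.mem_Icc.mp j.2
  rw [gLow_apply, g]
  have e : ∀ m : ℕ, extendZero (Finset.Icc 1 N) (Pi.single j h : LowModes N) m
      = if m = j then h else 0 := by
    intro m
    rw [extendZero]
    split_ifs with h1 h2 h2
    · subst h2; rw [Pi.single_eq_same]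
    · rw [Pi.single_eq_of_ne fun h => h2 (congrArg Subtype.val h)]
    · exact absurd (h2 ▸ j.2) h1
    · rfl
  rw [e]
  split_ifs <;> first | rfl | omega | simp

/-- The real trigonometric polynomial with given low modes. -/
def lowSeries (lam : ℝ) (N : ℕ) (x : LowModes N) : TrigPoly :=
  series lam N (extendZero (Finset.Icc 1 N) x)

lemma coeff_smooth_lowSeries (lam : ℝ) (φ : ℝ → ℝ) (x : LowModes N) (n : ℤ) :
    (smooth φ N (lowSeries lam N x)).coeff n = smoothFactor lam φ N n * gLow N n x :=
  coeff_smooth_series lam φ N _ n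

lemma smooth_one (N : ℕ) (p : TrigPoly) : smooth (fun _ => 1) N p = p := by
  ext n; simp

lemma coeff_lowSeries (lam : ℝ) (x : LowModes N) (n : ℤ) :
    (lowSeries lam N x).coeff n = smoothFactor lam (fun _ => 1) N n * gLow N n x := by
  rw [← coeff_smooth_lowSeries, smooth_one]

lemma isReal_lowSeries (lam : ℝ) (x : LowModes N) : IsReal (lowSeries lam N x) :=
  isReal_series _ _ _

lemma support_lowSeries_subset (x : LowModes N) :
    (lowSeries lam N x).coeff.support ⊆ Finset.Icc (-(N : ℤ)) N := support_series_subset _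

lemma hasCoeffDeriv_lowSeries {γ : ℝ → LowModes N} {y : LowModes N} {t : ℝ}
    (h : HasDerivAt γ y t) :
    HasCoeffDeriv (fun τ => lowSeries lam N (γ τ)) (lowSeries lam N y) t where
  bounded := ⟨_, fun _ => support_lowSeries_subset _⟩
  hasDerivAt n := by
    simp only [coeff_lowSeries]
    exact ((gLow N n).hasFDerivAt.comp_hasDerivAt t h).const_mul _

/-- The normalization of the Gaussian coordinates. -/
def modeScale (lam : ℝ) (n : ℤ) : ℂ := ((√(4 * Real.pi * lam) * |(n : ℝ)| ^ (3 / 2 : ℝ) : ℝ) : ℂ)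

lemma modeScale_ne_zero (hlam : 0 < lam) {n : ℤ} (hn : n ≠ 0) : modeScale lam n ≠ 0 := by
  have : 0 < |(n : ℝ)| := abs_pos.mpr (by exact_mod_cast hn)
  have : 0 < √(4 * Real.pi * lam) * |(n : ℝ)| ^ (3 / 2 : ℝ) := by positivity
  exact Complex.ofReal_ne_zero.mpr this.ne'

lemma seriesCoeff_eq (lam : ℝ) (z : ℕ → ℂ) (n : ℤ) : seriesCoeff lam z n = g z n / modeScale lam n :=
  rfl

/-- The truncated equation in the coordinates of the low modes. -/
def lowField (κ lam : ℝ) (φ : ℝ → ℝ) (N : ℕ) (x : LowModes N) : LowModes N := fun j =>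
  modeScale lam (j : ℕ) * (truncatedField κ φ N (lowSeries lam N x)).coeff ((j : ℕ) : ℤ)

lemma coeff_truncatedField (κ : ℝ) (φ : ℝ → ℝ) (N : ℕ) (u : TrigPoly) (n : ℤ) :
    (truncatedField κ φ N u).coeff n = -(hilbertSymbol κ n * (Complex.I * n) ^ 2 * u.coeff n)
      - φ ((n : ℝ) / N) * (smooth φ N u * dx (smooth φ N u)).coeff n := by
  rw [truncatedField, AddMonoidAlgebra.coeff_sub, AddMonoidAlgebra.coeff_neg, Finsupp.sub_apply,
    Finsupp.neg_apply, coeff_hilbert, coeff_dx, coeff_dx, coeff_smooth]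
  ring

lemma profile_eq_zero {ε : ℝ} (hφ : IsProfile ε φ) (hN : 0 < N) {n : ℤ}
    (hn : n ∉ Finset.Icc (-(N : ℤ)) N) : φ ((n : ℝ) / N) = 0 := by
  have hN' : (0 : ℝ) < N := by exact_mod_cast hN
  rw [hφ.even, abs_div, Nat.abs_cast]
  refine hφ.eq_zero _ ((one_lt_div hN').mpr ?_)
  have : (N : ℤ) < |n| := by
    rw [lt_abs]; rw [Finset.mem_Icc] at hn; omega
  exact_mod_cast this

/-- The modes `1, …, N` determine the whole field: negative modes follow from reality, the zero mode
vanishes because `v vₓ` is a derivative, and beyond `N` the profile vanishes. -/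
lemma lowSeries_lowField {ε : ℝ} (hlam : 0 < lam) (hφ : IsProfile ε φ) (hN : 0 < N)
    (x : LowModes N) :
    lowSeries lam N (lowField κ lam φ N x) = truncatedField κ φ N (lowSeries lam N x) := by
  have hpos : ∀ n : ℤ, 0 < n → n ≤ N → (lowSeries lam N (lowField κ lam φ N x)).coeff n
      = (truncatedField κ φ N (lowSeries lam N x)).coeff n := by
    intro n h0 hn
    obtain ⟨m, rfl⟩ := Int.eq_ofNat_of_zero_le h0.le
    have hm : m ∈ Finset.Icc 1 N := Finset.mem_Icc.mpr (by omega)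
    have := gLow_natCast ⟨m, hm⟩ (lowField κ lam φ N x)
    rw [lowSeries, coeff_series, if_pos (Finset.mem_Icc.mpr ⟨by omega, hn⟩), seriesCoeff_eq,
      ← gLow_apply, this, lowField]
    exact mul_div_cancel_left₀ _ (modeScale_ne_zero hlam (n := (m : ℤ)) (by omega))
  ext n
  by_cases hn : n ∈ Finset.Icc (-(N : ℤ)) N
  · rcases lt_trichotomy n 0 with h | rfl | h
    · have h1 := isReal_lowSeries lam (lowField κ lam φ N x) (-n)
      have h2 := isReal_truncatedField (κ := κ) hφ.even N (isReal_lowSeries lam x) (-n)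
      rw [neg_neg] at h1 h2
      rw [h1, h2, hpos]
      · omega
      · rw [Finset.mem_Icc] at hn; omega
    · have hz : (smooth φ N (lowSeries lam N x) * dx (smooth φ N (lowSeries lam N x))).coeff 0 = 0 :=
        mean_mul_dx_self _
      rw [coeff_truncatedField, hz, lowSeries, coeff_series_zero]
      simp
    · exact hpos n h (Finset.mem_Icc.mp hn).2
  · rw [coeff_truncatedField, profile_eq_zero hφ hN hn, lowSeries, coeff_series, if_neg hn,
      lowSeries, coeff_series, if_neg hn]
    simp

lemma hasCoeffDeriv_of_lowField {ε : ℝ} (hlam : 0 < lam) (hφ : IsProfile ε φ) (hN : 0 < N)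
    {γ : ℝ → LowModes N} {t : ℝ} (h : HasDerivAt γ (lowField κ lam φ N (γ t)) t) :
    HasCoeffDeriv (fun τ => lowSeries lam N (γ τ))
      (truncatedField κ φ N (lowSeries lam N (γ t))) t := by
  rw [← lowSeries_lowField hlam hφ hN]
  exact hasCoeffDeriv_lowSeries h

/-- The mass in the coordinates of the low modes. -/
def lowMass (lam : ℝ) (N : ℕ) (x : LowModes N) : ℝ := normSq lam 0 (lowSeries lam N x)

lemma contDiff_lowMass : ContDiff ℝ 1 (lowMass lam N) := by
  have h : lowMass lam N = fun x => 2 * Real.pi * lam * ∑ n ∈ Finset.Icc (-(N : ℤ)) N,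
      ‖smoothFactor lam (fun _ => 1) N n * gLow N n x‖ ^ 2 := by
    ext x
    rw [lowMass, normSq_eq_sob, sq_sob 0 (support_lowSeries_subset x)]
    simp only [Real.rpow_zero, one_mul, coeff_lowSeries]
  rw [h]
  refine contDiff_const.mul (ContDiff.sum fun n _ => ?_)
  exact (contDiff_norm_sq ℝ).comp (contDiff_const.mul (gLow N n).contDiff)

/-- Conservation of mass needs the equation only at one instant, so it can be tested on the straight
line through `x` in the direction of the field, before any solution has been constructed. -/
lemma fderiv_lowMass_lowField {ε : ℝ} (hlam : 0 < lam) (hφ : IsProfile ε φ) (hN : 0 < N)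
    (x : LowModes N) : fderiv ℝ (lowMass lam N) x (lowField κ lam φ N x) = 0 := by
  have h0 : HasDerivAt (fun τ : ℝ => x + τ • lowField κ lam φ N x) (lowField κ lam φ N x) 0 := by
    simpa using ((hasDerivAt_id (0 : ℝ)).smul_const (lowField κ lam φ N x)).const_add x
  have h1 : HasDerivAt (fun τ : ℝ => lowMass lam N (x + τ • lowField κ lam φ N x)) 0 0 := by
    refine HasCoeffDeriv.hasDerivAt_mass (κ := κ) (φ := φ) (N := N) ?_ hφ.even fun τ => isReal_lowSeries _ _
    refine hasCoeffDeriv_of_lowField hlam hφ hN ?_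
    simpa using h0
  have h2 := ((contDiff_lowMass (lam := lam) (N := N)).differentiable one_ne_zero
    (x + (0 : ℝ) • lowField κ lam φ N x)).hasFDerivAt.comp_hasDerivAt (0 : ℝ) h0
  simpa using h2.unique h1

lemma norm_sq_le_lowMass (hlam : 0 < lam) (x : LowModes N) (j : Finset.Icc 1 N) :
    ‖x j‖ ^ 2 ≤ ((N : ℝ) ^ (3 / 2 : ℝ)) ^ 2 * lowMass lam N x := by
  obtain ⟨j, hj⟩ := j
  have hj' := Finset.mem_Icc.mp hj
  have h1 := normSq_series hlam N (extendZero (Finset.Icc 1 N) x)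
  have h2 : ‖x ⟨j, hj⟩‖ ^ 2 ≤ normSq lam (3 / 2) (lowSeries lam N x) := by
    rw [lowSeries, h1]
    have e : ‖x ⟨j, hj⟩‖ ^ 2 = ‖extendZero (Finset.Icc 1 N) x (j - 1 + 1)‖ ^ 2 := by
      have : j - 1 + 1 = j := by omega
      rw [this, extendZero, dif_pos hj]
    rw [e]
    exact Finset.single_le_sum (f := fun i => ‖extendZero (Finset.Icc 1 N) x (i + 1)‖ ^ 2)
      (fun _ _ => by positivity) (Finset.mem_range.mpr (by omega))
  refine h2.trans ?_
  have h3 := sob_le_of_degree (N := N) (s := 0) (r := 3 / 2) (by norm_num)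
    (coeff_series_zero lam N (extendZero (Finset.Icc 1 N) x)) fun n hn => coeff_series_of_lt _ hn
  rw [zero_add] at h3
  have h4 := pow_le_pow_left₀ (sob_nonneg _ _) h3 2
  rw [lowMass, normSq_eq_sob, normSq_eq_sob, lowSeries]
  have := mul_le_mul_of_nonneg_left h4 (by positivity : 0 ≤ 2 * Real.pi * lam)
  linarith [mul_pow ((N : ℝ) ^ (3 / 2 : ℝ)) (sob 0 (series lam N (extendZero (Finset.Icc 1 N) x))) 2]

/-- Sublevel sets of the mass are bounded, so a cutoff in the mass makes the field compactly
supported. -/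
lemma norm_le_of_lowMass_le (hlam : 0 < lam) {M : ℝ} {x : LowModes N} (hx : lowMass lam N x ≤ M) :
    ‖x‖ ≤ √(((N : ℝ) ^ (3 / 2 : ℝ)) ^ 2 * M) := by
  refine (pi_norm_le_iff_of_nonneg (Real.sqrt_nonneg _)).mpr fun j => ?_
  exact Real.le_sqrt_of_sq_le ((norm_sq_le_lowMass hlam x j).trans
    (mul_le_mul_of_nonneg_left hx (sq_nonneg _)))

lemma lowField_apply (x : LowModes N) (j : Finset.Icc 1 N) : lowField κ lam φ N x j
    = -(modeScale lam (j : ℕ) * (hilbertSymbol κ (j : ℕ) * (Complex.I * (j : ℕ)) ^ 2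
        * smoothFactor lam (fun _ => 1) N (j : ℕ))) * gLow N (j : ℕ) x
      + ∑ k ∈ Finset.Icc (-(N : ℤ)) N, -(modeScale lam (j : ℕ) * φ (((j : ℕ) : ℝ) / N)
        * smoothFactor lam φ N k * (Complex.I * (((j : ℕ) : ℤ) - k : ℤ))
        * smoothFactor lam φ N ((j : ℕ) - k)) * (gLow N k x * gLow N ((j : ℕ) - k) x) := by
  rw [lowField, coeff_truncatedField, coeff_mul_eq_sum (s := Finset.Icc (-(N : ℤ)) N)
    (p := smooth φ N (lowSeries lam N x)) (support_multiplier_subset _ (support_lowSeries_subset x)), coeff_lowSeries, mul_sub,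
    Finset.mul_sum, Finset.mul_sum, sub_eq_add_neg, ← Finset.sum_neg_distrib]
  congr 1
  · push_cast; ring
  · refine Finset.sum_congr rfl fun k _ => ?_
    rw [coeff_dx, coeff_smooth_lowSeries, coeff_smooth_lowSeries]
    push_cast; ring

/-- The contribution of the `j`-th mode to the trace of a linear map, seen as a functional of the
`j`-th component. -/
def modeTrace (j : Finset.Icc 1 N) (L : LowModes N →L[ℝ] ℂ) : ℝ :=
  (L (Pi.single j 1)).re + (L (Pi.single j Complex.I)).im

/-- On the `j`-th mode `gLow N j` is complex linear, and multiplication by `w` has real trace `2 Re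
w`; `gLow N (-j)` is antilinear and has trace zero. -/
lemma modeTrace_smul_gLow (j : Finset.Icc 1 N) (w : ℂ) (m : ℤ) :
    modeTrace j (w • gLow N m) = if m = ((j : ℕ) : ℤ) then 2 * w.re else 0 := by
  have hj := Finset.mem_Icc.mp j.2
  simp only [modeTrace, FunLike.coe_smul, Pi.smul_apply, gLow_single, smul_eq_mul]
  split_ifs <;> simp
  ring

/-- The divergence vanishes mode by mode. The linear part is multiplication by an imaginary number,
and in a product `g_k g_{j-k}` the variable `g_j` can only be accompanied by `g_0 = 0`. -/
lemma hasFDerivAt_lowField (x : LowModes N) (j : Finset.Icc 1 N) :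
    ∃ L : LowModes N →L[ℝ] ℂ, HasFDerivAt (fun x => lowField κ lam φ N x j) L x ∧
      modeTrace j L = 0 := by
  have hj := Finset.mem_Icc.mp j.2
  have hG : ∀ n, HasFDerivAt (fun x => gLow N n x) (gLow N n) x := fun n => (gLow N n).hasFDerivAt
  simp only [lowField_apply]
  refine ⟨_, ((hG _).const_mul _).add (HasFDerivAt.fun_sum fun k _ =>
    ((hG k).mul (hG _)).const_mul _), ?_⟩
  have hadd : ∀ L L' : LowModes N →L[ℝ] ℂ, modeTrace j (L + L') = modeTrace j L + modeTrace j L' := by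
    intro L L'; simp only [modeTrace, FunLike.coe_add, Pi.add_apply, Complex.add_re, Complex.add_im]
    ring
  have hsum : ∀ (s : Finset ℤ) (L : ℤ → LowModes N →L[ℝ] ℂ), modeTrace j (∑ k ∈ s, L k)
      = ∑ k ∈ s, modeTrace j (L k) := by
    intro s L
    induction s using Finset.induction_on with
    | empty => simp [modeTrace]
    | insert a s ha ih => rw [Finset.sum_insert ha, Finset.sum_insert ha, hadd, ih]
  have h0 : gLow N 0 x = 0 := by rw [gLow_apply, g_zero]
  rw [hadd, hsum, modeTrace_smul_gLow, if_pos rfl, Finset.sum_eq_zero, add_zero]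
  · have e : modeScale lam (j : ℕ) * (hilbertSymbol κ (j : ℕ) * (Complex.I * (j : ℕ)) ^ 2
        * smoothFactor lam (fun _ => 1) N (j : ℕ)) = ((((j : ℕ) : ℝ) ^ 2 * κ
          * (modeScale lam (j : ℕ) * smoothFactor lam (fun _ => 1) N (j : ℕ)).re : ℝ) : ℂ)
          * Complex.I := by
      have : modeScale lam (j : ℕ) * smoothFactor lam (fun _ => 1) N (j : ℕ)
          = ((modeScale lam (j : ℕ) * smoothFactor lam (fun _ => 1) N (j : ℕ)).re : ℂ) := by
        rw [modeScale, smoothFactor]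
        split_ifs
        · rw [← Complex.ofReal_div, ← Complex.ofReal_mul, Complex.ofReal_re]
        · simp
      rw [Complex.ofReal_mul, ← this, hilbertSymbol, Int.sign_eq_one_of_pos (by omega)]
      push_cast
      linear_combination (-(Complex.I * κ * (j : ℕ) ^ 2 * (modeScale lam (j : ℕ)
        * smoothFactor lam (fun _ => 1) N (j : ℕ)))) * Complex.I_sq
    rw [Complex.neg_re, e, Complex.mul_I_re, Complex.ofReal_im]; simp
  · intro k _
    rw [smul_add, smul_smul, smul_smul, hadd, modeTrace_smul_gLow, modeTrace_smul_gLow]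
    -- The trace sees the factor of frequency `j`; the other factor then has frequency zero.
    have h1 : (if (((j : ℕ) : ℤ) - k) = ((j : ℕ) : ℤ) then gLow N k x else 0) = 0 := by
      split_ifs with h
      · obtain rfl : k = 0 := by omega
        exact h0
      · rfl
    have h2 : (if k = ((j : ℕ) : ℤ) then gLow N (((j : ℕ) : ℤ) - k) x else 0) = 0 := by
      split_ifs with h
      · rw [h, sub_self]; exact h0
      · rfl
    split_ifs at h1 h2 ⊢ <;> simp_all

end LowModes

end

/-! ### Construction of the finite-dimensional flow -/

section

open TrigPoly
open scoped NNReal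

section LowModes

variable {κ lam : ℝ} {φ : ℝ → ℝ} {N : ℕ}

lemma contDiff_lowField : ContDiff ℝ 1 (lowField κ lam φ N) := by
  refine contDiff_pi.mpr fun j => ?_
  simp only [lowField_apply]
  exact (contDiff_const.mul (gLow N _).contDiff).add (ContDiff.sum fun k _ =>
    contDiff_const.mul ((gLow N k).contDiff.mul (gLow N _).contDiff))

/-- The truncated equation, cut off at the mass `M`. -/
def cutField (κ lam : ℝ) (φ : ℝ → ℝ) (N : ℕ) (M : ℝ) (x : LowModes N) : LowModes N :=
  Real.smoothTransition (M + 1 - lowMass lam N x) • lowField κ lam φ N x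

lemma cutField_eq {M : ℝ} {x : LowModes N} (hx : lowMass lam N x ≤ M) :
    cutField κ lam φ N M x = lowField κ lam φ N x := by
  rw [cutField, Real.smoothTransition.one_of_one_le (by linarith), one_smul]

lemma contDiff_cutField (M : ℝ) : ContDiff ℝ 1 (cutField κ lam φ N M) :=
  (Real.smoothTransition.contDiff.comp (contDiff_const.sub contDiff_lowMass)).smul contDiff_lowField

lemma hasCompactSupport_cutField (hlam : 0 < lam) (M : ℝ) :
    HasCompactSupport (cutField κ lam φ N M) := by
  refine HasCompactSupport.of_support_subset_isCompact
    (isCompact_closedBall (0 : LowModes N) (√(((N : ℝ) ^ (3 / 2 : ℝ)) ^ 2 * (M + 1)))) fun x hx => ?_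
  rw [mem_closedBall_zero_iff]
  refine norm_le_of_lowMass_le hlam ?_
  by_contra! h
  refine hx ?_
  rw [cutField, Real.smoothTransition.zero_of_nonpos (by linarith), zero_smul]

lemma fderiv_lowMass_cutField {ε : ℝ} (hlam : 0 < lam) (hφ : IsProfile ε φ) (hN : 0 < N) (M : ℝ)
    (x : LowModes N) : fderiv ℝ (lowMass lam N) x (cutField κ lam φ N M x) = 0 := by
  rw [cutField, map_smul, fderiv_lowMass_lowField hlam hφ hN, smul_zero]

/-- The real coordinates of the low modes. -/
def lowBasis (N : ℕ) : Module.Basis (Σ _ : Finset.Icc 1 N, Fin 2) ℝ (LowModes N) :=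
  Pi.basis fun _ => Complex.basisOneI

lemma trace_eq (L : LowModes N →L[ℝ] LowModes N) :
    ∑ i, (lowBasis N).coord i (L (lowBasis N i))
      = ∑ j, modeTrace j ((ContinuousLinearMap.proj j).comp L) := by
  rw [Fintype.sum_sigma]
  refine Finset.sum_congr rfl fun j _ => ?_
  rw [Fin.sum_univ_two]
  simp [lowBasis, modeTrace, Pi.basis_apply, Pi.basis_repr]

/-- The cutoff is a function of the mass, whose gradient is orthogonal to the field. Both terms of
the divergence of the product therefore vanish. -/
lemma divergence_cutField {ε : ℝ} (hlam : 0 < lam) (hφ : IsProfile ε φ) (hN : 0 < N) (M : ℝ)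
    (x : LowModes N) :
    ∑ i, (lowBasis N).coord i (fderiv ℝ (cutField κ lam φ N M) x (lowBasis N i)) = 0 := by
  have hη : HasFDerivAt (fun x => Real.smoothTransition (M + 1 - lowMass lam N x))
      (deriv Real.smoothTransition (M + 1 - lowMass lam N x) • -fderiv ℝ (lowMass lam N) x) x := by
    have h1 : HasDerivAt Real.smoothTransition _ (M + 1 - lowMass lam N x) :=
      ((Real.smoothTransition.contDiff (n := 1)).differentiable (by simp) _).hasDerivAt
    exact h1.comp_hasFDerivAt x
      (((contDiff_lowMass.differentiable one_ne_zero x).hasFDerivAt).const_sub (M + 1))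
  have hb := ((contDiff_lowField (κ := κ) (lam := lam) (φ := φ) (N := N)).differentiable
    one_ne_zero x).hasFDerivAt
  have hd := (hη.smul hb).fderiv
  have hdiv : ∑ i, (lowBasis N).coord i (fderiv ℝ (lowField κ lam φ N) x (lowBasis N i)) = 0 := by
    rw [trace_eq]
    refine Finset.sum_eq_zero fun j _ => ?_
    obtain ⟨L, hL, hL0⟩ := hasFDerivAt_lowField (κ := κ) (lam := lam) (φ := φ) x j
    rw [← hL0]
    congr 1
    exact (hasFDerivAt_pi'.mp hb j).unique hL
  have hgrad : ∑ i, (lowBasis N).coord i (lowField κ lam φ N x)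
      * fderiv ℝ (lowMass lam N) x (lowBasis N i) = 0 := by
    rw [← fderiv_lowMass_lowField (κ := κ) hlam hφ hN x]
    conv_rhs => rw [← (lowBasis N).sum_repr (lowField κ lam φ N x), map_sum]
    simp
  have e : fderiv ℝ (cutField κ lam φ N M) x = _ := hd
  rw [e]
  simp only [FunLike.coe_add, FunLike.coe_smul, Pi.add_apply, Pi.smul_apply,
    ContinuousLinearMap.smulRight_apply, map_add, map_smul, smul_eq_mul, Finset.sum_add_distrib,
    FunLike.coe_neg, Pi.neg_apply]
  rw [← Finset.mul_sum, hdiv, mul_zero, zero_add]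
  have : ∀ i, deriv Real.smoothTransition (M + 1 - lowMass lam N x)
      * -fderiv ℝ (lowMass lam N) x (lowBasis N i) * (lowBasis N).coord i (lowField κ lam φ N x)
      = -deriv Real.smoothTransition (M + 1 - lowMass lam N x)
        * ((lowBasis N).coord i (lowField κ lam φ N x)
      * fderiv ℝ (lowMass lam N) x (lowBasis N i)) := fun i => by ring
  simp only [this]
  rw [← Finset.mul_sum, hgrad, mul_zero]

/-- A flow of the truncated equation on the region of mass at most `M`. -/
structure IsLowFlow (κ lam : ℝ) (φ : ℝ → ℝ) (N : ℕ) (M : ℝ)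
    (Ψ : ℝ → LowModes N → LowModes N) : Prop where
  continuous : Continuous fun p : ℝ × LowModes N => Ψ p.1 p.2
  zero : ∀ x, Ψ 0 x = x
  neg_apply : ∀ t x, Ψ (-t) (Ψ t x) = x
  measurePreserving : ∀ t, MeasurePreserving (Ψ t) volume volume
  mass : ∀ t x, lowMass lam N (Ψ t x) = lowMass lam N x
  hasDerivAt : ∀ x, lowMass lam N x ≤ M → ∀ t,
    HasDerivAt (fun τ => Ψ τ x) (lowField κ lam φ N (Ψ t x)) t
  unique : ∀ γ : ℝ → LowModes N, (∀ t, lowMass lam N (γ t) ≤ M) →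
    (∀ t, HasDerivAt γ (lowField κ lam φ N (γ t)) t) → ∀ t, γ t = Ψ t (γ 0)

/-- The quadratic field is neither bounded nor globally Lipschitz, so it is cut off at mass `M`. The
cut field still preserves the mass, hence a trajectory starting below `M` stays where the cutoff
equals one and solves the true equation. -/
lemma exists_isLowFlow {ε : ℝ} (κ : ℝ) (hlam : 0 < lam) (hφ : IsProfile ε φ) (hN : 0 < N) (M : ℝ) :
    ∃ Ψ, IsLowFlow κ lam φ N M Ψ := by
  have hc := hasCompactSupport_cutField (κ := κ) (φ := φ) (N := N) hlam M
  have hd := contDiff_cutField (κ := κ) (lam := lam) (φ := φ) (N := N) M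
  obtain ⟨K, hK⟩ : ∃ K, LipschitzWith K (cutField κ lam φ N M) :=
    hd.lipschitzWith_of_hasCompactSupport hc one_ne_zero
  obtain ⟨B, hB⟩ : ∃ B : ℝ≥0, ∀ x, ‖cutField κ lam φ N M x‖ ≤ B := by
    obtain ⟨B, hB⟩ := hc.exists_bound_of_continuous hd.continuous
    exact ⟨B.toNNReal, fun x => (hB x).trans (Real.le_coe_toNNReal B)⟩
  obtain ⟨Ψ, hΨ⟩ := exists_globalFlow hK hB
  have hmass : ∀ t x, lowMass lam N (Ψ t x) = lowMass lam N x := by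
    intro t x
    have hder : ∀ t, HasDerivAt (fun τ => lowMass lam N (Ψ τ x)) 0 t := fun t => by
      rw [← fderiv_lowMass_cutField (κ := κ) hlam hφ hN M (Ψ t x)]
      exact ((contDiff_lowMass.differentiable one_ne_zero _).hasFDerivAt).comp_hasDerivAt t
        (hΨ.hasDerivAt x t)
    have := is_const_of_deriv_eq_zero (fun t => (hder t).differentiableAt)
      (fun t => (hder t).deriv) t 0
    rwa [hΨ.zero] at this
  refine ⟨Ψ, ?_, hΨ.zero, hΨ.neg_apply hK, fun t => hΨ.measurePreserving (lowBasis N) hK hB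
    (hd.differentiable one_ne_zero) (divergence_cutField hlam hφ hN M) t, hmass, ?_, ?_⟩
  · refine continuous_iff_continuousAt.mpr fun ⟨t, x⟩ => ?_
    rw [ContinuousAt, tendsto_iff_dist_tendsto_zero]
    have hb : ∀ p : ℝ × LowModes N, dist (Ψ p.1 p.2) (Ψ t x)
        ≤ dist p.2 x * Real.exp (K * |p.1|) + B * dist p.1 t := fun p =>
      (dist_triangle _ (Ψ p.1 x) _).trans (add_le_add (hΨ.dist_le hK _ _ _)
        ((hΨ.dist_time_le hB x).dist_le_mul _ _))
    refine squeeze_zero (fun _ => dist_nonneg) hb ?_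
    have hcont : Continuous fun p : ℝ × LowModes N =>
        dist p.2 x * Real.exp (K * |p.1|) + B * dist p.1 t := by fun_prop
    simpa using hcont.tendsto (t, x)
  · intro x hx t
    have := hΨ.hasDerivAt x t
    rwa [cutField_eq (by rw [hmass]; exact hx)] at this
  · intro γ hM hγ t
    refine hΨ.eq_of_hasDerivAt hK (fun t => ?_) t
    rw [cutField_eq (hM t)]
    exact hγ t

end LowModes

end

/-! ### The truncated flow on the Gaussian coordinates -/

section

open TrigPoly
open scoped ENNReal NNReal

/-- The sequence with prescribed modes `1 ≤ j ≤ N`. -/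
def combine (N : ℕ) (x : LowModes N) (y : ℕ → ℂ) (j : ℕ) : ℂ :=
  if h : j ∈ Finset.Icc 1 N then x ⟨j, h⟩ else y j

lemma measurable_combine (N : ℕ) :
    Measurable fun p : LowModes N × (ℕ → ℂ) => combine N p.1 p.2 := by
  refine measurable_pi_lambda _ fun j => ?_
  unfold combine
  split_ifs
  · exact (measurable_pi_apply _).comp measurable_fst
  · exact (measurable_pi_apply _).comp measurable_snd

/-- The noise is split into its coordinates `1, …, N` and an independent copy whose own coordinates
`1, …, N` are discarded; the laws are compared on cylinder sets. -/
lemma measurePreserving_combine (N : ℕ) :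
    MeasurePreserving (fun p : LowModes N × (ℕ → ℂ) => combine N p.1 p.2)
      ((Measure.pi fun _ => complexGaussian).prod noise) noise := by
  classical
  refine ⟨measurable_combine N, Measure.eq_infinitePi _ fun s t ht => ?_⟩
  rw [Measure.map_apply (measurable_combine N) (.pi s.countable_toSet fun i _ => ht i)]
  have e : (fun p : LowModes N × (ℕ → ℂ) => combine N p.1 p.2) ⁻¹' Set.pi s t
      = (Set.univ.pi fun i : Finset.Icc 1 N => if (i : ℕ) ∈ s then t i else Set.univ)
        ×ˢ Set.pi (s \ Finset.Icc 1 N : Finset ℕ) t := by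
    ext ⟨x, y⟩
    simp only [Set.mem_preimage, Set.mem_pi, Finset.mem_coe, Set.mem_prod, Set.mem_univ,
      true_implies, Finset.mem_sdiff, combine]
    constructor
    · intro h
      refine ⟨fun i => ?_, fun j hj => ?_⟩
      · split_ifs with hi
        · have := h i hi
          rwa [dif_pos i.2] at this
        · trivial
      · have := h j hj.1
        rwa [dif_neg hj.2] at this
    · rintro ⟨h1, h2⟩ j hj
      split_ifs with h
      · have := h1 ⟨j, h⟩
        rwa [if_pos hj] at this
      · exact h2 j ⟨hj, h⟩
  rw [e, Measure.prod_prod, Measure.pi_pi, noise, Measure.infinitePi_pi _ fun i _ => ht i,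
    Finset.prod_coe_sort (Finset.Icc 1 N) fun i => complexGaussian (if i ∈ s then t i else Set.univ)]
  have e2 : ∀ i, complexGaussian (if i ∈ s then t i else Set.univ)
      = if i ∈ s then complexGaussian (t i) else 1 := fun i => by
    split_ifs
    · rfl
    · exact measure_univ
  simp only [e2]
  rw [Finset.prod_ite_mem, Finset.inter_comm]
  exact Finset.prod_inter_mul_prod_sdiff s (Finset.Icc 1 N) fun i => complexGaussian (t i)

lemma lintegral_combine (N : ℕ) {F : (ℕ → ℂ) → ℝ≥0∞} (hF : Measurable F) :
    ∫⁻ z, F z ∂noise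
      = ∫⁻ y, ∫⁻ x, F (combine N x y) ∂(Measure.pi fun _ => complexGaussian) ∂noise := by
  rw [← (measurePreserving_combine N).lintegral_comp hF]
  exact lintegral_prod_symm _ (hF.comp (measurable_combine N)).aemeasurable

/-- The square of the Euclidean norm of the low modes. -/
def lowEnergy {N : ℕ} (x : LowModes N) : ℝ := ∑ i, ‖x i‖ ^ 2

lemma continuous_lowEnergy {N : ℕ} : Continuous (lowEnergy (N := N)) := by
  unfold lowEnergy; fun_prop

lemma pi_complexGaussian_eq_withDensity (N : ℕ) :
    (Measure.pi fun _ : Finset.Icc 1 N => complexGaussian)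
      = (volume : Measure (LowModes N)).withDensity fun x =>
        ENNReal.ofReal (Real.pi⁻¹ ^ Fintype.card (Finset.Icc 1 N) * Real.exp (-lowEnergy x)) := by
  refine Measure.pi_eq fun s hs => ?_
  have e : ∀ x : LowModes N,
      ENNReal.ofReal (Real.pi⁻¹ ^ Fintype.card (Finset.Icc 1 N) * Real.exp (-lowEnergy x))
      = ∏ i, ENNReal.ofReal (Real.pi⁻¹ * Real.exp (-‖x i‖ ^ 2)) := by
    intro x
    rw [← ENNReal.ofReal_prod_of_nonneg fun i _ => by positivity, Finset.prod_mul_distrib,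
      Finset.prod_const, ← Real.exp_sum, lowEnergy, Finset.sum_neg_distrib, Finset.card_univ]
  simp only [e]
  set f : ℂ → ℝ := fun w => Real.pi⁻¹ * Real.exp (-‖w‖ ^ 2) with hf
  have hf0 : ∀ w, 0 ≤ f w := fun w => by positivity
  have hfm : Measurable f := by fun_prop
  have hcg : ∀ i, ∫⁻ w in s i, ENNReal.ofReal (f w) = complexGaussian (s i) := fun i => by
    rw [complexGaussian_eq_withDensity, withDensity_apply _ (hs i)]
  have hfi : ∀ i, Integrable f (volume.restrict (s i)) := fun i => by
    refine ⟨hfm.aestronglyMeasurable, ?_⟩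
    rw [hasFiniteIntegral_iff_ofReal (ae_of_all _ hf0), hcg]
    exact measure_lt_top _ _
  rw [withDensity_apply _ (.univ_pi hs), volume_pi, Measure.restrict_pi_pi]
  have hp : ∀ x : LowModes N, ∏ i, ENNReal.ofReal (f (x i)) = ENNReal.ofReal (∏ i, f (x i)) :=
    fun x => (ENNReal.ofReal_prod_of_nonneg fun i _ => hf0 _).symm
  change ∫⁻ x : LowModes N, ∏ i, ENNReal.ofReal (f (x i)) ∂_ = _
  simp only [hp]
  rw [← ofReal_integral_eq_lintegral_ofReal (Integrable.fintype_prod (f := fun _ => f) hfi)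
      (ae_of_all _ fun x => Finset.prod_nonneg fun i _ => hf0 _),
    integral_fintype_prod_eq_prod (fun _ => f),
    ENNReal.ofReal_prod_of_nonneg fun i _ => integral_nonneg hf0]
  refine Finset.prod_congr rfl fun i _ => ?_
  rw [ofReal_integral_eq_lintegral_ofReal (hfi i) (ae_of_all _ hf0), hcg]

/-- The exponential replaces the Gaussian density at `x` by the one at `ψ x`, after which invariance
of Lebesgue measure applies. -/
lemma lintegral_comp_mul_exp_eq {N : ℕ} {ψ : LowModes N → LowModes N}
    (hψ : MeasurePreserving ψ volume volume) {F : LowModes N → ℝ≥0∞} (hF : Measurable F) :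
    ∫⁻ x, F (ψ x) * ENNReal.ofReal (Real.exp (lowEnergy x - lowEnergy (ψ x)))
        ∂(Measure.pi fun _ => complexGaussian)
      = ∫⁻ x, F x ∂(Measure.pi fun _ => complexGaussian) := by
  have hm := hψ.measurable
  have he := (continuous_lowEnergy (N := N)).measurable
  have hme := he.comp hm
  have hG : Measurable fun x => F (ψ x)
      * ENNReal.ofReal (Real.exp (lowEnergy x - lowEnergy (ψ x))) :=
    (hF.comp hm).mul (he.sub hme).exp.ennreal_ofReal
  rw [pi_complexGaussian_eq_withDensity, lintegral_withDensity_eq_lintegral_mul _ (by fun_prop) hG,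
    lintegral_withDensity_eq_lintegral_mul _ (by fun_prop) hF]
  have h := hψ.lintegral_comp (f := (fun x => ENNReal.ofReal (Real.pi⁻¹ ^ Fintype.card
    (Finset.Icc 1 N) * Real.exp (-lowEnergy x))) * F) (Measurable.mul (by fun_prop) hF)
  rw [← h]
  refine lintegral_congr fun x => ?_
  simp only [Pi.mul_apply]
  rw [mul_comm (F (ψ x)), ← mul_assoc, ← ENNReal.ofReal_mul (by positivity), mul_assoc,
    ← Real.exp_add]
  congr 4
  ring

section Transport

variable {κ lam : ℝ} {φ : ℝ → ℝ} {N : ℕ}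

/-- The truncated flow acting on the Gaussian coordinates. -/
def noiseFlow (κ : ℝ) (N : ℕ) (Ψ : ℝ → LowModes N → LowModes N) (t : ℝ) (z : ℕ → ℂ) : ℕ → ℂ :=
  combine N (Ψ t ((Finset.Icc 1 N).restrict z))
    fun j => Complex.exp (-(Complex.I * κ * j ^ 2) * t) * z j

lemma noiseFlow_of_mem (Ψ : ℝ → LowModes N → LowModes N) (t : ℝ) (z : ℕ → ℂ) {j : ℕ}
    (hj : j ∈ Finset.Icc 1 N) :
    noiseFlow κ N Ψ t z j = Ψ t ((Finset.Icc 1 N).restrict z) ⟨j, hj⟩ := by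
  rw [noiseFlow, combine, dif_pos hj]

lemma noiseFlow_of_notMem (Ψ : ℝ → LowModes N → LowModes N) (t : ℝ) (z : ℕ → ℂ) {j : ℕ}
    (hj : j ∉ Finset.Icc 1 N) :
    noiseFlow κ N Ψ t z j = Complex.exp (-(Complex.I * κ * j ^ 2) * t) * z j := by
  rw [noiseFlow, combine, dif_neg hj]

lemma restrict_combine (x : LowModes N) (y : ℕ → ℂ) :
    (Finset.Icc 1 N).restrict (combine N x y) = x := by
  ext j; rw [Finset.restrict, combine, dif_pos j.2]

lemma restrict_noiseFlow (Ψ : ℝ → LowModes N → LowModes N) (t : ℝ) (z : ℕ → ℂ) :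
    (Finset.Icc 1 N).restrict (noiseFlow κ N Ψ t z) = Ψ t ((Finset.Icc 1 N).restrict z) :=
  restrict_combine _ _

lemma norm_exp_rotation (κ : ℝ) (j : ℕ) (t : ℝ) :
    ‖Complex.exp (-(Complex.I * κ * j ^ 2) * t)‖ = 1 := by
  have : -(Complex.I * κ * j ^ 2) * t = ((-(κ * j ^ 2 * t) : ℝ) : ℂ) * Complex.I := by
    push_cast; ring
  rw [this, Complex.norm_exp_ofReal_mul_I]

variable {M : ℝ} {Ψ : ℝ → LowModes N → LowModes N}

lemma noiseFlow_neg_noiseFlow (hΨ : IsLowFlow κ lam φ N M Ψ) (t : ℝ) (z : ℕ → ℂ) :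
    noiseFlow κ N Ψ (-t) (noiseFlow κ N Ψ t z) = z := by
  ext j
  by_cases hj : j ∈ Finset.Icc 1 N
  · rw [noiseFlow_of_mem _ _ _ hj, restrict_noiseFlow, hΨ.neg_apply, Finset.restrict]
  · rw [noiseFlow_of_notMem _ _ _ hj, noiseFlow_of_notMem _ _ _ hj, ← mul_assoc, ← Complex.exp_add]
    push_cast
    rw [mul_neg, neg_add_cancel, Complex.exp_zero, one_mul]

lemma continuous_noiseFlow (hΨ : IsLowFlow κ lam φ N M Ψ) :
    Continuous fun p : ℝ × (ℕ → ℂ) => noiseFlow κ N Ψ p.1 p.2 := by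
  refine continuous_pi fun j => ?_
  by_cases hj : j ∈ Finset.Icc 1 N
  · simp only [noiseFlow_of_mem _ _ _ hj]
    refine (continuous_apply _).comp (hΨ.continuous.comp (continuous_fst.prodMk ?_))
    exact continuous_pi fun i => (continuous_apply _).comp continuous_snd
  · simp only [noiseFlow_of_notMem _ _ _ hj]
    fun_prop

lemma measurable_noiseFlow_uncurry (hΨ : IsLowFlow κ lam φ N M Ψ) :
    Measurable fun p : ℝ × (ℕ → ℂ) => noiseFlow κ N Ψ p.1 p.2 :=
  (continuous_noiseFlow hΨ).measurable

lemma measurable_noiseFlow (hΨ : IsLowFlow κ lam φ N M Ψ) (t : ℝ) :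
    Measurable (noiseFlow κ N Ψ t) :=
  (measurable_noiseFlow_uncurry hΨ).comp measurable_prodMk_left

/-- The low mode energy of a sequence. -/
def noiseEnergy (N : ℕ) (z : ℕ → ℂ) : ℝ := lowEnergy ((Finset.Icc 1 N).restrict z)

lemma measurable_noiseEnergy (N : ℕ) : Measurable (noiseEnergy N) :=
  continuous_lowEnergy.measurable.comp (Finset.measurable_restrict _)

/-- Change of variables in the noise along the truncated flow. -/
lemma lintegral_noiseFlow (hΨ : IsLowFlow κ lam φ N M Ψ) (t : ℝ) {F : (ℕ → ℂ) → ℝ≥0∞}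
    (hF : Measurable F) :
    ∫⁻ z, F (noiseFlow κ N Ψ t z)
        * ENNReal.ofReal (Real.exp (noiseEnergy N z - noiseEnergy N (noiseFlow κ N Ψ t z))) ∂noise
      = ∫⁻ z, F z ∂noise := by
  have hm := measurable_noiseFlow hΨ t
  have he := measurable_noiseEnergy N
  have hme := he.comp hm
  set c : ℕ → ℂ := fun j => Complex.exp (-(Complex.I * κ * j ^ 2) * t) with hc
  have hR := measurePreserving_mul_noise (c := c) fun j => norm_exp_rotation κ j t
  have hG : Measurable fun z => F (noiseFlow κ N Ψ t z) * ENNReal.ofReal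
      (Real.exp (noiseEnergy N z - noiseEnergy N (noiseFlow κ N Ψ t z))) :=
    (hF.comp hm).mul (he.sub hme).exp.ennreal_ofReal
  rw [lintegral_combine N hG, lintegral_combine N hF]
  -- The flow acts separately on the two blocks: the low modes are handled by Liouville's theorem,
  -- the others by rotation invariance.
  have hflow : ∀ x y, noiseFlow κ N Ψ t (combine N x y)
      = combine N (Ψ t x) fun j => c j * y j := by
    intro x y
    ext j
    by_cases hj : j ∈ Finset.Icc 1 N
    · rw [noiseFlow_of_mem _ _ _ hj, restrict_combine, combine, dif_pos hj]
    · rw [noiseFlow_of_notMem _ _ _ hj, combine, combine, dif_neg hj, dif_neg hj]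
  simp only [noiseEnergy, hflow, restrict_combine]
  have hcm : ∀ y : ℕ → ℂ, Measurable fun x : LowModes N => F (combine N x fun j => c j * y j) := fun y =>
    hF.comp ((measurable_combine N).comp measurable_prodMk_right)
  have h1 : ∀ y : ℕ → ℂ, ∫⁻ x, F (combine N (Ψ t x) fun j => c j * y j)
      * ENNReal.ofReal (Real.exp (lowEnergy x - lowEnergy (Ψ t x)))
        ∂(Measure.pi fun _ => complexGaussian)
      = ∫⁻ x, F (combine N x fun j => c j * y j) ∂(Measure.pi fun _ => complexGaussian) := fun y =>
    lintegral_comp_mul_exp_eq (hΨ.measurePreserving t) (hcm y)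
  simp only [h1]
  refine hR.lintegral_comp
    (f := fun y => ∫⁻ x, F (combine N x y) ∂(Measure.pi fun _ => complexGaussian)) ?_
  exact Measurable.lintegral_prod_left' (f := fun p : LowModes N × (ℕ → ℂ) =>
    F (combine N p.1 p.2)) (hF.comp (measurable_combine N))

end Transport

end

/-! ### Gaussian coordinates on the Sobolev space -/

section

open TrigPoly Filter Topology
open scoped ENNReal NNReal

namespace Sobolev

variable {s : ℝ}

lemma coeff_eq_toEllTwo (u : Sobolev s) {n : ℤ} (hn : n ≠ 0) :
    u.coeff n = toEllTwo u n / ((|(n : ℝ)| ^ s : ℝ) : ℂ) := by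
  have hn' : 0 < |(n : ℝ)| := abs_pos.mpr (by exact_mod_cast hn)
  have : ((|(n : ℝ)| ^ s : ℝ) : ℂ) ≠ 0 := Complex.ofReal_ne_zero.mpr (by positivity)
  rw [eq_div_iff this, mul_comm]
  rfl

lemma continuous_coeff (n : ℤ) : Continuous fun u : Sobolev s => u.coeff n := by
  rcases eq_or_ne n 0 with rfl | hn
  · simp only [coeff_zero]; exact continuous_const
  · simp only [coeff_eq_toEllTwo _ hn]
    have h : Continuous fun f : lp (fun _ : ℤ => ℂ) 2 => f n :=
      (lp.evalCLM ℂ (fun _ : ℤ => ℂ) 2 n).continuous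
    have h' : Continuous (toEllTwo : Sobolev s → _) := continuous_induced_dom
    exact (h.comp h').div_const _

lemma measurable_coeff (n : ℤ) : Measurable fun u : Sobolev s => u.coeff n :=
  (continuous_coeff n).measurable

/-- The Gaussian coordinates of an element of `H^s`. -/
def coords (lam : ℝ) (u : Sobolev s) (j : ℕ) : ℂ := modeScale lam j * u.coeff j

lemma measurable_coords (lam : ℝ) : Measurable (coords lam : Sobolev s → ℕ → ℂ) :=
  measurable_pi_lambda _ fun j => (measurable_coeff (j : ℤ)).const_mul _

lemma seriesCoeff_coords {lam : ℝ} (hlam : 0 < lam) (u : Sobolev s) (n : ℤ) :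
    seriesCoeff lam (coords lam u) n = u.coeff n := by
  have hpos : ∀ n : ℤ, 0 < n → seriesCoeff lam (coords lam u) n = u.coeff n := by
    intro n hn
    obtain ⟨m, rfl⟩ := Int.eq_ofNat_of_zero_le hn.le
    rw [seriesCoeff_eq, g, if_pos hn, Int.natAbs_natCast, coords,
      mul_div_cancel_left₀ _ (modeScale_ne_zero hlam hn.ne')]
  rcases lt_trichotomy n 0 with h | rfl | h
  · have := hpos (-n) (by omega)
    rw [seriesCoeff_neg, u.coeff_neg] at this
    exact (starRingEnd ℂ).injective this
  · rw [seriesCoeff_zero, u.coeff_zero]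
  · exact hpos n h

lemma proj_eq_series {lam : ℝ} (hlam : 0 < lam) (N : ℕ) (u : Sobolev s) :
    u.proj N = series lam N (coords lam u) :=
  Finset.sum_congr rfl fun n _ => by rw [seriesCoeff_coords hlam]

end Sobolev

open Sobolev

section Series

variable {s lam : ℝ}

/-- The summability of the random series in `H^s`. -/
def SeriesSummable (s lam : ℝ) (z : ℕ → ℂ) : Prop :=
  Summable fun n : ℤ => (|(n : ℝ)| ^ s * ‖seriesCoeff lam z n‖) ^ 2

lemma coeff_randomSeries {z : ℕ → ℂ} (hz : SeriesSummable s lam z) (n : ℤ) :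
    (randomSeries s lam z).coeff n = seriesCoeff lam z n := by
  rw [randomSeries, dif_pos (show Summable _ from hz)]

lemma randomSeries_eq_zero {z : ℕ → ℂ} (hz : ¬SeriesSummable s lam z) : randomSeries s lam z = 0 :=
  dif_neg hz

lemma seriesSummable_coords (hlam : 0 < lam) (u : Sobolev s) : SeriesSummable s lam (coords lam u) :=
  u.summable.congr fun n => by rw [seriesCoeff_coords hlam]

lemma randomSeries_coords (hlam : 0 < lam) (u : Sobolev s) :
    randomSeries s lam (coords lam u) = u := by
  ext n
  rw [coeff_randomSeries (seriesSummable_coords hlam u), seriesCoeff_coords hlam]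

lemma seriesCoeff_congr {z z' : ℕ → ℂ} {n : ℤ} (h : n ≠ 0 → z n.natAbs = z' n.natAbs) :
    seriesCoeff lam z n = seriesCoeff lam z' n := by
  rcases eq_or_ne n 0 with rfl | hn
  · rw [seriesCoeff_zero, seriesCoeff_zero]
  · rw [seriesCoeff, seriesCoeff, g, g, h hn]

lemma coords_randomSeries (hlam : 0 < lam) {z : ℕ → ℂ} (hz : SeriesSummable s lam z) {j : ℕ}
    (hj : j ≠ 0) : coords lam (randomSeries s lam z) j = z j := by
  rw [coords, coeff_randomSeries hz, seriesCoeff_eq, g, if_pos (by omega), Int.natAbs_natCast,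
    mul_div_cancel₀ _ (modeScale_ne_zero hlam (by exact_mod_cast hj))]

/-- The coordinate `0` of the noise is never used, while `coords` sets it to zero; identities
between the two descriptions hold only off that coordinate. -/
lemma randomSeries_congr {z z' : ℕ → ℂ} (h : ∀ j, j ≠ 0 → z j = z' j) :
    randomSeries s lam z = randomSeries s lam z' := by
  have : seriesCoeff lam z = seriesCoeff lam z' :=
    funext fun n => seriesCoeff_congr fun hn => h _ (by omega)
  have hiff : SeriesSummable s lam z ↔ SeriesSummable s lam z' := by
    rw [SeriesSummable, SeriesSummable, this]
  by_cases hz : SeriesSummable s lam z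
  · ext n
    rw [coeff_randomSeries hz, coeff_randomSeries (hiff.mp hz), this]
  · rw [randomSeries_eq_zero hz, randomSeries_eq_zero (mt hiff.mpr hz)]

lemma proj_randomSeries {z : ℕ → ℂ} (hz : SeriesSummable s lam z) (N : ℕ) :
    (randomSeries s lam z).proj N = series lam N z :=
  Finset.sum_congr rfl fun n _ => by rw [coeff_randomSeries hz]

lemma seriesSummable_iff (z : ℕ → ℂ) : SeriesSummable s lam z ↔
    ∑' n : ℤ, ENNReal.ofReal ((|(n : ℝ)| ^ s * ‖seriesCoeff lam z n‖) ^ 2) ≠ ⊤ := by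
  constructor
  · intro h
    rw [← ENNReal.ofReal_tsum_of_nonneg (fun n => by positivity) h]
    exact ENNReal.ofReal_ne_top
  · intro h
    refine (ENNReal.summable_toReal h).congr fun n => ?_
    rw [ENNReal.toReal_ofReal (by positivity)]

lemma measurable_seriesTerm (n : ℤ) :
    Measurable fun z => ENNReal.ofReal ((|(n : ℝ)| ^ s * ‖seriesCoeff lam z n‖) ^ 2) := by
  have := measurable_seriesCoeff lam n
  fun_prop

lemma measurableSet_seriesSummable : MeasurableSet {z | SeriesSummable s lam z} := by
  simp only [seriesSummable_iff]
  have : Measurable fun z =>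
      ∑' n : ℤ, ENNReal.ofReal ((|(n : ℝ)| ^ s * ‖seriesCoeff lam z n‖) ^ 2) :=
    Measurable.tsum fun n => measurable_seriesTerm n
  exact (this (measurableSet_singleton ⊤)).compl

/-- The random series converges almost surely in `H^s` for `s < 1`. -/
lemma ae_seriesSummable (hlam : 0 < lam) (hs : s < 1) : ∀ᵐ z ∂noise, SeriesSummable s lam z := by
  simp only [seriesSummable_iff]
  have hm : Measurable fun z =>
      ∑' n : ℤ, ENNReal.ofReal ((|(n : ℝ)| ^ s * ‖seriesCoeff lam z n‖) ^ 2) :=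
    Measurable.tsum fun n => measurable_seriesTerm n
  refine (ae_lt_top hm ?_).mono fun z hz => hz.ne
  rw [lintegral_tsum fun n => (measurable_seriesTerm n).aemeasurable]
  have hsum := (summable_abs_rpow (r := 2 * s - 3) (by linarith)).mul_right
    ((4 * Real.pi * lam)⁻¹ * gaussMoment 2)
  refine ne_top_of_le_ne_top hsum.tsum_ofReal_ne_top (ENNReal.tsum_le_tsum fun n => ?_)
  have hp : 0 < 4 * Real.pi * lam := by positivity
  rcases eq_or_ne n 0 with rfl | hn
  · simp [seriesCoeff_zero]
  have hn' : 0 < |(n : ℝ)| := abs_pos.mpr (by exact_mod_cast hn)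
  have e : ∀ z, (|(n : ℝ)| ^ s * ‖seriesCoeff lam z n‖) ^ 2
      = |(n : ℝ)| ^ (2 * s - 3) * (4 * Real.pi * lam)⁻¹ * ‖g z n‖ ^ 2 := by
    intro z
    rw [norm_seriesCoeff, mul_pow, div_pow, mul_pow, Real.sq_sqrt hp.le,
      show 2 * s - 3 = 2 * s - 2 * (3 / 2) by ring, Real.rpow_sub hn', abs_rpow_two_mul,
      abs_rpow_two_mul]
    field_simp
  simp only [e]
  rw [← ofReal_integral_eq_lintegral_ofReal ((integrable_norm_g_pow n 2).const_mul _)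
    (ae_of_all _ fun z => by positivity), integral_const_mul]
  refine ENNReal.ofReal_le_ofReal ?_
  rw [mul_assoc]
  exact mul_le_mul_of_nonneg_left (mul_le_mul_of_nonneg_left (integral_norm_g_pow_le n 2)
    (by positivity)) (by positivity)

/-- The Borel sets of `H^s` are pulled back from `ℓ²`, and an element of `ℓ²` is the limit of its
finite coordinate sums, each a continuous function of finitely many measurable coordinates. -/
lemma measurable_randomSeries : Measurable (randomSeries s lam) := by
  let _ : MeasurableSpace (lp (fun _ : ℤ => ℂ) 2) := borel _
  have _ : BorelSpace (lp (fun _ : ℤ => ℂ) 2) := ⟨rfl⟩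
  have hcomap : (inferInstance : MeasurableSpace (Sobolev s))
      = MeasurableSpace.comap Sobolev.toEllTwo inferInstance := borel_comap
  have h2 : Measurable fun z => Sobolev.toEllTwo (randomSeries s lam z) := by
    have happ : ∀ K : Finset ℤ, Measurable fun z => ∑ n ∈ K, lp.single (E := fun _ : ℤ => ℂ) 2 n
        (Sobolev.toEllTwo (randomSeries s lam z) n) := by
      intro K
      have hcont : Continuous fun c : K → ℂ =>
          ∑ n : K, lp.single (E := fun _ : ℤ => ℂ) 2 (n : ℤ) (c n) := by
        refine continuous_finsetSum _ fun n _ => ?_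
        exact (lp.singleContinuousLinearMap ℂ (fun _ : ℤ => ℂ) 2 (n : ℤ)).continuous.comp
          (continuous_apply n)
      have hc : Measurable fun (z : ℕ → ℂ) (n : K) => Sobolev.toEllTwo (randomSeries s lam z) n := by
        refine measurable_pi_lambda _ fun n => ?_
        have e : (fun z => (Sobolev.toEllTwo (randomSeries s lam z) (n : ℤ) : ℂ))
            = Set.indicator {z | SeriesSummable s lam z}
              fun z => ((|((n : ℤ) : ℝ)| ^ s : ℝ) : ℂ) * seriesCoeff lam z n := by
          ext z
          by_cases hz : z ∈ {z | SeriesSummable s lam z}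
          · rw [Set.indicator_of_mem hz, ← coeff_randomSeries hz]; rfl
          · rw [Set.indicator_of_notMem hz, randomSeries_eq_zero hz]
            exact mul_zero _
        rw [e]
        exact ((measurable_seriesCoeff lam n).const_mul _).indicator measurableSet_seriesSummable
      have := hcont.measurable.comp hc
      have e : (fun z => ∑ n ∈ K, lp.single (E := fun _ : ℤ => ℂ) 2 n
          (Sobolev.toEllTwo (randomSeries s lam z) n)) = fun z => ∑ n : K,
            lp.single (E := fun _ : ℤ => ℂ) 2 (n : ℤ)
              (Sobolev.toEllTwo (randomSeries s lam z) (n : ℤ)) :=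
        funext fun z => (Finset.sum_coe_sort K fun n => lp.single (E := fun _ : ℤ => ℂ) 2 n
          (Sobolev.toEllTwo (randomSeries s lam z) n)).symm
      rw [e]
      exact this
    refine measurable_of_tendsto_metrizable' (atTop : Filter (Finset ℤ)) happ ?_
    refine tendsto_pi_nhds.mpr fun z => ?_
    exact lp.hasSum_single (by norm_num) (Sobolev.toEllTwo (randomSeries s lam z))
  intro S hS
  have hS' : MeasurableSet[MeasurableSpace.comap Sobolev.toEllTwo inferInstance] S := by
    rw [← hcomap]; exact hS
  obtain ⟨T, hT, rfl⟩ := hS'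
  exact h2 hT

end Series

end

/-! ### The flow of the truncated equation on the Sobolev space -/

section

open TrigPoly Filter Topology Sobolev
open scoped ENNReal NNReal

variable {κ lam : ℝ} {φ : ℝ → ℝ} {N : ℕ} {s : ℝ}

lemma coeff_nonlinearity (u : Sobolev s) (n : ℤ) : (nonlinearity φ N u).coeff n
    = φ ((n : ℝ) / N) * (smooth φ N (u.proj N) * dx (smooth φ N (u.proj N))).coeff n := by
  rw [nonlinearity, coeff_smooth, smooth_dx]

lemma lowSeries_restrict (lam : ℝ) (z : ℕ → ℂ) :
    lowSeries lam N ((Finset.Icc 1 N).restrict z) = series lam N z :=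
  series_congr lam fun _ h1 hj => extendZero_restrict _ z (Finset.mem_Icc.mpr ⟨h1, hj⟩)

/-- The mass of the low modes of a sequence. -/
def noiseMass (lam : ℝ) (N : ℕ) (z : ℕ → ℂ) : ℝ := lowMass lam N ((Finset.Icc 1 N).restrict z)

lemma noiseMass_eq (lam : ℝ) (N : ℕ) (z : ℕ → ℂ) :
    noiseMass lam N z = normSq lam 0 (series lam N z) := by
  rw [noiseMass, lowMass, lowSeries_restrict]

lemma hasDerivAt_lowMass {ε : ℝ} (hlam : 0 < lam) (hφ : IsProfile ε φ) (hN : 0 < N)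
    {γ : ℝ → LowModes N} (h : ∀ t, HasDerivAt γ (lowField κ lam φ N (γ t)) t) (t t' : ℝ) :
    lowMass lam N (γ t) = lowMass lam N (γ t') := by
  have hder : ∀ t, HasDerivAt (fun τ => lowMass lam N (γ τ)) 0 t := fun t =>
    HasCoeffDeriv.hasDerivAt_mass (κ := κ) (φ := φ) (N := N)
      (hasCoeffDeriv_of_lowField hlam hφ hN (h t)) hφ.even fun τ => isReal_lowSeries _ _
  exact is_const_of_deriv_eq_zero (fun t => (hder t).differentiableAt) (fun t => (hder t).deriv) t t'

lemma eq_exp_mul_of_hasDerivAt {f : ℝ → ℂ} {a : ℂ} (h : ∀ t, HasDerivAt f (a * f t) t) (t : ℝ) :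
    f t = Complex.exp (a * t) * f 0 := by
  have he : ∀ t : ℝ, HasDerivAt (fun τ : ℝ => Complex.exp (-a * τ)) (Complex.exp (-a * t) * -a) t := by
    intro t
    have h1 : HasDerivAt (fun τ : ℝ => -a * (τ : ℂ)) (-a) t := by
      simpa using (Complex.ofRealCLM.hasDerivAt (x := t)).const_mul (-a)
    exact h1.cexp
  have hder : ∀ t, HasDerivAt (fun τ : ℝ => Complex.exp (-a * τ) * f τ) 0 t := fun t =>
    ((he t).mul (h t)).congr_deriv (by ring)
  have hc := is_const_of_deriv_eq_zero (fun t => (hder t).differentiableAt)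
    (fun t => (hder t).deriv) t 0
  simp only [Complex.ofReal_zero, mul_zero, Complex.exp_zero, one_mul] at hc
  rw [← hc, ← mul_assoc, ← Complex.exp_add]
  simp

lemma symbol_eq {j : ℕ} (hj : j ≠ 0) :
    -(hilbertSymbol κ (j : ℤ) * (Complex.I * ((j : ℤ) : ℂ)) ^ 2) = -(Complex.I * κ * j ^ 2) := by
  rw [hilbertSymbol, Int.sign_eq_one_of_pos (by omega)]
  push_cast
  linear_combination (Complex.I * κ * j ^ 2) * Complex.I_sq

lemma notMem_Icc_of_natAbs {n : ℤ} (hn : n ≠ 0) (h : n.natAbs ∉ Finset.Icc 1 N) :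
    n ∉ Finset.Icc (-(N : ℤ)) N := by
  rw [Finset.mem_Icc] at *; omega

namespace IsSolution

variable {u : ℝ → Sobolev s}

lemma hasDerivAt_coords (hlam : 0 < lam) (h : IsSolution κ φ N u) (t : ℝ) :
    HasDerivAt (fun τ => (Finset.Icc 1 N).restrict (coords lam (u τ)))
      (lowField κ lam φ N ((Finset.Icc 1 N).restrict (coords lam (u t)))) t := by
  refine hasDerivAt_pi.mpr fun j => ?_
  have hj := Finset.mem_Icc.mp j.2
  refine ((h.equation (j : ℕ) t).const_mul (modeScale lam (j : ℕ))).congr_deriv ?_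
  rw [lowField, coeff_truncatedField, lowSeries_restrict, coeff_nonlinearity,
    proj_eq_series hlam, coeff_series, if_pos (Finset.mem_Icc.mpr (by omega)),
    seriesCoeff_coords hlam]

/-- Beyond `N` the profile vanishes and the equation is linear and diagonal, so each mode rotates.
-/
lemma coords_high {ε : ℝ} (hφ : IsProfile ε φ) (hN : 0 < N) (h : IsSolution κ φ N u) (t : ℝ)
    {j : ℕ} (hj : j ∉ Finset.Icc 1 N) :
    coords lam (u t) j = Complex.exp (-(Complex.I * κ * j ^ 2) * t) * coords lam (u 0) j := by
  rcases eq_or_ne j 0 with rfl | h0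
  · simp [coords, Sobolev.coeff_zero]
  have h1 : ∀ t, HasDerivAt (fun τ => (u τ).coeff (j : ℤ))
      (-(Complex.I * κ * j ^ 2) * (u t).coeff (j : ℤ)) t := fun t => by
    refine (h.equation j t).congr_deriv ?_
    rw [coeff_nonlinearity, profile_eq_zero hφ hN (notMem_Icc_of_natAbs (by omega) (by simpa using hj)),
      ← symbol_eq h0]
    simp
  rw [coords, coords, eq_exp_mul_of_hasDerivAt h1 t]
  ring

lemma noiseMass_eq {ε : ℝ} (hlam : 0 < lam) (hφ : IsProfile ε φ) (hN : 0 < N)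
    (h : IsSolution κ φ N u) (t : ℝ) :
    noiseMass lam N (coords lam (u t)) = noiseMass lam N (coords lam (u 0)) :=
  hasDerivAt_lowMass hlam hφ hN (h.hasDerivAt_coords hlam) t 0

/-- A solution conserves its own mass, so it remains where the low flow is the unique solution of
the finite-dimensional equation. This makes the choice in `flow` immaterial. -/
lemma coords_eq {ε : ℝ} (hlam : 0 < lam) (hφ : IsProfile ε φ) (hN : 0 < N)
    (h : IsSolution κ φ N u) {M : ℝ} {Ψ : ℝ → LowModes N → LowModes N}
    (hΨ : IsLowFlow κ lam φ N M Ψ) (hM : noiseMass lam N (coords lam (u 0)) ≤ M) (t : ℝ) :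
    coords lam (u t) = noiseFlow κ N Ψ t (coords lam (u 0)) := by
  ext j
  by_cases hj : j ∈ Finset.Icc 1 N
  · rw [noiseFlow_of_mem _ _ _ hj]
    have := hΨ.unique _ (fun t => (h.noiseMass_eq hlam hφ hN t).trans_le hM)
      (h.hasDerivAt_coords hlam) t
    exact congrFun this ⟨j, hj⟩
  · rw [noiseFlow_of_notMem _ _ _ hj, h.coords_high hφ hN t hj]

end IsSolution

section Existence

variable {M : ℝ} {Ψ : ℝ → LowModes N → LowModes N}

lemma norm_seriesCoeff_noiseFlow (t : ℝ) (z : ℕ → ℂ) {n : ℤ}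
    (hn : n ∉ Finset.Icc (-(N : ℤ)) N) :
    ‖seriesCoeff lam (noiseFlow κ N Ψ t z) n‖ = ‖seriesCoeff lam z n‖ := by
  have h0 : n ≠ 0 := by rintro rfl; simp at hn
  rw [norm_seriesCoeff, norm_seriesCoeff, norm_g h0, norm_g h0, noiseFlow_of_notMem, norm_mul,
    norm_exp_rotation, one_mul]
  rw [Finset.mem_Icc] at *; omega

lemma SeriesSummable.noiseFlow {z : ℕ → ℂ} (hz : SeriesSummable s lam z) (t : ℝ) :
    SeriesSummable s lam (noiseFlow κ N Ψ t z) := by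
  refine Summable.congr_cofinite hz ?_
  filter_upwards [(Finset.Icc (-(N : ℤ)) N).finite_toSet.compl_mem_cofinite] with n hn
  rw [norm_seriesCoeff_noiseFlow t z hn]

lemma noiseMass_noiseFlow (hΨ : IsLowFlow κ lam φ N M Ψ) (t : ℝ) (z : ℕ → ℂ) :
    noiseMass lam N (noiseFlow κ N Ψ t z) = noiseMass lam N z := by
  rw [noiseMass, restrict_noiseFlow, hΨ.mass, noiseMass]

lemma continuous_seriesCoeff_noiseFlow (hΨ : IsLowFlow κ lam φ N M Ψ) (z : ℕ → ℂ) (n : ℤ) :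
    Continuous fun t => seriesCoeff lam (noiseFlow κ N Ψ t z) n := by
  have hc : ∀ j, Continuous fun t => noiseFlow κ N Ψ t z j := fun j =>
    (continuous_apply j).comp ((continuous_noiseFlow hΨ).comp
      (continuous_id.prodMk (continuous_const (y := z))))
  simp only [seriesCoeff, g]
  split_ifs
  · exact (hc _).div_const _
  · exact (Complex.continuous_conj.comp (hc _)).div_const _
  · exact continuous_const.div_const _

/-- Dominated convergence in `ℓ²`: the modes beyond `N` keep their modulus, so four times the square
of the initial one dominates, and the finitely many low modes are continuous. -/
lemma continuous_randomSeries_noiseFlow (hΨ : IsLowFlow κ lam φ N M Ψ) {z : ℕ → ℂ}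
    (hz : SeriesSummable s lam z) :
    Continuous fun t => randomSeries s lam (noiseFlow κ N Ψ t z) := by
  refine continuous_induced_rng.mpr (continuous_iff_continuousAt.mpr fun t₀ => ?_)
  set F : ℝ → lp (fun _ : ℤ => ℂ) 2 := fun t =>
    Sobolev.toEllTwo (randomSeries s lam (noiseFlow κ N Ψ t z)) with hF
  have hFn : ∀ t n, (F t n : ℂ) = ((|(n : ℝ)| ^ s : ℝ) : ℂ) * seriesCoeff lam (noiseFlow κ N Ψ t z) n :=
    fun t n => by rw [← coeff_randomSeries (hz.noiseFlow t)]; rfl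
  have hcont : ∀ n, Continuous fun t => (F t n : ℂ) := fun n => by
    simp only [hFn]
    exact continuous_const.mul (continuous_seriesCoeff_noiseFlow hΨ z n)
  change Tendsto F (𝓝 t₀) (𝓝 (F t₀))
  rw [tendsto_iff_norm_sub_tendsto_zero]
  have hsq : Tendsto (fun t => ‖F t - F t₀‖ ^ 2) (𝓝 t₀) (𝓝 0) := by
    have e : ∀ t, ‖F t - F t₀‖ ^ 2 = ∑' n, ‖(F t n : ℂ) - F t₀ n‖ ^ 2 := fun t => by
      have := lp.norm_rpow_eq_tsum (p := 2) (by norm_num) (F t - F t₀)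
      simpa using this
    simp only [e]
    have := tendsto_tsum_of_dominated_convergence (𝓕 := 𝓝 t₀)
      (f := fun t n => ‖(F t n : ℂ) - F t₀ n‖ ^ 2) (g := fun _ => 0)
      (bound := fun n : ℤ => if n ∈ Finset.Icc (-(N : ℤ)) N then 1
        else 4 * (|(n : ℝ)| ^ s * ‖seriesCoeff lam z n‖) ^ 2) ?_ ?_ ?_
    · simpa using this
    · refine Summable.congr_cofinite (hz.mul_left 4) ?_
      filter_upwards [(Finset.Icc (-(N : ℤ)) N).finite_toSet.compl_mem_cofinite] with n hn
      exact (if_neg hn).symm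
    · intro n
      have : Continuous fun t => ‖(F t n : ℂ) - F t₀ n‖ ^ 2 :=
        ((hcont n).sub continuous_const).norm.pow 2
      simpa using this.tendsto t₀
    · have hlow : ∀ᶠ t in 𝓝 t₀, ∀ n ∈ Finset.Icc (-(N : ℤ)) N, ‖(F t n : ℂ) - F t₀ n‖ ^ 2 < 1 := by
        refine (Finset.eventually_all _).mpr fun n _ => ?_
        have := ((hcont n).sub (continuous_const (y := (F t₀ n : ℂ)))).norm.pow 2
        exact this.tendsto t₀ |>.eventually_lt_const (by simp)
      filter_upwards [hlow] with t ht n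
      rw [Real.norm_of_nonneg (by positivity)]
      split_ifs with hn
      · exact (ht n hn).le
      · have hb : ∀ t, ‖(F t n : ℂ)‖ = |(n : ℝ)| ^ s * ‖seriesCoeff lam z n‖ := fun t => by
          rw [hFn, norm_mul, norm_seriesCoeff_noiseFlow t z hn, Complex.norm_real,
            Real.norm_of_nonneg (by positivity)]
        have h1 := norm_sub_le (F t n : ℂ) (F t₀ n)
        rw [hb, hb] at h1
        calc _ ≤ (2 * (|(n : ℝ)| ^ s * ‖seriesCoeff lam z n‖)) ^ 2 :=
              pow_le_pow_left₀ (norm_nonneg _) (by linarith) 2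
          _ = _ := by ring
  have := hsq.sqrt
  simpa [Real.sqrt_sq] using this

/-- Positive modes come from the low flow or from the explicit rotation; negative modes follow by
conjugation. -/
lemma isSolution_randomSeries {ε : ℝ} (hlam : 0 < lam) (hφ : IsProfile ε φ) (hN : 0 < N)
    (hΨ : IsLowFlow κ lam φ N M Ψ) {z : ℕ → ℂ} (hz : SeriesSummable s lam z)
    (hM : noiseMass lam N z ≤ M) :
    IsSolution κ φ N fun t => randomSeries s lam (noiseFlow κ N Ψ t z) where
  continuous := continuous_randomSeries_noiseFlow hΨ hz
  equation := by
    have hproj : ∀ t, (randomSeries s lam (noiseFlow κ N Ψ t z)).proj N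
        = lowSeries lam N (Ψ t ((Finset.Icc 1 N).restrict z)) := fun t => by
      rw [proj_randomSeries (hz.noiseFlow t), ← lowSeries_restrict, restrict_noiseFlow]
    have hpos : ∀ (n : ℤ) (t : ℝ), 0 < n → HasDerivAt
        (fun τ => (randomSeries s lam (noiseFlow κ N Ψ τ z)).coeff n)
        (-(hilbertSymbol κ n * (Complex.I * n) ^ 2
            * (randomSeries s lam (noiseFlow κ N Ψ t z)).coeff n)
          - (nonlinearity φ N (randomSeries s lam (noiseFlow κ N Ψ t z))).coeff n) t := by
      intro n t hn
      obtain ⟨j, rfl⟩ := Int.eq_ofNat_of_zero_le hn.le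
      have hc : ∀ t, (randomSeries s lam (noiseFlow κ N Ψ t z)).coeff (j : ℤ)
          = noiseFlow κ N Ψ t z j / modeScale lam j := fun t => by
        rw [coeff_randomSeries (hz.noiseFlow t), seriesCoeff_eq, g, if_pos hn, Int.natAbs_natCast]
      have hm := modeScale_ne_zero hlam hn.ne'
      by_cases hj : j ∈ Finset.Icc 1 N
      · have hcoef : (randomSeries s lam (noiseFlow κ N Ψ t z)).coeff (j : ℤ)
            = (lowSeries lam N (Ψ t ((Finset.Icc 1 N).restrict z))).coeff (j : ℤ) := by
          rw [← hproj, proj_randomSeries (hz.noiseFlow t), coeff_series, if_pos,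
            coeff_randomSeries (hz.noiseFlow t)]
          rw [Finset.mem_Icc] at *; omega
        have h1 := (hasDerivAt_pi.mp (hΨ.hasDerivAt _ hM t) ⟨j, hj⟩).div_const (modeScale lam j)
        simp only [hc, noiseFlow_of_mem _ _ _ hj]
        refine h1.congr_deriv ?_
        have hc' := hc t
        rw [noiseFlow_of_mem _ _ _ hj] at hc'
        rw [← hc', hcoef, coeff_nonlinearity, hproj, lowField, mul_div_cancel_left₀ _ hm,
          coeff_truncatedField]
      · have h0 : j ≠ 0 := by rintro rfl; simp at hn
        simp only [hc, noiseFlow_of_notMem _ _ _ hj]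
        have he : HasDerivAt (fun τ : ℝ => Complex.exp (-(Complex.I * κ * j ^ 2) * τ))
            (Complex.exp (-(Complex.I * κ * j ^ 2) * t) * -(Complex.I * κ * j ^ 2)) t := by
          have h1 : HasDerivAt (fun τ : ℝ => -(Complex.I * κ * (j : ℂ) ^ 2) * (τ : ℂ))
              (-(Complex.I * κ * (j : ℂ) ^ 2)) t := by
            simpa using (Complex.ofRealCLM.hasDerivAt (x := t)).const_mul
              (-(Complex.I * κ * (j : ℂ) ^ 2))
          exact h1.cexp
        refine ((he.mul_const (z j)).div_const _).congr_deriv ?_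
        rw [coeff_nonlinearity, profile_eq_zero hφ hN (notMem_Icc_of_natAbs hn.ne' (by simpa using hj)),
          Complex.ofReal_zero, zero_mul, sub_zero]
        linear_combination (-(Complex.exp (-(Complex.I * κ * j ^ 2) * t) * z j / modeScale lam j))
          * symbol_eq (κ := κ) h0
    intro n t
    rcases lt_trichotomy n 0 with h | rfl | h
    · have h1 := (Complex.conjCLE : ℂ →L[ℝ] ℂ).hasFDerivAt.comp_hasDerivAt t (hpos (-n) t (by omega))
      have e : ∀ τ, (randomSeries s lam (noiseFlow κ N Ψ τ z)).coeff n
          = conj ((randomSeries s lam (noiseFlow κ N Ψ τ z)).coeff (-n)) := fun τ => by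
        rw [Sobolev.coeff_neg, Complex.conj_conj]
      simp only [e]
      refine h1.congr_deriv ?_
      have hr : IsReal (nonlinearity φ N (randomSeries s lam (noiseFlow κ N Ψ t z))) := by
        have hl := (isReal_lowSeries lam (Ψ t ((Finset.Icc 1 N).restrict z))).smooth hφ.even N
        rw [nonlinearity, smooth_dx, hproj]
        exact (hl.mul (hl.multiplier fun n => by simp)).smooth hφ.even N
      have hr' := hr n
      simp only [ContinuousLinearEquiv.coe_coe, Complex.conjCLE_apply, map_sub, map_neg, map_mul,
        map_pow, Complex.conj_I, hilbertSymbol_neg, hr', Complex.conj_conj, Int.cast_neg,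
        map_intCast]
      rw [hilbertSymbol]
      simp
    · have hz0 : (nonlinearity φ N (randomSeries s lam (noiseFlow κ N Ψ t z))).coeff 0 = 0 := by
        rw [coeff_nonlinearity, ← mean_def, mean_mul_dx_self, mul_zero]
      simp only [Sobolev.coeff_zero, hz0, mul_zero, neg_zero, sub_zero]
      exact hasDerivAt_const _ _
    · exact hpos n t h

end Existence

section Flow

variable {ε : ℝ}

/-- Existence uses the low flow at the level `M` equal to the mass of the initial value itself. -/
lemma flow_spec (hlam : 0 < lam) (hφ : IsProfile ε φ) (hN : 0 < N) (u₀ : Sobolev s) :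
    IsSolution κ φ N (fun t => flow κ φ N t u₀) ∧ flow κ φ N 0 u₀ = u₀ := by
  have hex : ∃ u : ℝ → Sobolev s, IsSolution κ φ N u ∧ u 0 = u₀ := by
    obtain ⟨Ψ, hΨ⟩ := exists_isLowFlow κ hlam hφ hN (noiseMass lam N (coords lam u₀))
    refine ⟨_, isSolution_randomSeries hlam hφ hN hΨ (seriesSummable_coords hlam u₀) le_rfl, ?_⟩
    have : noiseFlow κ N Ψ 0 (coords lam u₀) = coords lam u₀ := by
      ext j
      by_cases hj : j ∈ Finset.Icc 1 N
      · rw [noiseFlow_of_mem _ _ _ hj, hΨ.zero, Finset.restrict]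
      · rw [noiseFlow_of_notMem _ _ _ hj]; simp
    rw [this, randomSeries_coords hlam]
  have e : ∀ t, flow κ φ N t u₀ = hex.choose t := fun t => by rw [flow, dif_pos hex]
  simp only [e]
  exact hex.choose_spec

variable {M : ℝ} {Ψ : ℝ → LowModes N → LowModes N}

lemma flow_eq (hlam : 0 < lam) (hφ : IsProfile ε φ) (hN : 0 < N) (hΨ : IsLowFlow κ lam φ N M Ψ)
    {u : Sobolev s} (hM : noiseMass lam N (coords lam u) ≤ M) (t : ℝ) :
    flow κ φ N t u = randomSeries s lam (noiseFlow κ N Ψ t (coords lam u)) := by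
  obtain ⟨h1, h2⟩ := flow_spec (κ := κ) hlam hφ hN u
  have := h1.coords_eq hlam hφ hN hΨ (by rw [h2]; exact hM) t
  rw [h2] at this
  rw [← this, randomSeries_coords hlam]

lemma noiseFlow_congr {z z' : ℕ → ℂ} (h : ∀ j, j ≠ 0 → z j = z' j) (t : ℝ) {j : ℕ} (hj : j ≠ 0) :
    noiseFlow κ N Ψ t z j = noiseFlow κ N Ψ t z' j := by
  have : (Finset.Icc 1 N).restrict z = (Finset.Icc 1 N).restrict z' := by
    ext i
    exact h _ (by have := (Finset.mem_Icc.mp i.2).1; omega)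
  rw [noiseFlow, noiseFlow, combine, combine, this, h j hj]

lemma noiseMass_coords_randomSeries (hlam : 0 < lam) {z : ℕ → ℂ} (hz : SeriesSummable s lam z) :
    noiseMass lam N (coords lam (randomSeries s lam z)) = noiseMass lam N z := by
  rw [noiseMass_eq, noiseMass_eq, ← proj_eq_series hlam, proj_randomSeries hz]

lemma flow_randomSeries (hlam : 0 < lam) (hφ : IsProfile ε φ) (hN : 0 < N)
    (hΨ : IsLowFlow κ lam φ N M Ψ) {z : ℕ → ℂ} (hz : SeriesSummable s lam z)
    (hM : noiseMass lam N z ≤ M) (t : ℝ) :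
    flow κ φ N t (randomSeries s lam z) = randomSeries s lam (noiseFlow κ N Ψ t z) := by
  rw [flow_eq hlam hφ hN hΨ (by rwa [noiseMass_coords_randomSeries hlam hz])]
  exact randomSeries_congr fun j hj =>
    noiseFlow_congr (fun i hi => coords_randomSeries hlam hz hi) t hj

lemma flow_neg_flow (hlam : 0 < lam) (hφ : IsProfile ε φ) (hN : 0 < N) (t : ℝ) (u : Sobolev s) :
    flow κ φ N (-t) (flow κ φ N t u) = u := by
  obtain ⟨Ψ, hΨ⟩ := exists_isLowFlow κ hlam hφ hN (noiseMass lam N (coords lam u))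
  have hz := seriesSummable_coords hlam u
  rw [flow_eq hlam hφ hN hΨ le_rfl, flow_randomSeries hlam hφ hN hΨ (hz.noiseFlow t)
    (noiseMass_noiseFlow hΨ t _).le, noiseFlow_neg_noiseFlow hΨ, randomSeries_coords hlam]

/-- The image under an invertible map is a preimage under the inverse, which gives measurability of
the image. -/
lemma image_flow_eq (hlam : 0 < lam) (hφ : IsProfile ε φ) (hN : 0 < N) (t : ℝ)
    (A : Set (Sobolev s)) : flow κ φ N t '' A = flow κ φ N (-t) ⁻¹' A := by
  refine congrFun (Set.image_eq_preimage_of_inverse (flow_neg_flow hlam hφ hN t) fun u => ?_) A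
  have := flow_neg_flow (κ := κ) hlam hφ hN (-t) u
  rwa [neg_neg] at this

lemma measurable_noiseMass : Measurable (noiseMass lam N) :=
  contDiff_lowMass.continuous.measurable.comp (Finset.measurable_restrict _)

/-- One low flow describes the evolution only up to a mass level. The levels `k ∈ ℕ` exhaust the
space, and on each of them the flow is given by a measurable formula. -/
lemma measurable_flow (hlam : 0 < lam) (hφ : IsProfile ε φ) (hN : 0 < N) (t : ℝ) :
    Measurable (flow κ φ N t : Sobolev s → Sobolev s) := by
  intro A hA
  choose Ψ hΨ using fun k : ℕ => exists_isLowFlow κ hlam hφ hN (k : ℝ)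
  have e : flow κ φ N t ⁻¹' A = ⋃ k : ℕ, {u : Sobolev s | noiseMass lam N (coords lam u) ≤ k} ∩
      (fun u => randomSeries s lam (noiseFlow κ N (Ψ k) t (coords lam u))) ⁻¹' A := by
    ext u
    simp only [Set.mem_preimage, Set.mem_iUnion, Set.mem_inter_iff, Set.mem_ofPred_eq]
    constructor
    · intro hu
      obtain ⟨k, hk⟩ := exists_nat_ge (noiseMass lam N (coords lam u))
      exact ⟨k, hk, by rwa [← flow_eq hlam hφ hN (hΨ k) hk]⟩
    · rintro ⟨k, hk, hu⟩
      rwa [flow_eq hlam hφ hN (hΨ k) hk]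
  rw [e]
  refine MeasurableSet.iUnion fun k => (measurableSet_le
    (measurable_noiseMass.comp (measurable_coords lam)) measurable_const).inter ?_
  exact (measurable_randomSeries.comp ((measurable_noiseFlow (hΨ k) t).comp
    (measurable_coords lam))) hA

end Flow

end

/-! ### Transport of the weighted measure along the flow -/

section

open TrigPoly Filter Topology Sobolev
open scoped ENNReal NNReal

variable {κ lam : ℝ} {φ : ℝ → ℝ} {N : ℕ} {s : ℝ} {M : ℝ} {Ψ : ℝ → LowModes N → LowModes N}

/-- The law of the noise without the Gaussian weight on the modes `1, …, N`, up to a constant. -/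
def flatNoise (N : ℕ) : Measure (ℕ → ℂ) :=
  noise.withDensity fun z => ENNReal.ofReal (Real.exp (noiseEnergy N z))

instance : SFinite (flatNoise N) := by unfold flatNoise; infer_instance

lemma measurable_exp_noiseEnergy : Measurable fun z => ENNReal.ofReal (Real.exp (noiseEnergy N z)) :=
  (Real.measurable_exp.comp (measurable_noiseEnergy N)).ennreal_ofReal

/-- The weight removes the Gaussian factor on the low modes, so the change of variables formula
holds without a density. -/
lemma measurePreserving_noiseFlow (hΨ : IsLowFlow κ lam φ N M Ψ) (t : ℝ) :
    MeasurePreserving (noiseFlow κ N Ψ t) (flatNoise N) (flatNoise N) := by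
  refine ⟨measurable_noiseFlow hΨ t, Measure.ext fun S hS => ?_⟩
  rw [Measure.map_apply (measurable_noiseFlow hΨ t) hS, flatNoise,
    withDensity_apply _ (measurable_noiseFlow hΨ t hS), withDensity_apply _ hS,
    ← lintegral_indicator hS, ← lintegral_indicator (measurable_noiseFlow hΨ t hS),
    ← lintegral_noiseFlow hΨ t (measurable_exp_noiseEnergy.indicator hS)]
  refine lintegral_congr fun z => ?_
  by_cases hz : noiseFlow κ N Ψ t z ∈ S
  · rw [Set.indicator_of_mem hz, Set.indicator_of_mem (by exact hz),
      ← ENNReal.ofReal_mul (Real.exp_nonneg _), ← Real.exp_add]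
    congr 2; ring
  · rw [Set.indicator_of_notMem hz, Set.indicator_of_notMem (by exact hz), zero_mul]

/-- Invariance of the flat measure moves the flow from the set to the integrand. The increment of
`ρ` along a trajectory is the time integral of `L`; Tonelli's theorem and invariance at every time
bound the total by `|t|` times the `L¹` norm of `L`. -/
lemma abs_setIntegral_sub_le (hΨ : IsLowFlow κ lam φ N M Ψ) {ρ L : (ℕ → ℂ) → ℝ}
    (hρm : Measurable ρ) (hLm : Measurable L) (hρ : Integrable ρ (flatNoise N))
    (hder : ∀ z t, HasDerivAt (fun τ => ρ (noiseFlow κ N Ψ τ z)) (L (noiseFlow κ N Ψ t z)) t)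
    (hcont : ∀ z, Continuous fun τ => L (noiseFlow κ N Ψ τ z))
    {A : Set (ℕ → ℂ)} (hA : MeasurableSet A) (t : ℝ) {B : ℝ} (hB : 0 ≤ B)
    (hLB : ∫⁻ z, ‖L z‖ₑ ∂flatNoise N ≤ ENNReal.ofReal B) :
    |(∫ z in A, ρ z ∂flatNoise N) - ∫ z in noiseFlow κ N Ψ (-t) ⁻¹' A, ρ z ∂flatNoise N|
      ≤ B * |t| := by
  have hT := measurePreserving_noiseFlow hΨ t
  have h1 : ∫ z in noiseFlow κ N Ψ (-t) ⁻¹' A, ρ z ∂flatNoise N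
      = ∫ z in A, ρ (noiseFlow κ N Ψ t z) ∂flatNoise N := by
    have := setIntegral_map (μ := flatNoise N) (g := noiseFlow κ N Ψ t) (f := ρ)
      (measurable_noiseFlow hΨ (-t) hA) (hρm.aestronglyMeasurable) hT.measurable.aemeasurable
    rw [hT.map_eq] at this
    rw [this]
    congr 2
    ext z
    simp only [Set.mem_preimage, noiseFlow_neg_noiseFlow hΨ]
  have hρT : Integrable (fun z => ρ (noiseFlow κ N Ψ t z)) (flatNoise N) :=
    hT.integrable_comp_of_integrable hρ
  rw [h1, ← integral_sub hρ.integrableOn hρT.integrableOn, ← Real.norm_eq_abs,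
    ← ENNReal.ofReal_le_ofReal_iff (by positivity), ofReal_norm]
  refine (enorm_integral_le_lintegral_enorm _).trans ?_
  refine (setLIntegral_le_lintegral _ _).trans ?_
  have hpt : ∀ z, ‖ρ z - ρ (noiseFlow κ N Ψ t z)‖ₑ
      ≤ ∫⁻ τ in Set.uIoc 0 t, ‖L (noiseFlow κ N Ψ τ z)‖ₑ := fun z => by
    have := intervalIntegral.integral_eq_sub_of_hasDerivAt (a := 0) (b := t)
      (fun τ _ => hder z τ) ((hcont z).intervalIntegrable _ _)
    have h0 : noiseFlow κ N Ψ 0 z = z := by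
      ext j
      by_cases hj : j ∈ Finset.Icc 1 N
      · rw [noiseFlow_of_mem _ _ _ hj, hΨ.zero, Finset.restrict]
      · rw [noiseFlow_of_notMem _ _ _ hj]; simp
    rw [h0] at this
    rw [← enorm_neg, neg_sub, ← this, ← ofReal_norm,
      intervalIntegral.norm_intervalIntegral_eq, ofReal_norm]
    exact enorm_integral_le_lintegral_enorm _
  refine (lintegral_mono hpt).trans ?_
  rw [lintegral_lintegral_swap]
  · have : ∀ τ, ∫⁻ z, ‖L (noiseFlow κ N Ψ τ z)‖ₑ ∂flatNoise N = ∫⁻ z, ‖L z‖ₑ ∂flatNoise N :=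
      fun τ => (measurePreserving_noiseFlow hΨ τ).lintegral_comp hLm.enorm
    simp only [this, lintegral_const, Measure.restrict_apply_univ]
    rw [Set.uIoc, Real.volume_Ioc, max_sub_min_eq_abs, sub_zero, ENNReal.ofReal_mul hB]
    gcongr
  · exact ((hLm.comp ((measurable_noiseFlow_uncurry hΨ).comp measurable_swap)).enorm).aemeasurable

lemma noiseEnergy_eq (hlam : 0 < lam) (z : ℕ → ℂ) :
    noiseEnergy N z = normSq lam (3 / 2) (series lam N z) := by
  rw [normSq_series hlam, Finset.range_eq_Ico, Finset.sum_Ico_add' (fun j => ‖z j‖ ^ 2) 0 N 1,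
    zero_add, Finset.Ico_add_one_right_eq_Icc]
  exact Finset.sum_coe_sort (Finset.Icc 1 N) fun j => ‖z j‖ ^ 2

/-- Integrals over the Gaussian measure of a function of the low modes. -/
lemma setIntegral_gaussianMeasure (hlam : 0 < lam) (hs : s < 1) {ρ : TrigPoly → ℝ}
    {f : Sobolev s → ℝ} (hfm : Measurable f)
    (hf : ∀ u, f u = ρ (u.proj N) * Real.exp (normSq lam (3 / 2) (u.proj N)))
    {B : Set (Sobolev s)} (hB : MeasurableSet B) :
    ∫ u in B, f u ∂gaussianMeasure s lam
      = ∫ z in randomSeries s lam ⁻¹' B, ρ (series lam N z) ∂flatNoise N := by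
  rw [gaussianMeasure, setIntegral_map hB hfm.aestronglyMeasurable
    measurable_randomSeries.aemeasurable, flatNoise,
    setIntegral_withDensity_eq_setIntegral_toReal_smul measurable_exp_noiseEnergy
      (ae_of_all _ fun _ => ENNReal.ofReal_lt_top) _ (measurable_randomSeries hB)]
  refine integral_congr_ae (ae_restrict_of_ae ?_)
  filter_upwards [ae_seriesSummable hlam hs] with z hz
  rw [hf, proj_randomSeries hz, noiseEnergy_eq hlam, ENNReal.toReal_ofReal (Real.exp_nonneg _),
    smul_eq_mul, mul_comm]

/-- The low flow of level `M` agrees with the true flow for mass at most `M`. As `ρ` and `L` vanish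
above this level and the mass is conserved, the discrepancy elsewhere is invisible. -/
lemma abs_setIntegral_flow_sub_le {ε : ℝ} (hlam : 0 < lam) (hs : s < 1) (hφ : IsProfile ε φ)
    (hN : 0 < N) {ρ L : TrigPoly → ℝ}
    (hρm : Measurable fun z => ρ (series lam N z)) (hLm : Measurable fun z => L (series lam N z))
    (hρ : Integrable (fun z => ρ (series lam N z)) (flatNoise N))
    (hρM : ∀ p, M < normSq lam 0 p → ρ p = 0) (hLM : ∀ p, M < normSq lam 0 p → L p = 0)
    (hder : ∀ u : ℝ → TrigPoly, (∀ τ, IsReal (u τ)) →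
      (∀ τ, HasCoeffDeriv u (truncatedField κ φ N (u τ)) τ) →
      ∀ t, HasDerivAt (fun τ => ρ (u τ)) (L (u t)) t ∧ ContinuousAt (fun τ => L (u τ)) t)
    {f : Sobolev s → ℝ} (hfm : Measurable f)
    (hf : ∀ u, f u = ρ (u.proj N) * Real.exp (normSq lam (3 / 2) (u.proj N)))
    {A : Set (Sobolev s)} (hA : MeasurableSet A) (t : ℝ) {B : ℝ} (hB : 0 ≤ B)
    (hLB : ∫⁻ z, ‖L (series lam N z)‖ₑ ∂flatNoise N ≤ ENNReal.ofReal B) :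
    |(∫ u in A, f u ∂gaussianMeasure s lam)
      - ∫ u in flow κ φ N t '' A, f u ∂gaussianMeasure s lam| ≤ B * |t| := by
  obtain ⟨Ψ, hΨ⟩ := exists_isLowFlow κ hlam hφ hN M
  have hA' : MeasurableSet (randomSeries s lam ⁻¹' A) := measurable_randomSeries hA
  have hflow : MeasurableSet (flow κ φ N (-t) ⁻¹' A) := measurable_flow hlam hφ hN (-t) hA
  rw [image_flow_eq hlam hφ hN, setIntegral_gaussianMeasure hlam hs hfm hf hA,
    setIntegral_gaussianMeasure hlam hs hfm hf hflow]
  have hlow : ∀ z τ, series lam N (noiseFlow κ N Ψ τ z)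
      = lowSeries lam N (Ψ τ ((Finset.Icc 1 N).restrict z)) := fun z τ => by
    rw [← lowSeries_restrict, restrict_noiseFlow]
  -- The two sets may differ where the mass exceeds `M`, but `ρ` is zero there.
  have key : ∫ z in randomSeries s lam ⁻¹' (flow κ φ N (-t) ⁻¹' A), ρ (series lam N z) ∂flatNoise N
      = ∫ z in noiseFlow κ N Ψ (-t) ⁻¹' (randomSeries s lam ⁻¹' A),
          ρ (series lam N z) ∂flatNoise N := by
    rw [← integral_indicator (measurable_randomSeries hflow),
      ← integral_indicator (measurable_noiseFlow hΨ (-t) hA')]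
    refine integral_congr_ae ?_
    have hae : ∀ᵐ z ∂flatNoise N, SeriesSummable s lam z :=
      (withDensity_absolutelyContinuous _ _).ae_le (ae_seriesSummable hlam hs)
    filter_upwards [hae] with z hz
    rcases le_or_gt (noiseMass lam N z) M with h | h
    · have : flow κ φ N (-t) (randomSeries s lam z)
          = randomSeries s lam (noiseFlow κ N Ψ (-t) z) := flow_randomSeries hlam hφ hN hΨ hz h (-t)
      have hiff : z ∈ randomSeries s lam ⁻¹' (flow κ φ N (-t) ⁻¹' A)
          ↔ z ∈ noiseFlow κ N Ψ (-t) ⁻¹' (randomSeries s lam ⁻¹' A) := by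
        change flow κ φ N (-t) (randomSeries s lam z) ∈ A ↔ _
        rw [this]; rfl
      by_cases hz' : z ∈ randomSeries s lam ⁻¹' (flow κ φ N (-t) ⁻¹' A)
      · rw [Set.indicator_of_mem hz', Set.indicator_of_mem (hiff.mp hz')]
      · rw [Set.indicator_of_notMem hz', Set.indicator_of_notMem (mt hiff.mpr hz')]
    · rw [noiseMass_eq] at h
      simp only [Set.indicator, hρM _ h, ite_self]
  rw [key]
  have hdc : ∀ z t, HasDerivAt (fun τ => ρ (series lam N (noiseFlow κ N Ψ τ z)))
      (L (series lam N (noiseFlow κ N Ψ t z))) t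
      ∧ ContinuousAt (fun τ => L (series lam N (noiseFlow κ N Ψ τ z))) t := fun z t => by
    simp only [hlow]
    rcases le_or_gt (lowMass lam N ((Finset.Icc 1 N).restrict z)) M with h | h
    · exact hder _ (fun τ => isReal_lowSeries _ _)
        (fun τ => hasCoeffDeriv_of_lowField hlam hφ hN (hΨ.hasDerivAt _ h τ)) t
    · have hm : ∀ τ, M < normSq lam 0 (lowSeries lam N (Ψ τ ((Finset.Icc 1 N).restrict z))) :=
        fun τ => by rw [← hΨ.mass τ] at h; exact h
      simp only [hρM _ (hm _), hLM _ (hm _)]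
      exact ⟨hasDerivAt_const _ _, continuousAt_const⟩
  exact abs_setIntegral_sub_le hΨ hρm hLm hρ (fun z t => (hdc z t).1)
    (fun z => continuous_iff_continuousAt.mpr fun t => (hdc z t).2) hA' t hB hLB

end

/-! ### The density and its derivative along the flow -/

section

open TrigPoly Filter Topology

variable {κ lam : ℝ} {χ φ : ℝ → ℝ} {R : ℝ} {N : ℕ} {s : ℝ}

namespace TrigPoly

/-- The product of the first two cutoffs, which is constant along the truncated flow. -/
def cutoffs (κ lam : ℝ) (χ φ : ℝ → ℝ) (R : ℝ) (N : ℕ) (p : TrigPoly) : ℝ :=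
  χ (√(normSq lam 0 p) / R) * χ (hamiltonian κ lam φ N p / R)

/-- The argument of the third cutoff. -/
def cutoffArg (κ lam : ℝ) (φ : ℝ → ℝ) (R : ℝ) (N : ℕ) (p : TrigPoly) : ℝ :=
  (modifiedOne κ lam φ N p - ∑ n ∈ Finset.Icc 1 N, 1 / (n : ℝ)) / R

/-- The density with respect to the formal Lebesgue measure. -/
def weight (κ lam : ℝ) (χ φ : ℝ → ℝ) (R : ℝ) (N : ℕ) (p : TrigPoly) : ℝ :=
  cutoffs κ lam χ φ R N p *
    (χ (cutoffArg κ lam φ R N p) * Real.exp (-modifiedThreeHalves κ lam φ N p))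

/-- The derivative of the modified `H¹` energy along the truncated flow. -/
def rateOne (κ lam : ℝ) (φ : ℝ → ℝ) (N : ℕ) (p : TrigPoly) : ℝ :=
  2 * Real.pi * lam * (defectOne κ (smooth φ N p) (removedPart φ N (smooth φ N p))).re

/-- The derivative of the modified `H^{3/2}` energy along the truncated flow. -/
def rateThreeHalves (κ lam : ℝ) (φ : ℝ → ℝ) (N : ℕ) (p : TrigPoly) : ℝ :=
  2 * Real.pi * lam * (κ * (defectQuartic κ (smooth φ N p) (removedPart φ N (smooth φ N p))
    + defectHigher κ (smooth φ N p) (removedPart φ N (smooth φ N p))).re)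

/-- The derivative of `weight` along the truncated flow. -/
def weightRate (κ lam : ℝ) (χ φ : ℝ → ℝ) (R : ℝ) (N : ℕ) (p : TrigPoly) : ℝ :=
  cutoffs κ lam χ φ R N p *
    ((deriv χ (cutoffArg κ lam φ R N p) * (rateOne κ lam φ N p / R)
      - χ (cutoffArg κ lam φ R N p) * rateThreeHalves κ lam φ N p)
        * Real.exp (-modifiedThreeHalves κ lam φ N p))

/-- The exponent of the density is minus the modified energy plus `‖π_N u‖²_{Ḣ^{3/2}}`; the latter
exactly compensates the Gaussian weight. -/
lemma density_eq (u : Sobolev s) : density κ lam χ φ R N u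
    = weight κ lam χ φ R N (u.proj N) * Real.exp (normSq lam (3 / 2) (u.proj N)) := by
  have he : Real.exp (-modifiedThreeHalves κ lam φ N (u.proj N))
        * Real.exp (normSq lam (3 / 2) (u.proj N))
      = Real.exp (normSq lam (3 / 2) (smooth φ N (u.proj N))
        - energyThreeHalves κ lam (smooth φ N (u.proj N))) := by
    rw [← Real.exp_add, modifiedThreeHalves]
    congr 1; ring
  rw [weight, mul_assoc, mul_assoc, he, ← mul_assoc]
  rfl

lemma HasCoeffDeriv.sub {p q : ℝ → TrigPoly} {p' q' : TrigPoly} {t : ℝ}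
    (hp : HasCoeffDeriv p p' t) (hq : HasCoeffDeriv q q' t) :
    HasCoeffDeriv (fun τ => p τ - q τ) (p' - q') t where
  bounded := by
    obtain ⟨S, hS⟩ := hp.bounded
    obtain ⟨S', hS'⟩ := hq.bounded
    refine ⟨S ∪ S', fun τ n hn => ?_⟩
    by_contra h
    rw [Finset.mem_union, not_or] at h
    have h1 := Finsupp.notMem_support_iff.mp fun h' => h.1 (hS τ h')
    have h2 := Finsupp.notMem_support_iff.mp fun h' => h.2 (hS' τ h')
    simp [h1, h2] at hn
  hasDerivAt n := by
    simp only [AddMonoidAlgebra.coeff_sub, Finsupp.sub_apply]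
    exact (hp.hasDerivAt n).sub (hq.hasDerivAt n)

section Flow

variable {u : ℝ → TrigPoly}

lemma continuousAt_rates {u' : TrigPoly} {t : ℝ} (hu : HasCoeffDeriv u u' t) :
    ContinuousAt (fun τ => rateOne κ lam φ N (u τ)) t
      ∧ ContinuousAt (fun τ => rateThreeHalves κ lam φ N (u τ)) t := by
  have hv := hu.smooth (φ := φ) (N := N)
  have hx := hv.dx
  have hh := hx.hilbert (κ := κ)
  have hb := hv.mul hx
  have hw : HasCoeffDeriv (fun τ => removedPart φ N (smooth φ N (u τ))) _ t :=
    hb.sub ((hb.smooth (φ := φ) (N := N)).smooth (φ := φ) (N := N))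
  have c : ∀ {p : ℝ → TrigPoly} {p' : TrigPoly}, HasCoeffDeriv p p' t →
      ContinuousAt (fun τ => mean (removedPart φ N (smooth φ N (u τ)) * p τ)) t :=
    fun hp => (hw.mul hp).mean.continuousAt
  have hbh := hb.hilbert (κ := κ)
  have h1 := c (hv.mul hh)
  have h2 := c hbh
  have h3 := c ((hv.mul hv).mul hv)
  have q1 := c (hx.mul hx)
  have q2 := c (hh.mul hh)
  have q3 := c hb.dx
  have q4 := c ((hv.mul hh).hilbert (κ := κ)).dx
  have r1 := c ((hv.mul hv).mul hh)
  have r2 := c (((hv.mul hv).mul hx).hilbert (κ := κ))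
  have r3 := c (hv.mul hbh)
  have r4 := c ((hv.mul hv).mul (hv.mul hv))
  have re : ∀ {f : ℝ → ℂ}, ContinuousAt f t → ContinuousAt (fun τ => (f τ).re) t :=
    fun hf => Complex.continuous_re.continuousAt.comp hf
  have k : ∀ {f : ℝ → ℂ} (a : ℂ), ContinuousAt f t → ContinuousAt (fun τ => a * f τ) t :=
    fun a hf => continuousAt_const.mul hf
  exact ⟨continuousAt_const.mul (re ((k (3 / 2) (h1.add h2)).add (k (1 / 2) h3))),
    continuousAt_const.mul (continuousAt_const.mul
      (re (((((k (3 / 2) q1).add (k (1 / 2) q2)).sub (k 3 q3)).add q4).add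
        (((r1.add r2).add r3).add (k (1 / 4) r4)))))⟩

lemma cutoffs_eq (hκ : κ = 1 ∨ κ = -1) (hφ : ∀ x, φ x = φ |x|) (hr : ∀ τ, IsReal (u τ))
    (hu : ∀ τ, HasCoeffDeriv u (truncatedField κ φ N (u τ)) τ) (t : ℝ) :
    cutoffs κ lam χ φ R N (u t) = cutoffs κ lam χ φ R N (u 0) := by
  have hc : ∀ {f : ℝ → ℝ}, (∀ τ, HasDerivAt f 0 τ) → f t = f 0 := fun hf =>
    is_const_of_deriv_eq_zero (fun τ => (hf τ).differentiableAt) (fun τ => (hf τ).deriv) t 0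
  rw [cutoffs, cutoffs, hc fun τ => (hu τ).hasDerivAt_mass (lam := lam) hφ hr,
    hc fun τ => (hu τ).hasDerivAt_hamiltonian (lam := lam) hκ hφ hr]

/-- The cutoffs in mass and Hamiltonian are constants of motion, so only the third cutoff and the
exponential are differentiated. -/
lemma hasDerivAt_weight (hκ : κ = 1 ∨ κ = -1) (hφ : ∀ x, φ x = φ |x|) (hχ : ContDiff ℝ ∞ χ)
    (hr : ∀ τ, IsReal (u τ))
    (hu : ∀ τ, HasCoeffDeriv u (truncatedField κ φ N (u τ)) τ) (t : ℝ) :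
    HasDerivAt (fun τ => weight κ lam χ φ R N (u τ)) (weightRate κ lam χ φ R N (u t)) t
      ∧ ContinuousAt (fun τ => weightRate κ lam χ φ R N (u τ)) t := by
  have h1 : HasDerivAt (fun τ => modifiedOne κ lam φ N (u τ)) (rateOne κ lam φ N (u t)) t :=
    (hu t).hasDerivAt_modifiedOne hκ hφ hr
  have h2 : HasDerivAt (fun τ => modifiedThreeHalves κ lam φ N (u τ))
      (rateThreeHalves κ lam φ N (u t)) t := (hu t).hasDerivAt_modifiedThreeHalves hκ hφ hr
  have ha : HasDerivAt (fun τ => cutoffArg κ lam φ R N (u τ)) (rateOne κ lam φ N (u t) / R) t :=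
    (h1.sub_const _).div_const R
  have hχa : HasDerivAt (fun τ => χ (cutoffArg κ lam φ R N (u τ)))
      (deriv χ (cutoffArg κ lam φ R N (u t)) * (rateOne κ lam φ N (u t) / R)) t :=
    ((hχ.differentiable (by simp)) _).hasDerivAt.comp t ha
  obtain ⟨c1, c2⟩ := continuousAt_rates (κ := κ) (lam := lam) (φ := φ) (N := N) (hu t)
  constructor
  · simp only [weight, weightRate, cutoffs_eq hκ hφ hr hu]
    refine ((hχa.mul h2.neg.exp).const_mul _).congr_deriv ?_
    simp only [Pi.neg_apply]
    ring
  · simp only [weightRate, cutoffs_eq hκ hφ hr hu]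
    have hd : ContinuousAt (fun τ => deriv χ (cutoffArg κ lam φ R N (u τ))) t :=
      (hχ.continuous_deriv (by simp)).continuousAt.comp ha.continuousAt
    exact continuousAt_const.mul (((hd.mul (c1.div_const R)).sub (hχa.continuousAt.mul c2)).mul
      (Real.continuous_exp.continuousAt.comp h2.continuousAt.neg))

end Flow

end TrigPoly

end

/-! ### Bounds on the support of the cutoffs -/

section

open TrigPoly

variable {κ lam : ℝ} {χ φ : ℝ → ℝ} {R : ℝ} {N : ℕ} {s : ℝ}

namespace TrigPoly

lemma norm_coeff_mul_le (p q : TrigPoly) (n : ℤ) : ‖(p * q).coeff n‖ ≤ sob 0 p * sob 0 q := by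
  have h : (p * q).coeff n = mean (AddMonoidAlgebra.single (-n) 1 * p * q) := by
    rw [mul_assoc, mean_def, coeff_single_mul]; simp
  rw [h]
  refine (norm_mean_mul_le_zero _ _).trans (mul_le_mul_of_nonneg_right ?_ (sob_nonneg _ _))
  simpa using sob_single_mul (-n) 1 p

/-- Duality between weighted `ℓ¹` and `ℓ^∞` norms of the coefficients. -/
lemma norm_mean_mul_le_wie {s B : ℝ} {p q : TrigPoly} (hp : p.coeff 0 = 0)
    (hq : ∀ n : ℤ, |(n : ℝ)| ^ s * ‖q.coeff n‖ ≤ B) : ‖mean (p * q)‖ ≤ wie (-s) p * B := by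
  rw [mean_mul subset_rfl, wie, Finset.sum_mul]
  refine (norm_sum_le _ _).trans (Finset.sum_le_sum fun k _ => ?_)
  rcases eq_or_ne k 0 with rfl | hk
  · simp [hp]
  have hk' : 0 < |(k : ℝ)| := by positivity
  have h1 : |(k : ℝ)| ^ (-s) * |(k : ℝ)| ^ s = 1 := by
    rw [← Real.rpow_add hk']; simp
  have h2 := hq (-k)
  rw [Int.cast_neg, abs_neg] at h2
  calc ‖p.coeff k * q.coeff (-k)‖
      = |(k : ℝ)| ^ (-s) * ‖p.coeff k‖ * (|(k : ℝ)| ^ s * ‖q.coeff (-k)‖) := by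
        rw [norm_mul]; linear_combination (-‖p.coeff k‖ * ‖q.coeff (-k)‖) * h1
    _ ≤ _ := by gcongr

/-- Half a derivative falls on `v²`, whose coefficients are bounded by Cauchy–Schwarz; the remaining
factor has a Wiener norm of order `-1/2`, controlled by `H^{1/4}` because `2 (-1/2 - 1/4) < -1`. -/
lemma norm_mean_cube_le : ∃ C : ℝ, 0 ≤ C ∧ ∀ v : TrigPoly, v.coeff 0 = 0 →
    ‖mean (v * (v * v))‖ ≤ C * sob (1 / 4) v * (sob (1 / 2) v * sob 0 v) := by
  refine ⟨2 * √(∑' n : ℤ, |(n : ℝ)| ^ (2 * (-(1 / 2) - 1 / 4 : ℝ))), by positivity, fun v hv => ?_⟩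
  have h1 := wie_le_sob (s := -(1 / 2)) (t := 1 / 4) (by norm_num) hv
  have h2 : ∀ n : ℤ, |(n : ℝ)| ^ (1 / 2 : ℝ) * ‖(v * v).coeff n‖ ≤ 2 * (sob (1 / 2) v * sob 0 v) := by
    intro n
    refine (leibniz_coeff (by norm_num) (by norm_num) v v n).trans ?_
    rw [AddMonoidAlgebra.coeff_add, Finsupp.add_apply]
    refine (norm_add_le _ _).trans ?_
    have a := norm_coeff_mul_le (majorant (1 / 2) v) (majorant 0 v) n
    have b := norm_coeff_mul_le (majorant 0 v) (majorant (1 / 2) v) n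
    simp only [sob_majorant] at a b
    linarith
  refine (norm_mean_mul_le_wie hv h2).trans ?_
  have := sob_nonneg (1 / 2) v
  have := sob_nonneg 0 v
  calc _ ≤ √(∑' n : ℤ, |(n : ℝ)| ^ (2 * (-(1 / 2) - 1 / 4 : ℝ))) * sob (1 / 4) v
        * (2 * (sob (1 / 2) v * sob 0 v)) := by gcongr
    _ = _ := by ring

/-- The Hamiltonian and the mass control the `H^{1/2}` norm. -/
lemma sob_half_le_of_hamiltonian (hκ : κ = 1 ∨ κ = -1) (hlam : 0 < lam) {a b : ℝ} (ha : 0 ≤ a) :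
    ∃ C : ℝ, 0 ≤ C ∧ ∀ (φ : ℝ → ℝ) (_ : ∀ x, |φ x| ≤ 1) (N : ℕ) (p : TrigPoly)
      (_ : p.coeff 0 = 0) (_ : sob 0 p ≤ a) (_ : |hamiltonian κ lam φ N p| ≤ b),
      sob (1 / 2) p ≤ C := by
  obtain ⟨C, hC, h⟩ := norm_mean_cube_le
  refine ⟨√(b / (Real.pi * lam) + 2 * ((C * a) ^ 4 * a ^ 2)), by positivity,
    fun φ hφ N p hp h0 hH => ?_⟩
  set X := sob (1 / 2) p with hX
  have hXn : 0 ≤ X := sob_nonneg _ _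
  set v := smooth φ N p with hv
  have hv0 : v.coeff 0 = 0 := by simp [hv, hp]
  have hs : ∀ s, sob s v ≤ sob s p := fun s => sob_smooth_le hφ N s p
  set T := sob (1 / 4) p
  have hTn : 0 ≤ T := sob_nonneg _ _
  -- By interpolation the cubic term has order `X^{3/2}`, so the quadratic part of the Hamiltonian
  -- absorbs it whatever its sign.
  have hT : T ^ 2 ≤ a * X := by
    have := sob_sq_le_mul 0 (1 / 2) hp
    rw [show ((0 : ℝ) + 1 / 2) / 2 = 1 / 4 by norm_num] at this
    exact this.trans (mul_le_mul_of_nonneg_right h0 hXn)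
  have hcube : ‖mean (v * (v * v))‖ ≤ C * T * (X * a) :=
    (h v hv0).trans (mul_le_mul (mul_le_mul_of_nonneg_left (hs _) hC)
      (mul_le_mul (hs _) ((hs _).trans h0) (sob_nonneg _ _) hXn)
      (mul_nonneg (sob_nonneg _ _) (sob_nonneg _ _)) (by positivity))
  have hre : |(mean (v * (v * v))).re| ≤ C * T * (X * a) := (Complex.abs_re_le_norm _).trans hcube
  rw [hamiltonian, normSq_eq_sob, integral_eq_mean, ← hv, ← hX,
    show v ^ 3 = v * (v * v) by ring] at hH
  have hκ' : |κ| = 1 := by rcases hκ with rfl | rfl <;> simp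
  have hπ := Real.pi_pos
  have hκre : |κ * (mean (v * (v * v))).re| ≤ C * T * (X * a) := by rwa [abs_mul, hκ', one_mul]
  have h1 := (abs_le.mp hH).2
  have h2 := (abs_le.mp hκre).1
  have hpl : 0 < Real.pi * lam := by positivity
  have h3 : X ^ 2 ≤ b / (2 * (Real.pi * lam)) + C * a * X * T := by
    have e : X ^ 2 = 2 * Real.pi * lam * X ^ 2 / (2 * (Real.pi * lam)) := by field_simp
    rw [e, div_add' _ _ _ (by positivity)]
    gcongr
    have : 0 ≤ C * T * (X * a) := by positivity
    nlinarith [mul_nonneg hpl.le (by linarith : 0 ≤ κ * (mean (v * (v * v))).re + C * T * (X * a)),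
      mul_nonneg hpl.le this]
  refine Real.le_sqrt_of_sq_le ?_
  have h4 : C * a * X * T ≤ X ^ 2 / 2 + (C * a) ^ 4 * a ^ 2 := by
    have i1 : C * a * X * T ≤ X ^ 2 / 4 + (C * a) ^ 2 * T ^ 2 := by
      nlinarith [sq_nonneg (X / 2 - C * a * T)]
    have i2 : (C * a) ^ 2 * T ^ 2 ≤ (C * a) ^ 2 * (a * X) := by gcongr
    nlinarith [sq_nonneg (X / 2 - (C * a) ^ 2 * a)]
  have e : b / (2 * (Real.pi * lam)) = b / (Real.pi * lam) / 2 := by rw [div_div]; ring_nf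
  rw [e] at h3
  linarith

lemma _root_.BenjaminOno.IsCutoff.exists_bounds (hχ : IsCutoff χ) : ∃ K : ℝ, 0 ≤ K ∧
    (∀ x, K < |x| → χ x = 0) ∧ (∀ x, |χ x| ≤ K) ∧ ∀ x, |deriv χ x| ≤ K := by
  obtain ⟨r, hr⟩ := hχ.hasCompactSupport.isCompact.isBounded.subset_closedBall 0
  obtain ⟨B, hB⟩ := hχ.hasCompactSupport.exists_bound_of_continuous hχ.smooth.continuous
  obtain ⟨B', hB'⟩ := hχ.hasCompactSupport.deriv.exists_bound_of_continuous
    (hχ.smooth.continuous_deriv (by simp))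
  refine ⟨max (max r B) B', ?_, fun x hx => ?_, fun x => ?_, fun x => ?_⟩
  · exact le_max_of_le_right ((norm_nonneg _).trans (hB' 0))
  · refine image_eq_zero_of_notMem_tsupport fun h => ?_
    have := hr h
    rw [mem_closedBall_zero_iff, Real.norm_eq_abs] at this
    exact absurd ((this.trans (le_max_left _ _)).trans (le_max_left _ _)) hx.not_ge
  · exact (hB x).trans ((le_max_right _ _).trans (le_max_left _ _))
  · exact (hB' x).trans (le_max_right _ _)

/-- On the support of the cutoffs the `H^{1/2}` norm is bounded. -/
lemma exists_sob_le_of_cutoffs_ne_zero (hκ : κ = 1 ∨ κ = -1) (hlam : 0 < lam) (hR : 0 < R)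
    {K : ℝ} (hK : 0 ≤ K) (hχ : ∀ x, K < |x| → χ x = 0) :
    ∃ C : ℝ, 0 ≤ C ∧ ∀ (φ : ℝ → ℝ) (_ : ∀ x, |φ x| ≤ 1) (N : ℕ) (p : TrigPoly)
      (_ : p.coeff 0 = 0) (_ : cutoffs κ lam χ φ R N p ≠ 0), sob 0 p ≤ C ∧ sob (1 / 2) p ≤ C := by
  have hπ := Real.pi_pos
  set a := R * K / √(2 * Real.pi * lam) with ha
  obtain ⟨C, hC, h⟩ := sob_half_le_of_hamiltonian hκ hlam (a := a) (b := R * K) (by positivity)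
  refine ⟨max a C, le_max_of_le_right hC, fun φ hφ N p hp hne => ?_⟩
  have h1 : |√(normSq lam 0 p) / R| ≤ K := by
    by_contra hlt
    exact hne (by rw [cutoffs, hχ _ (not_le.mp hlt), zero_mul])
  have h2 : |hamiltonian κ lam φ N p / R| ≤ K := by
    by_contra hlt
    exact hne (by rw [cutoffs, hχ _ (not_le.mp hlt), mul_zero])
  rw [abs_div, abs_of_pos hR, div_le_iff₀ hR, mul_comm] at h1 h2
  rw [abs_of_nonneg (Real.sqrt_nonneg _), normSq_eq_sob, Real.sqrt_mul (by positivity),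
    Real.sqrt_sq (sob_nonneg _ _)] at h1
  have h0 : sob 0 p ≤ a := by
    rw [ha, le_div_iff₀ (by positivity), mul_comm]; exact h1
  exact ⟨h0.trans (le_max_left _ _), (h φ hφ N p hp h0 h2).trans (le_max_right _ _)⟩

lemma normSq_le_of_cutoffs_ne_zero (hR : 0 < R) {K : ℝ} (hχ : ∀ x, K < |x| → χ x = 0)
    {p : TrigPoly} (hp : (R * K) ^ 2 < normSq lam 0 p) : cutoffs κ lam χ φ R N p = 0 := by
  rw [cutoffs, hχ, zero_mul]
  rw [abs_div, abs_of_pos hR, lt_div_iff₀ hR, mul_comm, abs_of_nonneg (Real.sqrt_nonneg _)]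
  exact Real.lt_sqrt_of_sq_lt hp

end TrigPoly

end

/-! ### Total variation of the weight along the flow -/

section

open TrigPoly Filter Topology
open scoped ENNReal

variable {κ lam : ℝ} {χ φ : ℝ → ℝ} {R : ℝ} {N : ℕ} {s : ℝ}

namespace TrigPoly

/-- The sum of the squares of the defects. -/
def defectSq (κ : ℝ) (φ : ℝ → ℝ) (N : ℕ) (p : TrigPoly) : ℝ :=
  ‖defectOne κ (smooth φ N p) (removedPart φ N (smooth φ N p))‖ ^ 2
    + ‖defectQuartic κ (smooth φ N p) (removedPart φ N (smooth φ N p))‖ ^ 2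
    + ‖defectHigher κ (smooth φ N p) (removedPart φ N (smooth φ N p))‖ ^ 2

/-- The difference between the `H^{3/2}` energy and its quadratic part. -/
def remainder (κ lam : ℝ) (φ : ℝ → ℝ) (N : ℕ) (p : TrigPoly) : ℝ :=
  energyThreeHalves κ lam (smooth φ N p) - normSq lam (3 / 2) (smooth φ N p)

lemma exp_neg_modified_mul (p : TrigPoly) :
    Real.exp (-modifiedThreeHalves κ lam φ N p) * Real.exp (normSq lam (3 / 2) p)
      = Real.exp (-remainder κ lam φ N p) := by
  rw [← Real.exp_add, modifiedThreeHalves, remainder]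
  congr 1; ring

lemma abs_weight_mul_le {K : ℝ} (hK : ∀ x, |χ x| ≤ K) (p : TrigPoly) :
    |weight κ lam χ φ R N p| * Real.exp (normSq lam (3 / 2) p)
      ≤ K ^ 3 * Real.exp (-remainder κ lam φ N p) := by
  have hK0 : 0 ≤ K := (abs_nonneg _).trans (hK 0)
  rw [← exp_neg_modified_mul, weight, cutoffs]
  simp only [abs_mul, Real.abs_exp]
  rw [← mul_assoc, ← mul_assoc]
  gcongr
  calc _ ≤ K * K * K := by gcongr <;> exact hK _
    _ = K ^ 3 := by ring

/-- Young's inequality separates the exponential factor, whose square is integrable uniformly in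
`N`, from the defects, which are small in `L²`. No correlation between the two has to be understood.
-/
lemma abs_weightRate_mul_le (hκ : κ = 1 ∨ κ = -1) (hlam : 0 < lam) (hR : 0 < R) {K : ℝ}
    (hK : ∀ x, |χ x| ≤ K) (hK' : ∀ x, |deriv χ x| ≤ K) {η : ℝ} (hη : 0 < η) (p : TrigPoly) :
    |weightRate κ lam χ φ R N p| * Real.exp (normSq lam (3 / 2) p)
      ≤ η * Real.exp (-2 * remainder κ lam φ N p)
        + (K ^ 3 * (2 * Real.pi * lam) * (1 / R + 1)) ^ 2 / η * defectSq κ φ N p := by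
  have hK0 : 0 ≤ K := (abs_nonneg _).trans (hK 0)
  have hπ := Real.pi_pos
  have hκ' : |κ| = 1 := by rcases hκ with rfl | rfl <;> simp
  set d₁ := ‖defectOne κ (smooth φ N p) (removedPart φ N (smooth φ N p))‖ with hd₁
  set d₂ := ‖defectQuartic κ (smooth φ N p) (removedPart φ N (smooth φ N p))‖ with hd₂
  set d₃ := ‖defectHigher κ (smooth φ N p) (removedPart φ N (smooth φ N p))‖ with hd₃
  have hd₁0 : 0 ≤ d₁ := norm_nonneg _
  have hd₂0 : 0 ≤ d₂ := norm_nonneg _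
  have hd₃0 : 0 ≤ d₃ := norm_nonneg _
  have r1 : |rateOne κ lam φ N p| ≤ 2 * Real.pi * lam * d₁ := by
    rw [rateOne, abs_mul, abs_of_pos (by positivity)]
    gcongr
    exact Complex.abs_re_le_norm _
  have r2 : |rateThreeHalves κ lam φ N p| ≤ 2 * Real.pi * lam * (d₂ + d₃) := by
    rw [rateThreeHalves, abs_mul, abs_of_pos (by positivity), abs_mul, hκ', one_mul]
    gcongr
    exact (Complex.abs_re_le_norm _).trans (norm_add_le _ _)
  set W := Real.exp (-remainder κ lam φ N p) with hW
  have hW2 : Real.exp (-2 * remainder κ lam φ N p) = W ^ 2 := by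
    rw [hW, ← Real.exp_nat_mul]; congr 1; push_cast; ring
  set C := K ^ 3 * (2 * Real.pi * lam) * (1 / R + 1) with hC
  have hC0 : 0 ≤ C := by positivity
  have hbr : |deriv χ (cutoffArg κ lam φ R N p) * (rateOne κ lam φ N p / R)
      - χ (cutoffArg κ lam φ R N p) * rateThreeHalves κ lam φ N p|
      ≤ K * (2 * Real.pi * lam) * (1 / R + 1) * (d₁ + d₂ + d₃) := by
    refine (abs_sub _ _).trans ?_
    rw [abs_mul, abs_mul, abs_div, abs_of_pos hR]
    calc _ ≤ K * ((2 * Real.pi * lam * d₁) / R) + K * (2 * Real.pi * lam * (d₂ + d₃)) := by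
          gcongr
          · exact hK' _
          · exact hK _
      _ = K * (2 * Real.pi * lam) * (1 / R * d₁ + 1 * (d₂ + d₃)) := by ring
      _ ≤ K * (2 * Real.pi * lam) * ((1 / R + 1) * (d₁ + d₂ + d₃)) := by
          have : 0 < 1 / R := by positivity
          gcongr
          nlinarith [mul_nonneg this.le hd₂0, mul_nonneg this.le hd₃0]
      _ = _ := by ring
  have hmain : |weightRate κ lam χ φ R N p| * Real.exp (normSq lam (3 / 2) p)
      ≤ C * (d₁ + d₂ + d₃) * W := by
    rw [hW, ← exp_neg_modified_mul, weightRate, cutoffs]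
    simp only [abs_mul, Real.abs_exp]
    have h3 := mul_le_mul (mul_le_mul (hK (√(normSq lam 0 p) / R))
      (hK (hamiltonian κ lam φ N p / R)) (abs_nonneg _) hK0) hbr (abs_nonneg _) (by positivity)
    have h4 := mul_le_mul_of_nonneg_right (h3.trans (le_of_eq (show _ = C * (d₁ + d₂ + d₃) by
      rw [hC]; ring))) (mul_nonneg (Real.exp_nonneg (-modifiedThreeHalves κ lam φ N p))
        (Real.exp_nonneg (normSq lam (3 / 2) p)))
    refine (le_of_eq ?_).trans h4
    ring
  refine hmain.trans ?_
  rw [hW2, defectSq, ← hd₁, ← hd₂, ← hd₃]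
  have hy := young hη W (C * (d₁ + d₂ + d₃))
  have h3 : (d₁ + d₂ + d₃) ^ 2 ≤ 4 * (d₁ ^ 2 + d₂ ^ 2 + d₃ ^ 2) := by
    nlinarith [sq_nonneg (d₁ - d₂), sq_nonneg (d₂ - d₃), sq_nonneg (d₁ - d₃)]
  calc C * (d₁ + d₂ + d₃) * W = W * (C * (d₁ + d₂ + d₃)) := by ring
    _ ≤ η * W ^ 2 + (C * (d₁ + d₂ + d₃)) ^ 2 / (4 * η) := hy
    _ ≤ η * W ^ 2 + C ^ 2 * (4 * (d₁ ^ 2 + d₂ ^ 2 + d₃ ^ 2)) / (4 * η) := by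
        rw [mul_pow]; gcongr
    _ = _ := by field_simp

end TrigPoly

lemma measurable_cutoffs (hχ : Measurable χ) {Ω : Type*} [MeasurableSpace Ω] {p : Ω → TrigPoly}
    (hp : CoeffMeasurable p) : Measurable fun z => cutoffs κ lam χ φ R N (p z) := by
  have h1 := hp.normSq lam 0
  have h2 := hp.normSq lam (1 / 2)
  have h3 := ((hp.smooth φ N).pow 2).integral lam
  refine (hχ.comp (h1.sqrt.div_const R)).mul (hχ.comp (Measurable.div_const ?_ R))
  exact h2.add (h3.const_mul _)

lemma measurable_modified {Ω : Type*} [MeasurableSpace Ω] {p : Ω → TrigPoly}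
    (hp : CoeffMeasurable p) : Measurable (fun z => cutoffArg κ lam φ R N (p z))
      ∧ Measurable fun z => modifiedThreeHalves κ lam φ N (p z) :=
  ⟨((((hp.normSq lam 1).sub ((hp.smooth φ N).normSq lam 1)).add
      ((hp.smooth φ N).energyOne κ lam)).sub_const _).div_const R,
    ((hp.normSq lam (3 / 2)).sub ((hp.smooth φ N).normSq lam (3 / 2))).add
      ((hp.smooth φ N).energyThreeHalves κ lam)⟩

lemma measurable_weight (hχ : Measurable χ) {Ω : Type*} [MeasurableSpace Ω] {p : Ω → TrigPoly}
    (hp : CoeffMeasurable p) : Measurable fun z => weight κ lam χ φ R N (p z) := by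
  obtain ⟨h1, h2⟩ := measurable_modified (κ := κ) (lam := lam) (φ := φ) (R := R) (N := N) hp
  exact (measurable_cutoffs hχ hp).mul ((hχ.comp h1).mul (Real.measurable_exp.comp h2.neg))

lemma CoeffMeasurable.measurable_defectQuartic {Ω : Type*} [MeasurableSpace Ω]
    {p q : Ω → TrigPoly} (hp : CoeffMeasurable p) (hq : CoeffMeasurable q) (κ : ℝ) :
    Measurable fun z => defectQuartic κ (p z) (q z) := by
  have hx := hp.dx
  have hh := hx.hilbert κ
  have h1 := (hq.mul (hx.mul hx)).mean
  have h2 := (hq.mul (hh.mul hh)).mean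
  have h3 := (hq.mul (hp.mul hx).dx).mean
  have h4 := (hq.mul ((hp.mul hh).hilbert κ).dx).mean
  exact (((h1.const_mul _).add (h2.const_mul _)).sub (h3.const_mul _)).add h4

lemma measurable_weightRate (hχ : Measurable χ) {Ω : Type*} [MeasurableSpace Ω]
    {p : Ω → TrigPoly} (hp : CoeffMeasurable p) :
    Measurable fun z => weightRate κ lam χ φ R N (p z) := by
  obtain ⟨h1, h2⟩ := measurable_modified (κ := κ) (lam := lam) (φ := φ) (R := R) (N := N) hp
  have hv := hp.smooth φ N
  have hw := hv.removedPart φ N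
  have d1 := hv.measurable_defectOne hw κ
  have d2 := hv.measurable_defectQuartic hw κ
  have d3 := hv.measurable_defectHigher hw κ
  have m1 : Measurable fun z => rateOne κ lam φ N (p z) :=
    (Complex.measurable_re.comp d1).const_mul _
  have m2 : Measurable fun z => rateThreeHalves κ lam φ N (p z) :=
    ((Complex.measurable_re.comp (d2.add d3)).const_mul _).const_mul _
  exact (measurable_cutoffs hχ hp).mul (((((measurable_deriv χ).comp h1).mul (m1.div_const R)).sub
    ((hχ.comp h1).mul m2)).mul (Real.measurable_exp.comp h2.neg))

lemma lintegral_flatNoise (hlam : 0 < lam) {f : TrigPoly → ℝ}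
    (hf : Measurable fun z => f (series lam N z)) :
    ∫⁻ z, ‖f (series lam N z)‖ₑ ∂flatNoise N = ∫⁻ z, ENNReal.ofReal
      (|f (series lam N z)| * Real.exp (normSq lam (3 / 2) (series lam N z))) ∂noise := by
  rw [flatNoise, lintegral_withDensity_eq_lintegral_mul _ measurable_exp_noiseEnergy hf.enorm]
  refine lintegral_congr fun z => ?_
  rw [Pi.mul_apply, noiseEnergy_eq hlam, mul_comm, ENNReal.ofReal_mul (abs_nonneg _),
    Real.enorm_eq_ofReal_abs]

/-- The smallness parameter of the defects. -/
def defectSize (ε : ℝ) (N : ℕ) : ℝ :=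
  (ε + 1 / N) ^ 2 + ((ε * N / 2) ^ (-(1 / 4) : ℝ) * (N : ℝ) ^ (1 / 8 : ℝ)) ^ 4
    + (N : ℝ) ^ (-(1 / 4) : ℝ)

lemma integral_defectSq_le (hκ : κ = 1 ∨ κ = -1) (hlam : 0 < lam) :
    ∃ C : ℝ, 0 ≤ C ∧ ∀ (ε : ℝ) (_ : 0 < ε) (_ : ε ≤ 1 / 4) (φ : ℝ → ℝ) (_ : IsProfile ε φ)
      (N : ℕ) (_ : 0 < N), Integrable (fun z => defectSq κ φ N (series lam N z)) noise ∧
        ∫ z, defectSq κ φ N (series lam N z) ∂noise ≤ C * defectSize ε N := by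
  obtain ⟨C₁, hC₁, h₁⟩ := integral_defectQuartic_sq_le hκ hlam
  obtain ⟨C₂, hC₂, h₂⟩ := integral_defect_sq_le hκ hlam
  refine ⟨C₁ + 2 * C₂, by positivity, fun ε hε hε4 φ hφ N hN => ?_⟩
  obtain ⟨i1, b1⟩ := h₁ ε hε4 φ hφ N hN
  obtain ⟨i2, b2⟩ := h₂ ε hε hε4 φ hφ N hN _ (Or.inl rfl)
  obtain ⟨i3, b3⟩ := h₂ ε hε hε4 φ hφ N hN _ (Or.inr rfl)
  refine ⟨(i2.add i1).add i3, ?_⟩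
  have e : ∫ z, defectSq κ φ N (series lam N z) ∂noise = _ := (integral_add (i2.add i1) i3).trans
    (congrArg (· + _) (integral_add i2 i1))
  rw [e, defectSize]
  set x := (ε + 1 / N) ^ 2 + ((ε * N / 2) ^ (-(1 / 4) : ℝ) * (N : ℝ) ^ (1 / 8 : ℝ)) ^ 4 with hx
  have hx0 : 0 ≤ x := by rw [hx]; positivity
  have hy0 : 0 ≤ (N : ℝ) ^ (-(1 / 4) : ℝ) := by positivity
  nlinarith [mul_nonneg hC₁ hx0, mul_nonneg hC₂ hy0]

/-- The number `ε` is fixed first with `ε² < δ`; the other terms then tend to zero as `N → ∞`, the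
middle one because `(εN)^{-1/4} N^{1/8}` is a constant times `N^{-1/8}`. -/
lemma exists_defectSize_le {δ : ℝ} (hδ : 0 < δ) : ∃ ε : ℝ, 0 < ε ∧ ε ≤ 1 / 4 ∧ ∃ N₀ : ℕ, 0 < N₀ ∧
    ∀ N : ℕ, N₀ ≤ N → defectSize ε N ≤ δ := by
  set ε := min (1 / 4) (δ / 2) with hε
  have hε0 : 0 < ε := by positivity
  have hε4 : ε ≤ 1 / 4 := min_le_left _ _
  have hεδ : ε ^ 2 < δ := by
    have : ε ≤ δ / 2 := min_le_right _ _
    nlinarith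
  have t1 : Tendsto (fun N : ℕ => (ε + 1 / (N : ℝ)) ^ 2) atTop (𝓝 ((ε + 0) ^ 2)) :=
    (tendsto_const_nhds.add tendsto_one_div_atTop_nhds_zero_nat).pow 2
  have t3 : Tendsto (fun N : ℕ => (N : ℝ) ^ (-(1 / 4) : ℝ)) atTop (𝓝 0) :=
    (tendsto_rpow_neg_atTop (by norm_num)).comp tendsto_natCast_atTop_atTop
  have t2 : Tendsto (fun N : ℕ => ((ε * N / 2) ^ (-(1 / 4) : ℝ) * (N : ℝ) ^ (1 / 8 : ℝ)) ^ 4)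
      atTop (𝓝 0) := by
    have h8 : Tendsto (fun N : ℕ => (N : ℝ) ^ (-(1 / 8) : ℝ)) atTop (𝓝 0) :=
      (tendsto_rpow_neg_atTop (by norm_num)).comp tendsto_natCast_atTop_atTop
    have := (h8.const_mul ((ε / 2) ^ (-(1 / 4) : ℝ))).pow 4
    rw [mul_zero, zero_pow (by norm_num)] at this
    refine this.congr' ?_
    filter_upwards [eventually_gt_atTop 0] with N hN
    have hN' : (0 : ℝ) < N := by exact_mod_cast hN
    rw [show ε * N / 2 = ε / 2 * N by ring, Real.mul_rpow (by positivity) hN'.le, mul_assoc,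
      ← Real.rpow_add hN']
    norm_num
  have ht := (t1.add t2).add t3
  rw [add_zero, add_zero, add_zero] at ht
  obtain ⟨N₀, h⟩ := eventually_atTop.mp (ht.eventually_le_const hεδ)
  exact ⟨ε, hε0, hε4, N₀ + 1, by omega, fun N hN => h N (by omega)⟩

/-- The density is integrable and the total variation of its derivative along the truncated flow
is controlled by the size of the defects. -/
theorem lintegral_weightRate_le (hκ : κ = 1 ∨ κ = -1) (hlam : 0 < lam) (hχ : IsCutoff χ)
    (hR : 0 < R) : ∃ C : ℝ, 0 < C ∧ ∀ (η : ℝ) (_ : 0 < η) (ε : ℝ) (_ : 0 < ε) (_ : ε ≤ 1 / 4)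
      (φ : ℝ → ℝ) (_ : IsProfile ε φ) (N : ℕ) (_ : 0 < N),
      Integrable (fun z => weight κ lam χ φ R N (series lam N z)) (flatNoise N) ∧
      ∫⁻ z, ‖weightRate κ lam χ φ R N (series lam N z)‖ₑ ∂flatNoise N
        ≤ ENNReal.ofReal (C * (η + defectSize ε N / η)) := by
  obtain ⟨K, hK0, hKs, hK, hK'⟩ := hχ.exists_bounds
  obtain ⟨C₀, hC₀, hsupp⟩ := exists_sob_le_of_cutoffs_ne_zero hκ hlam hR hK0 hKs
  obtain ⟨C₁, hC₁, hexp⟩ := lintegral_exp_remainder_le hκ hlam hC₀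
  obtain ⟨C₂, hC₂, hdef⟩ := integral_defectSq_le hκ hlam
  set A := (K ^ 3 * (2 * Real.pi * lam) * (1 / R + 1)) ^ 2 with hA
  have hA0 : 0 ≤ A := by positivity
  refine ⟨C₁ + A * C₂, by positivity, fun η hη ε hε hε4 φ hφ N hN => ?_⟩
  have hχm := hχ.smooth.continuous.measurable
  have hser := coeffMeasurable_series lam N
  set S : Set (ℕ → ℂ) := {z | sob 0 (series lam N z) ≤ C₀ ∧ sob (1 / 2) (series lam N z) ≤ C₀}
    with hS
  set F : (ℕ → ℂ) → ℝ≥0∞ := fun z =>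
    ENNReal.ofReal (Real.exp (-2 * remainder κ lam φ N (series lam N z))) with hF
  have hFint : ∫⁻ z, S.indicator F z ∂noise ≤ ENNReal.ofReal C₁ := hexp φ hφ.abs_le_one N
  have hout : ∀ z, z ∉ S → cutoffs κ lam χ φ R N (series lam N z) = 0 := fun z hz => by
    by_contra h
    exact hz (hsupp φ hφ.abs_le_one N _ (coeff_series_zero lam N z) h)
  constructor
  · refine ⟨(measurable_weight hχm hser).aestronglyMeasurable, ?_⟩
    rw [HasFiniteIntegral, lintegral_flatNoise hlam (measurable_weight hχm hser)]
    -- On `S`, with `W` the exponential of minus the remainder, `K³ W ≤ W² + K⁶`, and `W²` is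
    -- covered by the exponential moment; off `S` the cutoffs vanish.
    have hb : ∀ z, ENNReal.ofReal (|weight κ lam χ φ R N (series lam N z)|
        * Real.exp (normSq lam (3 / 2) (series lam N z)))
        ≤ S.indicator F z + ENNReal.ofReal ((K ^ 3) ^ 2) := fun z => by
      by_cases hz : z ∈ S
      · rw [Set.indicator_of_mem hz, hF, ← ENNReal.ofReal_add (Real.exp_nonneg _) (by positivity)]
        refine ENNReal.ofReal_le_ofReal ((abs_weight_mul_le hK _).trans ?_)
        rw [show -2 * remainder κ lam φ N (series lam N z)
          = -remainder κ lam φ N (series lam N z) + -remainder κ lam φ N (series lam N z) by ring,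
          Real.exp_add]
        nlinarith [sq_nonneg (K ^ 3 - Real.exp (-remainder κ lam φ N (series lam N z))),
          sq_nonneg (K ^ 3), sq_nonneg (Real.exp (-remainder κ lam φ N (series lam N z)))]
      · rw [weight, hout z hz]; simp
    refine (lintegral_mono hb).trans_lt ?_
    rw [lintegral_add_right _ measurable_const, lintegral_const, measure_univ, mul_one]
    exact ENNReal.add_lt_top.mpr ⟨hFint.trans_lt ENNReal.ofReal_lt_top, ENNReal.ofReal_lt_top⟩
  · obtain ⟨hDi, hDb⟩ := hdef ε hε hε4 φ hφ N hN
    have hD0 : ∀ z, 0 ≤ defectSq κ φ N (series lam N z) := fun z => by unfold defectSq; positivity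
    rw [lintegral_flatNoise hlam (measurable_weightRate hχm hser)]
    have hb : ∀ z, ENNReal.ofReal (|weightRate κ lam χ φ R N (series lam N z)|
        * Real.exp (normSq lam (3 / 2) (series lam N z)))
        ≤ ENNReal.ofReal η * S.indicator F z
          + ENNReal.ofReal (A / η * defectSq κ φ N (series lam N z)) := fun z => by
      by_cases hz : z ∈ S
      · rw [Set.indicator_of_mem hz, hF, ← ENNReal.ofReal_mul hη.le,
          ← ENNReal.ofReal_add (by positivity) (mul_nonneg (by positivity) (hD0 z))]
        exact ENNReal.ofReal_le_ofReal (abs_weightRate_mul_le hκ hlam hR hK hK' hη _)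
      · rw [weightRate, hout z hz]; simp
    have hDi' := hDi.const_mul (A / η)
    refine (lintegral_mono hb).trans ?_
    rw [lintegral_add_right' _ hDi'.aestronglyMeasurable.aemeasurable.ennreal_ofReal,
      lintegral_const_mul' _ _ ENNReal.ofReal_ne_top,
      ← ofReal_integral_eq_lintegral_ofReal hDi'
        (ae_of_all _ fun z => mul_nonneg (by positivity) (hD0 z)), integral_const_mul]
    refine (add_le_add (mul_le_mul_right hFint _) le_rfl).trans ?_
    have hi0 : 0 ≤ ∫ z, defectSq κ φ N (series lam N z) ∂noise := integral_nonneg hD0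
    rw [← ENNReal.ofReal_mul hη.le, ← ENNReal.ofReal_add (by positivity) (by positivity)]
    refine ENNReal.ofReal_le_ofReal ?_
    have hs0 : 0 ≤ defectSize ε N := by unfold defectSize; positivity
    calc _ ≤ η * C₁ + A / η * (C₂ * defectSize ε N) := by gcongr
      _ = C₁ * η + A * C₂ * (defectSize ε N / η) := by ring
      _ ≤ _ := by
        have : 0 ≤ C₁ * (defectSize ε N / η) := by positivity
        have : 0 ≤ A * C₂ * η := by positivity
        nlinarith

/-- The projector does not depend on the scale of the Gaussian coordinates, so the value `1` is
taken. -/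
lemma coeffMeasurable_proj (s : ℝ) (N : ℕ) :
    CoeffMeasurable fun u : Sobolev s => u.proj N := by
  have h := coeffMeasurable_series 1 N
  have e : ∀ u : Sobolev s, u.proj N = series 1 N (Sobolev.coords 1 u) :=
    fun u => Sobolev.proj_eq_series one_pos N u
  simp only [e]
  exact ⟨h.bounded.imp fun S hS u => hS _, fun n => (h.measurable n).comp (Sobolev.measurable_coords 1)⟩

lemma measurable_density (hχ : Measurable χ) :
    Measurable fun u : Sobolev s => density κ lam χ φ R N u := by
  simp only [density_eq]
  exact (measurable_weight hχ (coeffMeasurable_proj s N)).mul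
    (Real.measurable_exp.comp ((coeffMeasurable_proj s N).normSq lam (3 / 2)))

end

end BenjaminOno
end

theorem proposition8p1 (κ lam : ℝ) (hκ : κ = 1 ∨ κ = -1) (hlam : 0 < lam)
    (χ : ℝ → ℝ) (hχ : BenjaminOno.IsCutoff χ)
    (ψ : ℝ → ℝ → ℝ) (hψ : ∀ ε ∈ Set.Ioo (0 : ℝ) 1, BenjaminOno.IsProfile ε (ψ ε))
    (σ R : ℝ) (hσ : 0 < σ) (hR : 0 < R) :
    ∀ δ : ℝ, 0 < δ → ∃ N₀ : ℕ, 0 < N₀ ∧ ∃ ε ∈ Set.Ioo (0 : ℝ) 1, ∀ N : ℕ, N₀ ≤ N →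
      ∀ A : Set (BenjaminOno.Sobolev (1 - σ)), MeasurableSet A → ∀ t : ℝ,
        |(∫ u in A, BenjaminOno.density κ lam χ (ψ ε) R N u
              ∂(BenjaminOno.gaussianMeasure (1 - σ) lam))
            - ∫ u in (BenjaminOno.flow κ (ψ ε) N t) '' A,
                BenjaminOno.density κ lam χ (ψ ε) R N u
              ∂(BenjaminOno.gaussianMeasure (1 - σ) lam)| ≤ δ * |t| := by
  intro δ hδ
  obtain ⟨C, hC, hmain⟩ := BenjaminOno.lintegral_weightRate_le hκ hlam hχ hR
  -- With this `η` and a defect size at most `η²`, both terms of `C (η + size / η)` are at most `δ /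
  -- 2`.
  set η := δ / (2 * C) with hηdef
  have hη : 0 < η := by positivity
  obtain ⟨ε, hε, hε4, N₀, hN₀, hsize⟩ :=
    BenjaminOno.exists_defectSize_le (show 0 < η ^ 2 by positivity)
  have hεm : ε ∈ Set.Ioo (0 : ℝ) 1 := ⟨hε, by linarith⟩
  refine ⟨N₀, hN₀, ε, hεm, fun N hN A hA t => ?_⟩
  have hN0 : 0 < N := hN₀.trans_le hN
  have hφ := hψ ε hεm
  obtain ⟨hint, hrate⟩ := hmain η hη ε hε hε4 _ hφ N hN0
  obtain ⟨K, -, hKs, -, -⟩ := hχ.exists_bounds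
  have hχm := hχ.smooth.continuous.measurable
  have hser := BenjaminOno.coeffMeasurable_series lam N
  have hle : C * (η + BenjaminOno.defectSize ε N / η) ≤ δ := by
    have h1 : BenjaminOno.defectSize ε N / η ≤ η := by
      rw [div_le_iff₀ hη, ← sq]; exact hsize N hN
    calc C * (η + BenjaminOno.defectSize ε N / η) ≤ C * (η + η) := by gcongr
      _ = δ := by rw [hηdef]; field_simp; ring
  -- The cutoff vanishes beyond `K`, so the first factor of the weight forces the `L²` norm to be at
  -- most `R K`; this is the mass level of the low flow.
  exact BenjaminOno.abs_setIntegral_flow_sub_le (M := (R * K) ^ 2)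
    (ρ := BenjaminOno.TrigPoly.weight κ lam χ (ψ ε) R N)
    (L := BenjaminOno.TrigPoly.weightRate κ lam χ (ψ ε) R N) hlam (by linarith) hφ hN0
    (BenjaminOno.measurable_weight hχm hser) (BenjaminOno.measurable_weightRate hχm hser) hint
    (fun p hp => by
      rw [BenjaminOno.TrigPoly.weight,
        BenjaminOno.TrigPoly.normSq_le_of_cutoffs_ne_zero hR hKs hp, zero_mul])
    (fun p hp => by
      rw [BenjaminOno.TrigPoly.weightRate,
        BenjaminOno.TrigPoly.normSq_le_of_cutoffs_ne_zero hR hKs hp, zero_mul])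
    (fun u hr hu τ => BenjaminOno.TrigPoly.hasDerivAt_weight hκ hφ.even hχ.smooth hr hu τ)
    (BenjaminOno.measurable_density hχm) BenjaminOno.TrigPoly.density_eq hA t hδ.le
    (hrate.trans (ENNReal.ofReal_le_ofReal hle))
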